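/- Let $0<q<1$ and $\ell\ge 1$. **Algebras.** Let $\mathcal U=U_q(\mathfrak{su}(\ell+1))$ be the Hopf $*$-algebra generated by $E_i$, $F_i=E_i^*$, $K_i=K_i^*$, $K_i^{-1}$ ($1\le i\le\ell$), enlarged by the root $\hat K=(K_1K_2^2\cdots K_\ell^\ell)^{2/(\ell+1)}$ and its inverse. Its relations are: $K_iK_i^{-1}=K_i^{-1}K_i=1$, $\hat K\hat K^{-1}=\hat K^{-1}\hat K=1$, and all $K_i$, $\hat K$ commute; $K_iE_i=qE_iK_i$, $K_iE_j=q^{-1/2}E_jK_i$ if $|i-j|=1$, $K_iE_j=E_jK_i$ if $|i-j|>1$; $\hat KE_j=q^{\delta_{j\ell}}E_j\hat K$; $[E_i,F_j]=\delta_{ij}\frac{K_i^2-K_i^{-2}}{q-q^{-1}}$; $E_i^2E_j-(q+q^{-1})E_iE_jE_i+E_jE_i^2=0$ if $|i-j|=1$, $[E_i,E_j]=0$ if $|i-j|>1$; the adjoints of all these; and $\hat K^{(\ell+1)/g}=(K_1K_2^2\cdots K_\ell^\ell)^{2/g}$ with $g=\gcd(2,\ell+1)$. The Hopf structure is $\Delta(K)=K\otimes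 K$, $\epsilon(K)=1$, $S(K)=K^{-1}$ for $K\in\{K_i,\hat K\}$; $\Delta(E_i)=E_i\otimes K_i+K_i^{-1}\otimes E_i$, $\Delta(F_i)=F_i\otimes K_i+K_i^{-1}\otimes F_i$, $\epsilon(E_i)=\epsilon(F_i)=0$, $S(E_i)=-qE_i$, $S(F_i)=-q^{-1}F_i$. Let $U_q(\mathfrak{su}(\ell))$ be generated by $E_i,F_i,K_i^{\pm1}$ with $i<\ell$, and $K_q(\mathfrak u(\ell))$ by these and $\hat K^{\pm1}$. Let $\mathcal A=\mathcal A(SU_q(\ell+1))$ be the $*$-algebra generated by $u^i_j$ ($1\le i,j\le \ell+1$) with the relations: $u^i_ku^j_k=qu^j_ku^i_k$ and $u^k_iu^k_j=qu^k_ju^k_i$ for $i<j$; $[u^i_l,u^j_k]=0$ and $[u^i_k,u^j_l]=(q-q^{-1})u^i_lu^j_k$ for $i<j$, $k<l$; $\sum_{p\in S_{\ell+1}}(-q)^{\|p\|}u^1_{p(1)}\cdots u^{\ell+1}_{p(\ell+1)}=1$, where $\|p\|$ is the number of inversions; and $(u^i_j)^*=(-q)^{j-i}D^i_j$, with $D^i_j$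 the quantum determinant of $u$ without row $i$ and column $j$. The coproduct is $\Delta(u^i_j)=\sum_ku^i_k\otimes u^k_j$. The pairing is given by $\langle h,u^j_k\rangle=\pi^j_k(h)$, $\langle h,ab\rangle=\langle h_{(1)},a\rangle\langle h_{(2)},b\rangle$, $\langle h,1\rangle=\epsilon(h)$, where $\pi$ is the representation with $\pi^j_k(K_i)=\delta_{jk}q^{(\delta_{i+1,j}-\delta_{i,j})/2}$, $\pi^j_k(E_i)=\delta_{j,i+1}\delta_{k,i}$, $\pi(F_i)=\pi(E_i)^t$, and $\pi(\hat K)=q^{-1/(\ell+1)}\,\mathrm{diag}(1,\dots,1,q)$. Put $h\triangleright a=a_{(1)}\langle h,a_{(2)}\rangle$, $a\triangleleft h=\langle h,a_{(1)}\rangle a_{(2)}$, $\mathcal L_ha=a\triangleleft S^{-1}(h)$, and $$\mathcal A(\mathbb CP^\ell_q)=\{a\in\mathcal A:\ \mathcal L_ha=\epsilon(h)a\ \ \forall h\in U_q(\mathfrak{su}(\ell)),\ \ \mathcal L_{\hat K}a=a\}.$$ **Forms.** Let $\mathrm{Gr}=\bigoplus_kW_k$ be the vector space with basis $e_s$, $s\subseteq\{1,\dots,\ell\}$,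 where $W_k$ is spanned by the $e_s$ with $|s|=k$. Its product is $$(v\wedge_qw)_s=\sum_{A\subseteq s}(-q^{-1})^{\#\{(a,b)\in A\times(s\setminus A):\,b<a\}}\,v_A\,w_{s\setminus A}.$$ For $N\in\mathbb Z$ let $\sigma^N_k$ be the representation of $K_q(\mathfrak u(\ell))$ on $W_k$ given, with $j\#s=1$ if $j\in s\not\ni j+1$, $j\#s=-1$ if $j\notin s\ni j+1$, and $j\#s=0$ otherwise, by $(K_jw)_s=q^{(j\#s)/2}w_s$, $(E_jw)_s=\delta_{j\#s,1}w_{(s\setminus\{j\})\cup\{j+1\}}$, $(F_jw)_s=\delta_{j\#s,-1}w_{(s\setminus\{j+1\})\cup\{j\}}$ for $j<\ell$, and $\hat K=q^{k-\frac{\ell}{\ell+1}N}$. Put $$\Omega^k_N=\{\omega\in\mathcal A\otimes W_k:\ (\mathcal L_{h_{(1)}}\otimes\sigma^N_k(h_{(2)}))\omega=\epsilon(h)\omega\ \ \forall h\in K_q(\mathfrak u(\ell))\}.$$ On $\mathcal A\otimes\mathrm{Gr}$ let $(a\otimes v)\wedge_q(a'\otimes v')=aa'\otimes(v\wedge_qv')$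 and $h\triangleright(a\otimes v)=(h\triangleright a)\otimes v$. **Operators.** With $[a,b]_q=ab-q^{-1}ba$ let $M_{\ell\ell}=E_\ell$, $M_{i\ell}=[E_i,M_{i+1,\ell}]_q$, and $X_i=K_iK_{i+1}\cdots K_\ell\,\hat K^{-1}M_{i\ell}^*$ ($1\le i\le\ell$). Let $\mathfrak e^L_iw=e_{\{i\}}\wedge_qw$, and let $\mathfrak i^L_i$ be its adjoint for the inner product $\sum_s\overline{v_s}w_s$ on $\mathrm{Gr}$. Define, on $\mathcal A\otimes\mathrm{Gr}$, $$\bar\partial=\sum_{i=1}^\ell\mathcal L_{\hat KX_i}\otimes\mathfrak e^L_i,\qquad \bar\partial^\dagger=\sum_{i=1}^\ell\mathcal L_{X_i^*\hat K}\otimes\mathfrak i^L_i .$$ **Statement.** 1. For all $N\in\mathbb Z$ and $k\ge0$, $\bar\partial$ maps $\Omega^k_N$ to $\Omega^{k+1}_N$; and $\bar\partial^2=0$. 2. $\bar\partial^\dagger$ is the Hermitian conjugate of $\bar\partial$: $\langle\bar\partial^\dagger\omega,\omega'\rangle=\langle\omega,\bar\partial\omega'\rangle$ for the inner product $\langle\omega,\omega'\rangle=\sum_s\varphi(\omega_s^*\omega'_s)$,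 where $\varphi$ is the Haar state of $\mathcal A$ (the normalized functional with $(\varphi\otimes\mathrm{id})\Delta=(\mathrm{id}\otimes\varphi)\Delta=\varphi(\cdot)1$). It maps $\Omega^{k+1}_N$ to $\Omega^k_N$, and $(\bar\partial^\dagger)^2=0$. 3. $(\Omega^\bullet_0,\bar\partial)$ is a left $\mathcal U$-covariant differential calculus over $\mathcal A(\mathbb CP^\ell_q)$. That is: * $\Omega^0_0=\mathcal A(\mathbb CP^\ell_q)\otimes e_\emptyset$, and with $\wedge_q$ the space $\Omega^\bullet_0=\bigoplus_k\Omega^k_0$ is a graded associative algebra, with unit $1\otimes e_\emptyset$, whose product in degree $0$ is that of $\mathcal A(\mathbb CP^\ell_q)$; * for $\omega\in\Omega^k_0$ and $\omega'\in\Omega^{k'}_0$, $$\bar\partial(\omega\wedge_q\omega')=(\bar\partial\omega)\wedge_q\omega'+(-1)^k\omega\wedge_q(\bar\partial\omega');$$ * every $\Omega^k_N$ is stable under the action $\triangleright$ of $\mathcal U$, which is a left action with $h\triangleright(\omega\wedge_q\omega')=(h_{(1)}\triangleright\omega)\wedge_q(h_{(2)}\triangleright\omega')$, $h\triangleright(1\otimes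 e_\emptyset)=\epsilon(h)\,1\otimes e_\emptyset$ and $\bar\partial(h\triangleright\omega)=h\triangleright\bar\partial\omega$ for all $h\in\mathcal U$. -/

import Mathlib

open scoped TensorProduct

set_option linter.unusedSectionVars false
set_option linter.unusedSimpArgs false

noncomputable section

namespace QProj

/-- The deformation parameter `0 < q < 1`. -/
abbrev QParam := Set.Ioo (0 : ℝ) 1

/-- `q ^ x` for a real exponent `x`, as a complex number. -/
def qpow (q : QParam) (x : ℝ) : ℂ := (((q : ℝ) ^ x : ℝ) : ℂ)

lemma qpow_add (q : QParam) (x y : ℝ) : qpow q (x + y) = qpow q x * qpow q y := by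
  simp [qpow, Real.rpow_add q.2.1]

@[simp] lemma qpow_zero (q : QParam) : qpow q 0 = 1 := by simp [qpow]

lemma qpow_ne_zero (q : QParam) (x : ℝ) : qpow q x ≠ 0 := by
  simpa [qpow] using (Real.rpow_pos_of_pos q.2.1 x).ne'

lemma qpow_neg (q : QParam) (x : ℝ) : qpow q (-x) = (qpow q x)⁻¹ := by
  simp [qpow, Real.rpow_neg q.2.1.le]

@[simp] lemma conj_qpow (q : QParam) (x : ℝ) : (starRingEnd ℂ) (qpow q x) = qpow q x := by
  simp [qpow]

lemma qpow_nat_mul (q : QParam) (n : ℕ) (x : ℝ) : qpow q (n * x) = qpow q x ^ n := by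
  rw [mul_comm]; simp [qpow, Real.rpow_mul q.2.1.le]

lemma qpow_sub_ne_zero (q : QParam) : qpow q 1 - qpow q (-1) ≠ 0 := by
  have h0 := q.2.1
  have h1 := q.2.2
  rw [qpow_neg, sub_ne_zero]
  simp only [qpow, Real.rpow_one]
  rw [← Complex.ofReal_inv]
  intro h
  have h2 : (q : ℝ) = (q : ℝ)⁻¹ := Complex.ofReal_injective h
  have h3 : (1 : ℝ) < (q : ℝ)⁻¹ := (one_lt_inv₀ h0).2 h1
  linarith

/-- The conjugate opposite of a complex algebra: the opposite multiplication and the conjugate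
scalar multiplication. An algebra homomorphism `B → ConjOp B` is a conjugate linear
anti-endomorphism of `B`. -/
def ConjOp (B : Type*) := Bᵐᵒᵖ

section ConjOp
variable {B : Type*} [Ring B] [Algebra ℂ B]

instance : Ring (ConjOp B) := inferInstanceAs (Ring Bᵐᵒᵖ)

instance : Algebra ℂ (ConjOp B) :=
  RingHom.toAlgebra' ((algebraMap ℂ Bᵐᵒᵖ).comp (starRingEnd ℂ)) fun c x =>
    Algebra.commutes (A := Bᵐᵒᵖ) ((starRingEnd ℂ) c) x

/-- The identity map `B → ConjOp B`. -/
def toCO (b : B) : ConjOp B := MulOpposite.op b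

/-- The identity map `ConjOp B → B`. -/
def ofCO (b : ConjOp B) : B := MulOpposite.unop b

lemma toCO_mul (a b : B) : toCO a * toCO b = toCO (b * a) := rfl
lemma toCO_add (a b : B) : toCO a + toCO b = toCO (a + b) := rfl
lemma toCO_sub (a b : B) : toCO a - toCO b = toCO (a - b) := rfl
lemma toCO_one : (1 : ConjOp B) = toCO 1 := rfl
lemma toCO_zero : (0 : ConjOp B) = toCO 0 := rfl
lemma smul_toCO (c : ℂ) (b : B) : c • toCO b = toCO ((starRingEnd ℂ) c • b) := by
  rw [Algebra.smul_def]
  change MulOpposite.op (b * algebraMap ℂ B ((starRingEnd ℂ) c)) = _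
  rw [← Algebra.commutes, ← Algebra.smul_def]; rfl
lemma toCO_pow (a : B) (n : ℕ) : toCO a ^ n = toCO (a ^ n) := rfl
lemma toCO_list_prod (l : List B) : (l.map toCO).prod = toCO l.reverse.prod := by
  induction l with
  | nil => rfl
  | cons a l ih => simp [ih, toCO_mul]

end ConjOp

/-! ### The quantized enveloping algebras -/

/-- Generators `E_i, F_i, K_i, K_i⁻¹` (`i = 1, …, m`, counted from `0` here), `K̂`, `K̂⁻¹`. -/
inductive Gen (m : ℕ)
  | E (i : Fin m) | F (i : Fin m) | K (i : Fin m) | Kinv (i : Fin m) | Khat | KhatInv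

/-- Half of the Cartan matrix of type `A`. -/
def cartanHalf (i j : ℕ) : ℝ := if i = j then 1 else if i + 1 = j ∨ j + 1 = i then -(1 / 2) else 0

lemma cartanHalf_comm (i j : ℕ) : cartanHalf i j = cartanHalf j i := by
  unfold cartanHalf; simp only [eq_comm, or_comm]

/-- `K̂ E_j = q^{hatWeight ℓ j} E_j K̂`: the weight is `1` for the last simple root and `0` else. -/
def hatWeight (ℓ j : ℕ) : ℝ := if j + 1 = ℓ then 1 else 0

open FreeAlgebra in
/-- The relations of the algebra generated by `E_i, F_i, K_i^{±1}` with `i ≤ m` and by `K̂^{±1}`,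
inside the enlargement of `U_q(su(ℓ+1))` by the root `K̂ = (K_1 K_2^2 ⋯ K_ℓ^ℓ)^{2/(ℓ+1)}`. -/
inductive UqRel (q : QParam) (ℓ m : ℕ) : FreeAlgebra ℂ (Gen m) → FreeAlgebra ℂ (Gen m) → Prop
  | K_Kinv (i) : UqRel q ℓ m (ι ℂ (.K i) * ι ℂ (.Kinv i)) 1
  | Kinv_K (i) : UqRel q ℓ m (ι ℂ (.Kinv i) * ι ℂ (.K i)) 1
  | Khat_KhatInv : UqRel q ℓ m (ι ℂ .Khat * ι ℂ .KhatInv) 1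
  | KhatInv_Khat : UqRel q ℓ m (ι ℂ .KhatInv * ι ℂ .Khat) 1
  | K_K (i j) : UqRel q ℓ m (ι ℂ (.K i) * ι ℂ (.K j)) (ι ℂ (.K j) * ι ℂ (.K i))
  | Khat_K (i) : UqRel q ℓ m (ι ℂ .Khat * ι ℂ (.K i)) (ι ℂ (.K i) * ι ℂ .Khat)
  | K_E (i j : Fin m) : UqRel q ℓ m (ι ℂ (.K i) * ι ℂ (.E j))
      (qpow q (cartanHalf i j) • (ι ℂ (.E j) * ι ℂ (.K i)))
  | F_K (i j : Fin m) : UqRel q ℓ m (ι ℂ (.F j) * ι ℂ (.K i))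
      (qpow q (cartanHalf i j) • (ι ℂ (.K i) * ι ℂ (.F j)))
  | Khat_E (j : Fin m) : UqRel q ℓ m (ι ℂ .Khat * ι ℂ (.E j))
      (qpow q (hatWeight ℓ j) • (ι ℂ (.E j) * ι ℂ .Khat))
  | F_Khat (j : Fin m) : UqRel q ℓ m (ι ℂ (.F j) * ι ℂ .Khat)
      (qpow q (hatWeight ℓ j) • (ι ℂ .Khat * ι ℂ (.F j)))
  | E_F (i j) : UqRel q ℓ m (ι ℂ (.E i) * ι ℂ (.F j) - ι ℂ (.F j) * ι ℂ (.E i))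
      (if i = j then (qpow q 1 - qpow q (-1))⁻¹ • (ι ℂ (.K i) ^ 2 - ι ℂ (.Kinv i) ^ 2) else 0)
  | serre_E (i j : Fin m) (h : (i : ℕ) + 1 = j ∨ (j : ℕ) + 1 = i) :
      UqRel q ℓ m (ι ℂ (.E i) ^ 2 * ι ℂ (.E j)
        - (qpow q 1 + qpow q (-1)) • (ι ℂ (.E i) * ι ℂ (.E j) * ι ℂ (.E i))
        + ι ℂ (.E j) * ι ℂ (.E i) ^ 2) 0
  | serre_F (i j : Fin m) (h : (i : ℕ) + 1 = j ∨ (j : ℕ) + 1 = i) :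
      UqRel q ℓ m (ι ℂ (.F i) ^ 2 * ι ℂ (.F j)
        - (qpow q 1 + qpow q (-1)) • (ι ℂ (.F i) * ι ℂ (.F j) * ι ℂ (.F i))
        + ι ℂ (.F j) * ι ℂ (.F i) ^ 2) 0
  | comm_E (i j : Fin m) (h : (i : ℕ) + 1 < j ∨ (j : ℕ) + 1 < i) :
      UqRel q ℓ m (ι ℂ (.E i) * ι ℂ (.E j)) (ι ℂ (.E j) * ι ℂ (.E i))
  | comm_F (i j : Fin m) (h : (i : ℕ) + 1 < j ∨ (j : ℕ) + 1 < i) :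
      UqRel q ℓ m (ι ℂ (.F i) * ι ℂ (.F j)) (ι ℂ (.F j) * ι ℂ (.F i))
  | root (h : m = ℓ) :
      UqRel q ℓ m (ι ℂ .Khat ^ ((ℓ + 1) / Nat.gcd 2 (ℓ + 1)))
        (((List.finRange m).map fun i : Fin m => ι ℂ (.K i) ^ ((i : ℕ) + 1)).prod
          ^ (2 / Nat.gcd 2 (ℓ + 1)))

/-- The same relations, for a family `f` of elements of an algebra. -/
structure UqRelations (q : QParam) (ℓ m : ℕ) {B : Type*} [Ring B] [Algebra ℂ B]
    (f : Gen m → B) : Prop where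
  K_Kinv (i) : f (.K i) * f (.Kinv i) = 1
  Kinv_K (i) : f (.Kinv i) * f (.K i) = 1
  Khat_KhatInv : f .Khat * f .KhatInv = 1
  KhatInv_Khat : f .KhatInv * f .Khat = 1
  K_K (i j) : f (.K i) * f (.K j) = f (.K j) * f (.K i)
  Khat_K (i) : f .Khat * f (.K i) = f (.K i) * f .Khat
  K_E (i j : Fin m) : f (.K i) * f (.E j) = qpow q (cartanHalf i j) • (f (.E j) * f (.K i))
  F_K (i j : Fin m) : f (.F j) * f (.K i) = qpow q (cartanHalf i j) • (f (.K i) * f (.F j))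
  Khat_E (j : Fin m) : f .Khat * f (.E j) = qpow q (hatWeight ℓ j) • (f (.E j) * f .Khat)
  F_Khat (j : Fin m) : f (.F j) * f .Khat = qpow q (hatWeight ℓ j) • (f .Khat * f (.F j))
  E_F (i j) : f (.E i) * f (.F j) - f (.F j) * f (.E i) =
    if i = j then (qpow q 1 - qpow q (-1))⁻¹ • (f (.K i) ^ 2 - f (.Kinv i) ^ 2) else 0
  serre_E (i j : Fin m) (h : (i : ℕ) + 1 = j ∨ (j : ℕ) + 1 = i) :
    f (.E i) ^ 2 * f (.E j) - (qpow q 1 + qpow q (-1)) • (f (.E i) * f (.E j) * f (.E i))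
        + f (.E j) * f (.E i) ^ 2 = 0
  serre_F (i j : Fin m) (h : (i : ℕ) + 1 = j ∨ (j : ℕ) + 1 = i) :
    f (.F i) ^ 2 * f (.F j) - (qpow q 1 + qpow q (-1)) • (f (.F i) * f (.F j) * f (.F i))
        + f (.F j) * f (.F i) ^ 2 = 0
  comm_E (i j : Fin m) (h : (i : ℕ) + 1 < j ∨ (j : ℕ) + 1 < i) :
    f (.E i) * f (.E j) = f (.E j) * f (.E i)
  comm_F (i j : Fin m) (h : (i : ℕ) + 1 < j ∨ (j : ℕ) + 1 < i) :
    f (.F i) * f (.F j) = f (.F j) * f (.F i)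
  root (h : m = ℓ) : f .Khat ^ ((ℓ + 1) / Nat.gcd 2 (ℓ + 1)) =
    ((List.finRange m).map fun i : Fin m => f (.K i) ^ ((i : ℕ) + 1)).prod ^ (2 / Nat.gcd 2 (ℓ + 1))

/-- `Uq q ℓ m`: the algebra presented by `UqRel q ℓ m`. -/
def Uq (q : QParam) (ℓ m : ℕ) := RingQuot (UqRel q ℓ m)

instance (q : QParam) (ℓ m : ℕ) : Ring (Uq q ℓ m) := inferInstanceAs (Ring (RingQuot _))
instance (q : QParam) (ℓ m : ℕ) : Algebra ℂ (Uq q ℓ m) :=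
  inferInstanceAs (Algebra ℂ (RingQuot _))

/-- The quotient map. -/
def Uq.mk (q : QParam) (ℓ m : ℕ) : FreeAlgebra ℂ (Gen m) →ₐ[ℂ] Uq q ℓ m :=
  RingQuot.mkAlgHom ℂ (UqRel q ℓ m)

/-- The generators of `Uq`. -/
def gen (q : QParam) (ℓ : ℕ) {m : ℕ} (g : Gen m) : Uq q ℓ m := Uq.mk q ℓ m (FreeAlgebra.ι ℂ g)

section Uq
variable {q : QParam} {ℓ m : ℕ} {B : Type*} [Ring B] [Algebra ℂ B]

lemma gen_relations : UqRelations q ℓ m (gen q ℓ) := by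
  have key : ∀ {x y}, UqRel q ℓ m x y → Uq.mk q ℓ m x = Uq.mk q ℓ m y :=
    fun h => RingQuot.mkAlgHom_rel ℂ h
  have hg : ∀ g, Uq.mk q ℓ m (FreeAlgebra.ι ℂ g) = gen q ℓ g := fun _ => rfl
  constructor
  · intro i; simpa [hg] using key (UqRel.K_Kinv i)
  · intro i; simpa [hg] using key (UqRel.Kinv_K i)
  · simpa [hg] using key UqRel.Khat_KhatInv
  · simpa [hg] using key UqRel.KhatInv_Khat
  · intro i j; simpa [hg] using key (UqRel.K_K i j)
  · intro i; simpa [hg] using key (UqRel.Khat_K i)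
  · intro i j; simpa [hg] using key (UqRel.K_E i j)
  · intro i j; simpa [hg] using key (UqRel.F_K i j)
  · intro j; simpa [hg] using key (UqRel.Khat_E j)
  · intro j; simpa [hg] using key (UqRel.F_Khat j)
  · intro i j
    have := key (UqRel.E_F (q := q) (ℓ := ℓ) i j)
    split_ifs at this ⊢ <;> simpa [hg] using this
  · intro i j h; simpa [hg] using key (UqRel.serre_E i j h)
  · intro i j h; simpa [hg] using key (UqRel.serre_F i j h)
  · intro i j h; simpa [hg] using key (UqRel.comm_E i j h)
  · intro i j h; simpa [hg] using key (UqRel.comm_F i j h)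
  · intro h
    have := key (UqRel.root (q := q) h)
    simpa [hg, map_list_prod, List.map_map, Function.comp_def] using this

/-- The universal property of `Uq`. -/
def Uq.lift (f : Gen m → B) (hf : UqRelations q ℓ m f) : Uq q ℓ m →ₐ[ℂ] B :=
  RingQuot.liftAlgHom ℂ ⟨FreeAlgebra.lift ℂ f, by
    intro x y h
    cases h with
    | K_Kinv i => simpa using hf.K_Kinv i
    | Kinv_K i => simpa using hf.Kinv_K i
    | Khat_KhatInv => simpa using hf.Khat_KhatInv
    | KhatInv_Khat => simpa using hf.KhatInv_Khat
    | K_K i j => simpa using hf.K_K i j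
    | Khat_K i => simpa using hf.Khat_K i
    | K_E i j => simpa using hf.K_E i j
    | F_K i j => simpa using hf.F_K i j
    | Khat_E j => simpa using hf.Khat_E j
    | F_Khat j => simpa using hf.F_Khat j
    | E_F i j =>
      have := hf.E_F i j
      split_ifs at this ⊢ <;> simpa using this
    | serre_E i j h => simpa using hf.serre_E i j h
    | serre_F i j h => simpa using hf.serre_F i j h
    | comm_E i j h => simpa using hf.comm_E i j h
    | comm_F i j h => simpa using hf.comm_F i j h
    | root h => simpa [map_list_prod, List.map_map, Function.comp_def] using hf.root h⟩

@[simp] lemma Uq.lift_gen (f : Gen m → B) (hf : UqRelations q ℓ m f) (g : Gen m) :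
    Uq.lift f hf (gen q ℓ g) = f g := by
  have : Uq.lift f hf (Uq.mk q ℓ m (FreeAlgebra.ι ℂ g)) = FreeAlgebra.lift ℂ f (FreeAlgebra.ι ℂ g) :=
    RingQuot.liftAlgHom_mkAlgHom_apply ℂ _ _ _
  exact this.trans (by simp)

lemma Uq.algHom_ext {f g : Uq q ℓ m →ₐ[ℂ] B} (h : ∀ x, f (gen q ℓ x) = g (gen q ℓ x)) :
    f = g := by
  apply RingQuot.ringQuot_ext'
  apply FreeAlgebra.hom_ext
  funext x
  exact h x

/-- A subalgebra that contains the generators is everything. -/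
lemma Uq.mem_of_gen (S : Subalgebra ℂ (Uq q ℓ m)) (h : ∀ x, gen q ℓ x ∈ S) (a : Uq q ℓ m) :
    a ∈ S := by
  obtain ⟨a, rfl⟩ : ∃ x, Uq.mk q ℓ m x = a := RingQuot.mkAlgHom_surjective ℂ (UqRel q ℓ m) a
  induction a using FreeAlgebra.induction with
  | grade0 r => rw [AlgHom.commutes]; exact S.algebraMap_mem r
  | grade1 x => exact h x
  | mul a b ha hb => rw [map_mul]; exact S.mul_mem ha hb
  | add a b ha hb => rw [map_add]; exact S.add_mem ha hb

end Uq

section aux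
variable {B : Type*} [Ring B] [Algebra ℂ B]

lemma inv_qcomm {k ki x : B} {c : ℂ} (h1 : k * ki = 1) (h2 : ki * k = 1)
    (h : k * x = c • (x * k)) : x * ki = c • (ki * x) := by
  calc x * ki = ki * (k * x) * ki := by rw [← mul_assoc ki, h2, one_mul]
    _ = c • (ki * x * (k * ki)) := by rw [h]; simp [mul_assoc]
    _ = c • (ki * x) := by rw [h1, mul_one]

lemma inv_qcomm' {k ki x : B} {c : ℂ} (h1 : k * ki = 1) (h2 : ki * k = 1)
    (h : x * k = c • (k * x)) : ki * x = c • (x * ki) := by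
  calc ki * x = ki * (x * k) * ki := by rw [mul_assoc, mul_assoc, h1, mul_one]
    _ = c • ((ki * k) * (x * ki)) := by rw [h]; simp [mul_assoc]
    _ = c • (x * ki) := by rw [h2, one_mul]

lemma swap_smul {x y : B} {c : ℂ} (hc : c ≠ 0) (h : x = c • y) : y = c⁻¹ • x := by
  rw [h, smul_smul, inv_mul_cancel₀ hc, one_smul]

/-- The Serre relation for sums of `q`-commuting elements. -/
lemma serre_add {q : QParam} {a b a' b' : B}
    (h1 : b * a = qpow q (-2) • (a * b)) (h2 : b * a' = qpow q 1 • (a' * b))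
    (h3 : b' * a = qpow q 1 • (a * b'))
    (ha : a ^ 2 * a' - (qpow q 1 + qpow q (-1)) • (a * a' * a) + a' * a ^ 2 = 0)
    (hb : b ^ 2 * b' - (qpow q 1 + qpow q (-1)) • (b * b' * b) + b' * b ^ 2 = 0) :
    (a + b) ^ 2 * (a' + b') - (qpow q 1 + qpow q (-1)) • ((a + b) * (a' + b') * (a + b))
      + (a' + b') * (a + b) ^ 2 = 0 := by
  have e2 : qpow q (-2) = (qpow q 1)⁻¹ * (qpow q 1)⁻¹ := by
    rw [← qpow_neg, ← qpow_add]; norm_num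
  have e1 : qpow q (-1) = (qpow q 1)⁻¹ := qpow_neg q 1
  have h0 := qpow_ne_zero q 1
  rw [e1] at ha hb ⊢
  rw [e2] at h1
  generalize qpow q 1 = t at *
  have h1' : ∀ x, b * (a * x) = (t⁻¹ * t⁻¹) • (a * (b * x)) := fun x => by
    rw [← mul_assoc, h1]; simp [mul_assoc]
  have h2' : ∀ x, b * (a' * x) = t • (a' * (b * x)) := fun x => by
    rw [← mul_assoc, h2]; simp [mul_assoc]
  have h3' : ∀ x, b' * (a * x) = t • (a * (b' * x)) := fun x => by
    rw [← mul_assoc, h3]; simp [mul_assoc]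
  have key : (a + b) ^ 2 * (a' + b') - (t + t⁻¹) • ((a + b) * (a' + b') * (a + b))
      + (a' + b') * (a + b) ^ 2 =
      (a ^ 2 * a' - (t + t⁻¹) • (a * a' * a) + a' * a ^ 2)
      + (b ^ 2 * b' - (t + t⁻¹) • (b * b' * b) + b' * b ^ 2) := by
    simp only [pow_two, mul_add, add_mul, mul_assoc, smul_add, h1, h2, h3, h1', h2', h3',
      mul_smul_comm, smul_mul_assoc, smul_smul]
    match_scalars <;> field_simp <;> ring
  rw [key, ha, hb, add_zero]

end aux

namespace UqRelations
variable {q : QParam} {ℓ m : ℕ} {B : Type*} [Ring B] [Algebra ℂ B] {f : Gen m → B}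

/-- `K_i` as a unit. -/
def kUnit (hf : UqRelations q ℓ m f) (i : Fin m) : Bˣ :=
  ⟨f (.K i), f (.Kinv i), hf.K_Kinv i, hf.Kinv_K i⟩

/-- `K̂` as a unit. -/
def khatUnit (hf : UqRelations q ℓ m f) : Bˣ :=
  ⟨f .Khat, f .KhatInv, hf.Khat_KhatInv, hf.KhatInv_Khat⟩

lemma E_Kinv (hf : UqRelations q ℓ m f) (i j : Fin m) :
    f (.E j) * f (.Kinv i) = qpow q (cartanHalf i j) • (f (.Kinv i) * f (.E j)) :=
  inv_qcomm (hf.K_Kinv i) (hf.Kinv_K i) (hf.K_E i j)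

lemma Kinv_F (hf : UqRelations q ℓ m f) (i j : Fin m) :
    f (.Kinv i) * f (.F j) = qpow q (cartanHalf i j) • (f (.F j) * f (.Kinv i)) :=
  inv_qcomm' (hf.K_Kinv i) (hf.Kinv_K i) (hf.F_K i j)

lemma E_KhatInv (hf : UqRelations q ℓ m f) (j : Fin m) :
    f (.E j) * f .KhatInv = qpow q (hatWeight ℓ j) • (f .KhatInv * f (.E j)) :=
  inv_qcomm hf.Khat_KhatInv hf.KhatInv_Khat (hf.Khat_E j)

lemma KhatInv_F (hf : UqRelations q ℓ m f) (j : Fin m) :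
    f .KhatInv * f (.F j) = qpow q (hatWeight ℓ j) • (f (.F j) * f .KhatInv) :=
  inv_qcomm' hf.Khat_KhatInv hf.KhatInv_Khat (hf.F_Khat j)

lemma Kinv_E (hf : UqRelations q ℓ m f) (i j : Fin m) :
    f (.Kinv i) * f (.E j) = qpow q (-cartanHalf i j) • (f (.E j) * f (.Kinv i)) := by
  rw [qpow_neg]; exact swap_smul (qpow_ne_zero _ _) (hf.E_Kinv i j)

lemma F_Kinv (hf : UqRelations q ℓ m f) (i j : Fin m) :
    f (.F j) * f (.Kinv i) = qpow q (-cartanHalf i j) • (f (.Kinv i) * f (.F j)) := by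
  rw [qpow_neg]; exact swap_smul (qpow_ne_zero _ _) (hf.Kinv_F i j)

lemma E_K (hf : UqRelations q ℓ m f) (i j : Fin m) :
    f (.E j) * f (.K i) = qpow q (-cartanHalf i j) • (f (.K i) * f (.E j)) := by
  rw [qpow_neg]; exact swap_smul (qpow_ne_zero _ _) (hf.K_E i j)

lemma kUnit_comm (hf : UqRelations q ℓ m f) (i j : Fin m) : Commute (hf.kUnit i) (hf.kUnit j) := by
  apply Units.ext; exact hf.K_K i j

lemma Kinv_Kinv (hf : UqRelations q ℓ m f) (i j : Fin m) :
    f (.Kinv i) * f (.Kinv j) = f (.Kinv j) * f (.Kinv i) :=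
  congrArg Units.val (((hf.kUnit_comm i j).inv_inv).eq)

lemma K_Kinv' (hf : UqRelations q ℓ m f) (i j : Fin m) :
    f (.K i) * f (.Kinv j) = f (.Kinv j) * f (.K i) :=
  congrArg Units.val (((hf.kUnit_comm i j).inv_right).eq)

lemma khat_comm (hf : UqRelations q ℓ m f) (i : Fin m) : Commute hf.khatUnit (hf.kUnit i) := by
  apply Units.ext; exact hf.Khat_K i

lemma KhatInv_Kinv (hf : UqRelations q ℓ m f) (i : Fin m) :
    f .KhatInv * f (.Kinv i) = f (.Kinv i) * f .KhatInv :=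
  congrArg Units.val (((hf.khat_comm i).inv_inv).eq)

lemma list_prod_reverse (hf : UqRelations q ℓ m f) (e : Fin m → ℕ) (l : List (Fin m)) :
    ((l.map fun i => f (.K i) ^ e i).reverse).prod = (l.map fun i => f (.K i) ^ e i).prod := by
  apply List.Perm.prod_eq' (List.reverse_perm _)
  rw [List.pairwise_reverse, List.pairwise_map]
  exact List.pairwise_of_forall fun i j =>
    ((show Commute (f (.K j)) (f (.K i)) from hf.K_K j i).pow_pow _ _)

lemma list_prod_inv (hf : UqRelations q ℓ m f) (e : Fin m → ℕ) (l : List (Fin m)) :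
    (((l.map fun i => hf.kUnit i ^ e i).prod)⁻¹ : Bˣ).val =
      ((l.map fun i => f (.Kinv i) ^ e i).reverse).prod := by
  induction l with
  | nil => simp
  | cons a l ih => simp [ih]; rfl

lemma list_prod_val (hf : UqRelations q ℓ m f) (e : Fin m → ℕ) (l : List (Fin m)) :
    (((l.map fun i => hf.kUnit i ^ e i).prod) : Bˣ).val =
      (l.map fun i => f (.K i) ^ e i).prod := by
  induction l with
  | nil => simp
  | cons a l ih => simp [ih]; rfl

/-- The root relation for the inverses. -/
lemma root_inv (hf : UqRelations q ℓ m f) (h : m = ℓ) :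
    f .KhatInv ^ ((ℓ + 1) / Nat.gcd 2 (ℓ + 1)) =
    (((List.finRange m).map fun i : Fin m => f (.Kinv i) ^ ((i : ℕ) + 1)).reverse).prod
      ^ (2 / Nat.gcd 2 (ℓ + 1)) := by
  have h1 : hf.khatUnit ^ ((ℓ + 1) / Nat.gcd 2 (ℓ + 1)) =
      (((List.finRange m).map fun i => hf.kUnit i ^ ((i : ℕ) + 1)).prod)
        ^ (2 / Nat.gcd 2 (ℓ + 1)) := by
    apply Units.ext
    rw [Units.val_pow_eq_pow_val, Units.val_pow_eq_pow_val, hf.list_prod_val]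
    exact hf.root h
  have h2 := congrArg (fun u : Bˣ => (u⁻¹).val) h1
  simp only [← inv_pow, Units.val_pow_eq_pow_val, hf.list_prod_inv] at h2
  exact h2

end UqRelations

section Hopf
variable (q : QParam) (ℓ m : ℕ)

/-- The values of the coproduct on the generators. -/
def comulGen : Gen m → Uq q ℓ m ⊗[ℂ] Uq q ℓ m
  | .E i => gen q ℓ (.E i) ⊗ₜ gen q ℓ (.K i) + gen q ℓ (.Kinv i) ⊗ₜ gen q ℓ (.E i)
  | .F i => gen q ℓ (.F i) ⊗ₜ gen q ℓ (.K i) + gen q ℓ (.Kinv i) ⊗ₜ gen q ℓ (.F i)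
  | .K i => gen q ℓ (.K i) ⊗ₜ gen q ℓ (.K i)
  | .Kinv i => gen q ℓ (.Kinv i) ⊗ₜ gen q ℓ (.Kinv i)
  | .Khat => gen q ℓ .Khat ⊗ₜ gen q ℓ .Khat
  | .KhatInv => gen q ℓ .KhatInv ⊗ₜ gen q ℓ .KhatInv

/-- The values of the counit on the generators. -/
def counitGen : Gen m → ℂ
  | .E _ => 0
  | .F _ => 0
  | _ => 1

/-- The anti-homomorphism `E_i ↦ -c E_i`, `F_i ↦ -c⁻¹ F_i`, `K ↦ K⁻¹` on generators: for `c = q` it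
is the antipode, for `c = q⁻¹` its inverse. -/
def antiGen (c : ℂ) : Gen m → (Uq q ℓ m)ᵐᵒᵖ
  | .E i => MulOpposite.op (-(c • gen q ℓ (.E i)))
  | .F i => MulOpposite.op (-(c⁻¹ • gen q ℓ (.F i)))
  | .K i => MulOpposite.op (gen q ℓ (.Kinv i))
  | .Kinv i => MulOpposite.op (gen q ℓ (.K i))
  | .Khat => MulOpposite.op (gen q ℓ .KhatInv)
  | .KhatInv => MulOpposite.op (gen q ℓ .Khat)

/-- The involution on generators: `E_i ↔ F_i`, `K` fixed. -/
def starGen : Gen m → ConjOp (Uq q ℓ m)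
  | .E i => toCO (gen q ℓ (.F i))
  | .F i => toCO (gen q ℓ (.E i))
  | g => toCO (gen q ℓ g)

variable {q ℓ m}

lemma cartanHalf_adj {i j : ℕ} (h : i + 1 = j ∨ j + 1 = i) : cartanHalf i j = -(1 / 2) := by
  unfold cartanHalf; rw [if_neg (by omega), if_pos h]

lemma cartanHalf_self (i : ℕ) : cartanHalf i i = 1 := by simp [cartanHalf]

lemma cartanHalf_far {i j : ℕ} (h : i + 1 < j ∨ j + 1 < i) : cartanHalf i j = 0 := by
  unfold cartanHalf; rw [if_neg (by omega), if_neg (by omega)]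

lemma counit_relations : UqRelations q ℓ m (counitGen m) := by
  constructor <;> intros <;> simp [counitGen]

lemma anti_relations {c : ℂ} (hc : c ≠ 0) : UqRelations q ℓ m (antiGen q ℓ m c) := by
  have G := gen_relations (q := q) (ℓ := ℓ) (m := m)
  constructor
  · intro i; simp only [antiGen, ← MulOpposite.op_mul, G.K_Kinv, MulOpposite.op_one]
  · intro i; simp only [antiGen, ← MulOpposite.op_mul, G.Kinv_K, MulOpposite.op_one]
  · simp only [antiGen, ← MulOpposite.op_mul, G.Khat_KhatInv, MulOpposite.op_one]
  · simp only [antiGen, ← MulOpposite.op_mul, G.KhatInv_Khat, MulOpposite.op_one]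
  · intro i j; simp only [antiGen, ← MulOpposite.op_mul]; rw [G.Kinv_Kinv]
  · intro i; simp only [antiGen, ← MulOpposite.op_mul]; rw [G.KhatInv_Kinv]
  · intro i j
    simp only [antiGen, ← MulOpposite.op_mul, ← MulOpposite.op_smul, neg_mul, mul_neg,
      smul_mul_assoc, mul_smul_comm, G.E_Kinv, smul_neg, smul_smul, mul_comm]
  · intro i j
    simp only [antiGen, ← MulOpposite.op_mul, ← MulOpposite.op_smul, neg_mul, mul_neg,
      smul_mul_assoc, mul_smul_comm, G.Kinv_F, smul_neg, smul_smul, mul_comm]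
  · intro j
    simp only [antiGen, ← MulOpposite.op_mul, ← MulOpposite.op_smul, neg_mul, mul_neg,
      smul_mul_assoc, mul_smul_comm, G.E_KhatInv, smul_neg, smul_smul, mul_comm]
  · intro j
    simp only [antiGen, ← MulOpposite.op_mul, ← MulOpposite.op_smul, neg_mul, mul_neg,
      smul_mul_assoc, mul_smul_comm, G.KhatInv_F, smul_neg, smul_smul, mul_comm]
  · intro i j
    have h := G.E_F i j
    simp only [antiGen, ← MulOpposite.op_mul, ← MulOpposite.op_smul, ← MulOpposite.op_sub,
      ← MulOpposite.op_pow, neg_mul, mul_neg, neg_neg, smul_neg,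
      smul_mul_assoc, mul_smul_comm, smul_smul, mul_inv_cancel₀ hc, inv_mul_cancel₀ hc, one_smul]
    have h' : gen q ℓ (.F j) * gen q ℓ (.E i) - gen q ℓ (.E i) * gen q ℓ (.F j) =
      -(gen q ℓ (.E i) * gen q ℓ (.F j) - gen q ℓ (.F j) * gen q ℓ (.E i)) := by abel
    rw [h', h]
    split_ifs
    · rw [← smul_neg, neg_sub]
    · simp
  · intro i j hij
    have h := congrArg (fun x => -(c ^ 3 • x)) (G.serre_E i j hij)
    simp only [antiGen, ← MulOpposite.op_mul, ← MulOpposite.op_smul, ← MulOpposite.op_sub,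
      ← MulOpposite.op_pow, ← MulOpposite.op_add]
    rw [← MulOpposite.op_zero]
    refine congrArg _ (Eq.trans ?_ (h.trans (by simp)))
    simp only [pow_two, neg_mul, mul_neg, neg_neg, smul_mul_assoc, mul_smul_comm, smul_smul,
      mul_assoc]
    module
  · intro i j hij
    have h := congrArg (fun x => -((c⁻¹) ^ 3 • x)) (G.serre_F i j hij)
    simp only [antiGen, ← MulOpposite.op_mul, ← MulOpposite.op_smul, ← MulOpposite.op_sub,
      ← MulOpposite.op_pow, ← MulOpposite.op_add]
    rw [← MulOpposite.op_zero]
    refine congrArg _ (Eq.trans ?_ (h.trans (by simp)))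
    simp only [pow_two, neg_mul, mul_neg, neg_neg, smul_mul_assoc, mul_smul_comm, smul_smul,
      mul_assoc]
    module
  · intro i j hij
    simp only [antiGen, ← MulOpposite.op_mul, neg_mul, mul_neg, smul_mul_assoc, mul_smul_comm,
      G.comm_E i j hij]
  · intro i j hij
    simp only [antiGen, ← MulOpposite.op_mul, neg_mul, mul_neg, smul_mul_assoc, mul_smul_comm,
      G.comm_F i j hij]
  · intro h
    have h1 := G.root_inv h
    simp only [antiGen, ← MulOpposite.op_pow]
    rw [h1, MulOpposite.op_pow, MulOpposite.op_list_prod]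
    simp [List.map_reverse, List.map_map, Function.comp_def]

lemma star_relations : UqRelations q ℓ m (starGen q ℓ m) := by
  have G := gen_relations (q := q) (ℓ := ℓ) (m := m)
  constructor
  · intro i; simp only [starGen, toCO_mul, G.Kinv_K, toCO_one]
  · intro i; simp only [starGen, toCO_mul, G.K_Kinv, toCO_one]
  · simp only [starGen, toCO_mul, G.KhatInv_Khat, toCO_one]
  · simp only [starGen, toCO_mul, G.Khat_KhatInv, toCO_one]
  · intro i j; simp only [starGen, toCO_mul]; rw [G.K_K]
  · intro i; simp only [starGen, toCO_mul]; rw [G.Khat_K]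
  · intro i j; simp only [starGen, toCO_mul, smul_toCO, conj_qpow, G.F_K]
  · intro i j; simp only [starGen, toCO_mul, smul_toCO, conj_qpow, G.K_E]
  · intro j; simp only [starGen, toCO_mul, smul_toCO, conj_qpow, G.F_Khat]
  · intro j; simp only [starGen, toCO_mul, smul_toCO, conj_qpow, G.Khat_E]
  · intro i j
    have h := G.E_F j i
    simp only [starGen, toCO_mul, toCO_sub, toCO_pow, smul_toCO, map_inv₀, map_sub, conj_qpow, h,
      toCO_zero, eq_comm (a := j)]
    split_ifs with hij
    · subst hij; rfl
    · rfl
  · intro i j hij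
    have h := G.serre_F i j hij
    simp only [starGen, toCO_mul, toCO_sub, toCO_pow, toCO_add, smul_toCO, map_add, conj_qpow,
      toCO_zero]
    refine congrArg _ (Eq.trans ?_ h)
    simp only [mul_assoc]; abel
  · intro i j hij
    have h := G.serre_E i j hij
    simp only [starGen, toCO_mul, toCO_sub, toCO_pow, toCO_add, smul_toCO, map_add, conj_qpow,
      toCO_zero]
    refine congrArg _ (Eq.trans ?_ h)
    simp only [mul_assoc]; abel
  · intro i j hij; simp only [starGen, toCO_mul]; rw [G.comm_F i j hij]
  · intro i j hij; simp only [starGen, toCO_mul]; rw [G.comm_E i j hij]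
  · intro h
    have h1 := G.root h
    have h2 := G.list_prod_reverse (fun i => (i : ℕ) + 1) (List.finRange m)
    simp only [starGen, toCO_pow]
    rw [h1, ← h2, ← toCO_pow, ← toCO_list_prod, List.map_map]
    rfl

lemma comul_list (e : Fin m → ℕ) (l : List (Fin m)) :
    (l.map fun i => comulGen q ℓ m (.K i) ^ e i).prod =
      (l.map fun i => gen q ℓ (.K i) ^ e i).prod ⊗ₜ[ℂ] (l.map fun i => gen q ℓ (.K i) ^ e i).prod := by
  induction l with
  | nil => rfl
  | cons a l ih =>
    rw [List.map_cons, List.prod_cons, ih]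
    simp only [List.map_cons, List.prod_cons, comulGen, Algebra.TensorProduct.tmul_pow,
      Algebra.TensorProduct.tmul_mul_tmul]

lemma comul_relations : UqRelations q ℓ m (comulGen q ℓ m) := by
  have G := gen_relations (q := q) (ℓ := ℓ) (m := m)
  have hone : (1 : Uq q ℓ m) ⊗ₜ[ℂ] (1 : Uq q ℓ m) = 1 := rfl
  constructor
  · intro i; simp only [comulGen, Algebra.TensorProduct.tmul_mul_tmul, G.K_Kinv, hone]
  · intro i; simp only [comulGen, Algebra.TensorProduct.tmul_mul_tmul, G.Kinv_K, hone]
  · simp only [comulGen, Algebra.TensorProduct.tmul_mul_tmul, G.Khat_KhatInv, hone]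
  · simp only [comulGen, Algebra.TensorProduct.tmul_mul_tmul, G.KhatInv_Khat, hone]
  · intro i j; simp only [comulGen, Algebra.TensorProduct.tmul_mul_tmul]; rw [G.K_K]
  · intro i; simp only [comulGen, Algebra.TensorProduct.tmul_mul_tmul]; rw [G.Khat_K]
  · intro i j
    simp only [comulGen, Algebra.TensorProduct.tmul_mul_tmul, mul_add, add_mul, smul_add]
    rw [G.K_E, G.K_K i j, G.K_Kinv' i j]
    simp only [TensorProduct.smul_tmul', TensorProduct.tmul_smul]
  · intro i j
    simp only [comulGen, Algebra.TensorProduct.tmul_mul_tmul, mul_add, add_mul, smul_add]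
    rw [G.F_K, G.K_K i j, G.K_Kinv' i j]
    simp only [TensorProduct.smul_tmul', TensorProduct.tmul_smul]
  · intro j
    have h : gen q ℓ .Khat * gen q ℓ (.Kinv j) = gen q ℓ (.Kinv j) * gen q ℓ .Khat :=
      congrArg Units.val (((G.khat_comm j).inv_right).eq)
    simp only [comulGen, Algebra.TensorProduct.tmul_mul_tmul, mul_add, add_mul, smul_add]
    rw [G.Khat_E, G.Khat_K j, h]
    simp only [TensorProduct.smul_tmul', TensorProduct.tmul_smul]
  · intro j
    have h : gen q ℓ .Khat * gen q ℓ (.Kinv j) = gen q ℓ (.Kinv j) * gen q ℓ .Khat :=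
      congrArg Units.val (((G.khat_comm j).inv_right).eq)
    simp only [comulGen, Algebra.TensorProduct.tmul_mul_tmul, mul_add, add_mul, smul_add]
    rw [G.F_Khat, G.Khat_K j, h]
    simp only [TensorProduct.smul_tmul', TensorProduct.tmul_smul]
  · intro i j
    have h := G.E_F i j
    have c1 : (gen q ℓ (.Kinv j) * gen q ℓ (.E i)) ⊗ₜ[ℂ] (gen q ℓ (.F j) * gen q ℓ (.K i)) =
        (gen q ℓ (.E i) * gen q ℓ (.Kinv j)) ⊗ₜ[ℂ] (gen q ℓ (.K i) * gen q ℓ (.F j)) := by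
      rw [G.F_K, G.E_Kinv, cartanHalf_comm]
      simp only [TensorProduct.smul_tmul', TensorProduct.tmul_smul]
    have c2 : (gen q ℓ (.F j) * gen q ℓ (.Kinv i)) ⊗ₜ[ℂ] (gen q ℓ (.K j) * gen q ℓ (.E i)) =
        (gen q ℓ (.Kinv i) * gen q ℓ (.F j)) ⊗ₜ[ℂ] (gen q ℓ (.E i) * gen q ℓ (.K j)) := by
      rw [G.Kinv_F, G.K_E, cartanHalf_comm]
      simp only [TensorProduct.smul_tmul', TensorProduct.tmul_smul]
    have c3 : comulGen q ℓ m (.E i) * comulGen q ℓ m (.F j)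
        - comulGen q ℓ m (.F j) * comulGen q ℓ m (.E i) =
        (gen q ℓ (.E i) * gen q ℓ (.F j) - gen q ℓ (.F j) * gen q ℓ (.E i)) ⊗ₜ[ℂ]
          (gen q ℓ (.K i) * gen q ℓ (.K j))
        + (gen q ℓ (.Kinv i) * gen q ℓ (.Kinv j)) ⊗ₜ[ℂ]
          (gen q ℓ (.E i) * gen q ℓ (.F j) - gen q ℓ (.F j) * gen q ℓ (.E i)) := by
      simp only [comulGen, Algebra.TensorProduct.tmul_mul_tmul, mul_add, add_mul,
        TensorProduct.sub_tmul, TensorProduct.tmul_sub]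
      rw [c1, c2, G.K_K j i, G.Kinv_Kinv j i]
      abel
    rw [c3, h]
    split_ifs with hij
    · subst hij
      simp only [comulGen, ← pow_two, Algebra.TensorProduct.tmul_pow, TensorProduct.smul_tmul',
        TensorProduct.tmul_smul, TensorProduct.sub_tmul, TensorProduct.tmul_sub, smul_sub]
      abel
    · simp
  · intro i j hij
    have e1 := cartanHalf_self (i : ℕ)
    have e2 := cartanHalf_adj hij
    have e3 : cartanHalf (j : ℕ) (i : ℕ) = -(1 / 2) := by rw [cartanHalf_comm, e2]
    have hs := G.serre_E i j hij
    refine serre_add ?_ ?_ ?_ ?_ ?_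
    · simp only [Algebra.TensorProduct.tmul_mul_tmul]
      rw [G.Kinv_E, G.E_K, e1]
      simp only [← TensorProduct.smul_tmul', TensorProduct.tmul_smul, smul_smul, ← qpow_add]
      norm_num
    · simp only [Algebra.TensorProduct.tmul_mul_tmul]
      rw [G.Kinv_E, G.E_K, e2, e3]
      simp only [← TensorProduct.smul_tmul', TensorProduct.tmul_smul, smul_smul, ← qpow_add]
      norm_num
    · simp only [Algebra.TensorProduct.tmul_mul_tmul]
      rw [G.Kinv_E, G.E_K, e2, e3]
      simp only [← TensorProduct.smul_tmul', TensorProduct.tmul_smul, smul_smul, ← qpow_add]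
      norm_num
    · have hk1 : gen q ℓ (.K i) * gen q ℓ (.K j) * gen q ℓ (.K i)
          = gen q ℓ (.K i) ^ 2 * gen q ℓ (.K j) := by rw [mul_assoc, G.K_K j i, pow_two, mul_assoc]
      have hk2 : gen q ℓ (.K j) * gen q ℓ (.K i) ^ 2
          = gen q ℓ (.K i) ^ 2 * gen q ℓ (.K j) := by
        rw [pow_two, ← mul_assoc, G.K_K j i, mul_assoc, G.K_K j i, ← mul_assoc]
      simp only [Algebra.TensorProduct.tmul_mul_tmul, Algebra.TensorProduct.tmul_pow, hk1, hk2,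
        TensorProduct.smul_tmul', ← TensorProduct.sub_tmul, ← TensorProduct.add_tmul, hs,
        TensorProduct.zero_tmul]
    · have hk1 : gen q ℓ (.Kinv i) * gen q ℓ (.Kinv j) * gen q ℓ (.Kinv i)
          = gen q ℓ (.Kinv i) ^ 2 * gen q ℓ (.Kinv j) := by
        rw [mul_assoc, G.Kinv_Kinv j i, pow_two, mul_assoc]
      have hk2 : gen q ℓ (.Kinv j) * gen q ℓ (.Kinv i) ^ 2
          = gen q ℓ (.Kinv i) ^ 2 * gen q ℓ (.Kinv j) := by
        rw [pow_two, ← mul_assoc, G.Kinv_Kinv j i, mul_assoc, G.Kinv_Kinv j i, ← mul_assoc]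
      simp only [Algebra.TensorProduct.tmul_mul_tmul, Algebra.TensorProduct.tmul_pow, hk1, hk2,
        ← TensorProduct.tmul_smul, ← TensorProduct.tmul_sub, ← TensorProduct.tmul_add, hs,
        TensorProduct.tmul_zero]
  · intro i j hij
    have e1 := cartanHalf_self (i : ℕ)
    have e2 := cartanHalf_adj hij
    have e3 : cartanHalf (j : ℕ) (i : ℕ) = -(1 / 2) := by rw [cartanHalf_comm, e2]
    have hs := G.serre_F i j hij
    have hc : ∀ x y : Fin m, comulGen q ℓ m (.F x) =
      gen q ℓ (.Kinv x) ⊗ₜ gen q ℓ (.F x) + gen q ℓ (.F x) ⊗ₜ gen q ℓ (.K x) :=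
      fun x _ => add_comm _ _
    rw [hc i i, hc j j]
    refine serre_add ?_ ?_ ?_ ?_ ?_
    · simp only [Algebra.TensorProduct.tmul_mul_tmul]
      rw [G.F_Kinv, swap_smul (qpow_ne_zero _ _) (G.F_K i i), e1, ← qpow_neg]
      simp only [← TensorProduct.smul_tmul', TensorProduct.tmul_smul, smul_smul, ← qpow_add]
      norm_num
    · simp only [Algebra.TensorProduct.tmul_mul_tmul]
      rw [G.F_Kinv, swap_smul (qpow_ne_zero _ _) (G.F_K i j), e2, e3, ← qpow_neg]
      simp only [← TensorProduct.smul_tmul', TensorProduct.tmul_smul, smul_smul, ← qpow_add]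
      norm_num
    · simp only [Algebra.TensorProduct.tmul_mul_tmul]
      rw [G.F_Kinv, swap_smul (qpow_ne_zero _ _) (G.F_K j i), e2, e3, ← qpow_neg]
      simp only [← TensorProduct.smul_tmul', TensorProduct.tmul_smul, smul_smul, ← qpow_add]
      norm_num
    · have hk1 : gen q ℓ (.Kinv i) * gen q ℓ (.Kinv j) * gen q ℓ (.Kinv i)
          = gen q ℓ (.Kinv i) ^ 2 * gen q ℓ (.Kinv j) := by
        rw [mul_assoc, G.Kinv_Kinv j i, pow_two, mul_assoc]
      have hk2 : gen q ℓ (.Kinv j) * gen q ℓ (.Kinv i) ^ 2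
          = gen q ℓ (.Kinv i) ^ 2 * gen q ℓ (.Kinv j) := by
        rw [pow_two, ← mul_assoc, G.Kinv_Kinv j i, mul_assoc, G.Kinv_Kinv j i, ← mul_assoc]
      simp only [Algebra.TensorProduct.tmul_mul_tmul, Algebra.TensorProduct.tmul_pow, hk1, hk2,
        ← TensorProduct.tmul_smul, ← TensorProduct.tmul_sub, ← TensorProduct.tmul_add, hs,
        TensorProduct.tmul_zero]
    · have hk1 : gen q ℓ (.K i) * gen q ℓ (.K j) * gen q ℓ (.K i)
          = gen q ℓ (.K i) ^ 2 * gen q ℓ (.K j) := by rw [mul_assoc, G.K_K j i, pow_two, mul_assoc]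
      have hk2 : gen q ℓ (.K j) * gen q ℓ (.K i) ^ 2
          = gen q ℓ (.K i) ^ 2 * gen q ℓ (.K j) := by
        rw [pow_two, ← mul_assoc, G.K_K j i, mul_assoc, G.K_K j i, ← mul_assoc]
      simp only [Algebra.TensorProduct.tmul_mul_tmul, Algebra.TensorProduct.tmul_pow, hk1, hk2,
        TensorProduct.smul_tmul', ← TensorProduct.sub_tmul, ← TensorProduct.add_tmul, hs,
        TensorProduct.zero_tmul]
  · intro i j hij
    have e2 := cartanHalf_far hij
    have e3 : cartanHalf (j : ℕ) (i : ℕ) = 0 := by rw [cartanHalf_comm, e2]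
    have h1 := G.K_E i j
    have h2 := G.K_E j i
    have h3 := G.E_Kinv i j
    have h4 := G.E_Kinv j i
    simp only [e2, e3, qpow_zero, one_smul] at h1 h2 h3 h4
    simp only [comulGen, Algebra.TensorProduct.tmul_mul_tmul, mul_add, add_mul]
    rw [G.comm_E i j hij, G.K_K i j, G.Kinv_Kinv i j, h1, h2, h3, h4]
    abel
  · intro i j hij
    have e2 := cartanHalf_far hij
    have e3 : cartanHalf (j : ℕ) (i : ℕ) = 0 := by rw [cartanHalf_comm, e2]
    have h1 := G.F_K i j
    have h2 := G.F_K j i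
    have h3 := G.Kinv_F i j
    have h4 := G.Kinv_F j i
    simp only [e2, e3, qpow_zero, one_smul] at h1 h2 h3 h4
    simp only [comulGen, Algebra.TensorProduct.tmul_mul_tmul, mul_add, add_mul]
    rw [G.comm_F i j hij, G.K_K i j, G.Kinv_Kinv i j, h1, h2, h3, h4]
    abel
  · intro h
    rw [comul_list (fun i => (i : ℕ) + 1)]
    simp only [comulGen, Algebra.TensorProduct.tmul_pow, G.root h]

variable (q ℓ m)

/-- The coproduct of `Uq`. -/
def comulU : Uq q ℓ m →ₐ[ℂ] Uq q ℓ m ⊗[ℂ] Uq q ℓ m := Uq.lift (comulGen q ℓ m) comul_relations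

/-- The counit of `Uq`. -/
def counitU : Uq q ℓ m →ₐ[ℂ] ℂ := Uq.lift (counitGen m) counit_relations

instance : Bialgebra ℂ (Uq q ℓ m) := Bialgebra.ofAlgHom (comulU q ℓ m) (counitU q ℓ m)
  (by
    apply Uq.algHom_ext
    rintro (i | i | i | i | _ | _) <;>
      simp [comulU, comulGen, TensorProduct.tmul_add, TensorProduct.add_tmul, add_assoc])
  (by
    apply Uq.algHom_ext
    rintro (i | i | i | i | _ | _) <;> simp [comulU, counitU, comulGen, counitGen])
  (by
    apply Uq.algHom_ext
    rintro (i | i | i | i | _ | _) <;> simp [comulU, counitU, comulGen, counitGen])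

/-- The anti-endomorphism of `Uq` with values `antiGen c`. -/
def antiU (c : ℂ) (hc : c ≠ 0) : Uq q ℓ m →ₐ[ℂ] (Uq q ℓ m)ᵐᵒᵖ :=
  Uq.lift (antiGen q ℓ m c) (anti_relations hc)

lemma antiU_antiU (c d : ℂ) (hc : c ≠ 0) (hd : d ≠ 0) (h : d * c = 1) (x : Uq q ℓ m) :
    (antiU q ℓ m c hc (antiU q ℓ m d hd x).unop).unop = x := by
  have h' : d⁻¹ * c⁻¹ = 1 := by rw [← mul_inv, h, inv_one]
  have key : (AlgHom.opComm (antiU q ℓ m c hc)).comp (antiU q ℓ m d hd) = AlgHom.id ℂ _ := by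
    apply Uq.algHom_ext
    rintro (i | i | i | i | _ | _) <;> simp [antiU, antiGen, AlgHom.opComm, smul_smul, h, h']
  exact congrArg (fun φ => φ x) key

/-- The antipode of `Uq`: `S(E_i) = -q E_i`, `S(F_i) = -q⁻¹ F_i`, `S(K_i) = K_i⁻¹`,
`S(K̂) = K̂⁻¹`, as an isomorphism onto the opposite algebra. -/
def antipodeU : Uq q ℓ m ≃ₐ[ℂ] (Uq q ℓ m)ᵐᵒᵖ :=
  AlgEquiv.ofBijective (antiU q ℓ m (qpow q 1) (qpow_ne_zero q 1)) (by
    have h : qpow q (-1) * qpow q 1 = 1 := by rw [← qpow_add]; simp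
    have h' : qpow q 1 * qpow q (-1) = 1 := by rw [← qpow_add]; simp
    refine Function.bijective_iff_has_inverse.2
      ⟨fun y => (antiU q ℓ m (qpow q (-1)) (qpow_ne_zero q (-1)) y.unop).unop, fun x => ?_,
        fun y => ?_⟩
    · exact antiU_antiU q ℓ m _ _ _ _ h' x
    · exact MulOpposite.unop_injective (antiU_antiU q ℓ m _ _ _ _ h y.unop))

/-- The involution of `Uq`, `E_i^* = F_i`, `K_i^* = K_i`, `K̂^* = K̂`, as an algebra homomorphism to
the conjugate opposite algebra. -/
def starHomU : Uq q ℓ m →ₐ[ℂ] ConjOp (Uq q ℓ m) := Uq.lift (starGen q ℓ m) star_relations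

end Hopf

/-! ### Quantum determinants -/

/-- The number of inversions of a word. -/
def invCount {n : ℕ} {J : Type*} [LinearOrder J] (p : Fin n → J) : ℕ :=
  (Finset.univ.filter fun x : Fin n × Fin n => x.1 < x.2 ∧ p x.2 < p x.1).card

/-- The quantum determinant `∑_p (-q)^{‖p‖} M_{1 p(1)} ⋯ M_{n p(n)}`, the products in this order. -/
def qdet (q : QParam) {B : Type*} [Ring B] [Algebra ℂ B] {n : ℕ} (M : Fin n → Fin n → B) : B :=
  ∑ p : Equiv.Perm (Fin n), (-qpow q 1) ^ invCount p • (List.ofFn fun t => M t (p t)).prod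

/-- The relations between the entries of a quantum matrix. -/
structure IsQMatrix (q : QParam) {I J B : Type*} [LinearOrder I] [LinearOrder J] [Ring B]
    [Algebra ℂ B] (M : I → J → B) : Prop where
  col {i j : I} (k : J) : i < j → M i k * M j k = qpow q 1 • (M j k * M i k)
  row (k : I) {i j : J} : i < j → M k i * M k j = qpow q 1 • (M k j * M k i)
  anti {i j : I} {k l : J} : i < j → k < l → M i l * M j k = M j k * M i l
  cross {i j : I} {k l : J} : i < j → k < l →
    M i k * M j l - M j l * M i k = (qpow q 1 - qpow q (-1)) • (M i l * M j k)

/-- Generators of a quantum exterior algebra. -/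
structure QExt {J R : Type*} [LinearOrder J] [Ring R] [Algebra ℂ R] (c : ℂ) (y : J → R) :
    Prop where
  sq (j : J) : y j * y j = 0
  swap {i j : J} : i < j → y j * y i = c • (y i * y j)

section word
variable {J R : Type*} [LinearOrder J] [Ring R] [Algebra ℂ R]

/-- The ordered monomial. -/
def ymon (y : J → R) (s : Finset J) : R := (s.sort.map y).prod

lemma ymon_empty (y : J → R) : ymon y ∅ = 1 := by simp [ymon]

lemma ymon_insert (y : J → R) {a : J} {s : Finset J} (h : ∀ b ∈ s, a < b) :
    ymon y (insert a s) = y a * ymon y s := by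
  have ha : a ∉ s := fun h' => lt_irrefl _ (h a h')
  unfold ymon
  rw [Finset.sort_insert _ (fun b hb => (h b hb).le) ha]
  simp

lemma QExt.mul_ymon {c : ℂ} {y : J → R} (h : QExt c y) (a : J) (s : Finset J) :
    y a * ymon y s = if a ∈ s then 0 else c ^ (s.filter (· < a)).card • ymon y (insert a s) := by
  induction s using Finset.induction_on_min with
  | empty => simp [ymon]
  | insert b s hb ih =>
    have hbs : b ∉ s := fun h' => lt_irrefl _ (hb b h')
    rw [ymon_insert y hb]
    rcases lt_trichotomy a b with hab | rfl | hab
    · have hlt : ∀ x ∈ insert b s, a < x := by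
        intro x hx
        rcases Finset.mem_insert.1 hx with rfl | hx
        · exact hab
        · exact hab.trans (hb x hx)
      have hna : a ∉ insert b s := fun h' => lt_irrefl _ (hlt a h')
      rw [if_neg hna, ymon_insert y hlt, ymon_insert y hb]
      have : (insert b s).filter (· < a) = ∅ := by
        apply Finset.filter_eq_empty_iff.2
        intro x hx
        exact not_lt.2 (hlt x hx).le
      simp [this]
    · simp [← mul_assoc, h.sq]
    · rw [← mul_assoc, h.swap hab, smul_mul_assoc, mul_assoc, ih]
      by_cases has : a ∈ s
      · simp [has]
      · have hna : a ∉ insert b s := by simp [has, hab.ne']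
        rw [if_neg has, if_neg hna, Finset.insert_comm, ymon_insert y (a := b),
          Finset.filter_insert, if_pos hab, Finset.card_insert_of_notMem (by simp [hbs]),
          mul_smul_comm, smul_smul, pow_succ']
        intro x hx
        rcases Finset.mem_insert.1 hx with rfl | hx
        · exact hab
        · exact hb x hx

lemma invCount_succ {n : ℕ} (p : Fin (n + 1) → J) :
    invCount p = (Finset.univ.filter fun b : Fin n => p b.succ < p 0).card
      + invCount (fun t => p (Fin.succ t)) := by
  have e : ∀ {m : ℕ} (p : Fin m → J), invCount p
      = ∑ i, ∑ j, if i < j ∧ p j < p i then 1 else 0 := by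
    intro m p
    rw [invCount, Finset.card_filter, ← Finset.univ_product_univ, Finset.sum_product]
  rw [e, e, Fin.sum_univ_succ, Finset.card_filter]
  congr 1
  · rw [Fin.sum_univ_succ]; simp
  · refine Finset.sum_congr rfl fun i _ => ?_
    rw [Fin.sum_univ_succ]; simp

lemma QExt.word {c : ℂ} {y : J → R} (h : QExt c y) {n : ℕ} (p : Fin n → J) [Decidable p.Injective] :
    (List.ofFn fun t => y (p t)).prod =
      if p.Injective then c ^ invCount p • ymon y (Finset.univ.image p) else 0 := by
  classical
  induction n with
  | zero =>
    have : Function.Injective p := fun a => a.elim0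
    simp [this, ymon_empty, invCount]
  | succ n ih =>
    rw [List.ofFn_succ, List.prod_cons, ih]
    have hinj : p.Injective ↔ (p 0 ∉ Finset.univ.image (fun t : Fin n => p t.succ)
        ∧ Function.Injective (fun t : Fin n => p t.succ)) := by
      have := Fin.cons_injective_iff (x₀ := p 0) (x := fun t : Fin n => p t.succ)
      rw [show (Fin.cons (p 0) (fun t : Fin n => p t.succ) : Fin (n + 1) → J) = p from
        Fin.cons_self_tail p] at this
      rw [this]; simp
    by_cases h2 : Function.Injective (fun t : Fin n => p t.succ)
    · rw [if_pos h2, mul_smul_comm, h.mul_ymon]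
      by_cases h1 : p 0 ∈ Finset.univ.image (fun t : Fin n => p t.succ)
      · rw [if_pos h1, if_neg (fun h' => (hinj.1 h').1 h1), smul_zero]
      · rw [if_neg h1, if_pos (hinj.2 ⟨h1, h2⟩), smul_smul, ← pow_add, invCount_succ]
        congr 2
        · rw [add_comm]; congr 1
          rw [Finset.filter_image, Finset.card_image_of_injective _ h2]
        · ext x
          simp [Fin.exists_fin_succ, eq_comm]
    · rw [if_neg h2, mul_zero, if_neg (fun h' => h2 (hinj.1 h').2)]

lemma prod_smul_comm_word {n : ℕ} (b y : Fin n → R) (h : ∀ s t, Commute (b s) (y t)) :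
    (List.ofFn fun t => b t * y t).prod = (List.ofFn b).prod * (List.ofFn y).prod := by
  induction n with
  | zero => simp
  | succ n ih =>
    simp only [List.ofFn_succ, List.prod_cons]
    rw [ih _ _ (fun s t => h _ _)]
    have : Commute (List.ofFn fun i : Fin n => b i.succ).prod (y 0) := by
      apply Commute.list_prod_left
      intro x hx
      obtain ⟨i, rfl⟩ := (List.mem_ofFn' _ _).1 hx
      exact h _ _
    rw [mul_assoc, mul_assoc, ← mul_assoc (y 0), ← this.eq, mul_assoc]

lemma prod_sum_word {K : Type*} [Fintype K] {n : ℕ} (f : Fin n → K → R) :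
    (List.ofFn fun t => ∑ k, f t k).prod = ∑ p : Fin n → K, (List.ofFn fun t => f t (p t)).prod := by
  induction n with
  | zero => simp
  | succ n ih =>
    simp only [List.ofFn_succ, List.prod_cons]
    rw [ih, Finset.sum_mul_sum, ← (Fin.consEquiv fun _ => K).sum_comp, Fintype.sum_prod_type]
    simp

/-- Expansion of a product of linear forms. -/
lemma prod_forms [Fintype J] {n : ℕ} (b : Fin n → J → R) (y : J → R)
    (hc : ∀ t k l, Commute (b t k) (y l)) :
    (List.ofFn fun t => ∑ k, b t k * y k).prod
      = ∑ p : Fin n → J, (List.ofFn fun t => b t (p t)).prod * (List.ofFn fun t => y (p t)).prod := by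
  rw [prod_sum_word]
  exact Finset.sum_congr rfl fun p _ => prod_smul_comm_word _ _ fun s t => hc _ _ _

/-- The same with the coefficients in reversed order. -/
lemma prod_forms_rev [Fintype J] {n : ℕ} (b : Fin n → J → R) (x : Fin n → R) (y : J → R)
    (hx : ∀ t, x t = ∑ k, b t k * y k) (hc : ∀ t k s, Commute (b t k) (x s)) :
    (List.ofFn x).prod
      = ∑ p : Fin n → J,
        (List.ofFn fun t => b t (p t)).reverse.prod * (List.ofFn fun t => y (p t)).prod := by
  induction n with
  | zero => simp
  | succ n ih =>
    rw [List.ofFn_succ', List.concat_eq_append, List.prod_append, List.prod_singleton,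
      hx (Fin.last n)]
    have hcomm : ∀ k, Commute (b (Fin.last n) k) (List.ofFn fun i : Fin n => x i.castSucc).prod := by
      intro k
      apply Commute.list_prod_right
      intro z hz
      obtain ⟨i, rfl⟩ := (List.mem_ofFn' _ _).1 hz
      exact hc _ _ _
    have ih' := ih (fun t => b t.castSucc) (fun t => x t.castSucc) (fun t => hx _)
      (fun t k s => hc _ _ _)
    rw [Finset.mul_sum]
    have : ∀ k, (List.ofFn fun i : Fin n => x i.castSucc).prod * (b (Fin.last n) k * y k)
        = ∑ p : Fin n → J, (b (Fin.last n) k *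
        (List.ofFn fun t : Fin n => b t.castSucc (p t)).reverse.prod) *
          ((List.ofFn fun t => y (p t)).prod * y k) := by
      intro k
      rw [← mul_assoc, ← (hcomm k).eq, ih', Finset.mul_sum, Finset.sum_mul]
      simp only [mul_assoc]
    simp only [this]
    rw [← (Fin.snocEquiv fun _ => J).sum_comp, Fintype.sum_prod_type]
    simp only [Fin.snocEquiv_apply, List.ofFn_succ', List.concat_eq_append, List.reverse_append,
      List.prod_append, Fin.snoc_castSucc, Fin.snoc_last,
      List.reverse_cons, List.reverse_nil, List.nil_append, List.prod_cons,
      List.singleton_append, List.prod_nil, mul_one]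

end word

section fullDet
variable {R : Type*} [Ring R] [Algebra ℂ R] (q : QParam)

lemma sum_perm {n : ℕ} {M : Type*} [AddCommMonoid M] (f : (Fin n → Fin n) → M)
    (hf : ∀ p, ¬ p.Injective → f p = 0) :
    ∑ p : Fin n → Fin n, f p = ∑ p : Equiv.Perm (Fin n), f p := by
  symm
  refine Finset.sum_of_injOn (fun p : Equiv.Perm (Fin n) => (p : Fin n → Fin n)) ?_ ?_ ?_ ?_
  · intro a _ b _ h; exact DFunLike.coe_injective h
  · intro a _; simp
  · intro p _ hp
    apply hf
    intro hinj
    exact hp ⟨Equiv.ofBijective p (Finite.injective_iff_bijective.1 hinj), by simp, rfl⟩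
  · intro p _; rfl

lemma image_perm {n : ℕ} (p : Equiv.Perm (Fin n)) :
    Finset.univ.image (p : Fin n → Fin n) = Finset.univ := by
  ext x; simp

lemma QExt.perm {n : ℕ} {c : ℂ} {y : Fin n → R} (hy : QExt c y) (p : Equiv.Perm (Fin n)) :
    (List.ofFn fun t => y (p t)).prod = c ^ invCount p • ymon y Finset.univ := by
  classical
  rw [hy.word, if_pos p.injective, image_perm]

lemma QExt.prod_qdet {n : ℕ} {y : Fin n → R} (hy : QExt (-qpow q 1) y) (b : Fin n → Fin n → R)
    (hc : ∀ t k l, Commute (b t k) (y l)) :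
    (List.ofFn fun t => ∑ k, b t k * y k).prod = qdet q b * ymon y Finset.univ := by
  classical
  rw [prod_forms _ _ hc, sum_perm]
  · rw [qdet, Finset.sum_mul]
    refine Finset.sum_congr rfl fun p _ => ?_
    rw [hy.perm, smul_mul_assoc, mul_smul_comm]
  · intro p hp
    rw [hy.word, if_neg hp, mul_zero]

lemma invCount_comp {n : ℕ} {J J' : Type*} [LinearOrder J] [LinearOrder J'] (f : J → J')
    (hf : StrictMono f) (p : Fin n → J) : invCount (fun t => f (p t)) = invCount p := by
  simp [invCount, hf.lt_iff_lt]

lemma QExt.prod_minors {n : ℕ} {y : Fin (n + 1) → R} (hy : QExt (-qpow q 1) y)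
    (b : Fin n → Fin (n + 1) → R) (hc : ∀ t k l, Commute (b t k) (y l)) :
    (List.ofFn fun t => ∑ k, b t k * y k).prod
      = ∑ j : Fin (n + 1), qdet q (fun s t => b s (j.succAbove t)) *
          ymon y (Finset.univ.erase j) := by
  classical
  rw [prod_forms _ _ hc]
  have : ∀ j : Fin (n + 1), qdet q (fun s t => b s (j.succAbove t)) *
          ymon y (Finset.univ.erase j) = ∑ p : Equiv.Perm (Fin n),
        (List.ofFn fun t => b t (j.succAbove (p t))).prod *
          (List.ofFn fun t => y (j.succAbove (p t))).prod := by
    intro j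
    rw [qdet, Finset.sum_mul]
    refine Finset.sum_congr rfl fun p _ => ?_
    rw [hy.word (fun t => j.succAbove (p t)),
      if_pos (show Function.Injective fun t => j.succAbove (p t) from
        Fin.succAbove_right_injective.comp p.injective),
      invCount_comp _ (Fin.strictMono_succAbove j), smul_mul_assoc, mul_smul_comm]
    congr 3
    ext x
    simp only [Finset.mem_erase, Finset.mem_univ, and_true, Finset.mem_image, true_and]
    constructor
    · intro hx
      obtain ⟨z, rfl⟩ := Fin.exists_succAbove_eq hx
      exact ⟨p.symm z, by simp⟩
    · rintro ⟨a, rfl⟩; exact Fin.succAbove_ne _ _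
  simp only [this]
  rw [← Fintype.sum_prod_type']
  symm
  refine Finset.sum_of_injOn
    (fun x : Fin (n + 1) × Equiv.Perm (Fin n) => fun t => x.1.succAbove (x.2 t)) ?_ ?_ ?_ ?_
  · rintro ⟨j, p⟩ _ ⟨j', p'⟩ _ h
    have h' : ∀ t, j.succAbove (p t) = j'.succAbove (p' t) := fun t => congrFun h t
    have hj : j = j' := by
      by_contra hne
      obtain ⟨z, hz⟩ := Fin.exists_succAbove_eq (Ne.symm hne)
      have := h' (p.symm z)
      simp only [Equiv.apply_symm_apply, hz] at this
      exact Fin.succAbove_ne _ _ this.symm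
    subst hj
    have : p = p' := by
      ext1 t; exact Fin.succAbove_right_injective (h' t)
    rw [this]
  · intro a _; simp
  · intro p _ hp
    rw [hy.word]
    split_ifs with hinj
    · exfalso
      apply hp
      have hns : ¬ Function.Surjective p := by
        intro hs
        have := Fintype.card_le_of_surjective _ hs
        simp at this
      obtain ⟨j, hj⟩ := not_forall.1 hns
      have : ∀ t, ∃ z, j.succAbove z = p t := fun t =>
        Fin.exists_succAbove_eq fun h => hj ⟨t, h⟩
      choose g hg using this
      have hgi : Function.Injective g := fun a b hab => hinj (by rw [← hg, ← hg, hab])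
      refine ⟨(j, Equiv.ofBijective g (Finite.injective_iff_bijective.1 hgi)), by simp, ?_⟩
      funext t; exact hg t
    · simp
  · intro x _; rfl

end fullDet

lemma QExt.ymon_mul {J R : Type*} [LinearOrder J] [Ring R] [Algebra ℂ R] {c : ℂ} {y : J → R}
    (h : QExt c y) (a : J) (s : Finset J) :
    ymon y s * y a = if a ∈ s then 0 else c ^ (s.filter (a < ·)).card • ymon y (insert a s) := by
  induction s using Finset.induction_on_min with
  | empty => simp [ymon]
  | insert b s hb ih =>
    have hbs : b ∉ s := fun h' => lt_irrefl _ (hb b h')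
    rw [ymon_insert y hb, mul_assoc, ih]
    by_cases has : a ∈ s
    · simp [has]
    rw [if_neg has, mul_smul_comm, h.mul_ymon]
    rcases lt_trichotomy a b with hab | rfl | hab
    · rw [if_neg (by simp [hab.ne', hbs]), if_neg (by simp [hab.ne, has]), smul_smul, ← pow_add]
      congr 2
      · have e1 : (insert a s).filter (· < b) = {a} := by
          ext x
          simp only [Finset.mem_filter, Finset.mem_insert, Finset.mem_singleton]
          constructor
          · rintro ⟨rfl | hx, hlt⟩
            · rfl
            · exact absurd hlt (not_lt.2 (hb x hx).le)
          · rintro rfl; exact ⟨Or.inl rfl, hab⟩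
        rw [e1, Finset.filter_insert, if_pos hab, Finset.card_insert_of_notMem (by simp [hbs])]
        simp
      · rw [Finset.insert_comm]
    · simp
    · rw [if_neg (by simp [hab.ne, hbs]), if_neg (by simp [hab.ne', has]), smul_smul, ← pow_add]
      congr 2
      · have e1 : (insert a s).filter (· < b) = ∅ := by
          ext x
          simp only [Finset.mem_filter, Finset.mem_insert, Finset.notMem_empty, iff_false]
          rintro ⟨rfl | hx, hlt⟩
          · exact lt_asymm hab hlt
          · exact absurd hlt (not_lt.2 (hb x hx).le)
        rw [e1, Finset.filter_insert, if_neg hab.not_gt]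
        simp
      · rw [Finset.insert_comm]

lemma sum_antisymm {J R : Type*} [Fintype J] [Ring R] [Algebra ℂ R] (T : J → J → R)
    (h : ∀ j k, T j k + T k j = 0) : ∑ j, ∑ k, T j k = 0 := by
  have h2 : (∑ j, ∑ k, T j k) + ∑ j, ∑ k, T j k = 0 := by
    nth_rw 2 [Finset.sum_comm]
    rw [← Finset.sum_add_distrib]
    simp [← Finset.sum_add_distrib, h]
  rw [← two_smul ℂ] at h2
  exact (smul_eq_zero_iff_right (two_ne_zero)).1 h2

lemma IsQMatrix.transpose {q : QParam} {I J B : Type*} [LinearOrder I] [LinearOrder J] [Ring B]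
    [Algebra ℂ B] {M : I → J → B} (hM : IsQMatrix q M) : IsQMatrix q (fun j i => M i j) where
  col k h := hM.row k h
  row k _ _ h := hM.col k h
  anti h h' := (hM.anti h' h).symm
  cross h h' := by rw [hM.cross h' h, hM.anti h' h]

lemma IsQMatrix.comp {q : QParam} {I J I' J' B : Type*} [LinearOrder I] [LinearOrder J]
    [LinearOrder I'] [LinearOrder J'] [Ring B] [Algebra ℂ B] {M : I → J → B} (hM : IsQMatrix q M)
    {f : I' → I} {g : J' → J} (hf : StrictMono f) (hg : StrictMono g) :
    IsQMatrix q (fun i j => M (f i) (g j)) where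
  col _ h := hM.col _ (hf h)
  row _ _ _ h := hM.row _ (hg h)
  anti h h' := hM.anti (hf h) (hg h')
  cross h h' := hM.cross (hf h) (hg h')

/-- The linear forms with coefficients in a quantum matrix generate a quantum exterior algebra. -/
lemma IsQMatrix.qext {q : QParam} {I J B R : Type*} [LinearOrder I] [LinearOrder J] [Fintype J]
    [Ring B] [Algebra ℂ B] [Ring R] [Algebra ℂ R] {M : I → J → B} (hM : IsQMatrix q M)
    (φ : B →ₐ[ℂ] R) {y : J → R} (hy : QExt (-qpow q 1) y) (hc : ∀ b j, Commute (φ b) (y j)) :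
    QExt (-qpow q 1) (fun i => ∑ j, φ (M i j) * y j) := by
  have expand : ∀ i i', (∑ j, φ (M i j) * y j) * (∑ j, φ (M i' j) * y j)
      = ∑ j, ∑ k, φ (M i j * M i' k) * (y j * y k) := by
    intro i i'
    rw [Finset.sum_mul_sum]
    refine Finset.sum_congr rfl fun j _ => Finset.sum_congr rfl fun k _ => ?_
    rw [map_mul, mul_assoc, mul_assoc, ← mul_assoc (y j), ← (hc _ j).eq, mul_assoc]
  have hq : qpow q 1 ≠ 0 := qpow_ne_zero q 1
  constructor
  · intro i
    rw [expand]
    apply sum_antisymm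
    have key : ∀ j k, j < k → φ (M i j * M i k) * (y j * y k) + φ (M i k * M i j) * (y k * y j) = 0 := by
      intro j k h
      rw [hM.row i h, hy.swap h, map_smul]
      simp
    intro j k
    rcases lt_trichotomy j k with h | rfl | h
    · exact key j k h
    · simp [hy.sq]
    · rw [add_comm]; exact key k j h
  · intro i i' hi
    have : ∑ j, ∑ k, (φ (M i' j * M i k) * (y j * y k)
        + qpow q 1 • (φ (M i j * M i' k) * (y j * y k))) = 0 := by
      apply sum_antisymm
      have key : ∀ j k, j < k → (φ (M i' j * M i k) * (y j * y k)
        + qpow q 1 • (φ (M i j * M i' k) * (y j * y k))) +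
          (φ (M i' k * M i j) * (y k * y j)
        + qpow q 1 • (φ (M i k * M i' j) * (y k * y j))) = 0 := by
        intro j k h
        have h1 := hM.cross hi h
        have h2 := hM.anti hi h
        rw [sub_eq_iff_eq_add] at h1
        rw [h1, h2, hy.swap h, qpow_neg]
        simp only [map_add, map_smul, add_mul, smul_mul_assoc, mul_smul_comm, smul_add, smul_smul,
          mul_sub, mul_inv_cancel₀ hq]
        module
      intro j k
      rcases lt_trichotomy j k with h | rfl | h
      · exact key j k h
      · simp [hy.sq]
      · rw [add_comm]; exact key k j h
    rw [expand, expand, neg_smul, eq_neg_iff_add_eq_zero, Finset.smul_sum, ← Finset.sum_add_distrib]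
    simp only [Finset.smul_sum, ← Finset.sum_add_distrib]
    exact this

/-! A faithful model of the quantum exterior algebra. -/

section model
variable {J : Type*} [LinearOrder J] [Fintype J]

/-- Left multiplication by a generator, in the basis of ordered monomials. -/
def extX (c : ℂ) (j : J) : Matrix (Finset J) (Finset J) ℂ := fun s t =>
  if j ∈ s ∧ t = s.erase j then c ^ (s.filter (· < j)).card else 0

lemma extX_mul (c : ℂ) (j i : J) (s u : Finset J) :
    (extX c j * extX c i) s u = if j ∈ s ∧ i ∈ s.erase j ∧ u = (s.erase j).erase i then
      c ^ (s.filter (· < j)).card * c ^ ((s.erase j).filter (· < i)).card else 0 := by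
  rw [Matrix.mul_apply, Finset.sum_eq_single (s.erase j)]
  · by_cases h1 : j ∈ s <;> by_cases h2 : i ∈ s.erase j ∧ u = (s.erase j).erase i <;>
      simp [extX, h1, h2]
  · intro t _ ht; simp [extX, ht]
  · simp

lemma extX_qext (c : ℂ) : QExt c (extX c : J → _) where
  sq j := by ext s u; rw [extX_mul]; simp
  swap {i j} h := by
    ext s u
    rw [Matrix.smul_apply, extX_mul, extX_mul]
    by_cases hj : j ∈ s <;> by_cases hi : i ∈ s <;> simp only [hj, hi, Finset.mem_erase, h.ne,
      h.ne', Finset.erase_right_comm (a := j) (b := i), ne_eq, not_false_eq_true, true_and,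
      false_and, and_false, and_true, if_false, smul_zero]
    split_ifs with hu
    · have e1 : (s.erase j).filter (· < i) = s.filter (· < i) := by
        ext x; simp only [Finset.mem_filter, Finset.mem_erase]
        constructor
        · rintro ⟨⟨_, h1⟩, h2⟩; exact ⟨h1, h2⟩
        · rintro ⟨h1, h2⟩; exact ⟨⟨(h2.trans h).ne, h1⟩, h2⟩
      have e2 : s.filter (· < j) = insert i ((s.erase i).filter (· < j)) := by
        ext x; simp only [Finset.mem_filter, Finset.mem_erase, Finset.mem_insert]
        constructor
        · rintro ⟨h1, h2⟩
          by_cases hx : x = i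
          · exact Or.inl hx
          · exact Or.inr ⟨⟨hx, h1⟩, h2⟩
        · rintro (rfl | ⟨⟨_, h1⟩, h2⟩)
          · exact ⟨hi, h⟩
          · exact ⟨h1, h2⟩
      rw [e1, e2, Finset.card_insert_of_notMem (by simp), pow_succ, smul_eq_mul]
      ring
    · simp

lemma extX_ymon (c : ℂ) (s t : Finset J) : ymon (extX c) s t ∅ = if t = s then 1 else 0 := by
  induction s using Finset.induction_on_min generalizing t with
  | empty => simp [ymon_empty, Matrix.one_apply]
  | insert a s ha ih =>
    have has : a ∉ s := fun h' => lt_irrefl _ (ha a h')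
    rw [ymon_insert _ ha, Matrix.mul_apply, Finset.sum_eq_single s]
    · rw [ih, if_pos rfl, mul_one, extX]
      have : (a ∈ t ∧ s = t.erase a) ↔ t = insert a s := by
        constructor
        · rintro ⟨h, rfl⟩; rw [Finset.insert_erase h]
        · rintro rfl; simp [has]
      simp only [this]
      split_ifs with ht
      · subst ht
        have : (insert a s).filter (· < a) = ∅ := by
          ext x
          simp only [Finset.mem_filter, Finset.mem_insert, Finset.notMem_empty, iff_false]
          rintro ⟨rfl | hx, hlt⟩
          · exact lt_irrefl _ hlt
          · exact absurd hlt (not_lt.2 (ha x hx).le)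
        simp [this]
      · rfl
    · intro u _ hu; rw [ih, if_neg hu, mul_zero]
    · simp

variable {B : Type*} [Ring B] [Algebra ℂ B]

/-- The model over an algebra. -/
def extXB (B : Type*) [Ring B] [Algebra ℂ B] (c : ℂ) (j : J) : Matrix (Finset J) (Finset J) B :=
  (Algebra.ofId ℂ B).mapMatrix (extX c j)

/-- The scalars of the model. -/
abbrev scB (J : Type*) [LinearOrder J] [Fintype J] (B : Type*) [Ring B] [Algebra ℂ B] :
    B →ₐ[ℂ] Matrix (Finset J) (Finset J) B := Matrix.scalarAlgHom (Finset J) ℂ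

lemma QExt.map {R R' : Type*} [Ring R] [Algebra ℂ R] [Ring R'] [Algebra ℂ R'] {c : ℂ} {y : J → R}
    (hy : QExt c y) (φ : R →ₐ[ℂ] R') : QExt c (fun j => φ (y j)) where
  sq j := by rw [← map_mul, hy.sq, map_zero]
  swap h := by rw [← map_mul, hy.swap h, map_smul, map_mul]

lemma map_ymon {R R' : Type*} [Ring R] [Algebra ℂ R] [Ring R'] [Algebra ℂ R'] (y : J → R)
    (φ : R →ₐ[ℂ] R') (s : Finset J) : ymon (fun j => φ (y j)) s = φ (ymon y s) := by
  rw [ymon, ymon, map_list_prod, List.map_map]; rfl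

lemma extXB_qext (c : ℂ) : QExt c (extXB B c : J → _) := (extX_qext c).map _

lemma extXB_commute (c : ℂ) (b : B) (j : J) : Commute (scB J B b) (extXB B c j) := by
  rw [Matrix.scalarAlgHom_apply, Matrix.scalar_commute_iff]
  ext s t
  simp only [Matrix.smul_apply, extXB, AlgHom.mapMatrix_apply, Matrix.map_apply, Algebra.ofId_apply,
    smul_eq_mul, MulOpposite.smul_eq_mul_unop, MulOpposite.unop_op]
  exact (Algebra.commutes _ _).symm

lemma scB_mul_apply (b : B) (N : Matrix (Finset J) (Finset J) B) (s t : Finset J) :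
    (scB J B b * N) s t = b * N s t := by
  simp [Matrix.scalar_apply, Matrix.diagonal_mul]

lemma scB_ymon (c : ℂ) (b : B) (s t : Finset J) :
    (scB J B b * ymon (extXB B c) s) t ∅ = if t = s then b else 0 := by
  rw [scB_mul_apply]
  have : ymon (extXB B c) s = (Algebra.ofId ℂ B).mapMatrix (ymon (extX c) s) := map_ymon _ _ _
  rw [this, AlgHom.mapMatrix_apply, Matrix.map_apply, extX_ymon]
  split_ifs <;> simp

lemma scB_inj (c : ℂ) {b b' : B} {s : Finset J}
    (h : scB J B b * ymon (extXB B c) s = scB J B b' * ymon (extXB B c) s) : b = b' := by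
  have := congrFun (congrFun h s) ∅
  simpa only [scB_ymon, if_pos] using this

end model

section det
variable {q : QParam} {B : Type*} [Ring B] [Algebra ℂ B]

lemma map_qdet {B' : Type*} [Ring B'] [Algebra ℂ B'] (φ : B →ₐ[ℂ] B') {n : ℕ}
    (M : Fin n → Fin n → B) : φ (qdet q M) = qdet q (fun i j => φ (M i j)) := by
  simp only [qdet, map_sum, map_smul, map_list_prod, List.map_ofFn, Function.comp_def]

/-- The forms attached to a quantum matrix. -/
def qform (q : QParam) {n : ℕ} (M : Fin n → Fin n → B) (i : Fin n) :
    Matrix (Finset (Fin n)) (Finset (Fin n)) B :=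
  ∑ j, scB (Fin n) B (M i j) * extXB B (-qpow q 1) j

lemma IsQMatrix.qform {n : ℕ} {M : Fin n → Fin n → B} (hM : IsQMatrix q M) :
    QExt (-qpow q 1) (qform q M) :=
  hM.qext (scB (Fin n) B) (extXB_qext _) (fun b j => extXB_commute _ b j)

lemma prod_qform {n : ℕ} (M : Fin n → Fin n → B) (f : Fin n → Fin n) :
    (List.ofFn fun t => qform q M (f t)).prod
      = scB (Fin n) B (qdet q (fun i j => M (f i) j)) * ymon (extXB B (-qpow q 1)) Finset.univ := by
  rw [map_qdet]
  exact (extXB_qext _).prod_qdet q (fun t k => scB (Fin n) B (M (f t) k))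
    (fun t k l => extXB_commute _ _ l)

lemma invCount_strictMono {n : ℕ} {J : Type*} [LinearOrder J] {p : Fin n → J} (hp : StrictMono p) :
    invCount p = 0 := by
  rw [invCount, Finset.card_eq_zero, Finset.filter_eq_empty_iff]
  rintro ⟨a, b⟩ _ ⟨h1, h2⟩
  exact lt_asymm h2 (hp h1)

lemma prod_ymon_univ {n : ℕ} {R : Type*} [Ring R] [Algebra ℂ R] {c : ℂ} {y : Fin n → R}
    (hy : QExt c y) : ymon y Finset.univ = (List.ofFn fun t => y t).prod := by
  have := hy.perm (1 : Equiv.Perm (Fin n))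
  rw [invCount_strictMono (p := ⇑(1 : Equiv.Perm (Fin n))) (fun a b h => h), pow_zero,
    one_smul] at this
  exact this.symm

lemma IsQMatrix.ymon_qform {n : ℕ} {M : Fin n → Fin n → B} (hM : IsQMatrix q M) :
    ymon (QProj.qform q M) Finset.univ
      = scB (Fin n) B (qdet q M) * ymon (extXB B (-qpow q 1)) Finset.univ := by
  rw [prod_ymon_univ hM.qform]
  exact prod_qform M id

lemma IsQMatrix.qdet_rows_perm {n : ℕ} {M : Fin n → Fin n → B} (hM : IsQMatrix q M)
    (f : Equiv.Perm (Fin n)) :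
    qdet q (fun i j => M (f i) j) = (-qpow q 1) ^ invCount f • qdet q M := by
  apply scB_inj (J := Fin n) (-qpow q 1) (s := Finset.univ)
  rw [← prod_qform, hM.qform.perm, hM.ymon_qform, map_smul, smul_mul_assoc]

lemma IsQMatrix.qdet_rows_noninj {n : ℕ} {M : Fin n → Fin n → B} (hM : IsQMatrix q M)
    (f : Fin n → Fin n) (hf : ¬ f.Injective) : qdet q (fun i j => M (f i) j) = 0 := by
  classical
  apply scB_inj (J := Fin n) (-qpow q 1) (s := Finset.univ)
  rw [← prod_qform, hM.qform.word, if_neg hf, map_zero, zero_mul]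

lemma qdet_mul {n : ℕ} (M : Fin n → Fin n → B) {M' : Fin n → Fin n → B} (hM' : IsQMatrix q M')
    (hc : ∀ i j k l, Commute (M i j) (M' k l)) :
    qdet q (fun i j => ∑ k, M i k * M' k j) = qdet q M * qdet q M' := by
  apply scB_inj (J := Fin n) (-qpow q 1) (s := Finset.univ)
  rw [map_mul, mul_assoc, ← hM'.ymon_qform, map_qdet (scB (Fin n) B) M,
    ← hM'.qform.prod_qdet q (fun t k => scB (Fin n) B (M t k)), map_qdet,
    ← (extXB_qext _).prod_qdet q]
  · congr 2
    funext t
    simp only [qform, map_sum, map_mul, Finset.sum_mul, Finset.mul_sum, mul_assoc]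
    rw [Finset.sum_comm]
  · intro t k l; exact extXB_commute _ _ l
  · intro t k l
    apply Commute.sum_right
    intro j _
    refine Commute.mul_right ?_ (extXB_commute _ _ j)
    exact (hc _ _ _ _).map (scB (Fin n) B)

lemma sum_inv_ne_zero (q : QParam) (n : ℕ) :
    ∑ p : Equiv.Perm (Fin n), (-qpow q 1) ^ invCount p * (-qpow q 1) ^ invCount p ≠ 0 := by
  have h : ∀ p : Equiv.Perm (Fin n), (-qpow q 1) ^ invCount p * (-qpow q 1) ^ invCount p
      = (((q : ℝ) ^ 2) ^ invCount p : ℝ) := by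
    intro p
    rw [← mul_pow, neg_mul_neg, ← sq]
    simp [qpow]
  simp only [h]
  rw [← Complex.ofReal_sum, Complex.ofReal_ne_zero]
  refine (Finset.sum_pos (fun p _ => ?_) Finset.univ_nonempty).ne'
  exact pow_pos (pow_pos q.2.1 2) _

lemma IsQMatrix.sum_qdet {n : ℕ} {M : Fin n → Fin n → B} (hM : IsQMatrix q M) :
    ∑ f : Equiv.Perm (Fin n), ∑ p : Equiv.Perm (Fin n),
      ((-qpow q 1) ^ invCount f * (-qpow q 1) ^ invCount p) •
        (List.ofFn fun t => M (f t) (p t)).prod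
      = (∑ p : Equiv.Perm (Fin n), (-qpow q 1) ^ invCount p * (-qpow q 1) ^ invCount p) •
        qdet q M := by
  rw [Finset.sum_smul]
  refine Finset.sum_congr rfl fun f _ => ?_
  rw [mul_smul, ← hM.qdet_rows_perm f, qdet, Finset.smul_sum]
  simp only [smul_smul]

lemma IsQMatrix.qdet_transpose {n : ℕ} {M : Fin n → Fin n → B} (hM : IsQMatrix q M) :
    qdet q (fun i j => M j i) = qdet q M := by
  have h1 := hM.sum_qdet
  have h2 := hM.transpose.sum_qdet
  rw [Finset.sum_comm] at h2
  simp only [mul_comm] at h1 h2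
  rw [h1] at h2
  exact ((IsUnit.mk0 _ (by simpa only [mul_comm] using sum_inv_ne_zero q n)).smul_left_cancel.1 h2).symm

lemma card_erase_lt {n : ℕ} (j : Fin (n + 1)) :
    ((Finset.univ.erase j).filter (· < j)).card = (j : ℕ) := by
  have : (Finset.univ.erase j).filter (· < j) = Finset.Iio j := by
    ext x; simp only [Finset.mem_filter, Finset.mem_erase, Finset.mem_univ, and_true,
      Finset.mem_Iio]
    exact ⟨fun h => h.2, fun h => ⟨h.ne, h⟩⟩
  rw [this, Fin.card_Iio]

lemma card_erase_gt {n : ℕ} (j : Fin (n + 1)) :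
    ((Finset.univ.erase j).filter (j < ·)).card = n - (j : ℕ) := by
  have : (Finset.univ.erase j).filter (j < ·) = Finset.Ioi j := by
    ext x; simp only [Finset.mem_filter, Finset.mem_erase, Finset.mem_univ, and_true,
      Finset.mem_Ioi]
    exact ⟨fun h => h.2, fun h => ⟨h.ne', h⟩⟩
  rw [this, Fin.card_Ioi]; omega

/-- The quantum minor obtained by removing row `k` and column `j`. -/
def qminor (q : QParam) {n : ℕ} (M : Fin (n + 1) → Fin (n + 1) → B) (k j : Fin (n + 1)) : B :=
  qdet q (fun s t => M (k.succAbove s) (j.succAbove t))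

lemma qform_erase {n : ℕ} {M : Fin (n + 1) → Fin (n + 1) → B} (hM : IsQMatrix q M)
    (k : Fin (n + 1)) :
    ymon (qform q M) (Finset.univ.erase k) = ∑ j, scB (Fin (n + 1)) B (qminor q M k j) *
      ymon (extXB B (-qpow q 1)) (Finset.univ.erase j) := by
  classical
  have h1 := hM.qform.word k.succAbove
  rw [if_pos Fin.succAbove_right_injective, invCount_strictMono (Fin.strictMono_succAbove k),
    pow_zero, one_smul] at h1
  have : Finset.univ.image k.succAbove = Finset.univ.erase k := by
    ext x
    simp only [Finset.mem_erase, Finset.mem_univ, and_true, Finset.mem_image, true_and]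
    exact ⟨fun ⟨a, ha⟩ => ha ▸ Fin.succAbove_ne _ _, fun h => Fin.exists_succAbove_eq h⟩
  rw [this] at h1
  rw [← h1]
  refine ((extXB_qext _).prod_minors q (fun t j => scB _ B (M (k.succAbove t) j))
    (fun t k l => extXB_commute _ _ l)).trans ?_
  refine Finset.sum_congr rfl fun j _ => ?_
  rw [qminor, map_qdet]

lemma IsQMatrix.laplace_left {n : ℕ} {M : Fin (n + 1) → Fin (n + 1) → B} (hM : IsQMatrix q M)
    (i k : Fin (n + 1)) : ∑ j : Fin (n + 1), (-qpow q 1) ^ (j : ℕ) • (M i j * qminor q M k j)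
      = if i = k then (-qpow q 1) ^ (k : ℕ) • qdet q M else 0 := by
  apply scB_inj (J := Fin (n + 1)) (-qpow q 1) (s := Finset.univ)
  have h1 := hM.qform.mul_ymon i (Finset.univ.erase k)
  have h2 : QProj.qform q M i * ymon (QProj.qform q M) (Finset.univ.erase k)
      = ∑ j : Fin (n + 1), scB (Fin (n + 1)) B ((-qpow q 1) ^ (j : ℕ) • (M i j * qminor q M k j)) *
        ymon (extXB B (-qpow q 1)) Finset.univ := by
    rw [qform_erase hM, Finset.mul_sum]
    refine Finset.sum_congr rfl fun j _ => ?_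
    rw [QProj.qform, Finset.sum_mul, Finset.sum_eq_single j]
    · rw [mul_assoc, ← mul_assoc (extXB B _ j), ← (extXB_commute _ _ j).eq, mul_assoc,
        (extXB_qext _).mul_ymon, if_neg (by simp), card_erase_lt,
        Finset.insert_erase (Finset.mem_univ j), map_smul, map_mul]
      simp only [mul_smul_comm, smul_mul_assoc, mul_assoc]
    · intro l _ hl
      rw [mul_assoc, ← mul_assoc (extXB B _ l), ← (extXB_commute _ _ l).eq, mul_assoc,
        (extXB_qext _).mul_ymon, if_pos (by simp [hl])]
      simp
    · simp
  rw [map_sum, Finset.sum_mul, ← h2, h1]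
  by_cases hik : i = k
  · subst hik
    rw [if_neg (by simp), if_pos rfl, card_erase_lt, Finset.insert_erase (Finset.mem_univ i),
      hM.ymon_qform, map_smul, smul_mul_assoc]
  · rw [if_pos (by simp [hik]), if_neg hik, map_zero, zero_mul]

lemma IsQMatrix.laplace_right {n : ℕ} {M : Fin (n + 1) → Fin (n + 1) → B} (hM : IsQMatrix q M)
    (i k : Fin (n + 1)) : ∑ j : Fin (n + 1), (-qpow q 1) ^ (n - (j : ℕ)) • (qminor q M k j * M i j)
      = if i = k then (-qpow q 1) ^ (n - (k : ℕ)) • qdet q M else 0 := by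
  apply scB_inj (J := Fin (n + 1)) (-qpow q 1) (s := Finset.univ)
  have h1 := hM.qform.ymon_mul i (Finset.univ.erase k)
  have h2 : ymon (QProj.qform q M) (Finset.univ.erase k) * QProj.qform q M i
      = ∑ j : Fin (n + 1), scB (Fin (n + 1)) B
          ((-qpow q 1) ^ (n - (j : ℕ)) • (qminor q M k j * M i j)) *
        ymon (extXB B (-qpow q 1)) Finset.univ := by
    have hcomm : ∀ (b : B) (s : Finset (Fin (n + 1))),
        Commute (scB (Fin (n + 1)) B b) (ymon (extXB B (-qpow q 1)) s) := by
      intro b s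
      apply Commute.list_prod_right
      intro x hx
      obtain ⟨j, _, rfl⟩ := List.mem_map.1 hx
      exact extXB_commute _ _ _
    rw [qform_erase hM, Finset.sum_mul]
    refine Finset.sum_congr rfl fun j _ => ?_
    rw [QProj.qform, Finset.mul_sum, Finset.sum_eq_single j]
    · rw [mul_assoc, ← mul_assoc (ymon _ _), ← (hcomm _ _).eq, mul_assoc,
        (extXB_qext _).ymon_mul, if_neg (by simp), card_erase_gt,
        Finset.insert_erase (Finset.mem_univ j), map_smul, map_mul]
      simp only [mul_smul_comm, smul_mul_assoc, mul_assoc]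
    · intro l _ hl
      rw [mul_assoc, ← mul_assoc (ymon _ _), ← (hcomm _ _).eq, mul_assoc,
        (extXB_qext _).ymon_mul, if_pos (by simp [hl])]
      simp
    · simp
  rw [map_sum, Finset.sum_mul, ← h2, h1]
  by_cases hik : i = k
  · subst hik
    rw [if_neg (by simp), if_pos rfl, card_erase_gt, Finset.insert_erase (Finset.mem_univ i),
      hM.ymon_qform, map_smul, smul_mul_assoc]
  · rw [if_pos (by simp [hik]), if_neg hik, map_zero, zero_mul]

end det

/-! ### The quantum matrix relations through the braiding matrix -/

section RTT
variable {q : QParam} {n : ℕ} {B : Type*} [Ring B] [Algebra ℂ B]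

/-- The diagonal coefficient of the braiding matrix. -/
def rA (q : QParam) {n : ℕ} (i j : Fin n) : ℂ :=
  if i = j then qpow q 1 else if i < j then qpow q 1 - qpow q (-1) else 0

/-- The coefficient of the flip in the braiding matrix. -/
def rB {n : ℕ} (i j : Fin n) : ℂ := if i = j then 0 else 1

/-- The braiding matrix. -/
def rMat (q : QParam) (n : ℕ) (B : Type*) [Ring B] [Algebra ℂ B] :
    Matrix (Fin n × Fin n) (Fin n × Fin n) B := fun x y =>
  algebraMap ℂ B ((if y = x then rA q x.1 x.2 else 0) + if y = x.swap then rB x.1 x.2 else 0)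

lemma rMat_mul (T : Matrix (Fin n × Fin n) (Fin n × Fin n) B) (x y) :
    (rMat q n B * T) x y = rA q x.1 x.2 • T x y + rB x.1 x.2 • T x.swap y := by
  simp only [Matrix.mul_apply, rMat, map_add, add_mul, Finset.sum_add_distrib, apply_ite
    (algebraMap ℂ B), map_zero, ite_mul, zero_mul, Finset.sum_ite_eq', Finset.mem_univ, if_true,
    Algebra.smul_def]

lemma mul_rMat (T : Matrix (Fin n × Fin n) (Fin n × Fin n) B) (x y) :
    (T * rMat q n B) x y = rA q y.1 y.2 • T x y + rB y.1 y.2 • T x y.swap := by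
  have h1 : ∀ z : Fin n × Fin n, (y = z.swap) ↔ z = y.swap := fun z =>
    ⟨fun h => by rw [h, Prod.swap_swap], fun h => by rw [h, Prod.swap_swap]⟩
  have h2 : rB y.2 y.1 = rB y.1 y.2 := by simp [rB, eq_comm]
  simp only [Matrix.mul_apply, rMat, map_add, mul_add, Finset.sum_add_distrib, apply_ite
    (algebraMap ℂ B), map_zero, mul_ite, mul_zero, Finset.sum_ite_eq, Finset.mem_univ, if_true,
    h1, Finset.sum_ite_eq', Algebra.smul_def, Prod.fst_swap, Prod.snd_swap, h2]
  rw [Algebra.commutes, Algebra.commutes]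

/-- The tensor square of a matrix. -/
def umat (M : Fin n → Fin n → B) : Matrix (Fin n × Fin n) (Fin n × Fin n) B :=
  fun x y => M x.1 y.1 * M x.2 y.2

lemma isQMatrix_iff_pt (M : Fin n → Fin n → B) : IsQMatrix q M ↔
    ∀ i j k l, rA q i j • (M i k * M j l) + rB i j • (M j k * M i l)
      = rA q k l • (M i k * M j l) + rB k l • (M i l * M j k) := by
  have hq : qpow q 1 ≠ 0 := qpow_ne_zero q 1
  have hq1 : qpow q (-1) * qpow q 1 = 1 := by rw [qpow_neg, inv_mul_cancel₀ hq]
  have hq2 : qpow q 1 * qpow q (-1) = 1 := by rw [mul_comm, hq1]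
  constructor
  · intro h i j k l
    rcases lt_trichotomy i j with hij | rfl | hij <;> rcases lt_trichotomy k l with hkl | rfl | hkl
      <;> simp only [rA, rB, *, lt_irrefl, LT.lt.ne, LT.lt.ne', if_true,
        if_false, zero_smul, zero_add, add_zero, one_smul, not_lt_of_gt]
    · rw [h.anti hij hkl]
    · rw [h.col k hij, smul_smul, smul_smul, sub_mul, hq1]; module
    · have := h.cross hij hkl
      rw [sub_eq_iff_eq_add] at this
      rw [this]
    · rw [h.row i hkl, smul_smul, smul_smul, sub_mul, hq1]; module
    · rw [h.row i hkl]
    · have := h.cross hij hkl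
      rw [sub_eq_iff_eq_add] at this
      rw [this, ← h.anti hij hkl]
    · rw [h.col k hij]
    · rw [← h.anti hij hkl]
  · intro h
    constructor
    · intro i j k hij
      have := h i j k k
      simp only [rA, rB, hij, hij.ne, if_true, if_false, zero_smul, add_zero, one_smul] at this
      have h2 : M j k * M i k = qpow q (-1) • (M i k * M j k) := by
        rw [sub_smul, sub_add, sub_eq_self, sub_eq_zero] at this; exact this.symm
      rw [h2, smul_smul, hq2, one_smul]
    · intro k i j hij
      have := h k k i j
      simp only [rA, rB, hij, hij.ne, if_true, if_false, zero_smul, add_zero, one_smul] at this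
      have h2 : M k j * M k i = qpow q (-1) • (M k i * M k j) := by
        rw [sub_smul] at this
        have h3 := this.symm
        rw [sub_add, sub_eq_self, sub_eq_zero] at h3; exact h3.symm
      rw [h2, smul_smul, hq2, one_smul]
    · intro i j k l hij hkl
      have := h i j k l
      simp only [rA, rB, hij, hij.ne, hkl, hkl.ne, if_true, if_false, one_smul] at this
      exact (add_left_cancel this).symm
    · intro i j k l hij hkl
      have := h i j l k
      simp only [rA, rB, hij, hij.ne, hkl.not_gt, hkl.ne', if_true, if_false, one_smul, zero_smul,
        zero_add] at this
      rw [← this]; abel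

lemma isQMatrix_iff (M : Fin n → Fin n → B) :
    IsQMatrix q M ↔ rMat q n B * umat M = umat M * rMat q n B := by
  rw [isQMatrix_iff_pt, ← Matrix.ext_iff]
  simp only [rMat_mul, mul_rMat, Prod.forall]
  rfl

lemma IsQMatrix.map {B' : Type*} [Ring B'] [Algebra ℂ B'] {M : Fin n → Fin n → B}
    (hM : IsQMatrix q M) (φ : B →ₐ[ℂ] B') : IsQMatrix q (fun i j => φ (M i j)) where
  col k h := by rw [← map_mul, hM.col k h, map_smul, map_mul]
  row k _ _ h := by rw [← map_mul, hM.row k h, map_smul, map_mul]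
  anti h h' := by rw [← map_mul, hM.anti h h', map_mul]
  cross h h' := by
    rw [← map_mul, ← map_mul, ← map_sub, hM.cross h h', map_smul, map_mul]

lemma IsQMatrix.mul {M M' : Fin n → Fin n → B} (hM : IsQMatrix q M) (hM' : IsQMatrix q M')
    (hc : ∀ i j k l, Commute (M i j) (M' k l)) :
    IsQMatrix q (fun i j => ∑ k, M i k * M' k j) := by
  have h : umat (fun i j => ∑ k, M i k * M' k j) = umat M * umat M' := by
    ext x y
    simp only [umat, Matrix.mul_apply, Finset.sum_mul_sum, Fintype.sum_prod_type]
    refine Finset.sum_congr rfl fun a _ => Finset.sum_congr rfl fun b _ => ?_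
    rw [mul_assoc, mul_assoc, ← mul_assoc (M' _ _), ← (hc _ _ _ _).eq, mul_assoc]
  rw [isQMatrix_iff] at *
  rw [h, ← mul_assoc, hM, mul_assoc, hM', mul_assoc]

/-- The inverse of a quantum matrix, transposed, is a quantum matrix in the conjugate opposite. -/
lemma IsQMatrix.inverse {M N : Fin n → Fin n → B} (hM : IsQMatrix q M)
    (h1 : ∀ i j, ∑ k, M i k * N k j = if i = j then 1 else 0)
    (h2 : ∀ i j, ∑ k, N i k * M k j = if i = j then 1 else 0) :
    IsQMatrix q (fun i j => toCO (N j i)) := by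
  let T : Matrix (Fin n × Fin n) (Fin n × Fin n) B := fun x y => N x.2 y.2 * N x.1 y.1
  have hT1 : umat M * T = 1 := by
    ext x y
    rw [Matrix.mul_apply, Fintype.sum_prod_type]
    simp only [umat, T]
    have : ∀ a, ∑ b, M x.1 a * M x.2 b * (N b y.2 * N a y.1)
        = if x.2 = y.2 then M x.1 a * N a y.1 else 0 := by
      intro a
      have e : ∀ b, M x.1 a * M x.2 b * (N b y.2 * N a y.1)
          = M x.1 a * (M x.2 b * N b y.2) * N a y.1 := fun b => by simp only [mul_assoc]
      simp only [e, ← Finset.sum_mul, ← Finset.mul_sum, h1]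
      split_ifs <;> simp
    simp only [this, Matrix.one_apply, Prod.ext_iff]
    by_cases h : x.2 = y.2 <;> simp [h, h1]
  have hT2 : T * umat M = 1 := by
    ext x y
    rw [Matrix.mul_apply, Fintype.sum_prod_type]
    simp only [umat, T]
    rw [Finset.sum_comm]
    have : ∀ b, ∑ a, N x.2 b * N x.1 a * (M a y.1 * M b y.2)
        = if x.1 = y.1 then N x.2 b * M b y.2 else 0 := by
      intro b
      have e : ∀ a, N x.2 b * N x.1 a * (M a y.1 * M b y.2)
          = N x.2 b * (N x.1 a * M a y.1) * M b y.2 := fun b => by simp only [mul_assoc]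
      simp only [e, ← Finset.sum_mul, ← Finset.mul_sum, h2]
      split_ifs <;> simp
    simp only [this, Matrix.one_apply, Prod.ext_iff]
    by_cases h : x.1 = y.1 <;> simp [h, h2]
  have hR : rMat q n B * T = T * rMat q n B := by
    rw [isQMatrix_iff] at hM
    calc rMat q n B * T = (T * umat M) * (rMat q n B * T) := by rw [hT2, one_mul]
      _ = T * (umat M * rMat q n B) * T := by simp only [mul_assoc]
      _ = T * rMat q n B * (umat M * T) := by rw [← hM]; simp only [mul_assoc]
      _ = T * rMat q n B := by rw [hT1, mul_one]
  rw [isQMatrix_iff_pt]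
  intro i j k l
  have := congrFun (congrFun hR (k, l)) (i, j)
  rw [rMat_mul, mul_rMat] at this
  have ca : ∀ i j : Fin n, (starRingEnd ℂ) (rA q i j) = rA q i j := by
    intro i j; unfold rA; split_ifs <;> simp
  have cb : ∀ i j : Fin n, (starRingEnd ℂ) (rB i j) = rB i j := by
    intro i j; unfold rB; split_ifs <;> simp
  simp only [toCO_mul, smul_toCO, toCO_add, ca, cb]
  exact congrArg toCO this.symm

lemma toCO_sum {ι : Type*} (s : Finset ι) (f : ι → B) :
    ∑ i ∈ s, toCO (f i) = toCO (∑ i ∈ s, f i) := by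
  classical
  induction s using Finset.induction_on with
  | empty => rfl
  | insert a s ha ih => rw [Finset.sum_insert ha, Finset.sum_insert ha, ih, toCO_add]

lemma IsQMatrix.qdet_inverse {M N : Fin n → Fin n → B} (hM : IsQMatrix q M)
    (h1 : ∀ i j, ∑ k, M i k * N k j = if i = j then 1 else 0)
    (h2 : ∀ i j, ∑ k, N i k * M k j = if i = j then 1 else 0) (hd : qdet q M = 1) :
    qdet q (fun i j => toCO (N j i)) = 1 := by
  classical
  rw [← (hM.inverse h1 h2).qdet_transpose, toCO_one]
  have e1 : qdet q (fun i j => toCO (N i j)) = toCO (∑ p : Equiv.Perm (Fin n),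
      (-qpow q 1) ^ invCount p • (List.ofFn fun t => N t (p t)).reverse.prod) := by
    rw [qdet, ← toCO_sum]
    refine Finset.sum_congr rfl fun p _ => ?_
    have : (List.ofFn fun t => toCO (N t (p t))).prod
        = toCO (List.ofFn fun t => N t (p t)).reverse.prod := by
      rw [← toCO_list_prod, List.map_ofFn]; rfl
    rw [this, smul_toCO, map_pow, map_neg, conj_qpow]
  rw [e1]
  congr 1
  apply scB_inj (J := Fin n) (-qpow q 1) (s := Finset.univ)
  rw [map_one, one_mul]
  conv_rhs => rw [prod_ymon_univ (extXB_qext _)]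
  rw [prod_forms_rev (fun t k => scB (Fin n) B (N t k)) (fun t => extXB B (-qpow q 1) t)
    (QProj.qform q M), sum_perm]
  · rw [map_sum, Finset.sum_mul]
    refine Finset.sum_congr rfl fun p _ => ?_
    rw [hM.qform.perm, hM.ymon_qform, hd, map_one, one_mul, map_smul, smul_mul_assoc,
      mul_smul_comm, map_list_prod, List.map_reverse, List.map_ofFn]
    rfl
  · intro p hp; rw [hM.qform.word, if_neg hp, mul_zero]
  · intro t
    simp only [QProj.qform, Finset.mul_sum, ← mul_assoc, ← map_mul]
    rw [Finset.sum_comm]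
    simp only [← Finset.sum_mul, ← map_sum, h2]
    rw [Finset.sum_eq_single t]
    · simp
    · intro j _ hj; simp [Ne.symm hj]
    · simp
  · intro t k s; exact extXB_commute _ _ _

/-- The candidate for the inverse of a quantum matrix of quantum determinant one. -/
def qinv (q : QParam) {n : ℕ} (M : Fin (n + 1) → Fin (n + 1) → B) (i j : Fin (n + 1)) : B :=
  (-qpow q 1) ^ ((i : ℤ) - (j : ℤ)) • qminor q M j i

lemma neg_qpow_ne_zero (q : QParam) : -qpow q 1 ≠ 0 := neg_ne_zero.2 (qpow_ne_zero q 1)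

lemma mul_qinv {n : ℕ} {M : Fin (n + 1) → Fin (n + 1) → B} (hM : IsQMatrix q M)
    (hd : qdet q M = 1) (i j : Fin (n + 1)) :
    ∑ k, M i k * qinv q M k j = if i = j then 1 else 0 := by
  have hq := neg_qpow_ne_zero q
  have h := congrArg (fun z => (-qpow q 1) ^ (-(j : ℤ)) • z) (hM.laplace_left i j)
  simp only [Finset.smul_sum, smul_smul, hd] at h
  have e : ∀ k : Fin (n + 1), (-qpow q 1) ^ (-(j : ℤ)) * (-qpow q 1) ^ (k : ℕ)
      = (-qpow q 1) ^ ((k : ℤ) - (j : ℤ)) := by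
    intro k; rw [← zpow_natCast, ← zpow_add₀ hq]; congr 1; ring
  simp only [e] at h
  simp only [qinv, mul_smul_comm]
  rw [h]
  split_ifs
  · rw [smul_smul, e, sub_self, zpow_zero, one_smul]
  · simp

lemma qinv_mul {n : ℕ} {M : Fin (n + 1) → Fin (n + 1) → B} (hM : IsQMatrix q M)
    (hd : qdet q M = 1) (i j : Fin (n + 1)) :
    ∑ k, qinv q M i k * M k j = if i = j then 1 else 0 := by
  have hq := neg_qpow_ne_zero q
  have h := congrArg (fun z => (-qpow q 1) ^ ((i : ℤ) - (n : ℤ)) • z)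
    (hM.transpose.laplace_right j i)
  simp only [Finset.smul_sum, smul_smul, hM.qdet_transpose, hd] at h
  have e : ∀ k : Fin (n + 1), (-qpow q 1) ^ ((i : ℤ) - (n : ℤ)) * (-qpow q 1) ^ (n - (k : ℕ))
      = (-qpow q 1) ^ ((i : ℤ) - (k : ℤ)) := by
    intro k
    rw [← zpow_natCast, ← zpow_add₀ hq]; congr 1
    have := k.is_le
    push_cast [this]; ring
  have e2 : ∀ k, qminor q (fun a b => M b a) i k = qminor q M k i := by
    intro k
    exact (hM.comp (Fin.strictMono_succAbove k) (Fin.strictMono_succAbove i)).qdet_transpose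
  simp only [e, e2] at h
  simp only [qinv, smul_mul_assoc]
  rw [h]
  by_cases hij : j = i
  · subst hij
    simp only [if_true]
    rw [smul_smul, e, sub_self, zpow_zero, one_smul]
  · simp [hij, Ne.symm hij]

end RTT

/-! ### Matrix representations -/

section rep
variable {S : Type*} [Fintype S] [DecidableEq S]

/-- A diagonal matrix with entries powers of `q`. -/
def qdiag (q : QParam) (κ : S → ℝ) : Matrix S S ℂ := Matrix.diagonal fun s => qpow q (κ s)

lemma qdiag_mul (q : QParam) (κ κ' : S → ℝ) : qdiag q κ * qdiag q κ' = qdiag q (κ + κ') := by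
  simp [qdiag, Matrix.diagonal_mul_diagonal, qpow_add]

lemma qdiag_zero (q : QParam) : qdiag q (0 : S → ℝ) = 1 := by
  simp [qdiag]

lemma qdiag_pow (q : QParam) (κ : S → ℝ) (n : ℕ) : qdiag q κ ^ n = qdiag q (n • κ) := by
  induction n with
  | zero => simp [qdiag_zero]
  | succ n ih => rw [pow_succ, ih, qdiag_mul, succ_nsmul]

lemma qdiag_list (q : QParam) {T : Type*} (l : List T) (κ : T → S → ℝ) :
    (l.map fun i => qdiag q (κ i)).prod = qdiag q (l.map κ).sum := by
  induction l with
  | nil => simp [qdiag_zero]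
  | cons a l ih => simp [ih, qdiag_mul]

/-- The matrix of a partially defined map: `(pmat P τ w)_s = w_{τ s}` if `P s`, and `0` else. -/
def pmat (P : S → Prop) [DecidablePred P] (τ : S → S) : Matrix S S ℂ :=
  Matrix.of fun s t => if P s ∧ t = τ s then 1 else 0

lemma pmat_apply (P : S → Prop) [DecidablePred P] (τ : S → S) (s t : S) :
    pmat P τ s t = if P s ∧ t = τ s then 1 else 0 := rfl

lemma pmat_mul (P Q : S → Prop) [DecidablePred P] [DecidablePred Q] (τ τ' : S → S) :
    pmat P τ * pmat Q τ' = pmat (fun s => P s ∧ Q (τ s)) (fun s => τ' (τ s)) := by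
  ext s t
  rw [Matrix.mul_apply, Finset.sum_eq_single (τ s)]
  · by_cases h1 : P s <;> by_cases h2 : Q (τ s) <;> simp [pmat_apply, h1, h2]
  · intro u _ hu; simp [pmat_apply, hu]
  · simp

lemma pmat_eq_zero (P : S → Prop) [DecidablePred P] (τ : S → S) (h : ∀ s, ¬ P s) :
    pmat P τ = 0 := by
  ext s t; simp [pmat_apply, h]

/-- The images of the generators in a minuscule representation: `c i` are the weights of the index
set for `K_i ^ 2`, `κ` the weights for `K̂`, and `τ i` is the `i`-th simple reflection. -/
def repGen (q : QParam) {m : ℕ} (c : Fin m → S → ℤ) (κ : S → ℝ) (τ : Fin m → S → S) :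
    Gen m → Matrix S S ℂ
  | .E i => pmat (fun s => c i s = 1) (τ i)
  | .F i => pmat (fun s => c i s = -1) (τ i)
  | .K i => qdiag q fun s => (c i s : ℝ) / 2
  | .Kinv i => qdiag q fun s => -((c i s : ℝ) / 2)
  | .Khat => qdiag q κ
  | .KhatInv => qdiag q fun s => -κ s

lemma rep_relations (q : QParam) {ℓ m : ℕ} (c : Fin m → S → ℤ) (κ : S → ℝ) (τ : Fin m → S → S)
    (hc : ∀ i s, c i s = 1 ∨ c i s = 0 ∨ c i s = -1)
    (hself : ∀ i s, c i (τ i s) = - c i s)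
    (hadj : ∀ i j : Fin m, ((i : ℕ) + 1 = j ∨ (j : ℕ) + 1 = i) → ∀ s, c i (τ j s) = c i s + c j s)
    (hfar : ∀ i j : Fin m, ((i : ℕ) + 1 < j ∨ (j : ℕ) + 1 < i) → ∀ s, c i (τ j s) = c i s)
    (hinv : ∀ i s, τ i (τ i s) = s)
    (hcomm : ∀ i j : Fin m, ((i : ℕ) + 1 < j ∨ (j : ℕ) + 1 < i) → ∀ s, τ i (τ j s) = τ j (τ i s))
    (hκ : ∀ (i : Fin m) s, κ (τ i s) = κ s - hatWeight ℓ i * c i s)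
    (hroot : m = ℓ → ∀ s, ((ℓ + 1 : ℕ) : ℝ) * κ s = ∑ i : Fin m, ((i : ℕ) + 1 : ℝ) * c i s) :
    UqRelations q ℓ m (repGen q c κ τ) := by
  have tri : ∀ i j : Fin m, i = j ∨ ((i : ℕ) + 1 = j ∨ (j : ℕ) + 1 = i) ∨
      ((i : ℕ) + 1 < j ∨ (j : ℕ) + 1 < i) := by
    intro i j
    rcases lt_trichotomy (i : ℕ) j with h | h | h
    · omega
    · exact Or.inl (Fin.ext h)
    · omega
  have hcart : ∀ (i j : Fin m) s, (c i (τ j s) : ℝ) / 2 = c i s / 2 - cartanHalf i j * c j s := by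
    intro i j s
    rcases tri i j with rfl | h | h
    · rw [hself]; simp [cartanHalf]; ring
    · rw [hadj i j h]
      have : (i : ℕ) ≠ j := by omega
      simp only [cartanHalf, this, if_false, h, if_true]; push_cast; ring
    · rw [hfar i j h]
      have h1 : (i : ℕ) ≠ j := by omega
      have h2 : ¬ ((i : ℕ) + 1 = j ∨ (j : ℕ) + 1 = i) := by omega
      simp [cartanHalf, h1, h2]
  have diag_raise : ∀ (κ' : S → ℝ) (w : ℝ) (j : Fin m), (∀ s, κ' (τ j s) = κ' s - w * c j s) →
      qdiag q κ' * pmat (fun s => c j s = 1) (τ j) = qpow q w • (pmat (fun s => c j s = 1) (τ j) * qdiag q κ') := by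
    intro κ' w j h
    ext s t
    simp only [qdiag, Matrix.diagonal_mul, Matrix.mul_diagonal, Matrix.smul_apply, pmat_apply]
    split_ifs with hst
    · rw [hst.2, h, hst.1, mul_one, one_mul, smul_eq_mul, ← qpow_add]
      congr 1; push_cast; ring
    · simp
  have diag_lower : ∀ (κ' : S → ℝ) (w : ℝ) (j : Fin m), (∀ s, κ' (τ j s) = κ' s - w * c j s) →
      pmat (fun s => c j s = -1) (τ j) * qdiag q κ' = qpow q w • (qdiag q κ' * pmat (fun s => c j s = -1) (τ j)) := by
    intro κ' w j h
    ext s t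
    simp only [qdiag, Matrix.diagonal_mul, Matrix.mul_diagonal, Matrix.smul_apply, pmat_apply]
    split_ifs with hst
    · rw [hst.2, h, hst.1, mul_one, one_mul, smul_eq_mul, ← qpow_add]
      congr 1; push_cast; ring
    · simp
  have addneg : ∀ κ' : S → ℝ, (κ' + fun s => -κ' s) = 0 := fun κ' => by ext; simp
  have negadd : ∀ κ' : S → ℝ, ((fun s => -κ' s) + κ') = 0 := fun κ' => by ext; simp
  constructor
  · intro i; simp only [repGen]; rw [qdiag_mul, addneg, qdiag_zero]
  · intro i; simp only [repGen]; rw [qdiag_mul, negadd, qdiag_zero]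
  · simp only [repGen]; rw [qdiag_mul, addneg, qdiag_zero]
  · simp only [repGen]; rw [qdiag_mul, negadd, qdiag_zero]
  · intro i j; simp only [repGen]; rw [qdiag_mul, qdiag_mul, add_comm]
  · intro i; simp only [repGen]; rw [qdiag_mul, qdiag_mul, add_comm]
  · intro i j; exact diag_raise _ _ _ (hcart i j)
  · intro i j; exact diag_lower _ _ _ (hcart i j)
  · intro j; exact diag_raise _ _ _ (hκ j)
  · intro j; exact diag_lower _ _ _ (hκ j)
  · intro i j
    simp only [repGen, pmat_mul]
    ext s t
    rw [Matrix.sub_apply, pmat_apply, pmat_apply]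
    rcases tri i j with rfl | h | h
    · simp only [if_true, hself, hinv, neg_inj]
      rw [qdiag_pow, qdiag_pow, Matrix.smul_apply, Matrix.sub_apply, qdiag, qdiag,
        Matrix.diagonal_apply, Matrix.diagonal_apply]
      by_cases hst : s = t
      · subst hst
        have hq := qpow_sub_ne_zero q
        have hr : (2 • fun s => (c i s : ℝ) / 2) s = c i s := by simp; ring
        have hr' : (2 • fun s => -((c i s : ℝ) / 2)) s = -c i s := by simp; ring
        rw [hr, hr']
        rcases hc i s with h | h | h
        · simp [h, hq]
        · simp [h]
        · simp only [h]; norm_num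
          rw [← neg_sub (qpow q 1), mul_neg, inv_mul_cancel₀ hq]
      · simp [hst, Ne.symm hst]
    · have hij : i ≠ j := by rintro rfl; omega
      rw [if_neg hij, if_neg, if_neg]
      · simp
      · rintro ⟨⟨h1, h2⟩, _⟩
        rw [hadj i j h] at h2
        rcases hc i s with h' | h' | h' <;> omega
      · rintro ⟨⟨h1, h2⟩, _⟩
        rw [hadj j i h.symm] at h2
        rcases hc j s with h' | h' | h' <;> omega
    · have hij : i ≠ j := by rintro rfl; omega
      rw [if_neg hij, hfar i j h, hfar j i h.symm, hcomm i j h]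
      by_cases h1 : c i s = 1 <;> by_cases h2 : c j s = -1 <;> simp [h1, h2]
  · intro i j h
    have h1 : pmat (fun s => c i s = 1) (τ i) ^ 2 = 0 := by
      rw [sq, pmat_mul]
      apply pmat_eq_zero
      rintro s ⟨h1, h2⟩; rw [hself] at h2; omega
    have h2 : pmat (fun s => c i s = 1) (τ i) * pmat (fun s => c j s = 1) (τ j) * pmat (fun s => c i s = 1) (τ i) = 0 := by
      rw [pmat_mul, pmat_mul]
      apply pmat_eq_zero
      rintro s ⟨⟨h1, h2⟩, h3⟩; rw [hadj i j h, hself] at h3; omega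
    simp only [repGen]; rw [h1, h2]; simp
  · intro i j h
    have h1 : pmat (fun s => c i s = -1) (τ i) ^ 2 = 0 := by
      rw [sq, pmat_mul]
      apply pmat_eq_zero
      rintro s ⟨h1, h2⟩; rw [hself] at h2; omega
    have h2 : pmat (fun s => c i s = -1) (τ i) * pmat (fun s => c j s = -1) (τ j) * pmat (fun s => c i s = -1) (τ i) = 0 := by
      rw [pmat_mul, pmat_mul]
      apply pmat_eq_zero
      rintro s ⟨⟨h1, h2⟩, h3⟩; rw [hadj i j h, hself] at h3; omega
    simp only [repGen]; rw [h1, h2]; simp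
  · intro i j h
    simp only [repGen, pmat_mul]
    ext s t
    rw [pmat_apply, pmat_apply]
    simp only [hfar i j h, hfar j i h.symm, hcomm i j h, and_comm (a := c i s = 1)]
  · intro i j h
    simp only [repGen, pmat_mul]
    ext s t
    rw [pmat_apply, pmat_apply]
    simp only [hfar i j h, hfar j i h.symm, hcomm i j h, and_comm (a := c i s = -1)]
  · intro h
    simp only [repGen, qdiag_pow, qdiag_list]
    congr 1
    ext s
    have hg : (Nat.gcd 2 (ℓ + 1) : ℝ) ≠ 0 := by
      have : 0 < Nat.gcd 2 (ℓ + 1) := Nat.gcd_pos_of_pos_left _ (by norm_num)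
      exact_mod_cast this.ne'
    have e1 : (((ℓ + 1) / Nat.gcd 2 (ℓ + 1) : ℕ) : ℝ) = ((ℓ + 1 : ℕ) : ℝ) / Nat.gcd 2 (ℓ + 1) :=
      Nat.cast_div (Nat.gcd_dvd_right _ _) hg
    have e2 : ((2 / Nat.gcd 2 (ℓ + 1) : ℕ) : ℝ) = ((2 : ℕ) : ℝ) / Nat.gcd 2 (ℓ + 1) :=
      Nat.cast_div (Nat.gcd_dvd_left _ _) hg
    have e3 : ((List.finRange m).map fun i : Fin m =>
        (((i : ℕ) + 1) • fun s => (c i s : ℝ) / 2 : S → ℝ)).sum s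
        = (∑ i : Fin m, ((i : ℕ) + 1 : ℝ) * c i s) / 2 := by
      rw [← List.ofFn_eq_map, List.sum_ofFn, Finset.sum_apply, Finset.sum_div]
      refine Finset.sum_congr rfl fun i _ => ?_
      simp; ring
    rw [Pi.smul_apply, Pi.smul_apply, e3, nsmul_eq_mul, nsmul_eq_mul, e1, e2, ← hroot h s]
    field_simp
    push_cast; ring

end rep

/-! ### The vector representation -/

/-- The weights of the vector representation. -/
def piC (ℓ : ℕ) (i : Fin ℓ) (s : Fin (ℓ + 1)) : ℤ :=
  (if s = i.succ then 1 else 0) - (if s = i.castSucc then 1 else 0)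

/-- The weights of `K̂` in the vector representation. -/
def piHat (ℓ : ℕ) (s : Fin (ℓ + 1)) : ℝ :=
  if s = Fin.last ℓ then (ℓ : ℝ) / (ℓ + 1) else -1 / (ℓ + 1)

lemma pi_relations (q : QParam) (ℓ : ℕ) : UqRelations q ℓ ℓ
    (repGen q (piC ℓ) (piHat ℓ) fun i => Equiv.swap i.castSucc i.succ) := by
  apply rep_relations
  · intro i s
    unfold piC; split_ifs <;> simp_all
  · intro i s
    simp only [piC, Equiv.swap_apply_def, Fin.ext_iff, apply_ite Fin.val, Fin.val_succ,
      Fin.val_castSucc]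
    split_ifs <;> omega
  · intro i j h s
    simp only [piC, Equiv.swap_apply_def, Fin.ext_iff, apply_ite Fin.val, Fin.val_succ,
      Fin.val_castSucc]
    split_ifs <;> omega
  · intro i j h s
    simp only [piC, Equiv.swap_apply_def, Fin.ext_iff, apply_ite Fin.val, Fin.val_succ,
      Fin.val_castSucc]
    split_ifs <;> omega
  · intro i s; simp
  · intro i j h s
    simp only [Equiv.swap_apply_def, Fin.ext_iff, apply_ite Fin.val, Fin.val_succ,
      Fin.val_castSucc]
    split_ifs <;> omega
  · intro i s
    have hi := i.2
    have h0 : (ℓ : ℝ) + 1 ≠ 0 := by positivity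
    simp only [piC, piHat, hatWeight, Equiv.swap_apply_def]
    split_ifs <;> simp_all [Fin.ext_iff] <;> first | omega | (field_simp; ring)
  · intro _ s
    have h0 : (ℓ : ℝ) + 1 ≠ 0 := by positivity
    have e1 : ∑ i : Fin ℓ, ((i : ℕ) + 1 : ℝ) * (if s = i.succ then 1 else 0) = (s : ℕ) := by
      refine Fin.cases ?_ (fun j => ?_) s
      · rw [Fin.val_zero, Nat.cast_zero]
        apply Finset.sum_eq_zero; intro i _
        rw [if_neg (Fin.succ_ne_zero i).symm, mul_zero]
      · rw [Finset.sum_eq_single j]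
        · simp
        · intro b _ hb; rw [if_neg (by simpa using hb.symm), mul_zero]
        · simp
    have e2 : ∑ i : Fin ℓ, ((i : ℕ) + 1 : ℝ) * (if s = i.castSucc then 1 else 0)
        = if s = Fin.last ℓ then 0 else ((s : ℕ) : ℝ) + 1 := by
      refine Fin.lastCases ?_ (fun j => ?_) s
      · rw [if_pos rfl]; apply Finset.sum_eq_zero; intro i _
        rw [if_neg (Fin.castSucc_lt_last i).ne', mul_zero]
      · rw [if_neg (Fin.castSucc_lt_last j).ne, Finset.sum_eq_single j]
        · simp
        · intro b _ hb; rw [if_neg (by simpa using hb.symm), mul_zero]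
        · simp
    have : ∀ i : Fin ℓ, ((i : ℕ) + 1 : ℝ) * piC ℓ i s
        = ((i : ℕ) + 1 : ℝ) * (if s = i.succ then 1 else 0)
          - ((i : ℕ) + 1 : ℝ) * (if s = i.castSucc then 1 else 0) := by
      intro i; simp only [piC]; push_cast; ring
    simp only [this, Finset.sum_sub_distrib, e1, e2, piHat]
    push_cast
    split_ifs with h
    · rw [h]; simp; field_simp
    · field_simp; ring

/-- The vector representation `π` of `U_q(su(ℓ+1))`. -/
def piRep (q : QParam) (ℓ : ℕ) : Uq q ℓ ℓ →ₐ[ℂ] Matrix (Fin (ℓ + 1)) (Fin (ℓ + 1)) ℂ :=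
  Uq.lift _ (pi_relations q ℓ)

/-! ### The Hopf algebra `K_q(u(ℓ))` and its representations on the quantum Grassmann algebra -/

/-- Change of the range of the indices. -/
def Gen.castLE {m ℓ : ℕ} (h : m ≤ ℓ) : Gen m → Gen ℓ
  | .E i => .E (i.castLE h)
  | .F i => .F (i.castLE h)
  | .K i => .K (i.castLE h)
  | .Kinv i => .Kinv (i.castLE h)
  | .Khat => .Khat
  | .KhatInv => .KhatInv

lemma castLE_relations (q : QParam) {m ℓ : ℕ} (h : m ≤ ℓ) :
    UqRelations q ℓ m (fun g : Gen m => gen q ℓ (g.castLE h)) := by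
  have H := gen_relations (q := q) (ℓ := ℓ) (m := ℓ)
  constructor
  · intro i; exact H.K_Kinv _
  · intro i; exact H.Kinv_K _
  · exact H.Khat_KhatInv
  · exact H.KhatInv_Khat
  · intro i j; exact H.K_K _ _
  · intro i; exact H.Khat_K _
  · intro i j; exact H.K_E _ _
  · intro i j; exact H.F_K _ _
  · intro j; exact H.Khat_E _
  · intro j; exact H.F_Khat _
  · intro i j
    have := H.E_F (i.castLE h) (j.castLE h)
    simp only [Fin.castLE_inj] at this
    exact this
  · intro i j hij; exact H.serre_E _ _ hij
  · intro i j hij; exact H.serre_F _ _ hij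
  · intro i j hij; exact H.comm_E _ _ hij
  · intro i j hij; exact H.comm_F _ _ hij
  · intro hm; subst hm; exact H.root rfl

/-- `K_q(u(ℓ))`, generated by `E_i, F_i, K_i^{±1}` with `i ≤ ℓ - 1` and `K̂^{±1}`. -/
abbrev Kq (q : QParam) (ℓ : ℕ) := Uq q ℓ (ℓ - 1)

/-- The map `K_q(u(ℓ)) → U_q(su(ℓ+1))`. -/
def incl (q : QParam) (ℓ : ℕ) : Kq q ℓ →ₐ[ℂ] Uq q ℓ ℓ :=
  Uq.lift _ (castLE_relations q (Nat.sub_le ℓ 1))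

/-- The index `i`, in `{1, …, ℓ}`. -/
def lo {ℓ : ℕ} (i : Fin (ℓ - 1)) : Fin ℓ := ⟨i, by omega⟩

/-- The index `i + 1`, in `{1, …, ℓ}`. -/
def hi {ℓ : ℕ} (i : Fin (ℓ - 1)) : Fin ℓ := ⟨i + 1, by omega⟩

/-- The weight `i # s`: `1` if `s` contains `i` but not `i+1`, `-1` if `s` contains `i+1` but not
`i`, and `0` else. -/
def sharp {ℓ : ℕ} (i : Fin (ℓ - 1)) (s : Finset (Fin ℓ)) : ℤ :=
  (if lo i ∈ s then 1 else 0) - (if hi i ∈ s then 1 else 0)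

/-- Exchange of `i` and `i + 1` in a subset. -/
def exch {ℓ : ℕ} (i : Fin (ℓ - 1)) (s : Finset (Fin ℓ)) : Finset (Fin ℓ) :=
  s.map (Equiv.swap (lo i) (hi i)).toEmbedding

lemma mem_exch {ℓ : ℕ} (i : Fin (ℓ - 1)) (s : Finset (Fin ℓ)) (x : Fin ℓ) :
    x ∈ exch i s ↔ Equiv.swap (lo i) (hi i) x ∈ s := by
  rw [exch, Finset.mem_map_equiv, Equiv.symm_swap]

lemma sigma_relations (q : QParam) (ℓ : ℕ) (N : ℤ) : UqRelations q ℓ (ℓ - 1)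
    (repGen q (sharp (ℓ := ℓ)) (fun s => (s.card : ℝ) - ℓ * N / (ℓ + 1)) exch) := by
  have hlh : ∀ i : Fin (ℓ - 1), lo i ≠ hi i := by
    intro i; simp [lo, hi]
  have sw : ∀ (i j : Fin (ℓ - 1)), ((i : ℕ) + 1 < j ∨ (j : ℕ) + 1 < i) →
      lo i ≠ lo j ∧ lo i ≠ hi j ∧ hi i ≠ lo j ∧ hi i ≠ hi j := by
    intro i j h; simp only [lo, hi, ne_eq, Fin.mk.injEq]; omega
  apply rep_relations
  · intro i s
    unfold sharp; split_ifs <;> simp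
  · intro i s
    simp only [sharp, mem_exch, Equiv.swap_apply_left, Equiv.swap_apply_right]; ring
  · intro i j h s
    simp only [sharp, mem_exch]
    rcases h with h | h
    · have h1 : hi i = lo j := by simp [lo, hi, h]
      have h2 : lo i ≠ lo j := by simp [lo]; omega
      have h3 : lo i ≠ hi j := by simp [lo, hi]; omega
      rw [h1, Equiv.swap_apply_left, Equiv.swap_apply_of_ne_of_ne h2 h3]; ring
    · have h1 : lo i = hi j := by simp [lo, hi, h]
      have h2 : hi i ≠ lo j := by simp [lo, hi]; omega
      have h3 : hi i ≠ hi j := by simp [hi]; omega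
      rw [h1, Equiv.swap_apply_right, Equiv.swap_apply_of_ne_of_ne h2 h3]; ring
  · intro i j h s
    obtain ⟨h1, h2, h3, h4⟩ := sw i j h
    simp only [sharp, mem_exch]
    rw [Equiv.swap_apply_of_ne_of_ne h1 h2, Equiv.swap_apply_of_ne_of_ne h3 h4]
  · intro i s; ext x; simp [mem_exch]
  · intro i j h s
    obtain ⟨h1, h2, h3, h4⟩ := sw i j h
    ext x
    simp only [mem_exch]
    have : Equiv.swap (lo j) (hi j) (Equiv.swap (lo i) (hi i) x)
        = Equiv.swap (lo i) (hi i) (Equiv.swap (lo j) (hi j) x) := by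
      rcases eq_or_ne x (lo i) with rfl | a1
      · rw [Equiv.swap_apply_left, Equiv.swap_apply_of_ne_of_ne h3 h4,
          Equiv.swap_apply_of_ne_of_ne h1 h2, Equiv.swap_apply_left]
      rcases eq_or_ne x (hi i) with rfl | a2
      · rw [Equiv.swap_apply_right, Equiv.swap_apply_of_ne_of_ne h3 h4,
          Equiv.swap_apply_of_ne_of_ne h1 h2, Equiv.swap_apply_right]
      rw [Equiv.swap_apply_of_ne_of_ne a1 a2]
      rcases eq_or_ne x (lo j) with rfl | a3
      · rw [Equiv.swap_apply_left, Equiv.swap_apply_of_ne_of_ne h2.symm h4.symm]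
      rcases eq_or_ne x (hi j) with rfl | a4
      · rw [Equiv.swap_apply_right, Equiv.swap_apply_of_ne_of_ne h1.symm h3.symm]
      rw [Equiv.swap_apply_of_ne_of_ne a3 a4, Equiv.swap_apply_of_ne_of_ne a1 a2]
    rw [this]
  · intro i s
    have : ¬ ((i : ℕ) + 1 = ℓ) := by omega
    simp [hatWeight, this, exch]
  · intro h s
    obtain rfl : ℓ = 0 := by omega
    have : s = ∅ := Subsingleton.elim _ _
    simp [this]

/-- The representation `σ^N = ⊕_k σ^N_k` of `K_q(u(ℓ))` on the quantum Grassmann algebra. -/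
def sigma (q : QParam) (ℓ : ℕ) (N : ℤ) :
    Kq q ℓ →ₐ[ℂ] Matrix (Finset (Fin ℓ)) (Finset (Fin ℓ)) ℂ :=
  Uq.lift _ (sigma_relations q ℓ N)

/-! ### The coordinate algebra of `SU_q(ℓ+1)` -/

open FreeAlgebra in
/-- The relations of the algebra `A(SU_q(ℓ+1))` between the generators `u^i_j`. -/
inductive ARel (q : QParam) (ℓ : ℕ) :
    FreeAlgebra ℂ (Fin (ℓ + 1) × Fin (ℓ + 1)) → FreeAlgebra ℂ (Fin (ℓ + 1) × Fin (ℓ + 1)) → Prop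
  | col (i j k) (h : i < j) : ARel q ℓ (ι ℂ (i, k) * ι ℂ (j, k))
      (qpow q 1 • (ι ℂ (j, k) * ι ℂ (i, k)))
  | row (i j k) (h : i < j) : ARel q ℓ (ι ℂ (k, i) * ι ℂ (k, j))
      (qpow q 1 • (ι ℂ (k, j) * ι ℂ (k, i)))
  | anti (i j k l) (h : i < j) (h' : k < l) :
      ARel q ℓ (ι ℂ (i, l) * ι ℂ (j, k)) (ι ℂ (j, k) * ι ℂ (i, l))
  | cross (i j k l) (h : i < j) (h' : k < l) :
      ARel q ℓ (ι ℂ (i, k) * ι ℂ (j, l) - ι ℂ (j, l) * ι ℂ (i, k))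
        ((qpow q 1 - qpow q (-1)) • (ι ℂ (i, l) * ι ℂ (j, k)))
  | det : ARel q ℓ (qdet q fun i j => ι ℂ (i, j)) 1

/-- The coordinate algebra `A(SU_q(ℓ+1))`. -/
def ASU (q : QParam) (ℓ : ℕ) := RingQuot (ARel q ℓ)

instance (q : QParam) (ℓ : ℕ) : Ring (ASU q ℓ) := inferInstanceAs (Ring (RingQuot _))
instance (q : QParam) (ℓ : ℕ) : Algebra ℂ (ASU q ℓ) := inferInstanceAs (Algebra ℂ (RingQuot _))

/-- The quotient map. -/
def ASU.mk (q : QParam) (ℓ : ℕ) : FreeAlgebra ℂ (Fin (ℓ + 1) × Fin (ℓ + 1)) →ₐ[ℂ] ASU q ℓ :=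
  RingQuot.mkAlgHom ℂ (ARel q ℓ)

/-- The generators `u^i_j` of `A(SU_q(ℓ+1))`. -/
def uA (q : QParam) (ℓ : ℕ) (i j : Fin (ℓ + 1)) : ASU q ℓ :=
  ASU.mk q ℓ (FreeAlgebra.ι ℂ (i, j))

section ASU
variable {q : QParam} {ℓ : ℕ} {B : Type*} [Ring B] [Algebra ℂ B]

lemma uA_isQMatrix : IsQMatrix q (uA q ℓ) := by
  have key : ∀ {x y}, ARel q ℓ x y →
      ASU.mk q ℓ x = ASU.mk q ℓ y :=
    fun h => RingQuot.mkAlgHom_rel ℂ h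
  have hg : ∀ i j, ASU.mk q ℓ (FreeAlgebra.ι ℂ (i, j)) = uA q ℓ i j := fun _ _ => rfl
  constructor
  · intro i j k h; simpa only [map_mul, map_smul, hg] using key (ARel.col i j k h)
  · intro k i j h; simpa only [map_mul, map_smul, hg] using key (ARel.row i j k h)
  · intro i j k l h h'; simpa only [map_mul, map_smul, hg] using key (ARel.anti i j k l h h')
  · intro i j k l h h'
    simpa only [map_mul, map_smul, map_sub, hg] using key (ARel.cross i j k l h h')

lemma uA_qdet : qdet q (uA q ℓ) = 1 := by
  have : ASU.mk q ℓ _ = ASU.mk q ℓ _ := RingQuot.mkAlgHom_rel ℂ (ARel.det (q := q) (ℓ := ℓ))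
  rw [map_qdet, map_one] at this
  exact this

/-- The universal property of `A(SU_q(ℓ+1))`. -/
def ASU.lift (M : Fin (ℓ + 1) → Fin (ℓ + 1) → B) (hM : IsQMatrix q M) (hd : qdet q M = 1) :
    ASU q ℓ →ₐ[ℂ] B :=
  RingQuot.liftAlgHom ℂ ⟨FreeAlgebra.lift ℂ fun x => M x.1 x.2, by
    intro x y h
    cases h with
    | col i j k h => simpa using hM.col k h
    | row i j k h => simpa using hM.row k h
    | anti i j k l h h' => simpa using hM.anti h h'
    | cross i j k l h h' => simpa using hM.cross h h'
    | det => rw [map_qdet, map_one]; simpa using hd⟩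

@[simp] lemma ASU.lift_u (M : Fin (ℓ + 1) → Fin (ℓ + 1) → B) (hM : IsQMatrix q M)
    (hd : qdet q M = 1) (i j) : ASU.lift M hM hd (uA q ℓ i j) = M i j := by
  have : ASU.lift M hM hd (ASU.mk q ℓ (FreeAlgebra.ι ℂ (i, j)))
      = FreeAlgebra.lift ℂ (fun x => M x.1 x.2) (FreeAlgebra.ι ℂ (i, j)) :=
    RingQuot.liftAlgHom_mkAlgHom_apply ℂ _ _ _
  exact this.trans (by simp)

end ASU

section ASU2
variable (q : QParam) (ℓ : ℕ)

lemma comulA_aux : IsQMatrix q (fun i j => ∑ k, uA q ℓ i k ⊗ₜ[ℂ] uA q ℓ k j)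
    ∧ qdet q (fun i j => ∑ k, uA q ℓ i k ⊗ₜ[ℂ] uA q ℓ k j) = 1 := by
  have h1 := (uA_isQMatrix (q := q) (ℓ := ℓ)).map
    (Algebra.TensorProduct.includeLeft : ASU q ℓ →ₐ[ℂ] ASU q ℓ ⊗[ℂ] ASU q ℓ)
  have h2 := (uA_isQMatrix (q := q) (ℓ := ℓ)).map
    (Algebra.TensorProduct.includeRight : ASU q ℓ →ₐ[ℂ] ASU q ℓ ⊗[ℂ] ASU q ℓ)
  have hc : ∀ i j k l, Commute
      ((Algebra.TensorProduct.includeLeft : ASU q ℓ →ₐ[ℂ] ASU q ℓ ⊗[ℂ] ASU q ℓ) (uA q ℓ i j))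
      ((Algebra.TensorProduct.includeRight : ASU q ℓ →ₐ[ℂ] ASU q ℓ ⊗[ℂ] ASU q ℓ) (uA q ℓ k l)) := by
    intro i j k l; simp [Commute, SemiconjBy]
  have e : (fun i j => ∑ k, uA q ℓ i k ⊗ₜ[ℂ] uA q ℓ k j) = fun i j => ∑ k,
      (Algebra.TensorProduct.includeLeft : ASU q ℓ →ₐ[ℂ] ASU q ℓ ⊗[ℂ] ASU q ℓ) (uA q ℓ i k) *
      (Algebra.TensorProduct.includeRight : ASU q ℓ →ₐ[ℂ] ASU q ℓ ⊗[ℂ] ASU q ℓ) (uA q ℓ k j) := by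
    simp
  rw [e]
  refine ⟨h1.mul h2 hc, ?_⟩
  rw [qdet_mul _ h2 hc, ← map_qdet, ← map_qdet, uA_qdet, map_one, map_one, mul_one]

/-- The coproduct of `A(SU_q(ℓ+1))`: `Δ(u^i_j) = ∑_k u^i_k ⊗ u^k_j`. -/
def comulA : ASU q ℓ →ₐ[ℂ] ASU q ℓ ⊗[ℂ] ASU q ℓ :=
  ASU.lift (fun i j => ∑ k, uA q ℓ i k ⊗ₜ[ℂ] uA q ℓ k j) (comulA_aux q ℓ).1 (comulA_aux q ℓ).2

/-- The involution of `A(SU_q(ℓ+1))` as an algebra homomorphism to the conjugate opposite algebra: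
`(u^i_j)^* = (-q)^{j-i} D`, where `D` is the quantum determinant of the matrix `u` without row `i`
and column `j`. -/
def starHomA : ASU q ℓ →ₐ[ℂ] ConjOp (ASU q ℓ) :=
  ASU.lift (fun i j => toCO ((-qpow q 1) ^ ((j : ℤ) - (i : ℤ)) • qminor q (uA q ℓ) i j))
    (uA_isQMatrix.inverse (mul_qinv uA_isQMatrix uA_qdet) (qinv_mul uA_isQMatrix uA_qdet))
    (uA_isQMatrix.qdet_inverse (mul_qinv uA_isQMatrix uA_qdet) (qinv_mul uA_isQMatrix uA_qdet)
      uA_qdet)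

/-- The involution of `A(SU_q(ℓ+1))`. -/
def starA (a : ASU q ℓ) : ASU q ℓ := ofCO (starHomA q ℓ a)

end ASU2

/-! ### The pairing of `U_q(su(ℓ+1))` with `A(SU_q(ℓ+1))` -/

section pairing
variable (q : QParam) (ℓ : ℕ)

/-- The algebra of linear functionals on `U_q(su(ℓ+1))`, with the convolution product. -/
abbrev Udual := WithConv (Uq q ℓ ℓ →ₗ[ℂ] ℂ)

/-- The matrix coefficients of the vector representation. -/
def piCoef (j k : Fin (ℓ + 1)) : Udual q ℓ :=
  WithConv.toConv ((Matrix.entryLinearMap ℂ ℂ j k).comp (piRep q ℓ).toLinearMap)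

lemma piCoef_apply (j k : Fin (ℓ + 1)) (h : Uq q ℓ ℓ) : piCoef q ℓ j k h = piRep q ℓ h j k := rfl

/-- The tensor square of the vector representation. -/
def pi2 : Uq q ℓ ℓ →ₐ[ℂ]
    Matrix (Fin (ℓ + 1) × Fin (ℓ + 1)) (Fin (ℓ + 1) × Fin (ℓ + 1)) ℂ :=
  (Matrix.kroneckerAlgEquiv (Fin (ℓ + 1)) (Fin (ℓ + 1)) ℂ).toAlgHom.comp
    ((Algebra.TensorProduct.map (piRep q ℓ) (piRep q ℓ)).comp (comulU q ℓ ℓ))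

lemma conv_apply (i j k l : Fin (ℓ + 1)) (h : Uq q ℓ ℓ) :
    (piCoef q ℓ i k * piCoef q ℓ j l) h = pi2 q ℓ h (i, j) (k, l) := by
  rw [LinearMap.convMul_apply]
  have : (LinearMap.mul' ℂ ℂ).comp (TensorProduct.map (piCoef q ℓ i k).ofConv (piCoef q ℓ j l).ofConv)
      = (Matrix.entryLinearMap ℂ ℂ (i, j) (k, l)).comp
        ((Matrix.kroneckerAlgEquiv (Fin (ℓ + 1)) (Fin (ℓ + 1)) ℂ).toAlgHom.toLinearMap.comp
        (Algebra.TensorProduct.map (piRep q ℓ) (piRep q ℓ)).toLinearMap) := by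
    apply TensorProduct.ext'
    intro x y
    simp [piCoef, Matrix.kroneckerMap_apply]
  exact congrArg (fun φ => φ (comulU q ℓ ℓ h)) this

end pairing

section pairing
variable (q : QParam) (ℓ : ℕ)

lemma rB_comm {n : ℕ} (i j : Fin n) : rB i j = rB j i := by simp [rB, eq_comm]

lemma diag_rtt {n : ℕ} (κ : Fin n → ℝ) :
    rMat q n ℂ * (Matrix.kroneckerMap (· * ·) (qdiag q κ) (qdiag q κ))
      = Matrix.kroneckerMap (· * ·) (qdiag q κ) (qdiag q κ) * rMat q n ℂ := by
  ext ⟨i, j⟩ ⟨k, l⟩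
  rw [rMat_mul, mul_rMat]
  simp only [Matrix.kroneckerMap_apply, qdiag, Matrix.diagonal_apply, Prod.swap_prod_mk,
    smul_eq_mul]
  by_cases h1 : i = k
  · by_cases h2 : j = l
    · subst h1 h2
      by_cases h3 : i = j
      · subst h3; simp [rB]
      · simp [h3, Ne.symm h3]
    · subst h1
      by_cases h3 : j = i
      · subst h3; simp [h2]
      · simp [h2, h3]
  · by_cases h3 : j = k
    · subst h3
      by_cases h4 : i = l
      · subst h4; rw [rB_comm i j]; simp [h1]; ring_nf; simp
      · simp [h1, h4]
    · simp [h1, h3]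

lemma raise_rtt_aux {n : ℕ} (s c : Fin n) (hcs : c < s) (hl : ∀ b, b ≠ s → b ≠ c → (b < s ↔ b < c))
    (hr : ∀ b, b ≠ s → b ≠ c → (s < b ↔ c < b)) (x : Fin n → ℂ) (x' : Fin n → ℂ)
    (T : Fin n → Fin n → Fin n → Fin n → ℂ)
    (hT : ∀ i j k l, T i j k l = (if j = l ∧ i = s ∧ k = c then x j else 0)
      + (if i = k ∧ j = s ∧ l = c then x' i else 0))
    (h1 : x' c = qpow q 1 * x c) (h2 : qpow q (-1) * x s = x' s)
    (h3 : qpow q (-1) * x' c = x c) (h4 : x s = qpow q 1 * x' s)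
    (h5 : ∀ b, b ≠ s → b ≠ c → x b = 1 ∧ x' b = 1) (i j k l : Fin n) :
    rA q i j * T i j k l + rB i j * T j i k l = rA q k l * T i j k l + rB k l * T i j l k := by
  have hne := hcs.ne
  have hne' := hcs.ne'
  have hng := hcs.not_gt
  have oA : ∀ b, b ≠ s → b ≠ c → rA q s b = rA q c b ∧ rA q b s = rA q b c ∧ rB s b = 1 ∧
      rB c b = 1 ∧ rB b s = 1 ∧ rB b c = 1 := by
    intro b hb hb'
    simp only [rA, rB, hl b hb hb', hr b hb hb', hb, hb', hb.symm, hb'.symm, if_false, and_self]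
  have rss : rA q s s = qpow q 1 := by simp [rA]
  have rcc : rA q c c = qpow q 1 := by simp [rA]
  have rsc : rA q s c = 0 := by simp [rA, hne', hng]
  have rcs : rA q c s = qpow q 1 - qpow q (-1) := by simp [rA, hne, hcs]
  have bss : rB s s = 0 := by simp [rB]
  have bcc : rB c c = 0 := by simp [rB]
  have bsc : rB s c = 1 := by simp [rB, hne']
  have bcs : rB c s = 1 := by simp [rB, hne]
  have tri : ∀ b : Fin n, b = s ∨ b = c ∨ (b ≠ s ∧ b ≠ c) := fun b => by tauto
  have done : ∀ b : Fin n, b ≠ s → b ≠ c → (s ≠ b ∧ c ≠ b) := fun b h h' => ⟨h.symm, h'.symm⟩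
  by_cases D1 : j = l ∧ i = s ∧ k = c
  · obtain ⟨rfl, rfl, rfl⟩ := D1
    rcases tri j with rfl | rfl | ⟨hb, hb'⟩
    · simp [hT, rss, rcs, bss, bcs, hne', hne, ← h2]; ring
    · simp [hT, rsc, rcc, bsc, bcc, hne', hne, h1]
    · obtain ⟨o1, o2, o3, o4, o5, o6⟩ := oA j hb hb'
      simp [hT, o1, o3, o4, hne', hne, hb, hb', hb.symm, hb'.symm]
  by_cases D2 : i = k ∧ j = s ∧ l = c
  · obtain ⟨rfl, rfl, rfl⟩ := D2
    rcases tri i with rfl | rfl | ⟨hb, hb'⟩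
    · simp [hT, rss, rsc, bss, bsc, hne', hne, h4]
    · simp [hT, rcc, rcs, bcs, bcc, hne', hne, ← h3]; ring
    · obtain ⟨o1, o2, o3, o4, o5, o6⟩ := oA i hb hb'
      simp [hT, o2, o5, o6, hne', hne, hb, hb', hb.symm, hb'.symm]
  by_cases D3 : i = l ∧ j = s ∧ k = c
  · obtain ⟨rfl, rfl, rfl⟩ := D3
    rcases tri i with rfl | rfl | ⟨hb, hb'⟩
    · simp at D1
    · simp at D2
    · obtain ⟨o1, o2, o3, o4, o5, o6⟩ := oA i hb hb'
      obtain ⟨p1, p2⟩ := h5 i hb hb'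
      simp [hT, o4, o5, hne', hne, hb, hb', hb.symm, p1, p2]
  by_cases D4 : j = k ∧ i = s ∧ l = c
  · obtain ⟨rfl, rfl, rfl⟩ := D4
    rcases tri j with rfl | rfl | ⟨hb, hb'⟩
    · simp at D2
    · simp at D1
    · obtain ⟨o1, o2, o3, o4, o5, o6⟩ := oA j hb hb'
      obtain ⟨p1, p2⟩ := h5 j hb hb'
      simp [hT, o3, o6, hne', hne, hb, hb', hb.symm, p1, p2]
  simp [hT, D1, D2, D3, D4]

lemma piRep_E (i : Fin ℓ) : piRep q ℓ (gen q ℓ (.E i)) = Matrix.single i.succ i.castSucc 1 := by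
  simp only [piRep, Uq.lift_gen, repGen]
  ext s t
  rw [pmat_apply, Matrix.single_apply]
  congr 1
  apply propext
  simp only [piC, Equiv.swap_apply_def, Fin.ext_iff, apply_ite Fin.val, Fin.val_succ,
      Fin.val_castSucc]
  split_ifs <;> omega

/-- The coproduct of a raising generator in the tensor square of the vector representation commutes
with the braiding. -/
lemma raise_rtt (a : Fin ℓ) :
    rMat q (ℓ + 1) ℂ * pi2 q ℓ (gen q ℓ (.E a)) = pi2 q ℓ (gen q ℓ (.E a)) * rMat q (ℓ + 1) ℂ := by
  ext ⟨i, j⟩ ⟨k, l⟩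
  rw [rMat_mul, mul_rMat]
  simp only [Prod.swap_prod_mk, smul_eq_mul]
  have hs : piC ℓ a a.succ = 1 := by simp [piC, Fin.ext_iff]
  have hc : piC ℓ a a.castSucc = -1 := by simp [piC, Fin.ext_iff]
  refine raise_rtt_aux q a.succ a.castSucc (Fin.castSucc_lt_succ) ?_ ?_
    (fun b => qpow q ((piC ℓ a b : ℝ) / 2)) (fun b => qpow q (-((piC ℓ a b : ℝ) / 2)))
    (fun i j k l => pi2 q ℓ (gen q ℓ (.E a)) (i, j) (k, l)) ?_ ?_ ?_ ?_ ?_ ?_ i j k l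
  · intro b hb hb'
    simp only [ne_eq, Fin.ext_iff, Fin.lt_def, Fin.val_succ, Fin.val_castSucc] at *; omega
  · intro b hb hb'
    simp only [ne_eq, Fin.ext_iff, Fin.lt_def, Fin.val_succ, Fin.val_castSucc] at *; omega
  · intro i j k l
    simp only [pi2, AlgHom.comp_apply, comulU, Uq.lift_gen, comulGen, map_add,
      Algebra.TensorProduct.map_tmul, piRep_E, Matrix.add_apply]
    have hK : piRep q ℓ (gen q ℓ (.K a)) = qdiag q fun b => (piC ℓ a b : ℝ) / 2 := by
      simp only [piRep, Uq.lift_gen, repGen]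
    have hK' : piRep q ℓ (gen q ℓ (.Kinv a)) = qdiag q fun b => -((piC ℓ a b : ℝ) / 2) := by
      simp only [piRep, Uq.lift_gen, repGen]
    rw [hK, hK']
    have hk : ∀ M M' : Matrix (Fin (ℓ + 1)) (Fin (ℓ + 1)) ℂ,
        (Matrix.kroneckerAlgEquiv (Fin (ℓ + 1)) (Fin (ℓ + 1)) ℂ).toAlgHom (M ⊗ₜ M') (i, j) (k, l)
          = M i k * M' j l := by
      intro M M'; simp [Matrix.kroneckerMap_apply]
    rw [hk, hk]
    simp only [Matrix.single_apply, qdiag, Matrix.diagonal_apply]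
    congr 1
    · by_cases h1 : j = l <;> by_cases h2 : a.succ = i ∧ a.castSucc = k <;>
        simp [h1, h2, eq_comm (a := i), eq_comm (a := k)]
    · by_cases h1 : i = k <;> by_cases h2 : a.succ = j ∧ a.castSucc = l <;>
        simp [h1, h2, eq_comm (a := j), eq_comm (a := l)]
  · simp only [hc]; rw [← qpow_add]; norm_num
  · simp only [hs]; rw [← qpow_add]; norm_num
  · simp only [hc]; rw [← qpow_add]; norm_num
  · simp only [hs]; rw [← qpow_add]; norm_num
  · intro b hb hb'
    have : piC ℓ a b = 0 := by simp [piC, hb, hb']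
    simp [this]

lemma rMat_transpose (n : ℕ) : (rMat q n ℂ).transpose = rMat q n ℂ := by
  ext ⟨i, j⟩ ⟨k, l⟩
  simp only [rMat, Matrix.transpose_apply, Prod.mk.injEq, Prod.swap_prod_mk]
  congr 1
  congr 1
  · by_cases h : i = k ∧ j = l
    · obtain ⟨rfl, rfl⟩ := h; simp
    · rw [if_neg h, if_neg (by rwa [eq_comm (a := k), eq_comm (a := l)])]
  · by_cases h : i = l ∧ j = k
    · obtain ⟨rfl, rfl⟩ := h; simp [rB_comm i j]
    · rw [if_neg h, if_neg (by rintro ⟨rfl, rfl⟩; exact h ⟨rfl, rfl⟩)]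

lemma pmat_transpose {S : Type*} [Fintype S] [DecidableEq S] (c : S → ℤ) (τ : S → S)
    (h1 : ∀ s, c (τ s) = - c s) (h2 : ∀ s, τ (τ s) = s) :
    (pmat (fun s => c s = 1) τ).transpose = pmat (fun s => c s = -1) τ := by
  ext s t
  simp only [Matrix.transpose_apply, pmat_apply]
  congr 1
  apply propext
  constructor
  · rintro ⟨h, rfl⟩; simp [h1, h, h2]
  · rintro ⟨h, rfl⟩; simp [h1, h, h2]

lemma piC_swap (i : Fin ℓ) (s : Fin (ℓ + 1)) :
    piC ℓ i (Equiv.swap i.castSucc i.succ s) = - piC ℓ i s := by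
  simp only [piC, Equiv.swap_apply_def, Fin.ext_iff, apply_ite Fin.val, Fin.val_succ,
      Fin.val_castSucc]
  split_ifs <;> omega

lemma pi2_F (a : Fin ℓ) : pi2 q ℓ (gen q ℓ (.F a)) = (pi2 q ℓ (gen q ℓ (.E a))).transpose := by
  have hE : (piRep q ℓ (gen q ℓ (.E a))).transpose = piRep q ℓ (gen q ℓ (.F a)) := by
    simp only [piRep, Uq.lift_gen, repGen]
    exact pmat_transpose _ _ (piC_swap ℓ a) (by simp)
  have hK : (piRep q ℓ (gen q ℓ (.K a))).transpose = piRep q ℓ (gen q ℓ (.K a)) := by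
    simp [piRep, Uq.lift_gen, repGen, qdiag]
  have hK' : (piRep q ℓ (gen q ℓ (.Kinv a))).transpose = piRep q ℓ (gen q ℓ (.Kinv a)) := by
    simp [piRep, Uq.lift_gen, repGen, qdiag]
  simp only [pi2, AlgHom.comp_apply, comulU, Uq.lift_gen, comulGen, map_add, Matrix.transpose_add,
    Algebra.TensorProduct.map_tmul]
  simp [← Matrix.kroneckerMap_transpose, hE, hK, hK']

lemma pi2_rtt (h : Uq q ℓ ℓ) :
    rMat q (ℓ + 1) ℂ * pi2 q ℓ h = pi2 q ℓ h * rMat q (ℓ + 1) ℂ := by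
  have : h ∈ (Subalgebra.centralizer ℂ {rMat q (ℓ + 1) ℂ}).comap (pi2 q ℓ) := by
    apply Uq.mem_of_gen
    intro x
    rw [Subalgebra.mem_comap, Subalgebra.mem_centralizer_iff]
    rintro _ rfl
    rcases x with i | i | i | i | _ | _
    · exact raise_rtt q ℓ i
    · have := congrArg Matrix.transpose (raise_rtt q ℓ i)
      rw [Matrix.transpose_mul, Matrix.transpose_mul, ← pi2_F, rMat_transpose] at this
      exact this.symm
    all_goals
      simp only [pi2, AlgHom.comp_apply, comulU, Uq.lift_gen, comulGen,
        Algebra.TensorProduct.map_tmul, piRep, repGen]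
      simpa using diag_rtt q _
  rw [Subalgebra.mem_comap, Subalgebra.mem_centralizer_iff] at this
  exact this _ rfl

lemma piCoef_isQMatrix : IsQMatrix q (piCoef q ℓ) := by
  rw [isQMatrix_iff_pt]
  intro i j k l
  ext h
  have := congrFun (congrFun (pi2_rtt q ℓ h) (i, j)) (k, l)
  rw [rMat_mul, mul_rMat] at this
  have e : ∀ i j k l : Fin (ℓ + 1),
    (piCoef q ℓ i k * piCoef q ℓ j l).ofConv h = pi2 q ℓ h (i, j) (k, l) := fun i j k l =>
      conv_apply q ℓ i j k l h
  simp only [WithConv.ofConv_add, WithConv.ofConv_smul, LinearMap.add_apply, LinearMap.smul_apply, e]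
  exact this

/-- Left translation of functionals. -/
def lam (g : Uq q ℓ ℓ) (f : Udual q ℓ) : Udual q ℓ :=
  WithConv.toConv (f.ofConv.comp (LinearMap.mulLeft ℂ g))

lemma lam_apply (g h : Uq q ℓ ℓ) (f : Udual q ℓ) : (lam q ℓ g f).ofConv h = f.ofConv (g * h) := rfl

lemma lam_sum {T : Type*} (g : Uq q ℓ ℓ) (s : Finset T) (f : T → Udual q ℓ) :
    lam q ℓ g (∑ t ∈ s, f t) = ∑ t ∈ s, lam q ℓ g (f t) := by
  ext h; simp [lam_apply, LinearMap.sum_apply]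

lemma lam_smul (g : Uq q ℓ ℓ) (c : ℂ) (f : Udual q ℓ) :
    lam q ℓ g (c • f) = c • lam q ℓ g f := rfl

lemma conv_tmul (x y : Uq q ℓ ℓ) (f f' : Udual q ℓ) (T : Uq q ℓ ℓ ⊗[ℂ] Uq q ℓ ℓ) :
    LinearMap.mul' ℂ ℂ (TensorProduct.map f.ofConv f'.ofConv (x ⊗ₜ y * T))
      = LinearMap.mul' ℂ ℂ (TensorProduct.map (lam q ℓ x f).ofConv (lam q ℓ y f').ofConv T) := by
  induction T using TensorProduct.induction_on with
  | zero => simp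
  | tmul a b => simp [lam_apply]
  | add a b ha hb => rw [mul_add, map_add, map_add, ha, hb, map_add, map_add]

lemma lam_mul_group (g : Uq q ℓ ℓ) (hg : comulU q ℓ ℓ g = g ⊗ₜ g) (f f' : Udual q ℓ) :
    lam q ℓ g (f * f') = lam q ℓ g f * lam q ℓ g f' := by
  ext h
  rw [lam_apply, LinearMap.convMul_apply, LinearMap.convMul_apply, Bialgebra.comul_mul]
  change LinearMap.mul' ℂ ℂ (TensorProduct.map _ _ (comulU q ℓ ℓ g * _)) = _
  rw [hg, conv_tmul]

lemma lam_one (g : Uq q ℓ ℓ) : lam q ℓ g 1 = counitU q ℓ ℓ g • 1 := by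
  ext h
  rw [lam_apply, LinearMap.convOne_apply, WithConv.ofConv_smul, LinearMap.smul_apply,
    LinearMap.convOne_apply, Bialgebra.counit_mul, map_mul]
  rfl

lemma lam_mul_skew (g k k' : Uq q ℓ ℓ) (hg : comulU q ℓ ℓ g = g ⊗ₜ k + k' ⊗ₜ g)
    (f f' : Udual q ℓ) :
    lam q ℓ g (f * f') = lam q ℓ g f * lam q ℓ k f' + lam q ℓ k' f * lam q ℓ g f' := by
  ext h
  rw [lam_apply, WithConv.ofConv_add, LinearMap.add_apply, LinearMap.convMul_apply,
    LinearMap.convMul_apply, LinearMap.convMul_apply, Bialgebra.comul_mul]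
  change LinearMap.mul' ℂ ℂ (TensorProduct.map _ _ (comulU q ℓ ℓ g * _)) = _
  rw [hg, add_mul, map_add, map_add, conv_tmul, conv_tmul]

lemma lam_prod_group (g : Uq q ℓ ℓ) (hg : comulU q ℓ ℓ g = g ⊗ₜ g) (h1 : counitU q ℓ ℓ g = 1)
    {n : ℕ} (f : Fin n → Udual q ℓ) :
    lam q ℓ g (List.ofFn f).prod = (List.ofFn fun t => lam q ℓ g (f t)).prod := by
  induction n with
  | zero => simp [lam_one, h1]
  | succ n ih => rw [List.ofFn_succ, List.prod_cons, lam_mul_group q ℓ g hg, ih, List.ofFn_succ,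
      List.prod_cons]

lemma lam_prod_skew (g k k' : Uq q ℓ ℓ) (hg : comulU q ℓ ℓ g = g ⊗ₜ k + k' ⊗ₜ g)
    (h0 : counitU q ℓ ℓ g = 0) (hk : comulU q ℓ ℓ k = k ⊗ₜ k) (h1 : counitU q ℓ ℓ k = 1)
    {n : ℕ} (f : Fin n → Udual q ℓ) :
    lam q ℓ g (List.ofFn f).prod = ∑ r : Fin n, (List.ofFn fun t => if t < r then lam q ℓ k' (f t)
      else if t = r then lam q ℓ g (f t) else lam q ℓ k (f t)).prod := by
  induction n with
  | zero => simp [lam_one, h0]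
  | succ n ih =>
    rw [List.ofFn_succ, List.prod_cons, lam_mul_skew q ℓ g k k' hg, ih, Fin.sum_univ_succ,
      lam_prod_group q ℓ k hk h1, Finset.mul_sum]
    congr 1
    · rw [List.ofFn_succ, List.prod_cons]
      simp [Fin.succ_ne_zero]
    · refine Finset.sum_congr rfl fun r _ => ?_
      rw [List.ofFn_succ, List.prod_cons]
      simp [Fin.succ_inj]

lemma prod_smul_list {R : Type*} [Ring R] [Algebra ℂ R] {n : ℕ} (c : Fin n → ℂ) (f : Fin n → R) :
    (List.ofFn fun t => c t • f t).prod = (∏ t, c t) • (List.ofFn f).prod := by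
  induction n with
  | zero => simp
  | succ n ih =>
    rw [List.ofFn_succ, List.prod_cons, ih, List.ofFn_succ, List.prod_cons, Fin.prod_univ_succ,
      smul_mul_smul_comm]

lemma lam_piCoef (g : Uq q ℓ ℓ) (j k : Fin (ℓ + 1)) :
    lam q ℓ g (piCoef q ℓ j k) = ∑ a, piRep q ℓ g j a • piCoef q ℓ a k := by
  ext h
  have : ∀ a, (piCoef q ℓ a k).ofConv h = piRep q ℓ h a k := fun _ => rfl
  simp only [WithConv.ofConv_sum, LinearMap.sum_apply, WithConv.ofConv_smul, LinearMap.smul_apply,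
    this]
  change piRep q ℓ (g * h) j k = _
  rw [map_mul, Matrix.mul_apply]
  rfl

lemma lam_piCoef_diag (g : Uq q ℓ ℓ) (κ : Fin (ℓ + 1) → ℝ) (hg : piRep q ℓ g = qdiag q κ)
    (j k : Fin (ℓ + 1)) : lam q ℓ g (piCoef q ℓ j k) = qpow q (κ j) • piCoef q ℓ j k := by
  rw [lam_piCoef, hg, Finset.sum_eq_single j]
  · simp [qdiag]
  · intro b _ hb; simp [qdiag, Matrix.diagonal_apply_ne _ hb.symm]
  · simp

lemma qpow_sum {T : Type*} (s : Finset T) (f : T → ℝ) :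
    ∏ t ∈ s, qpow q (f t) = qpow q (∑ t ∈ s, f t) := by
  classical
  induction s using Finset.induction_on with
  | empty => simp
  | insert a s ha ih => rw [Finset.prod_insert ha, Finset.sum_insert ha, ih, qpow_add]

lemma lam_qdet_group (g : Uq q ℓ ℓ) (hg : comulU q ℓ ℓ g = g ⊗ₜ g) (h1 : counitU q ℓ ℓ g = 1)
    (κ : Fin (ℓ + 1) → ℝ) (hκ : piRep q ℓ g = qdiag q κ) (h0 : ∑ s, κ s = 0) :
    lam q ℓ g (qdet q (piCoef q ℓ)) = qdet q (piCoef q ℓ) := by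
  simp only [qdet, lam_sum, lam_smul, lam_prod_group q ℓ g hg h1, lam_piCoef_diag q ℓ g κ hκ,
    prod_smul_list, qpow_sum, h0, qpow_zero, one_smul]

lemma lam_qdet_skew (g k k' : Uq q ℓ ℓ) (hg : comulU q ℓ ℓ g = g ⊗ₜ k + k' ⊗ₜ g)
    (h0 : counitU q ℓ ℓ g = 0) (hk : comulU q ℓ ℓ k = k ⊗ₜ k) (h1 : counitU q ℓ ℓ k = 1)
    (κ κ' : Fin (ℓ + 1) → ℝ) (hκ : piRep q ℓ k = qdiag q κ) (hκ' : piRep q ℓ k' = qdiag q κ')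
    (r a : Fin (ℓ + 1)) (hra : r ≠ a) (hπ : piRep q ℓ g = Matrix.single r a 1) :
    lam q ℓ g (qdet q (piCoef q ℓ)) = 0 := by
  have hgP : ∀ j k, lam q ℓ g (piCoef q ℓ j k) = if j = r then piCoef q ℓ a k else 0 := by
    intro j k
    rw [lam_piCoef, hπ]
    split_ifs with h
    · subst h
      rw [Finset.sum_eq_single a]
      · simp
      · intro b _ hb; simp [Ne.symm hb]
      · simp
    · apply Finset.sum_eq_zero
      intro b _; simp [Ne.symm h]
  simp only [qdet, lam_sum, lam_smul, lam_prod_skew q ℓ g k k' hg h0 hk h1,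
    lam_piCoef_diag q ℓ k κ hκ, lam_piCoef_diag q ℓ k' κ' hκ', hgP]
  let f : Fin (ℓ + 1) → Fin (ℓ + 1) := Function.update id r a
  let cf : Fin (ℓ + 1) → ℂ := fun t => if t < r then qpow q (κ' t) else if t = r then 1 else
    qpow q (κ t)
  have key : ∀ p : Equiv.Perm (Fin (ℓ + 1)), ∑ r' : Fin (ℓ + 1), (List.ofFn fun t =>
      if t < r' then qpow q (κ' t) • piCoef q ℓ t (p t)
      else if t = r' then (if t = r then piCoef q ℓ a (p t) else 0)
      else qpow q (κ t) • piCoef q ℓ t (p t)).prod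
      = (∏ t, cf t) • (List.ofFn fun t => piCoef q ℓ (f t) (p t)).prod := by
    intro p
    rw [Finset.sum_eq_single r]
    · rw [← prod_smul_list]
      congr 2
      funext t
      simp only [cf, f]
      by_cases h : t = r
      · subst h; simp
      · by_cases h' : t < r <;> simp [h, h']
    · intro r' _ hr'
      apply List.prod_eq_zero
      rw [List.mem_ofFn']
      exact ⟨r', by simp [hr']⟩
    · simp
  simp only [key]
  have hz := (piCoef_isQMatrix q ℓ).qdet_rows_noninj f (by
    intro hinj
    apply hra
    apply hinj
    simp [f, Function.update_of_ne hra.symm])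
  rw [qdet] at hz
  have := congrArg (fun z => (∏ t, cf t) • z) hz
  simp only [smul_zero, Finset.smul_sum] at this
  rw [← this]
  exact Finset.sum_congr rfl fun p _ => smul_comm _ _ _

lemma qdet_one (n : ℕ) : qdet q (fun i j : Fin n => if i = j then (1 : ℂ) else 0) = 1 := by
  rw [qdet, Finset.sum_eq_single 1]
  · rw [invCount_strictMono (p := ⇑(1 : Equiv.Perm (Fin n))) (fun a b h => h)]
    simp
  · intro p _ hp
    obtain ⟨t, ht⟩ : ∃ t, p t ≠ t := by
      by_contra! h
      exact hp (Equiv.ext h)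
    rw [List.prod_eq_zero, smul_zero]
    rw [List.mem_ofFn']
    exact ⟨t, by simp [Ne.symm ht]⟩
  · simp

lemma piC_sum (i : Fin ℓ) : ∑ s, (piC ℓ i s : ℝ) / 2 = 0 := by
  rw [← Finset.sum_div]
  simp [piC]

lemma piHat_sum : ∑ s, piHat ℓ s = 0 := by
  rw [Fin.sum_univ_castSucc]
  have : ∀ i : Fin ℓ, piHat ℓ i.castSucc = -1 / (ℓ + 1) := by
    intro i; simp [piHat, (Fin.castSucc_lt_last i).ne]
  simp only [this]
  have h0 : (ℓ : ℝ) + 1 ≠ 0 := by positivity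
  simp [piHat]; field_simp; ring

lemma piRep_F (i : Fin ℓ) : piRep q ℓ (gen q ℓ (.F i)) = Matrix.single i.castSucc i.succ 1 := by
  simp only [piRep, Uq.lift_gen, repGen]
  ext s t
  rw [pmat_apply, Matrix.single_apply]
  congr 1
  apply propext
  simp only [piC, Equiv.swap_apply_def, Fin.ext_iff, apply_ite Fin.val, Fin.val_succ,
      Fin.val_castSucc]
  split_ifs <;> omega

lemma lam_qdet_gen (x : Gen ℓ) : lam q ℓ (gen q ℓ x) (qdet q (piCoef q ℓ))
    = counitU q ℓ ℓ (gen q ℓ x) • qdet q (piCoef q ℓ) := by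
  have hne : ∀ i : Fin ℓ, i.succ ≠ i.castSucc := fun i => by simp [Fin.ext_iff]
  rcases x with i | i | i | i | _ | _
  · rw [lam_qdet_skew q ℓ _ (gen q ℓ (.K i)) (gen q ℓ (.Kinv i)) (by simp [comulU, comulGen])
      (by simp [counitU, counitGen]) (by simp [comulU, comulGen]) (by simp [counitU, counitGen])
      _ _ (by simp only [piRep, Uq.lift_gen, repGen]; rfl)
      (by simp only [piRep, Uq.lift_gen, repGen]; rfl) i.succ i.castSucc (hne i) (piRep_E q ℓ i)]
    simp [counitU, counitGen]
  · rw [lam_qdet_skew q ℓ _ (gen q ℓ (.K i)) (gen q ℓ (.Kinv i)) (by simp [comulU, comulGen])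
      (by simp [counitU, counitGen]) (by simp [comulU, comulGen]) (by simp [counitU, counitGen])
      _ _ (by simp only [piRep, Uq.lift_gen, repGen]; rfl)
      (by simp only [piRep, Uq.lift_gen, repGen]; rfl) i.castSucc i.succ (hne i).symm
      (piRep_F q ℓ i)]
    simp [counitU, counitGen]
  · rw [lam_qdet_group q ℓ _ (by simp [comulU, comulGen]) (by simp [counitU, counitGen])
      _ (by simp only [piRep, Uq.lift_gen, repGen]) (piC_sum ℓ i)]
    simp [counitU, counitGen]
  · rw [lam_qdet_group q ℓ _ (by simp [comulU, comulGen]) (by simp [counitU, counitGen])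
      _ (by simp only [piRep, Uq.lift_gen, repGen]; rfl)
      (by rw [Finset.sum_neg_distrib, piC_sum ℓ i, neg_zero])]
    simp [counitU, counitGen]
  · rw [lam_qdet_group q ℓ _ (by simp [comulU, comulGen]) (by simp [counitU, counitGen])
      _ (by simp only [piRep, Uq.lift_gen, repGen]) (piHat_sum ℓ)]
    simp [counitU, counitGen]
  · rw [lam_qdet_group q ℓ _ (by simp [comulU, comulGen]) (by simp [counitU, counitGen])
      _ (by simp only [piRep, Uq.lift_gen, repGen]; rfl)
      (by rw [Finset.sum_neg_distrib, piHat_sum ℓ, neg_zero])]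
    simp [counitU, counitGen]

/-- Evaluation at the unit. -/
def evalOne : Udual q ℓ →ₐ[ℂ] ℂ where
  toFun f := f.ofConv 1
  map_one' := by simp
  map_mul' f g := by
    rw [LinearMap.convMul_apply, Bialgebra.comul_one, Algebra.TensorProduct.one_def]; simp
  map_zero' := rfl
  map_add' _ _ := rfl
  commutes' c := by simp

lemma piCoef_qdet : qdet q (piCoef q ℓ) = 1 := by
  let S : Subalgebra ℂ (Uq q ℓ ℓ) :=
    { carrier := {g | lam q ℓ g (qdet q (piCoef q ℓ)) = counitU q ℓ ℓ g • qdet q (piCoef q ℓ)}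
      mul_mem' := by
        intro a b ha hb
        have : ∀ f, lam q ℓ (a * b) f = lam q ℓ b (lam q ℓ a f) := by
          intro f; ext h; simp [lam_apply, mul_assoc]
        simp only [Set.mem_ofPred_eq] at *
        rw [this, ha, lam_smul, hb, smul_smul, map_mul]
      add_mem' := by
        intro a b ha hb
        have : ∀ f, lam q ℓ (a + b) f = lam q ℓ a f + lam q ℓ b f := by
          intro f; ext h; simp [lam_apply, add_mul]
        simp only [Set.mem_ofPred_eq] at *
        rw [this, ha, hb, map_add, add_smul]
      algebraMap_mem' := by
        intro r
        have : ∀ f, lam q ℓ (algebraMap ℂ _ r) f = r • f := by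
          intro f; ext h; simp [lam_apply, ← Algebra.smul_def]
        simp only [Set.mem_ofPred_eq]
        rw [this, AlgHom.commutes]
        rfl }
  have h1 : evalOne q ℓ (qdet q (piCoef q ℓ)) = 1 := by
    rw [map_qdet]
    have : ∀ i j, evalOne q ℓ (piCoef q ℓ i j) = if i = j then (1 : ℂ) else 0 := by
      intro i j
      change piRep q ℓ 1 i j = _
      rw [map_one, Matrix.one_apply]
    simp only [this, qdet_one]
  ext g
  have hg : g ∈ S := Uq.mem_of_gen S (lam_qdet_gen q ℓ) g
  have := congrArg (fun f : Udual q ℓ => f.ofConv 1) (show lam q ℓ g (qdet q (piCoef q ℓ)) = _ from hg)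
  simp only [lam_apply, mul_one, WithConv.ofConv_smul, LinearMap.smul_apply] at this
  rw [this]
  change counitU q ℓ ℓ g • evalOne q ℓ (qdet q (piCoef q ℓ)) = _
  rw [h1]
  simp
  rfl

/-- The pairing `⟨h, a⟩`, as an algebra homomorphism from `A(SU_q(ℓ+1))` to the functionals on
`U_q(su(ℓ+1))`; it is `⟨h, u^j_k⟩ = π^j_k(h)` on the generators. -/
def pairing : ASU q ℓ →ₐ[ℂ] Udual q ℓ :=
  ASU.lift (piCoef q ℓ) (piCoef_isQMatrix q ℓ) (piCoef_qdet q ℓ)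

end pairing

section actions
variable (q : QParam) (ℓ : ℕ)

/-- The bilinear pairing `⟨h, a⟩`. -/
def pair : Uq q ℓ ℓ →ₗ[ℂ] ASU q ℓ →ₗ[ℂ] ℂ :=
  ((WithConv.linearEquiv ℂ (Uq q ℓ ℓ →ₗ[ℂ] ℂ)).toLinearMap.comp (pairing q ℓ).toLinearMap).flip

/-- The left canonical action `h ▷ a = a_(1) ⟨h, a_(2)⟩`. -/
def lact : Uq q ℓ ℓ →ₗ[ℂ] ASU q ℓ →ₗ[ℂ] ASU q ℓ where
  toFun h := (TensorProduct.rid ℂ (ASU q ℓ)).toLinearMap ∘ₗ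
    (pair q ℓ h).lTensor (ASU q ℓ) ∘ₗ (comulA q ℓ).toLinearMap
  map_add' g h := by
    rw [map_add, LinearMap.lTensor_add, LinearMap.add_comp, LinearMap.comp_add]
  map_smul' c h := by
    rw [map_smul, LinearMap.lTensor_smul, LinearMap.smul_comp, LinearMap.comp_smul]; rfl

/-- The right canonical action `a ◁ h = ⟨h, a_(1)⟩ a_(2)`. -/
def ract : Uq q ℓ ℓ →ₗ[ℂ] ASU q ℓ →ₗ[ℂ] ASU q ℓ where
  toFun h := (TensorProduct.lid ℂ (ASU q ℓ)).toLinearMap ∘ₗ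
    (pair q ℓ h).rTensor (ASU q ℓ) ∘ₗ (comulA q ℓ).toLinearMap
  map_add' g h := by
    rw [map_add, LinearMap.rTensor_add, LinearMap.add_comp, LinearMap.comp_add]
  map_smul' c h := by
    rw [map_smul, LinearMap.rTensor_smul, LinearMap.smul_comp, LinearMap.comp_smul]; rfl

/-- The inverse of the antipode of `U_q(su(ℓ+1))`. -/
def antipodeInv : Uq q ℓ ℓ →ₗ[ℂ] Uq q ℓ ℓ :=
  (antipodeU q ℓ ℓ).symm.toLinearMap ∘ₗ (MulOpposite.opLinearEquiv ℂ).toLinearMap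

/-- The operators `𝓛_h a = a ◁ S⁻¹(h)`. -/
def Lop : Uq q ℓ ℓ →ₗ[ℂ] ASU q ℓ →ₗ[ℂ] ASU q ℓ := (ract q ℓ).comp (antipodeInv q ℓ)

/-- The subalgebra `U_q(su(ℓ))` of `U_q(su(ℓ+1))`. -/
def UqSub : Subalgebra ℂ (Uq q ℓ ℓ) :=
  Algebra.adjoin ℂ {x | ∃ i : Fin ℓ, (i : ℕ) + 1 < ℓ ∧
    (x = gen q ℓ (.E i) ∨ x = gen q ℓ (.F i) ∨ x = gen q ℓ (.K i) ∨ x = gen q ℓ (.Kinv i))}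

/-- The coordinate algebra `A(CP^ℓ_q)` of the quantum projective space, as a subspace of
`A(SU_q(ℓ+1))`. -/
def ACP : Submodule ℂ (ASU q ℓ) where
  carrier := {a | (∀ h ∈ UqSub q ℓ, Lop q ℓ h a = counitU q ℓ ℓ h • a)
    ∧ Lop q ℓ (gen q ℓ .Khat) a = a}
  add_mem' := by
    rintro a b ⟨ha, ha'⟩ ⟨hb, hb'⟩
    exact ⟨fun h hh => by rw [map_add, ha h hh, hb h hh, smul_add], by rw [map_add, ha', hb']⟩
  zero_mem' := ⟨fun h _ => by simp, by simp⟩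
  smul_mem' := by
    rintro c a ⟨ha, ha'⟩
    exact ⟨fun h hh => by rw [map_smul, ha h hh, smul_comm], by rw [map_smul, ha']⟩

end actions

/-! ### The quantum Grassmann algebra -/

section grassmann
variable (q : QParam) (ℓ : ℕ)

/-- The underlying space of the quantum Grassmann algebra: a vector has a component for each subset
of `{1, …, ℓ}`, a subset with `k` elements standing for the multi-index `i_1 < ⋯ < i_k`. -/
abbrev Gr (ℓ : ℕ) := Finset (Fin ℓ) → ℂ

/-- The homogeneous vectors of degree `k`. -/
def Wk (ℓ k : ℕ) : Submodule ℂ (Gr ℓ) where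
  carrier := {w | ∀ s : Finset (Fin ℓ), s.card ≠ k → w s = 0}
  add_mem' := by
    intro v w hv hw s hs
    rw [Pi.add_apply, hv s hs, hw s hs, add_zero]
  zero_mem' := fun _ _ => rfl
  smul_mem' := by
    intro c w hw s hs
    rw [Pi.smul_apply, hw s hs, smul_zero]

/-- The number of pairs `(a, b)` with `a ∈ A`, `b ∈ B`, `b < a`: the length of the shuffle that
sorts `A` followed by `B`. -/
def crossings {ℓ : ℕ} (A B : Finset (Fin ℓ)) : ℕ := ((A ×ˢ B).filter fun x => x.2 < x.1).card

/-- The product of the quantum Grassmann algebra,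
`(v ∧_q w)_s = ∑_{A ⊆ s} (-q⁻¹)^{crossings(A, s∖A)} v_A w_{s∖A}`. -/
def wedge : Gr ℓ →ₗ[ℂ] Gr ℓ →ₗ[ℂ] Gr ℓ :=
  LinearMap.mk₂ ℂ (fun v w s => ∑ A ∈ s.powerset,
      (-qpow q (-1)) ^ crossings A (s \ A) * (v A * w (s \ A)))
    (fun v v' w => by
      ext s; simp only [Pi.add_apply, add_mul, mul_add, Finset.sum_add_distrib])
    (fun c v w => by
      ext s; simp only [Pi.smul_apply, smul_eq_mul, Finset.mul_sum]
      exact Finset.sum_congr rfl fun _ _ => by ring)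
    (fun v w w' => by
      ext s; simp only [Pi.add_apply, mul_add, Finset.sum_add_distrib])
    (fun c v w => by
      ext s; simp only [Pi.smul_apply, smul_eq_mul, Finset.mul_sum]
      exact Finset.sum_congr rfl fun _ _ => by ring)

/-- The basis vector of a subset. -/
def basisGr {ℓ : ℕ} (s : Finset (Fin ℓ)) : Gr ℓ := Pi.single s 1

/-- The left exterior product by the `i`-th basis vector of `W_1`. -/
def eL (i : Fin ℓ) : Gr ℓ →ₗ[ℂ] Gr ℓ := wedge q ℓ (basisGr {i})

/-- The left contraction: the adjoint of `eL` for the inner product `∑_s conj(v_s) w_s`. -/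
def iL (i : Fin ℓ) : Gr ℓ →ₗ[ℂ] Gr ℓ :=
  Matrix.toLin' (LinearMap.toMatrix' (eL q ℓ i)).conjTranspose

end grassmann

/-! ### Forms and the Dolbeault operator -/

section forms
variable (q : QParam) (ℓ : ℕ)

/-- The space `A(SU_q(ℓ+1)) ⊗ Gr`. -/
abbrev Forms := ASU q ℓ ⊗[ℂ] Gr ℓ

/-- The action `𝓛_{h_(1)} ⊗ σ^N(h_(2))` of `K_q(u(ℓ))` on `A(SU_q(ℓ+1)) ⊗ Gr`. -/
def formAct (N : ℤ) : Kq q ℓ →ₗ[ℂ] Forms q ℓ →ₗ[ℂ] Forms q ℓ :=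
  (TensorProduct.homTensorHomMap (RingHom.id ℂ) (ASU q ℓ) (Gr ℓ) (ASU q ℓ) (Gr ℓ)).comp
    ((TensorProduct.map ((Lop q ℓ).comp (incl q ℓ).toLinearMap)
      (Matrix.toLin'.toLinearMap.comp (sigma q ℓ N).toLinearMap)).comp
        (comulU q ℓ (ℓ - 1)).toLinearMap)

/-- The module `Ω^k_N` of antiholomorphic `k`-forms twisted by `N`: the elements of
`A(SU_q(ℓ+1)) ⊗ W_k` that are invariant under `K_q(u(ℓ))`. -/
def Omega (k : ℕ) (N : ℤ) : Submodule ℂ (Forms q ℓ) where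
  carrier := {v | v ∈ LinearMap.range ((Wk ℓ k).subtype.lTensor (ASU q ℓ))
    ∧ ∀ h : Kq q ℓ, formAct q ℓ N h v = counitU q ℓ (ℓ - 1) h • v}
  add_mem' := by
    rintro a b ⟨ha, ha'⟩ ⟨hb, hb'⟩
    exact ⟨Submodule.add_mem _ ha hb, fun h => by rw [map_add, ha', hb', smul_add]⟩
  zero_mem' := ⟨Submodule.zero_mem _, fun h => by simp⟩
  smul_mem' := by
    rintro c a ⟨ha, ha'⟩
    exact ⟨Submodule.smul_mem _ _ ha, fun h => by rw [map_smul, ha', smul_comm]⟩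

/-- The product of forms, `(a ⊗ v) ∧_q (a' ⊗ v') = a a' ⊗ (v ∧_q v')`. -/
def wedgeForm : Forms q ℓ →ₗ[ℂ] Forms q ℓ →ₗ[ℂ] Forms q ℓ :=
  TensorProduct.map₂ (LinearMap.mul ℂ (ASU q ℓ)) (wedge q ℓ)

/-- The element `a ⊗ 1`. -/
def ofFun : ASU q ℓ →ₗ[ℂ] Forms q ℓ := (TensorProduct.mk ℂ (ASU q ℓ) (Gr ℓ)).flip (basisGr ∅)

/-- The left action `h ▷ (a ⊗ v) = (h ▷ a) ⊗ v` of `U_q(su(ℓ+1))` on `A(SU_q(ℓ+1)) ⊗ Gr`. -/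
def lactForm : Uq q ℓ ℓ →ₗ[ℂ] Forms q ℓ →ₗ[ℂ] Forms q ℓ :=
  (LinearMap.rTensorHom (Gr ℓ)).comp (lact q ℓ)

/-- The involution of `U_q(su(ℓ+1))`. -/
def starU (x : Uq q ℓ ℓ) : Uq q ℓ ℓ := ofCO (starHomU q ℓ ℓ x)

/-- The `q`-commutator `[a, b]_q = a b - q⁻¹ b a`. -/
def qcomm {B : Type*} [Ring B] [Algebra ℂ B] (a b : B) : B := a * b - qpow q (-1) • (b * a)

/-- `rootM d j` is `M_{j, j+d} = [E_j, [E_{j+1}, …, E_{j+d}]_q]_q`. -/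
def rootM : (d j : ℕ) → j + d < ℓ → Uq q ℓ ℓ
  | 0, j, h => gen q ℓ (.E ⟨j, by omega⟩)
  | d + 1, j, h => qcomm q (gen q ℓ (.E ⟨j, by omega⟩)) (rootM d (j + 1) (by omega))

/-- `X_i = N_{i ℓ} M_{i ℓ}^*`, where `N_{i ℓ} = K_i K_{i+1} ⋯ K_ℓ K̂⁻¹`. -/
def Xel (i : Fin ℓ) : Uq q ℓ ℓ :=
  (((List.finRange ℓ).filter (i ≤ ·)).map fun j => gen q ℓ (.K j)).prod * gen q ℓ .KhatInv *
    starU q ℓ (rootM q ℓ (ℓ - 1 - i) i (by omega))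

/-- The Dolbeault operator `∂̄ = ∑_i 𝓛_{K̂ X_i} ⊗ e^L_i`. -/
def dbar : Forms q ℓ →ₗ[ℂ] Forms q ℓ :=
  ∑ i : Fin ℓ, TensorProduct.map (Lop q ℓ (gen q ℓ .Khat * Xel q ℓ i)) (eL q ℓ i)

/-- The operator `∂̄† = ∑_i 𝓛_{X_i^* K̂} ⊗ i^L_i`. -/
def dbarDag : Forms q ℓ →ₗ[ℂ] Forms q ℓ :=
  ∑ i : Fin ℓ, TensorProduct.map (Lop q ℓ (starU q ℓ (Xel q ℓ i) * gen q ℓ .Khat)) (iL q ℓ i)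

/-- The component in `A(SU_q(ℓ+1))` of index `s`. -/
def coord (s : Finset (Fin ℓ)) : Forms q ℓ →ₗ[ℂ] ASU q ℓ :=
  (TensorProduct.rid ℂ (ASU q ℓ)).toLinearMap ∘ₗ (LinearMap.proj s).lTensor (ASU q ℓ)

/-- The Haar state of `A(SU_q(ℓ+1))`: the normalized functional that is invariant on both sides.
There is at most one. -/
structure IsHaar (φ : ASU q ℓ →ₗ[ℂ] ℂ) : Prop where
  map_one : φ 1 = 1
  right_inv (a : ASU q ℓ) :
    TensorProduct.rid ℂ (ASU q ℓ) (φ.lTensor (ASU q ℓ) (comulA q ℓ a)) = φ a • 1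
  left_inv (a : ASU q ℓ) :
    TensorProduct.lid ℂ (ASU q ℓ) (φ.rTensor (ASU q ℓ) (comulA q ℓ a)) = φ a • 1

/-- The inner product `⟨ω, ω'⟩ = φ(ω† ω') = ∑_s φ(ω_s^* ω'_s)`. -/
def formInner (φ : ASU q ℓ →ₗ[ℂ] ℂ) (ω ω' : Forms q ℓ) : ℂ :=
  ∑ s : Finset (Fin ℓ), φ (starA q ℓ (coord q ℓ s ω) * coord q ℓ s ω')

/-- The map `g ⊗ h ↦ (g ▷ ω) ∧_q (h ▷ ω')`, to be evaluated at the coproduct of an element. -/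
def lactWedge (ω ω' : Forms q ℓ) : Uq q ℓ ℓ ⊗[ℂ] Uq q ℓ ℓ →ₗ[ℂ] Forms q ℓ :=
  TensorProduct.lift
    ((wedgeForm q ℓ).compl₁₂ ((lactForm q ℓ).flip ω) ((lactForm q ℓ).flip ω'))

end forms

end QProj

end

open QProj

open scoped TensorProduct

set_option linter.unusedSectionVars false
set_option linter.unusedSimpArgs false

noncomputable section

namespace QProj

/-! ### Structure of the coordinate algebra and of the pairing -/

section coordinateAlgebra
variable {q : QParam} {ℓ : ℕ}

/-! Write t = q^{1/2} and y_i = K̂ X_i. All operators in the theorem are images, under `opOf`, of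
elements ("symbols") of the algebra U ⊗ End(Gr), where U acts on A by 𝓛. The symbol of ∂̄ is D = ∑_i
y_i ⊗ e_i, with e_i the left exterior multiplication; the invariance that defines Ω^k_N is expressed
by θ(h) = h_(1) ⊗ σ^N(h_(2)). Parts 1 and 2 of the theorem thereby become identities between
symbols.

The elements y_i satisfy y_ℓ = K_ℓ F_ℓ and y_i = K_i (y_{i+1} F_i - t^{-1} F_i y_{i+1})
(`Yel_isLowering`). From this recursion, the Serre relations and [E_i, F_i] one gets two facts.
First, y_i y_j = q^{-1} y_j y_i for i < j (`IsLowering.mul_mul`); since e_j e_i = -q^{-1} e_i e_j,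
this gives D² = 0 (`dbarSymb_mul_self`). Second, under U_q(su(ℓ)) the y_i transform like a vector
representation (`IsLowering.K_mul`, `IsLowering.mul_E`, `IsLowering.mul_F`) that is dual to the one
spanned by the e_i (`sg_E_eL`, `sg_F_eL`), so that D commutes with every θ(h)
(`commute_theta_dbarSymb_gen`) and ∂̄ preserves invariance.

The symbol of ∂̄† is D^*. As θ is compatible with the involutions, the statements on D pass to D^*
by taking adjoints. That D^* induces the Hermitian conjugate follows from (𝓛_h a)^* = a^* ◁ h^*
(`starA_Lop`) and φ((x ◁ h) y) = φ(x 𝓛_h y) (`IsHaar.ract_mul_left`), which together make 𝓛 a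
*-representation for the Haar inner product.

The Leibniz rule is the deepest point. The coproduct is Δ(y_i) = 1 ⊗ y_i + ∑_j y_j ⊗ t_{ij} with an
upper triangular matrix (t_{ij}) (`IsRow`, `exists_isRow`). Hence ∂̄(ω ∧ ω') is (∂̄ω) ∧ ω' plus ∑_j
(T_j ω) ∧ (𝓛_{y_j} ⊗ 1) ω', where T_j has the symbol ∑_i t_{ij} ⊗ e_i (`dbar_wedgeForm`), and it
remains to see that T_j ω = (-1)^k ω ∧ e_j for ω in Ω^k_0 (`opOf_twistSymb`). For j = 1 only t_{11}
= (K_1 ⋯ K_ℓ)² survives. It acts on the component ω_s, 1 ∉ s, by q^{-k} (`Lop_Nel_sq`), which is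
what is needed to move e_1 from the left to the right of e_s. The passage from j to j+1 is made by
acting with F_j on both sides (`theta_F_mul_twistSymb`, `formAct_F_rightWedge`).

Invariance under K_q(u(ℓ)) determines only the ℓ-th power of (K_1 ⋯ K_ℓ)² on ω_s, because K̂ is a
root. The root is extracted by means of the diagonalizability of this operator on A with positive
eigenvalues (`apply_eq_of_pow_apply_eq`, `span_eigenvectors_Nel`).

The product of invariant forms is invariant because Gr is a module algebra (`sg_E_wedge`,
`sg_F_wedge`) and 𝓛 obeys the opposite product rule (`Lop_mul`). Covariance holds because ▷ and ◁
commute (`ract_lact`). -/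

lemma ASU.induction {P : ASU q ℓ → Prop} (halg : ∀ c : ℂ, P (algebraMap ℂ _ c))
    (hu : ∀ i j, P (uA q ℓ i j)) (hmul : ∀ a b, P a → P b → P (a * b))
    (hadd : ∀ a b, P a → P b → P (a + b)) (a : ASU q ℓ) : P a := by
  obtain ⟨a, rfl⟩ : ∃ x, ASU.mk q ℓ x = a := RingQuot.mkAlgHom_surjective ℂ (ARel q ℓ) a
  induction a using FreeAlgebra.induction with
  | grade0 r => rw [AlgHom.commutes]; exact halg r
  | grade1 x => exact hu x.1 x.2
  | mul a b ha hb => rw [map_mul]; exact hmul _ _ ha hb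
  | add a b ha hb => rw [map_add]; exact hadd _ _ ha hb

lemma ASU.algHom_ext {B : Type*} [Ring B] [Algebra ℂ B] {f g : ASU q ℓ →ₐ[ℂ] B}
    (h : ∀ i j, f (uA q ℓ i j) = g (uA q ℓ i j)) : f = g := by
  ext a
  induction a using ASU.induction with
  | halg c => simp
  | hu i j => exact h i j
  | hmul a b ha hb => rw [map_mul, map_mul, ha, hb]
  | hadd a b ha hb => rw [map_add, map_add, ha, hb]

lemma Uq.induction {m : ℕ} {P : Uq q ℓ m → Prop} (halg : ∀ c : ℂ, P (algebraMap ℂ _ c))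
    (hgen : ∀ x, P (gen q ℓ x)) (hmul : ∀ a b, P a → P b → P (a * b))
    (hadd : ∀ a b, P a → P b → P (a + b)) (a : Uq q ℓ m) : P a :=
  Uq.mem_of_gen
    { carrier := {x | P x}
      mul_mem' := hmul _ _
      add_mem' := hadd _ _
      algebraMap_mem' := halg } hgen a

lemma comulU_gen {m : ℕ} (x : Gen m) : comulU q ℓ m (gen q ℓ x) = comulGen q ℓ m x :=
  Uq.lift_gen _ _ _

lemma counitU_gen {m : ℕ} (x : Gen m) : counitU q ℓ m (gen q ℓ x) = counitGen m x :=
  Uq.lift_gen _ _ _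

lemma comulA_u (i j : Fin (ℓ + 1)) :
    comulA q ℓ (uA q ℓ i j) = ∑ k, uA q ℓ i k ⊗ₜ[ℂ] uA q ℓ k j := ASU.lift_u _ _ _ _ _

/-- Both sides are algebra homomorphisms, so matrix multiplication of the generators suffices. -/
lemma comulA_coassoc (a : ASU q ℓ) :
    TensorProduct.assoc ℂ _ _ _ ((comulA q ℓ).toLinearMap.rTensor (ASU q ℓ) (comulA q ℓ a))
      = (comulA q ℓ).toLinearMap.lTensor (ASU q ℓ) (comulA q ℓ a) := by
  have : ((Algebra.TensorProduct.assoc ℂ ℂ ℂ (ASU q ℓ) (ASU q ℓ) (ASU q ℓ)).toAlgHom.comp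
      (Algebra.TensorProduct.map (comulA q ℓ) (AlgHom.id ℂ (ASU q ℓ)))).comp (comulA q ℓ)
      = (Algebra.TensorProduct.map (AlgHom.id ℂ (ASU q ℓ)) (comulA q ℓ)).comp (comulA q ℓ) := by
    apply ASU.algHom_ext
    intro i j
    simp only [AlgHom.comp_apply, comulA_u, map_sum, Algebra.TensorProduct.map_tmul, AlgHom.id_apply]
    simp only [comulA_u, TensorProduct.sum_tmul, TensorProduct.tmul_sum, map_sum]
    rw [Finset.sum_comm]
    rfl
  exact DFunLike.congr_fun this a

lemma pair_apply (h : Uq q ℓ ℓ) (a : ASU q ℓ) : pair q ℓ h a = (pairing q ℓ a).ofConv h := rfl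

lemma pair_u (h : Uq q ℓ ℓ) (i j : Fin (ℓ + 1)) : pair q ℓ h (uA q ℓ i j) = piRep q ℓ h i j := by
  rw [pair_apply, pairing, ASU.lift_u]; rfl

lemma pair_one (h : Uq q ℓ ℓ) : pair q ℓ h 1 = counitU q ℓ ℓ h := by
  rw [pair_apply, map_one, LinearMap.convOne_apply]; rfl

lemma pair_mul (h : Uq q ℓ ℓ) (a b : ASU q ℓ) : pair q ℓ h (a * b) =
    TensorProduct.lift ((LinearMap.mul ℂ ℂ).compl₁₂ ((pair q ℓ).flip a) ((pair q ℓ).flip b))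
      (comulU q ℓ ℓ h) := by
  rw [pair_apply, map_mul, LinearMap.convMul_apply]
  change _ = TensorProduct.lift _ (Coalgebra.comul (R := ℂ) h)
  generalize Coalgebra.comul (R := ℂ) h = T
  induction T using TensorProduct.induction_on with
  | zero => simp
  | tmul x y => simp; rfl
  | add x y hx hy => rw [map_add, map_add, map_add, hx, hy]

/-- The map `a ⊗ b ↦ (h ↦ ⟨h, a⟩ b)`. -/
def sliceL (q : QParam) (ℓ : ℕ) : ASU q ℓ ⊗[ℂ] ASU q ℓ →ₗ[ℂ] Uq q ℓ ℓ →ₗ[ℂ] ASU q ℓ :=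
  TensorProduct.lift (LinearMap.mk₂ ℂ (fun a b => ((pair q ℓ).flip a).smulRight b)
    (by intros; ext; simp [add_smul]) (by intros; ext; simp [mul_smul])
    (by intros; ext; simp) (fun c a b => by ext h; exact smul_comm _ _ _))

/-- The map `a ⊗ b ↦ (h ↦ ⟨h, b⟩ a)`. -/
def sliceR (q : QParam) (ℓ : ℕ) : ASU q ℓ ⊗[ℂ] ASU q ℓ →ₗ[ℂ] Uq q ℓ ℓ →ₗ[ℂ] ASU q ℓ :=
  TensorProduct.lift (LinearMap.mk₂ ℂ (fun a b => ((pair q ℓ).flip b).smulRight a)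
    (by intros; ext; simp) (fun c a b => by ext h; exact smul_comm _ _ _)
    (by intros; ext; simp [add_smul]) (by intros; ext; simp [mul_smul]))

lemma sliceL_tmul (a b : ASU q ℓ) (h : Uq q ℓ ℓ) :
    sliceL q ℓ (a ⊗ₜ b) h = pair q ℓ h a • b := rfl

lemma sliceR_tmul (a b : ASU q ℓ) (h : Uq q ℓ ℓ) :
    sliceR q ℓ (a ⊗ₜ b) h = pair q ℓ h b • a := rfl

lemma ract_eq (h : Uq q ℓ ℓ) (a : ASU q ℓ) : ract q ℓ h a = sliceL q ℓ (comulA q ℓ a) h := by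
  change TensorProduct.lid ℂ (ASU q ℓ) ((pair q ℓ h).rTensor (ASU q ℓ) (comulA q ℓ a)) = _
  generalize comulA q ℓ a = T
  induction T using TensorProduct.induction_on with
  | zero => simp
  | tmul x y => simp [sliceL_tmul]
  | add x y hx hy => rw [map_add, map_add, hx, hy, map_add, LinearMap.add_apply]

lemma lact_eq (h : Uq q ℓ ℓ) (a : ASU q ℓ) : lact q ℓ h a = sliceR q ℓ (comulA q ℓ a) h := by
  change TensorProduct.rid ℂ (ASU q ℓ) ((pair q ℓ h).lTensor (ASU q ℓ) (comulA q ℓ a)) = _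
  generalize comulA q ℓ a = T
  induction T using TensorProduct.induction_on with
  | zero => simp
  | tmul x y => simp [sliceR_tmul]
  | add x y hx hy => rw [map_add, map_add, hx, hy, map_add, LinearMap.add_apply]

/-- The map `g ⊗ h ↦ f(g, a) f(h, b)`, to be evaluated at a coproduct. -/
def mulAct {B U : Type*} [Ring B] [Algebra ℂ B] [AddCommGroup U] [Module ℂ U]
    (f : U →ₗ[ℂ] B →ₗ[ℂ] B) (a b : B) : U ⊗[ℂ] U →ₗ[ℂ] B :=
  TensorProduct.lift ((LinearMap.mul ℂ B).compl₁₂ (f.flip a) (f.flip b))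

lemma mulAct_tmul {B U : Type*} [Ring B] [Algebra ℂ B] [AddCommGroup U] [Module ℂ U]
    (f : U →ₗ[ℂ] B →ₗ[ℂ] B) (a b : B) (g h : U) : mulAct f a b (g ⊗ₜ h) = f g a * f h b := rfl

section lift
variable {B U : Type*} [Ring B] [Algebra ℂ B] [AddCommGroup U] [Module ℂ U] (f f' g g' : U →ₗ[ℂ] B)

lemma lift_add_left : TensorProduct.lift ((LinearMap.mul ℂ B).compl₁₂ (f + f') g) =
    TensorProduct.lift ((LinearMap.mul ℂ B).compl₁₂ f g)
      + TensorProduct.lift ((LinearMap.mul ℂ B).compl₁₂ f' g) := by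
  ext; simp [add_mul]

lemma lift_add_right : TensorProduct.lift ((LinearMap.mul ℂ B).compl₁₂ f (g + g')) =
    TensorProduct.lift ((LinearMap.mul ℂ B).compl₁₂ f g)
      + TensorProduct.lift ((LinearMap.mul ℂ B).compl₁₂ f g') := by
  ext; simp [mul_add]

lemma lift_zero_left : TensorProduct.lift ((LinearMap.mul ℂ B).compl₁₂ (0 : U →ₗ[ℂ] B) g) = 0 := by
  ext; simp

lemma lift_zero_right : TensorProduct.lift ((LinearMap.mul ℂ B).compl₁₂ f (0 : U →ₗ[ℂ] B)) = 0 := by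
  ext; simp

end lift

/-- Multiplicativity of the pairing in its second variable, with the other tensor leg carried along.
For T = Δ(a) and T' = Δ(b) it becomes the product rule for ◁. -/
lemma sliceL_mul (T T' : ASU q ℓ ⊗[ℂ] ASU q ℓ) (h : Uq q ℓ ℓ) : sliceL q ℓ (T * T') h =
    TensorProduct.lift ((LinearMap.mul ℂ (ASU q ℓ)).compl₁₂ (sliceL q ℓ T) (sliceL q ℓ T'))
      (comulU q ℓ ℓ h) := by
  induction T using TensorProduct.induction_on with
  | zero => rw [zero_mul, map_zero, lift_zero_left]; rfl
  | add x y hx hy =>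
    rw [add_mul, map_add, LinearMap.add_apply, hx, hy, map_add, lift_add_left]; rfl
  | tmul a b =>
    induction T' using TensorProduct.induction_on with
    | zero => rw [mul_zero, map_zero, lift_zero_right]; rfl
    | add x y hx hy =>
      rw [mul_add, map_add, LinearMap.add_apply, hx, hy, map_add, lift_add_right]; rfl
    | tmul a' b' =>
      rw [Algebra.TensorProduct.tmul_mul_tmul, sliceL_tmul, pair_mul]
      generalize comulU q ℓ ℓ h = W
      induction W using TensorProduct.induction_on with
      | zero => simp
      | add x y hx hy => rw [map_add, add_smul, hx, hy, map_add]
      | tmul x y => simp [sliceL_tmul, smul_smul, mul_comm]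

lemma sliceR_mul (T T' : ASU q ℓ ⊗[ℂ] ASU q ℓ) (h : Uq q ℓ ℓ) : sliceR q ℓ (T * T') h =
    TensorProduct.lift ((LinearMap.mul ℂ (ASU q ℓ)).compl₁₂ (sliceR q ℓ T) (sliceR q ℓ T'))
      (comulU q ℓ ℓ h) := by
  induction T using TensorProduct.induction_on with
  | zero => rw [zero_mul, map_zero, lift_zero_left]; rfl
  | add x y hx hy =>
    rw [add_mul, map_add, LinearMap.add_apply, hx, hy, map_add, lift_add_left]; rfl
  | tmul a b =>
    induction T' using TensorProduct.induction_on with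
    | zero => rw [mul_zero, map_zero, lift_zero_right]; rfl
    | add x y hx hy =>
      rw [mul_add, map_add, LinearMap.add_apply, hx, hy, map_add, lift_add_right]; rfl
    | tmul a' b' =>
      rw [Algebra.TensorProduct.tmul_mul_tmul, sliceR_tmul, pair_mul]
      generalize comulU q ℓ ℓ h = W
      induction W using TensorProduct.induction_on with
      | zero => simp
      | add x y hx hy => rw [map_add, add_smul, hx, hy, map_add]
      | tmul x y => simp [sliceR_tmul, smul_smul, mul_comm]

/-- `(a b) ◁ h = (a ◁ h_(1)) (b ◁ h_(2))`. -/
lemma ract_mul (h : Uq q ℓ ℓ) (a b : ASU q ℓ) :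
    ract q ℓ h (a * b) = mulAct (ract q ℓ) a b (comulU q ℓ ℓ h) := by
  rw [ract_eq, map_mul, sliceL_mul, mulAct]
  congr 2
  ext; simp [ract_eq]

/-- `h ▷ (a b) = (h_(1) ▷ a) (h_(2) ▷ b)`. -/
lemma lact_mul (h : Uq q ℓ ℓ) (a b : ASU q ℓ) :
    lact q ℓ h (a * b) = mulAct (lact q ℓ) a b (comulU q ℓ ℓ h) := by
  rw [lact_eq, map_mul, sliceR_mul, mulAct]
  congr 2
  ext; simp [lact_eq]

lemma ract_algebraMap (h : Uq q ℓ ℓ) (c : ℂ) :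
    ract q ℓ h (algebraMap ℂ _ c) = counitU q ℓ ℓ h • algebraMap ℂ _ c := by
  rw [Algebra.algebraMap_eq_smul_one, map_smul, ract_eq, map_one,
    Algebra.TensorProduct.one_def, sliceL_tmul, pair_one, smul_comm]

lemma ract_u (h : Uq q ℓ ℓ) (i j : Fin (ℓ + 1)) :
    ract q ℓ h (uA q ℓ i j) = ∑ k, piRep q ℓ h i k • uA q ℓ k j := by
  simp [ract_eq, comulA_u, sliceL_tmul, pair_u]

lemma lact_one_right (h : Uq q ℓ ℓ) : lact q ℓ h 1 = counitU q ℓ ℓ h • 1 := by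
  rw [lact_eq, map_one, Algebra.TensorProduct.one_def, sliceR_tmul, pair_one]

lemma lact_u (h : Uq q ℓ ℓ) (i j : Fin (ℓ + 1)) :
    lact q ℓ h (uA q ℓ i j) = ∑ k, piRep q ℓ h k j • uA q ℓ i k := by
  simp [lact_eq, comulA_u, sliceR_tmul, pair_u]

lemma ract_one_left (a : ASU q ℓ) : ract q ℓ 1 a = a := by
  induction a using ASU.induction with
  | halg c => rw [ract_algebraMap, map_one, one_smul]
  | hu i j => simp [ract_u, Matrix.one_apply]
  | hmul a b ha hb =>
    rw [ract_mul, map_one, Algebra.TensorProduct.one_def, mulAct_tmul, ha, hb]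
  | hadd a b ha hb => rw [map_add, ha, hb]

lemma lact_one_left (a : ASU q ℓ) : lact q ℓ 1 a = a := by
  induction a using ASU.induction with
  | halg c =>
    rw [Algebra.algebraMap_eq_smul_one, map_smul, lact_one_right, map_one, one_smul]
  | hu i j => simp [lact_u, Matrix.one_apply]
  | hmul a b ha hb =>
    rw [lact_mul, map_one, Algebra.TensorProduct.one_def, mulAct_tmul, ha, hb]
  | hadd a b ha hb => rw [map_add, ha, hb]

/-- The dichotomy between group-like and skew primitive generators. -/
lemma comulU_gen_cases (x : Gen ℓ) :
    (comulU q ℓ ℓ (gen q ℓ x) = gen q ℓ x ⊗ₜ gen q ℓ x) ∨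
    ∃ y z : Gen ℓ, comulU q ℓ ℓ (gen q ℓ x) = gen q ℓ x ⊗ₜ gen q ℓ y + gen q ℓ z ⊗ₜ gen q ℓ x := by
  rcases x with i | i | i | i | _ | _
  · exact Or.inr ⟨.K i, .Kinv i, comulU_gen _⟩
  · exact Or.inr ⟨.K i, .Kinv i, comulU_gen _⟩
  all_goals exact Or.inl (comulU_gen _)

/-- The pairing is defined through its multiplicativity in a; its behaviour under products in U has
to be proved. Left translation of functionals and ◁ obey the same product rule, dictated by Δ(x),
and agree on the u^i_j. The statement is kept general in x because the product rule of E_i and F_i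
also involves K_i and its inverse. -/
lemma lam_pairing_gen (x : Gen ℓ) (a : ASU q ℓ) :
    lam q ℓ (gen q ℓ x) (pairing q ℓ a) = pairing q ℓ (ract q ℓ (gen q ℓ x) a) := by
  induction a using ASU.induction generalizing x with
  | halg c =>
    rw [ract_algebraMap, map_smul, Algebra.algebraMap_eq_smul_one, map_smul, map_one, lam_smul,
      lam_one, smul_comm]
  | hu i j =>
    rw [ract_u, map_sum, pairing, ASU.lift_u, lam_piCoef]
    simp
  | hmul a b ha hb =>
    rw [ract_mul, map_mul]
    rcases comulU_gen_cases (q := q) x with h | ⟨y, z, h⟩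
    · rw [lam_mul_group q ℓ _ h, h, mulAct_tmul, map_mul, ha, hb]
    · rw [lam_mul_skew q ℓ _ _ _ h, h, map_add, mulAct_tmul, mulAct_tmul, map_add, map_mul, map_mul,
        ha, hb, ha, hb]
  | hadd a b ha hb =>
    rw [map_add, map_add, map_add, ← ha, ← hb]; rfl

/-- Both ways of applying two functionals and keeping one factor of an iterated coproduct. -/
lemma pair_ract_mul_aux (g h : Uq q ℓ ℓ) (a : ASU q ℓ)
    (H : ∀ a, pair q ℓ (g * h) a = pair q ℓ h (ract q ℓ g a)) :
    ract q ℓ (g * h) a = ract q ℓ h (ract q ℓ g a) := by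
  -- Φ(a ⊗ b ⊗ c) = ⟨g, a⟩ ⟨h, b⟩ c. The two sides are Φ at the two bracketings of the iterated
  -- coproduct.
  let Φ : ASU q ℓ ⊗[ℂ] (ASU q ℓ ⊗[ℂ] ASU q ℓ) →ₗ[ℂ] ASU q ℓ :=
    (TensorProduct.lid ℂ _).toLinearMap ∘ₗ TensorProduct.map (pair q ℓ g)
      ((TensorProduct.lid ℂ _).toLinearMap ∘ₗ (pair q ℓ h).rTensor _)
  have h1 : ∀ T : ASU q ℓ ⊗[ℂ] ASU q ℓ, sliceL q ℓ T (g * h) =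
      Φ (TensorProduct.assoc ℂ _ _ _ ((comulA q ℓ).toLinearMap.rTensor (ASU q ℓ) T)) := by
    intro T
    induction T using TensorProduct.induction_on with
    | zero => simp
    | add x y hx hy => simp only [map_add, LinearMap.add_apply, hx, hy]
    | tmul x y =>
      rw [sliceL_tmul, H, ract_eq, LinearMap.rTensor_tmul]
      change _ = Φ (TensorProduct.assoc ℂ _ _ _ (comulA q ℓ x ⊗ₜ y))
      generalize comulA q ℓ x = W
      induction W using TensorProduct.induction_on with
      | zero => simp
      | add x y hx hy =>
        simp only [map_add, LinearMap.add_apply, add_smul, hx, hy, TensorProduct.add_tmul]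
      | tmul x y => simp [Φ, sliceL_tmul, smul_smul, mul_comm]
  have h2 : ∀ T : ASU q ℓ ⊗[ℂ] ASU q ℓ, ract q ℓ h (sliceL q ℓ T g) =
      Φ ((comulA q ℓ).toLinearMap.lTensor (ASU q ℓ) T) := by
    intro T
    induction T using TensorProduct.induction_on with
    | zero => simp
    | add x y hx hy => simp only [map_add, LinearMap.add_apply, hx, hy]
    | tmul x y =>
      rw [sliceL_tmul, map_smul]
      simp [Φ]; rfl
  rw [ract_eq, ract_eq g, h1, h2, comulA_coassoc]

/-- The pairing turns the product of `U` into the coproduct of `A`. -/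
lemma pair_mul_left (g h : Uq q ℓ ℓ) (a : ASU q ℓ) :
    pair q ℓ (g * h) a = pair q ℓ h (ract q ℓ g a) := by
  induction g using Uq.induction generalizing h a with
  | halg c =>
    rw [← Algebra.smul_def, map_smul, Algebra.algebraMap_eq_smul_one, map_smul]
    simp [ract_one_left]
  | hgen x =>
    have := congrArg (fun f : Udual q ℓ => f.ofConv h) (lam_pairing_gen x a)
    exact this
  -- The induction hypothesis for x concerns the pairing only; `pair_ract_mul_aux` turns it into a ◁
  -- (x y) = (a ◁ x) ◁ y.
  | hmul x y hx hy => rw [mul_assoc, hx, hy, pair_ract_mul_aux x y a (hx y)]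
  | hadd x y hx hy => simp only [add_mul, map_add, LinearMap.add_apply, hx, hy]

/-- `◁` is a right action. -/
lemma ract_mul_left (g h : Uq q ℓ ℓ) (a : ASU q ℓ) :
    ract q ℓ (g * h) a = ract q ℓ h (ract q ℓ g a) :=
  pair_ract_mul_aux g h a (pair_mul_left g h)

/-- Left and right translations commute by coassociativity. The left covariance of everything built
from 𝓛 rests on this. -/
lemma ract_lact (g h : Uq q ℓ ℓ) (a : ASU q ℓ) :
    ract q ℓ g (lact q ℓ h a) = lact q ℓ h (ract q ℓ g a) := by
  let Φ : ASU q ℓ ⊗[ℂ] (ASU q ℓ ⊗[ℂ] ASU q ℓ) →ₗ[ℂ] ASU q ℓ :=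
    (TensorProduct.lid ℂ _).toLinearMap ∘ₗ TensorProduct.map (pair q ℓ g)
      ((TensorProduct.rid ℂ _).toLinearMap ∘ₗ (pair q ℓ h).lTensor _)
  have h1 : ∀ T : ASU q ℓ ⊗[ℂ] ASU q ℓ, ract q ℓ g (sliceR q ℓ T h) =
      Φ (TensorProduct.assoc ℂ _ _ _ ((comulA q ℓ).toLinearMap.rTensor (ASU q ℓ) T)) := by
    intro T
    induction T using TensorProduct.induction_on with
    | zero => simp
    | add x y hx hy => simp only [map_add, LinearMap.add_apply, hx, hy]
    | tmul x y =>
      rw [sliceR_tmul, map_smul, ract_eq, LinearMap.rTensor_tmul]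
      change _ = Φ (TensorProduct.assoc ℂ _ _ _ (comulA q ℓ x ⊗ₜ y))
      generalize comulA q ℓ x = W
      induction W using TensorProduct.induction_on with
      | zero => simp
      | add x y hx hy =>
        simp only [map_add, LinearMap.add_apply, smul_add, hx, hy, TensorProduct.add_tmul]
      | tmul x y => simp [Φ, sliceL_tmul, smul_smul, mul_comm]
  have h2 : ∀ T : ASU q ℓ ⊗[ℂ] ASU q ℓ, lact q ℓ h (sliceL q ℓ T g) =
      Φ ((comulA q ℓ).toLinearMap.lTensor (ASU q ℓ) T) := by
    intro T
    induction T using TensorProduct.induction_on with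
    | zero => simp
    | add x y hx hy => simp only [map_add, LinearMap.add_apply, hx, hy]
    | tmul x y =>
      rw [sliceL_tmul, map_smul]
      simp [Φ]; rfl
  rw [lact_eq, ract_eq g a, h1, h2, comulA_coassoc]

/-- `▷` is a left action. -/
lemma lact_mul_left (g h : Uq q ℓ ℓ) (a : ASU q ℓ) :
    lact q ℓ (g * h) a = lact q ℓ g (lact q ℓ h a) := by
  let Φ : ASU q ℓ ⊗[ℂ] (ASU q ℓ ⊗[ℂ] ASU q ℓ) →ₗ[ℂ] ASU q ℓ :=
    (TensorProduct.rid ℂ _).toLinearMap ∘ₗ TensorProduct.map LinearMap.id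
      (LinearMap.mul' ℂ ℂ ∘ₗ TensorProduct.map (pair q ℓ g) (pair q ℓ h))
  have h1 : ∀ T : ASU q ℓ ⊗[ℂ] ASU q ℓ, lact q ℓ g (sliceR q ℓ T h) =
      Φ (TensorProduct.assoc ℂ _ _ _ ((comulA q ℓ).toLinearMap.rTensor (ASU q ℓ) T)) := by
    intro T
    induction T using TensorProduct.induction_on with
    | zero => simp
    | add x y hx hy => simp only [map_add, LinearMap.add_apply, hx, hy]
    | tmul x y =>
      rw [sliceR_tmul, map_smul, lact_eq, LinearMap.rTensor_tmul]
      change _ = Φ (TensorProduct.assoc ℂ _ _ _ (comulA q ℓ x ⊗ₜ y))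
      generalize comulA q ℓ x = W
      induction W using TensorProduct.induction_on with
      | zero => simp
      | add x y hx hy =>
        simp only [map_add, LinearMap.add_apply, smul_add, hx, hy, TensorProduct.add_tmul]
      | tmul x y => simp [Φ, sliceR_tmul, smul_smul, mul_comm]
  -- In contrast to `h1`, this needs ⟨g h, y⟩ = ⟨g, y_(1)⟩ ⟨h, y_(2)⟩, which is `pair_mul_left`.
  have h2 : ∀ T : ASU q ℓ ⊗[ℂ] ASU q ℓ, sliceR q ℓ T (g * h) =
      Φ ((comulA q ℓ).toLinearMap.lTensor (ASU q ℓ) T) := by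
    intro T
    induction T using TensorProduct.induction_on with
    | zero => simp
    | add x y hx hy => simp only [map_add, LinearMap.add_apply, hx, hy]
    | tmul x y =>
      rw [sliceR_tmul, pair_mul_left, LinearMap.lTensor_tmul, ract_eq]
      change _ = Φ (x ⊗ₜ comulA q ℓ y)
      generalize comulA q ℓ y = W
      induction W using TensorProduct.induction_on with
      | zero => simp
      | add x y hx hy =>
        simp only [map_add, LinearMap.add_apply, add_smul, hx, hy, TensorProduct.tmul_add]
      | tmul x y => simp [Φ, sliceL_tmul]
  rw [lact_eq, lact_eq h, h1, h2, comulA_coassoc]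

end coordinateAlgebra

/-! ### The operators `𝓛_h`, the involutions and the Haar state -/

section leftOperators
variable {q : QParam} {ℓ : ℕ}

lemma antipodeInv_mul (g h : Uq q ℓ ℓ) :
    antipodeInv q ℓ (g * h) = antipodeInv q ℓ h * antipodeInv q ℓ g := by
  change (antipodeU q ℓ ℓ).symm (MulOpposite.op (g * h)) = _
  rw [MulOpposite.op_mul, map_mul]; rfl

lemma antipodeInv_one : antipodeInv q ℓ 1 = 1 := by
  change (antipodeU q ℓ ℓ).symm (MulOpposite.op 1) = _
  rw [MulOpposite.op_one, map_one]

lemma antipodeInv_eq {g h : Uq q ℓ ℓ} (H : antipodeU q ℓ ℓ g = MulOpposite.op h) :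
    antipodeInv q ℓ h = g := by
  change (antipodeU q ℓ ℓ).symm (MulOpposite.op h) = _
  rw [← H, AlgEquiv.symm_apply_apply]

lemma antipodeU_gen (x : Gen ℓ) : antipodeU q ℓ ℓ (gen q ℓ x) = antiGen q ℓ ℓ (qpow q 1) x :=
  Uq.lift_gen _ _ _

lemma antipodeInv_K (i : Fin ℓ) : antipodeInv q ℓ (gen q ℓ (.K i)) = gen q ℓ (.Kinv i) :=
  antipodeInv_eq (antipodeU_gen _)

lemma antipodeInv_Kinv (i : Fin ℓ) : antipodeInv q ℓ (gen q ℓ (.Kinv i)) = gen q ℓ (.K i) :=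
  antipodeInv_eq (antipodeU_gen _)

lemma antipodeInv_Khat : antipodeInv q ℓ (gen q ℓ .Khat) = gen q ℓ .KhatInv :=
  antipodeInv_eq (antipodeU_gen _)

lemma antipodeInv_KhatInv : antipodeInv q ℓ (gen q ℓ .KhatInv) = gen q ℓ .Khat :=
  antipodeInv_eq (antipodeU_gen _)

lemma antipodeInv_E (i : Fin ℓ) :
    antipodeInv q ℓ (gen q ℓ (.E i)) = -(qpow q (-1) • gen q ℓ (.E i)) := by
  apply antipodeInv_eq
  rw [map_neg, map_smul, antipodeU_gen, antiGen, ← MulOpposite.op_smul, ← MulOpposite.op_neg,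
    smul_neg, smul_smul, ← qpow_add]
  simp

lemma antipodeInv_F (i : Fin ℓ) :
    antipodeInv q ℓ (gen q ℓ (.F i)) = -(qpow q 1 • gen q ℓ (.F i)) := by
  apply antipodeInv_eq
  rw [map_neg, map_smul, antipodeU_gen, antiGen, ← MulOpposite.op_smul, ← MulOpposite.op_neg,
    smul_neg, smul_smul, mul_inv_cancel₀ (qpow_ne_zero _ _)]
  simp

lemma Lop_eq (h : Uq q ℓ ℓ) (a : ASU q ℓ) : Lop q ℓ h a = ract q ℓ (antipodeInv q ℓ h) a := rfl

lemma Lop_mul_left (g h : Uq q ℓ ℓ) (a : ASU q ℓ) :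
    Lop q ℓ (g * h) a = Lop q ℓ g (Lop q ℓ h a) := by
  rw [Lop_eq, antipodeInv_mul, ract_mul_left]; rfl

lemma Lop_one_left (a : ASU q ℓ) : Lop q ℓ 1 a = a := by
  rw [Lop_eq, antipodeInv_one, ract_one_left]

/-- The operators `𝓛` as an algebra homomorphism. -/
def LopHom (q : QParam) (ℓ : ℕ) : Uq q ℓ ℓ →ₐ[ℂ] Module.End ℂ (ASU q ℓ) :=
  AlgHom.ofLinearMap (Lop q ℓ) (by ext a; exact Lop_one_left a)
    (fun g h => by ext a; exact Lop_mul_left g h a)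

lemma LopHom_apply (h : Uq q ℓ ℓ) : LopHom q ℓ h = Lop q ℓ h := rfl

lemma Lop_lact (g h : Uq q ℓ ℓ) (a : ASU q ℓ) :
    Lop q ℓ g (lact q ℓ h a) = lact q ℓ h (Lop q ℓ g a) := ract_lact _ _ _

lemma mulAct_Lop_mul (a b : ASU q ℓ) (x y : Uq q ℓ ℓ) (V : Uq q ℓ ℓ ⊗[ℂ] Uq q ℓ ℓ) :
    mulAct (Lop q ℓ) (Lop q ℓ x a) (Lop q ℓ y b) V = mulAct (Lop q ℓ) a b (V * x ⊗ₜ y) := by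
  induction V using TensorProduct.induction_on with
  | zero => simp
  | add x y hx hy => rw [add_mul, map_add, map_add, hx, hy]
  | tmul g h =>
    rw [Algebra.TensorProduct.tmul_mul_tmul, mulAct_tmul, mulAct_tmul, Lop_mul_left, Lop_mul_left]

/-- `𝓛_h (a b) = (𝓛_{h_(2)} a) (𝓛_{h_(1)} b)`. -/
lemma Lop_mul (h : Uq q ℓ ℓ) (a b : ASU q ℓ) : Lop q ℓ h (a * b) =
    mulAct (Lop q ℓ) a b (Algebra.TensorProduct.comm ℂ _ _ (comulU q ℓ ℓ h)) := by
  induction h using Uq.induction generalizing a b with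
  | halg c =>
    rw [AlgHom.commutes, AlgEquiv.commutes, Algebra.algebraMap_eq_smul_one,
      Algebra.algebraMap_eq_smul_one, map_smul, map_smul, LinearMap.smul_apply, Lop_one_left,
      Algebra.TensorProduct.one_def, mulAct_tmul, Lop_one_left, Lop_one_left]
  | hgen x =>
    -- The inverse antipode exchanges the legs of the coproduct. On E_i this is visible directly:
    -- K_i and K_i^{-1}, which stand on different sides in Δ(E_i), are exchanged by S^{-1}, and the
    -- scalar -q^{-1} occurs once in each term.
    rw [Lop_eq, comulU_gen]
    rcases x with i | i | i | i | _ | _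
    · rw [antipodeInv_E, map_neg, map_smul, LinearMap.neg_apply, LinearMap.smul_apply, ract_mul,
        comulU_gen]
      simp only [comulGen, map_add, mulAct_tmul, Algebra.TensorProduct.comm_tmul, Lop_eq,
        antipodeInv_E, antipodeInv_K, antipodeInv_Kinv, map_neg, map_smul, LinearMap.neg_apply,
        LinearMap.smul_apply, mul_neg, neg_mul, smul_add, mul_smul_comm, smul_mul_assoc]
      abel
    · rw [antipodeInv_F, map_neg, map_smul, LinearMap.neg_apply, LinearMap.smul_apply, ract_mul,
        comulU_gen]
      simp only [comulGen, map_add, mulAct_tmul, Algebra.TensorProduct.comm_tmul, Lop_eq,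
        antipodeInv_F, antipodeInv_K, antipodeInv_Kinv, map_neg, map_smul, LinearMap.neg_apply,
        LinearMap.smul_apply, mul_neg, neg_mul, smul_add, mul_smul_comm, smul_mul_assoc]
      abel
    · rw [antipodeInv_K, ract_mul, comulU_gen]
      simp only [comulGen, mulAct_tmul, Algebra.TensorProduct.comm_tmul, Lop_eq, antipodeInv_K]
    · rw [antipodeInv_Kinv, ract_mul, comulU_gen]
      simp only [comulGen, mulAct_tmul, Algebra.TensorProduct.comm_tmul, Lop_eq, antipodeInv_Kinv]
    · rw [antipodeInv_Khat, ract_mul, comulU_gen]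
      simp only [comulGen, mulAct_tmul, Algebra.TensorProduct.comm_tmul, Lop_eq, antipodeInv_Khat]
    · rw [antipodeInv_KhatInv, ract_mul, comulU_gen]
      simp only [comulGen, mulAct_tmul, Algebra.TensorProduct.comm_tmul, Lop_eq,
        antipodeInv_KhatInv]
  | hmul g h hg hh =>
    rw [Lop_mul_left, hh, map_mul, map_mul]
    generalize (Algebra.TensorProduct.comm ℂ _ _ (comulU q ℓ ℓ h)) = W
    induction W using TensorProduct.induction_on with
    | zero => simp
    | add x y hx hy => rw [mul_add, map_add, map_add, map_add, hx, hy]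
    | tmul x y => rw [mulAct_tmul, hg, mulAct_Lop_mul]
  | hadd g h hg hh => simp only [map_add, LinearMap.add_apply, hg, hh]

lemma Lop_one_right (h : Uq q ℓ ℓ) : Lop q ℓ h 1 = counitU q ℓ ℓ h • 1 := by
  induction h using Uq.induction with
  | halg c =>
    rw [Algebra.algebraMap_eq_smul_one, map_smul, LinearMap.smul_apply, Lop_one_left, map_smul,
      map_one, smul_eq_mul, mul_one]
  | hgen x =>
    rw [Lop_eq, ← map_one (algebraMap ℂ (ASU q ℓ)), ract_algebraMap]
    congr 1
    rcases x with i | i | i | i | _ | _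
    · simp [antipodeInv_E, counitU_gen, counitGen]
    · simp [antipodeInv_F, counitU_gen, counitGen]
    · simp [antipodeInv_K, counitU_gen, counitGen]
    · simp [antipodeInv_Kinv, counitU_gen, counitGen]
    · simp [antipodeInv_Khat, counitU_gen, counitGen]
    · simp [antipodeInv_KhatInv, counitU_gen, counitGen]
  | hmul g h hg hh => rw [Lop_mul_left, hh, map_smul, hg, map_mul, smul_smul, mul_comm]
  | hadd g h hg hh => rw [map_add, LinearMap.add_apply, hg, hh, map_add, add_smul]

/-! The involutions. -/

lemma starU_mul (g h : Uq q ℓ ℓ) : starU q ℓ (g * h) = starU q ℓ h * starU q ℓ g := by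
  rw [starU, map_mul]; rfl

lemma starU_add (g h : Uq q ℓ ℓ) : starU q ℓ (g + h) = starU q ℓ g + starU q ℓ h := by
  rw [starU, map_add]; rfl

lemma starU_algebraMap (c : ℂ) :
    starU q ℓ (algebraMap ℂ _ c) = algebraMap ℂ _ ((starRingEnd ℂ) c) := by
  rw [starU, AlgHom.commutes]; rfl

lemma starU_smul (c : ℂ) (h : Uq q ℓ ℓ) :
    starU q ℓ (c • h) = (starRingEnd ℂ) c • starU q ℓ h := by
  rw [Algebra.smul_def, starU_mul, starU_algebraMap, ← Algebra.commutes, ← Algebra.smul_def]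

lemma starU_gen (x : Gen ℓ) : starU q ℓ (gen q ℓ x) = ofCO (starGen q ℓ ℓ x) := by
  rw [starU, starHomU, Uq.lift_gen]

lemma starU_E (i : Fin ℓ) : starU q ℓ (gen q ℓ (.E i)) = gen q ℓ (.F i) := starU_gen _
lemma starU_F (i : Fin ℓ) : starU q ℓ (gen q ℓ (.F i)) = gen q ℓ (.E i) := starU_gen _
lemma starU_K (i : Fin ℓ) : starU q ℓ (gen q ℓ (.K i)) = gen q ℓ (.K i) := starU_gen _
lemma starU_Kinv (i : Fin ℓ) : starU q ℓ (gen q ℓ (.Kinv i)) = gen q ℓ (.Kinv i) := starU_gen _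
lemma starU_Khat : starU q ℓ (gen q ℓ .Khat) = gen q ℓ .Khat := starU_gen _
lemma starU_KhatInv : starU q ℓ (gen q ℓ .KhatInv) = gen q ℓ .KhatInv := starU_gen _

lemma starU_starU (h : Uq q ℓ ℓ) : starU q ℓ (starU q ℓ h) = h := by
  induction h using Uq.induction with
  | halg c => simp [starU_algebraMap]
  | hgen x =>
    rcases x with i | i | i | i | _ | _
    · rw [starU_E, starU_F]
    · rw [starU_F, starU_E]
    · rw [starU_K, starU_K]
    · rw [starU_Kinv, starU_Kinv]
    · rw [starU_Khat, starU_Khat]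
    · rw [starU_KhatInv, starU_KhatInv]
  | hmul g h hg hh => rw [starU_mul, starU_mul, hg, hh]
  | hadd g h hg hh => rw [starU_add, starU_add, hg, hh]

lemma starA_mul (a b : ASU q ℓ) : starA q ℓ (a * b) = starA q ℓ b * starA q ℓ a := by
  rw [starA, map_mul]; rfl

lemma starA_add (a b : ASU q ℓ) : starA q ℓ (a + b) = starA q ℓ a + starA q ℓ b := by
  rw [starA, map_add]; rfl

lemma starA_algebraMap (c : ℂ) :
    starA q ℓ (algebraMap ℂ _ c) = algebraMap ℂ _ ((starRingEnd ℂ) c) := by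
  rw [starA, AlgHom.commutes]; rfl

lemma starA_smul (c : ℂ) (a : ASU q ℓ) : starA q ℓ (c • a) = (starRingEnd ℂ) c • starA q ℓ a := by
  rw [Algebra.smul_def, starA_mul, starA_algebraMap, ← Algebra.commutes, ← Algebra.smul_def]

lemma starA_neg (a : ASU q ℓ) : starA q ℓ (-a) = -starA q ℓ a := by
  rw [← neg_one_smul ℂ a, starA_smul]; simp

lemma starA_zero : starA q ℓ 0 = 0 := by
  rw [starA, map_zero]; rfl

/-- The entries of the inverse of the matrix `u`. -/
def vA (q : QParam) (ℓ : ℕ) (i j : Fin (ℓ + 1)) : ASU q ℓ := qinv q (uA q ℓ) i j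

lemma starA_u (i j : Fin (ℓ + 1)) : starA q ℓ (uA q ℓ i j) = vA q ℓ j i := by
  rw [starA, starHomA, ASU.lift_u]; rfl

lemma vA_mul_uA (i j : Fin (ℓ + 1)) : ∑ k, vA q ℓ i k * uA q ℓ k j = if i = j then 1 else 0 :=
  qinv_mul uA_isQMatrix uA_qdet i j

lemma uA_mul_vA (i j : Fin (ℓ + 1)) : ∑ k, uA q ℓ i k * vA q ℓ k j = if i = j then 1 else 0 :=
  mul_qinv uA_isQMatrix uA_qdet i j

/-- A row vector is determined by its product with `u`. -/
lemma eq_of_mul_uA {f g : Fin (ℓ + 1) → ASU q ℓ}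
    (h : ∀ j, ∑ k, f k * uA q ℓ k j = ∑ k, g k * uA q ℓ k j) : f = g := by
  have key : ∀ (f : Fin (ℓ + 1) → ASU q ℓ) n,
      ∑ j, (∑ k, f k * uA q ℓ k j) * vA q ℓ j n = f n := by
    intro f n
    simp only [Finset.sum_mul, mul_assoc]
    rw [Finset.sum_comm]
    simp only [← Finset.mul_sum, uA_mul_vA]
    simp
  ext n
  rw [← key f n, ← key g n]
  simp only [h]

/-- The matrix v is the inverse of u, so the action on its entries is found by applying g to v u = 1
and cancelling u on the right. -/
lemma ract_vA_diag (g : Uq q ℓ ℓ) (κ : Fin (ℓ + 1) → ℂ) (hκ : ∀ i, κ i ≠ 0)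
    (hg : comulU q ℓ ℓ g = g ⊗ₜ g) (h1 : counitU q ℓ ℓ g = 1)
    (hp : piRep q ℓ g = Matrix.diagonal κ) (i k : Fin (ℓ + 1)) :
    ract q ℓ g (vA q ℓ i k) = (κ k)⁻¹ • vA q ℓ i k := by
  have : (fun k => κ k • ract q ℓ g (vA q ℓ i k)) = fun k => vA q ℓ i k := by
    apply eq_of_mul_uA
    intro j
    have h := congrArg (ract q ℓ g) (vA_mul_uA (q := q) i j)
    rw [map_sum] at h
    simp only [ract_mul, hg, mulAct_tmul, ract_u, hp, Matrix.diagonal_apply, ite_smul, zero_smul,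
      Finset.sum_ite_eq, Finset.mem_univ, if_true] at h
    simp only [vA_mul_uA]
    simp only [smul_mul_assoc, ← mul_smul_comm]
    rw [h]
    split_ifs
    · rw [← map_one (algebraMap ℂ (ASU q ℓ)), ract_algebraMap, h1, one_smul]
    · rw [map_zero]
  rw [eq_inv_smul_iff₀ (hκ k)]; exact congrFun this k

/-- The same argument for a skew primitive element: x applied to v u = 1 gives two terms with sum
zero, and u is cancelled. The factor κ_m comes from k' acting on v, the factor κ_n^{-1} from k
acting on u. -/
lemma ract_vA_skew (x k k' : Uq q ℓ ℓ) (κ : Fin (ℓ + 1) → ℂ) (hκ : ∀ i, κ i ≠ 0)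
    (hx : comulU q ℓ ℓ x = x ⊗ₜ k + k' ⊗ₜ x) (h0 : counitU q ℓ ℓ x = 0)
    (hk : comulU q ℓ ℓ k' = k' ⊗ₜ k') (h1 : counitU q ℓ ℓ k' = 1)
    (hp : piRep q ℓ k = Matrix.diagonal κ) (hp' : piRep q ℓ k' = Matrix.diagonal fun i => (κ i)⁻¹)
    (i n : Fin (ℓ + 1)) :
    ract q ℓ x (vA q ℓ i n)
      = -∑ m, (κ m * (κ n)⁻¹ * piRep q ℓ x m n) • vA q ℓ i m := by
  have : (fun n => κ n • ract q ℓ x (vA q ℓ i n))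
      = fun n => -∑ m, (κ m * piRep q ℓ x m n) • vA q ℓ i m := by
    apply eq_of_mul_uA
    intro j
    have h := congrArg (ract q ℓ x) (vA_mul_uA (q := q) i j)
    have hr : ract q ℓ x (if i = j then 1 else 0) = 0 := by
      split_ifs
      · rw [← map_one (algebraMap ℂ (ASU q ℓ)), ract_algebraMap, h0, zero_smul]
      · rw [map_zero]
    have hv : ∀ m, ract q ℓ k' (vA q ℓ i m) = κ m • vA q ℓ i m := by
      intro m
      rw [ract_vA_diag k' (fun i => (κ i)⁻¹) (fun i => inv_ne_zero (hκ i)) hk h1 hp', inv_inv]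
    rw [map_sum, hr] at h
    simp only [ract_mul, hx, map_add, mulAct_tmul, ract_u k, hp, Matrix.diagonal_apply, ite_smul,
      zero_smul, Finset.sum_ite_eq, Finset.mem_univ, if_true, hv, Finset.sum_add_distrib] at h
    simp only [neg_mul, Finset.sum_neg_distrib]
    rw [← sub_eq_zero, sub_neg_eq_add, ← h]
    congr 1
    · simp only [smul_mul_assoc, mul_smul_comm]
    · simp only [ract_u, Finset.sum_mul, Finset.mul_sum]
      rw [Finset.sum_comm]
      simp only [smul_mul_assoc, mul_smul_comm, smul_smul, mul_comm]
  have h2 := congrArg (fun z => (κ n)⁻¹ • z) (congrFun this n)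
  simp only [smul_smul, inv_mul_cancel₀ (hκ n), one_smul] at h2
  rw [h2, smul_neg, Finset.smul_sum]
  simp only [smul_smul, mul_assoc, mul_left_comm]

lemma piRep_K (i : Fin ℓ) : piRep q ℓ (gen q ℓ (.K i)) =
    Matrix.diagonal fun s => qpow q ((piC ℓ i s : ℝ) / 2) := by
  rw [piRep, Uq.lift_gen]; rfl

lemma piRep_Kinv (i : Fin ℓ) : piRep q ℓ (gen q ℓ (.Kinv i)) =
    Matrix.diagonal fun s => (qpow q ((piC ℓ i s : ℝ) / 2))⁻¹ := by
  rw [piRep, Uq.lift_gen]; simp only [← qpow_neg]; rfl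

lemma piRep_Khat : piRep q ℓ (gen q ℓ .Khat) = Matrix.diagonal fun s => qpow q (piHat ℓ s) := by
  rw [piRep, Uq.lift_gen]; rfl

lemma piRep_KhatInv : piRep q ℓ (gen q ℓ .KhatInv) =
    Matrix.diagonal fun s => (qpow q (piHat ℓ s))⁻¹ := by
  rw [piRep, Uq.lift_gen]; simp only [← qpow_neg]; rfl

lemma piC_succ (i : Fin ℓ) : piC ℓ i i.succ = 1 := by
  simp [piC, Fin.ext_iff]

lemma piC_castSucc (i : Fin ℓ) : piC ℓ i i.castSucc = -1 := by
  simp [piC, Fin.ext_iff]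

/-- The involution sends u to the transpose of v. For E_i and F_i the scalars q^{∓1} of S^{-1}
reappear on the other side as the ratio of two eigenvalues q^{±1/2} of K_i. -/
lemma starA_Lop_gen_u (x : Gen ℓ) (i j : Fin (ℓ + 1)) :
    starA q ℓ (Lop q ℓ (gen q ℓ x) (uA q ℓ i j))
      = ract q ℓ (starU q ℓ (gen q ℓ x)) (starA q ℓ (uA q ℓ i j)) := by
  have hd : ∀ κ : Fin (ℓ + 1) → ℂ, ∑ k, Matrix.diagonal κ i k • uA q ℓ k j = κ i • uA q ℓ i j := by
    intro κ; simp [Matrix.diagonal_apply]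
  rcases x with a | a | a | a | _ | _
  · rw [Lop_eq, antipodeInv_E, starU_E, starA_u, ract_vA_skew _ _ _ _ (by intro s; exact qpow_ne_zero _ _) (comulU_gen (.F a))
      (counitU_gen _) (comulU_gen _) (counitU_gen _) (piRep_K a) (piRep_Kinv a), map_neg, map_smul,
      LinearMap.neg_apply, LinearMap.smul_apply, ract_u, piRep_E, piRep_F, starA_neg, starA_smul,
      conj_qpow]
    by_cases h : i = a.succ
    · subst h
      simp only [Matrix.single_apply, ite_smul, true_and, and_true, one_smul, zero_smul,
        Finset.sum_ite_eq, Finset.mem_univ, if_true, starA_u, mul_ite, mul_zero, mul_one]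
      rw [piC_succ, piC_castSucc, ← qpow_neg, ← qpow_add]
      norm_num
    · simp [Matrix.single_apply, Ne.symm h, starA_zero]
  · rw [Lop_eq, antipodeInv_F, starU_F, starA_u, ract_vA_skew _ _ _ _ (by intro s; exact qpow_ne_zero _ _) (comulU_gen (.E a))
      (counitU_gen _) (comulU_gen _) (counitU_gen _) (piRep_K a) (piRep_Kinv a), map_neg, map_smul,
      LinearMap.neg_apply, LinearMap.smul_apply, ract_u, piRep_E, piRep_F, starA_neg, starA_smul,
      conj_qpow]
    by_cases h : i = a.castSucc
    · subst h
      simp only [Matrix.single_apply, ite_smul, true_and, and_true, one_smul, zero_smul,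
        Finset.sum_ite_eq, Finset.mem_univ, if_true, starA_u, mul_ite, mul_zero, mul_one]
      rw [piC_succ, piC_castSucc, ← qpow_neg, ← qpow_add]
      norm_num
    · simp [Matrix.single_apply, Ne.symm h, starA_zero]
  · rw [Lop_eq, antipodeInv_K, starU_K, starA_u, ract_vA_diag _ _ (by intro s; exact qpow_ne_zero _ _) (comulU_gen _)
      (counitU_gen _) (piRep_K a), ract_u, piRep_Kinv, hd, starA_smul, starA_u, map_inv₀, conj_qpow]
  · rw [Lop_eq, antipodeInv_Kinv, starU_Kinv, starA_u, ract_vA_diag _ _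
      (by intro s; exact inv_ne_zero (qpow_ne_zero _ _)) (comulU_gen _)
      (counitU_gen _) (piRep_Kinv a), ract_u, piRep_K, hd, starA_smul, starA_u, inv_inv, conj_qpow]
  · rw [Lop_eq, antipodeInv_Khat, starU_Khat, starA_u, ract_vA_diag _ _ (by intro s; exact qpow_ne_zero _ _) (comulU_gen _)
      (counitU_gen _) piRep_Khat, ract_u, piRep_KhatInv, hd, starA_smul, starA_u, map_inv₀,
      conj_qpow]
  · rw [Lop_eq, antipodeInv_KhatInv, starU_KhatInv, starA_u, ract_vA_diag _ _
      (by intro s; exact inv_ne_zero (qpow_ne_zero _ _)) (comulU_gen _)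
      (counitU_gen _) piRep_KhatInv, ract_u, piRep_Khat, hd, starA_smul, starA_u, inv_inv,
      conj_qpow]

/-- The involution of A reverses products and 𝓛 reverses the coproduct, so both sides obey the same
product rule and only the generators of A have to be compared. -/
lemma starA_Lop_gen (x : Gen ℓ) (a : ASU q ℓ) :
    starA q ℓ (Lop q ℓ (gen q ℓ x) a) = ract q ℓ (starU q ℓ (gen q ℓ x)) (starA q ℓ a) := by
  induction a using ASU.induction generalizing x with
  | halg c =>
    rw [starA_algebraMap, ract_algebraMap, Algebra.algebraMap_eq_smul_one, map_smul, Lop_one_right,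
      starA_smul, starA_smul, ← map_one (algebraMap ℂ (ASU q ℓ)), starA_algebraMap, map_one,
      map_one, smul_comm, Algebra.algebraMap_eq_smul_one]
    congr 1
    rcases x with a | a | a | a | _ | _ <;>
      simp [starU_gen, starGen, counitU_gen, counitGen, toCO, ofCO]
  | hu i j => exact starA_Lop_gen_u x i j
  | hmul a b ha hb =>
    rw [Lop_mul, starA_mul, ract_mul, comulU_gen]
    rcases x with i | i | i | i | _ | _
    · rw [starU_E, comulU_gen]
      simp only [comulGen, map_add, Algebra.TensorProduct.comm_tmul, mulAct_tmul, starA_add,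
        starA_mul, ha, hb, starU_E, starU_K, starU_Kinv]
    · rw [starU_F, comulU_gen]
      simp only [comulGen, map_add, Algebra.TensorProduct.comm_tmul, mulAct_tmul, starA_add,
        starA_mul, ha, hb, starU_F, starU_K, starU_Kinv]
    · rw [starU_K, comulU_gen]
      simp only [comulGen, Algebra.TensorProduct.comm_tmul, mulAct_tmul, starA_mul, ha, hb, starU_K]
    · rw [starU_Kinv, comulU_gen]
      simp only [comulGen, Algebra.TensorProduct.comm_tmul, mulAct_tmul, starA_mul, ha, hb,
        starU_Kinv]
    · rw [starU_Khat, comulU_gen]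
      simp only [comulGen, Algebra.TensorProduct.comm_tmul, mulAct_tmul, starA_mul, ha, hb,
        starU_Khat]
    · rw [starU_KhatInv, comulU_gen]
      simp only [comulGen, Algebra.TensorProduct.comm_tmul, mulAct_tmul, starA_mul, ha, hb,
        starU_KhatInv]
  | hadd a b ha hb => rw [map_add, starA_add, ha, hb, starA_add, map_add]

/-- `(𝓛_h a)^* = a^* ◁ h^*`. -/
lemma starA_Lop (h : Uq q ℓ ℓ) (a : ASU q ℓ) :
    starA q ℓ (Lop q ℓ h a) = ract q ℓ (starU q ℓ h) (starA q ℓ a) := by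
  induction h using Uq.induction generalizing a with
  | halg c =>
    rw [starU_algebraMap, Algebra.algebraMap_eq_smul_one, Algebra.algebraMap_eq_smul_one, map_smul,
      map_smul, LinearMap.smul_apply, LinearMap.smul_apply, Lop_one_left, ract_one_left, starA_smul]
  | hgen x => exact starA_Lop_gen x a
  | hmul g h hg hh => rw [Lop_mul_left, hg, hh, starU_mul, ract_mul_left]
  | hadd g h hg hh =>
    rw [map_add, LinearMap.add_apply, starA_add, hg, hh, starU_add, map_add, LinearMap.add_apply]

/-! The Haar state. -/

variable {φ : ASU q ℓ →ₗ[ℂ] ℂ}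

/-- Apply ⟨h, ·⟩ to the invariance (id ⊗ φ)Δ(a) = φ(a) 1. -/
lemma IsHaar.ract (hφ : IsHaar q ℓ φ) (h : Uq q ℓ ℓ) (a : ASU q ℓ) :
    φ (ract q ℓ h a) = counitU q ℓ ℓ h * φ a := by
  have key : ∀ T : ASU q ℓ ⊗[ℂ] ASU q ℓ, φ (sliceL q ℓ T h)
      = pair q ℓ h (TensorProduct.rid ℂ (ASU q ℓ) (φ.lTensor (ASU q ℓ) T)) := by
    intro T
    induction T using TensorProduct.induction_on with
    | zero => simp
    | add x y hx hy => simp only [map_add, LinearMap.add_apply, hx, hy]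
    | tmul x y => simp [sliceL_tmul, mul_comm]
  rw [ract_eq, key, hφ.right_inv, map_smul, pair_one, smul_eq_mul, mul_comm]

/-- Invariance of φ under g, evaluated on the product x (y ◁ g'), in which the second factor becomes
y again. -/
lemma IsHaar.ract_mul_group (hφ : IsHaar q ℓ φ) {g g' : Uq q ℓ ℓ} (h1 : g' * g = 1)
    (hg : comulU q ℓ ℓ g = g ⊗ₜ g) (hc : counitU q ℓ ℓ g = 1) (x y : ASU q ℓ) :
    φ (QProj.ract q ℓ g x * y) = φ (x * QProj.ract q ℓ g' y) := by
  have h := hφ.ract g (x * QProj.ract q ℓ g' y)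
  rwa [ract_mul, hg, mulAct_tmul, ← ract_mul_left, h1, ract_one_left, hc, one_mul] at h

/-- Integration by parts: φ vanishes on (x (y ◁ k')) ◁ e, which has two terms. In the first k' and k
cancel; in the second the remaining k' on x is moved to the other factor as k. -/
lemma IsHaar.ract_mul_skew (hφ : IsHaar q ℓ φ) {e k k' : Uq q ℓ ℓ} (h1 : k' * k = 1)
    (h2 : k * k' = 1) (hk' : comulU q ℓ ℓ k' = k' ⊗ₜ k') (hc' : counitU q ℓ ℓ k' = 1)
    (he : comulU q ℓ ℓ e = e ⊗ₜ k + k' ⊗ₜ e)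
    (hc : counitU q ℓ ℓ e = 0) (x y : ASU q ℓ) :
    φ (QProj.ract q ℓ e x * y) = - φ (x * QProj.ract q ℓ (k' * e * k) y) := by
  have h := hφ.ract e (x * QProj.ract q ℓ k' y)
  rw [ract_mul, he, map_add, mulAct_tmul, mulAct_tmul, ← ract_mul_left, ← ract_mul_left, h1,
    ract_one_left, hc, zero_mul, map_add, hφ.ract_mul_group h2 hk' hc', ← ract_mul_left] at h
  exact eq_neg_of_add_eq_zero_left h

/-- `φ((x ◁ h) y) = φ(x 𝓛_h y)`. -/
lemma IsHaar.ract_mul_left (hφ : IsHaar q ℓ φ) (h : Uq q ℓ ℓ) (x y : ASU q ℓ) :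
    φ (QProj.ract q ℓ h x * y) = φ (x * Lop q ℓ h y) := by
  have G := gen_relations (q := q) (ℓ := ℓ) (m := ℓ)
  induction h using Uq.induction generalizing x y with
  | halg c =>
    rw [Algebra.algebraMap_eq_smul_one, map_smul, map_smul, LinearMap.smul_apply,
      LinearMap.smul_apply, Lop_one_left, ract_one_left, smul_mul_assoc, mul_smul_comm]
  | hgen z =>
    rw [Lop_eq]
    rcases z with i | i | i | i | _ | _
    -- K_i^{-1} E_i K_i = q^{-1} E_i = -S^{-1}(E_i), so the sign and the scalar are those of the
    -- inverse antipode.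
    · rw [hφ.ract_mul_skew (G.Kinv_K i) (G.K_Kinv i) (comulU_gen _) (counitU_gen _) (comulU_gen _)
        (counitU_gen _), mul_assoc, G.E_K, cartanHalf_self, mul_smul_comm, ← mul_assoc, G.Kinv_K,
        one_mul, antipodeInv_E, map_neg, LinearMap.neg_apply, mul_neg, map_neg]
    · have h : gen q ℓ (.F i) * gen q ℓ (.K i) = qpow q 1 • (gen q ℓ (.K i) * gen q ℓ (.F i)) := by
        rw [G.F_K, cartanHalf_self]
      rw [hφ.ract_mul_skew (G.Kinv_K i) (G.K_Kinv i) (comulU_gen _) (counitU_gen _) (comulU_gen _)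
        (counitU_gen _), mul_assoc, h, mul_smul_comm, ← mul_assoc, G.Kinv_K,
        one_mul, antipodeInv_F, map_neg, LinearMap.neg_apply, mul_neg, map_neg]
    · rw [antipodeInv_K, hφ.ract_mul_group (G.Kinv_K i) (comulU_gen _) (counitU_gen _)]
    · rw [antipodeInv_Kinv, hφ.ract_mul_group (G.K_Kinv i) (comulU_gen _) (counitU_gen _)]
    · rw [antipodeInv_Khat, hφ.ract_mul_group G.KhatInv_Khat (comulU_gen _) (counitU_gen _)]
    · rw [antipodeInv_KhatInv, hφ.ract_mul_group G.Khat_KhatInv (comulU_gen _) (counitU_gen _)]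
  | hmul g h hg hh => rw [QProj.ract_mul_left, hh, hg, Lop_mul_left]
  | hadd g h hg hh => simp only [map_add, LinearMap.add_apply, add_mul, mul_add, hg, hh]

/-- `𝓛` is a `*`-representation for the Haar inner product. -/
lemma IsHaar.adjoint (hφ : IsHaar q ℓ φ) (h : Uq q ℓ ℓ) (a b : ASU q ℓ) :
    φ (starA q ℓ (Lop q ℓ (starU q ℓ h) a) * b) = φ (starA q ℓ a * Lop q ℓ h b) := by
  rw [starA_Lop, starU_starU, hφ.ract_mul_left]

end leftOperators

/-! ### The root vectors `K̂ X_i` -/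

/-- `q^{1/2}`. -/
def qhalf (q : QParam) : ℂ := qpow q (1 / 2)

section qhalf
variable (q : QParam)

lemma qhalf_ne_zero : qhalf q ≠ 0 := qpow_ne_zero _ _

lemma qpow_one : qpow q 1 = qhalf q ^ 2 := by
  rw [qhalf, ← qpow_nat_mul]; norm_num

lemma qpow_half : qpow q (1 / 2) = qhalf q := rfl

lemma qpow_neg_half : qpow q (-(1 / 2)) = (qhalf q)⁻¹ := by
  rw [qpow_neg]; rfl

lemma qpow_neg_one : qpow q (-1) = (qhalf q ^ 2)⁻¹ := by
  rw [qpow_neg, qpow_one]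

/-- This number is q² + 1, the denominator that appears when a Serre relation is solved for its
middle word. Its companion q² - 1 below is the denominator of [E_i, F_i]. -/
lemma qhalf_pow_add_one_ne_zero : qhalf q ^ 4 + 1 ≠ 0 := by
  have h : (0 : ℝ) < ((q : ℝ) ^ (1 / 2 : ℝ)) ^ 4 + 1 := by
    have := q.2.1
    positivity
  have h2 : ((((q : ℝ) ^ (1 / 2 : ℝ)) ^ 4 + 1 : ℝ) : ℂ) ≠ 0 := by exact_mod_cast h.ne'
  simpa [qhalf, qpow] using h2

lemma qhalf_pow_sub_one_ne_zero : qhalf q ^ 4 - 1 ≠ 0 := by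
  have h := qpow_sub_ne_zero q
  have h0 := qhalf_ne_zero q
  rw [qpow_neg_one, qpow_one] at h
  intro h1
  apply h
  field_simp
  linear_combination h1

end qhalf

/-! ### Identities in a noncommutative algebra, with t in the role of q^{1/2}. -/

section wordIdentities
variable {B : Type*} [Ring B] [Algebra ℂ B]

lemma qcomm_assoc {a b : B} {c : ℂ} (h : b * a = c • (a * b)) (x : B) :
    b * (a * x) = c • (a * (b * x)) := by
  rw [← mul_assoc, h, smul_mul_assoc, mul_assoc]

lemma cancel_assoc {a b : B} (h : a * b = 1) (x : B) : a * (b * x) = x := by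
  rw [← mul_assoc, h, one_mul]

/-- `q`-commutation is inherited by twisted commutators. -/
lemma qcomm_twisted {x k z f : B} {c d : ℂ} (hz : x * z = c • (z * x)) (hk : Commute x k)
    (hf : Commute x f) :
    x * (k * (z * f - d • (f * z))) = c • (k * (z * f - d • (f * z)) * x) := by
  have hk' : ∀ w, x * (k * w) = k * (x * w) := fun w => by rw [← mul_assoc, hk.eq, mul_assoc]
  have hf' : ∀ w, x * (f * w) = f * (x * w) := fun w => by rw [← mul_assoc, hf.eq, mul_assoc]
  have hz' := qcomm_assoc hz
  simp only [mul_sub, sub_mul, mul_smul_comm, smul_mul_assoc, mul_assoc, hk', hf', hz', hz, hf.eq,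
    smul_sub, smul_smul, mul_comm c d]

lemma commute_twisted {x k z f : B} {d : ℂ} (hz : Commute x z) (hk : Commute x k)
    (hf : Commute x f) : Commute x (k * (z * f - d • (f * z))) :=
  hk.mul_right ((hz.mul_right hf).sub_right ((hf.mul_right hz).smul_right d))

/-- The Serre expression of `a` and `b`. -/
def serre (t : ℂ) (a b : B) : B :=
  a ^ 2 * b - (t ^ 2 + (t ^ 2)⁻¹) • (a * b * a) + b * a ^ 2

/-- The Serre expression is linear in its second argument, and factors that commute with a can be
pulled out on either side. -/
lemma serre_twisted {t d : ℂ} {a b z : B} (h : serre t a b = 0) (hz : Commute a z) :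
    serre t a (z * b - d • (b * z)) = 0 := by
  have h1 := hz.eq
  have h2 : ∀ w, a * (z * w) = z * (a * w) := fun w => by rw [← mul_assoc, h1, mul_assoc]
  have : serre t a (z * b - d • (b * z)) = z * serre t a b - d • (serre t a b * z) := by
    simp only [serre, pow_two, mul_sub, sub_mul, mul_add, add_mul, mul_smul_comm, smul_mul_assoc,
      mul_assoc, h1, h2, smul_sub, smul_add]
    module
  rw [this, h, mul_zero, zero_mul, smul_zero, sub_zero]

/-- The Serre relation, for a factor that is multiplied by a `q`-commuting element. -/
lemma serre_mul_left {t : ℂ} (ht : t ≠ 0) {a k w : B} (h : serre t a w = 0)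
    (hk : a * k = t⁻¹ • (k * a)) :
    t ^ 2 • (a * (a * (k * w))) - (t ^ 3 + t⁻¹) • (a * (k * w * a)) + k * w * (a * a) = 0 := by
  have hk' := qcomm_assoc hk
  have : t ^ 2 • (a * (a * (k * w))) - (t ^ 3 + t⁻¹) • (a * (k * w * a)) + k * w * (a * a)
      = k * serre t a w := by
    simp only [serre, pow_two, mul_sub, mul_add, mul_smul_comm, mul_assoc, hk', smul_smul]
    match_scalars <;> field_simp
  rw [this, h, mul_zero]

/-- The Serre relation solved for a b a: a rewriting rule that puts words in a and b with two
letters a into normal form. -/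
lemma serre_eq {t : ℂ} (ht : t ≠ 0) (h4 : t ^ 4 + 1 ≠ 0) {a b : B} (h : serre t a b = 0) :
    a * (b * a) = (t ^ 2 / (t ^ 4 + 1)) • (a * (a * b) + b * (a * a)) := by
  have e : (t ^ 2 / (t ^ 4 + 1)) * (t ^ 2 + (t ^ 2)⁻¹) = 1 := by field_simp
  have h' : a * (a * b) + b * (a * a) = (t ^ 2 + (t ^ 2)⁻¹) • (a * (b * a)) := by
    rw [← sub_eq_zero, ← h, serre]; simp only [pow_two, mul_assoc]; abel
  rw [h', smul_smul, e, one_smul]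

/-- The commutator with the raising operator. -/
lemma raise_twisted {t : ℂ} (ht : t ≠ 0) (h4 : t ^ 4 - 1 ≠ 0) {e f k ki z : B} (h1 : k * ki = 1)
    (h2 : ki * k = 1) (hek : e * k = (t ^ 2)⁻¹ • (k * e)) (hez : e * z = t • (z * e))
    (hkz : k * z = t • (z * k))
    (hef : e * f - f * e = (t ^ 2 - (t ^ 2)⁻¹)⁻¹ • (k ^ 2 - ki ^ 2)) :
    k * (z * f - t⁻¹ • (f * z)) * e
      = t • (e * (k * (z * f - t⁻¹ • (f * z)))) + ki * z := by
  have hzk : z * k = t⁻¹ • (k * z) := swap_smul ht hkz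
  have hzki : z * ki = t • (ki * z) := inv_qcomm h1 h2 hkz
  have hef' : e * f = f * e + (t ^ 2 - (t ^ 2)⁻¹)⁻¹ • (k * k - ki * ki) := by
    rw [← pow_two, ← pow_two, ← hef]; abel
  have a1 := qcomm_assoc hek
  have a2 := qcomm_assoc hez
  have a3 := qcomm_assoc hzk
  have a4 := qcomm_assoc hzki
  have a5 := cancel_assoc h1
  have a6 := cancel_assoc h2
  have a7 : ∀ x, e * (f * x) = f * (e * x) + (t ^ 2 - (t ^ 2)⁻¹)⁻¹ • (k * (k * x) - ki * (ki * x)) := by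
    intro x; rw [← mul_assoc, hef']; simp only [add_mul, smul_mul_assoc, sub_mul, mul_assoc]
  simp only [mul_sub, sub_mul, mul_add, mul_smul_comm, smul_mul_assoc, mul_assoc, a1, a2, a3, a4,
    a5, a6, a7, hek, hez, hzk, hzki, hef', smul_add, smul_sub, smul_smul]
  have e1 : t ^ 2 - (t ^ 2)⁻¹ ≠ 0 := by
    intro h; apply h4; field_simp at h; linear_combination h
  generalize hc : (t ^ 2 - (t ^ 2)⁻¹)⁻¹ = c
  have e2 : c * (t ^ 2 - (t ^ 2)⁻¹) = 1 := by rw [← hc, inv_mul_cancel₀ e1]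
  have e3 : c * (t ^ 4 - 1) = t ^ 2 := by
    field_simp at e2; linear_combination e2
  match_scalars
  all_goals field_simp
  all_goals first | ring1 | linear_combination e3

/-- The next lowering operator commutes with the second twisted commutator. -/
lemma lower_twisted {t : ℂ} (ht : t ≠ 0) (h4 : t ^ 4 + 1 ≠ 0) {a b c k l : B}
    (hac : a * c = c * a) (hbl : b * l = t⁻¹ • (l * b)) (hak : a * k = t⁻¹ • (k * a))
    (hbk : b * k = t ^ 2 • (k * b)) (hba : serre t b a = 0)
    (hbc : t ^ 2 • (b * (b * c)) - (t ^ 3 + t⁻¹) • (b * (c * b)) + c * (b * b) = 0) :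
    Commute b (l * ((k * (c * b - t⁻¹ • (b * c))) * a
      - t⁻¹ • (a * (k * (c * b - t⁻¹ • (b * c)))))) := by
  -- Two Serre relations, one between b and a and one between b and c, eliminate b a b and b c b.
  -- After moving l and k to the left, both sides become combinations of words in which the two
  -- letters b are adjacent, and these agree.
  have s1 := serre_eq ht h4 hba
  have e : (t / (t ^ 4 + 1)) * (t ^ 3 + t⁻¹) = 1 := by field_simp
  have s2 : b * (c * b) = (t / (t ^ 4 + 1)) • (t ^ 2 • (b * (b * c)) + c * (b * b)) := by
    have h' : t ^ 2 • (b * (b * c)) + c * (b * b) = (t ^ 3 + t⁻¹) • (b * (c * b)) := by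
      rw [← sub_eq_zero, ← hbc]; abel
    rw [h', smul_smul, e, one_smul]
  have a1 : ∀ x, b * (a * (b * x))
      = (t ^ 2 / (t ^ 4 + 1)) • (b * (b * (a * x)) + a * (b * (b * x))) := by
    intro x
    have := congrArg (· * x) s1
    simpa only [mul_assoc, smul_mul_assoc, add_mul] using this
  have a2 : ∀ x, b * (c * (b * x))
      = (t / (t ^ 4 + 1)) • (t ^ 2 • (b * (b * (c * x))) + c * (b * (b * x))) := by
    intro x
    have := congrArg (· * x) s2
    simpa only [mul_assoc, smul_mul_assoc, add_mul] using this
  have a3 : ∀ x, c * (a * x) = a * (c * x) := fun x => by rw [← mul_assoc, ← hac, mul_assoc]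
  have b1 := qcomm_assoc hbl
  have b2 := qcomm_assoc hak
  have b3 := qcomm_assoc hbk
  rw [Commute, SemiconjBy]
  simp only [mul_sub, sub_mul, mul_add, mul_smul_comm, smul_mul_assoc, mul_assoc, ← hac, a3,
    b1, b2, b3, hbl, hak, hbk, smul_sub, smul_add, smul_smul]
  simp only [mul_sub, sub_mul, mul_add, mul_smul_comm, smul_mul_assoc, mul_assoc, s1, s2, a1, a2,
    smul_sub, smul_add, smul_smul]
  simp only [← hac, a3]
  match_scalars <;> field_simp <;> ring

end wordIdentities

/-! ### The lowering root vectors and their commutation relations. -/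

section lowering
variable {q : QParam} {ℓ : ℕ} {B : Type*} [Ring B] [Algebra ℂ B] {f : Gen ℓ → B}

lemma Fin.down_induction {P : Fin ℓ → Prop} (last : ∀ i : Fin ℓ, (i : ℕ) + 1 = ℓ → P i)
    (step : ∀ i j : Fin ℓ, (i : ℕ) + 1 = j → P j → P i) (i : Fin ℓ) : P i := by
  obtain ⟨d, hd⟩ : ∃ d, (i : ℕ) + 1 + d = ℓ := ⟨ℓ - (i + 1), by omega⟩
  induction d generalizing i with
  | zero => exact last i hd
  | succ d ih => exact step i ⟨i + 1, by omega⟩ rfl (ih _ (by simp only; omega))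

namespace UqRelations

lemma F_K_self (G : UqRelations q ℓ ℓ f) (i : Fin ℓ) :
    f (.F i) * f (.K i) = qhalf q ^ 2 • (f (.K i) * f (.F i)) := by
  rw [G.F_K, cartanHalf_self, qpow_one]

lemma F_K_adj (G : UqRelations q ℓ ℓ f) {i j : Fin ℓ} (h : (i : ℕ) + 1 = j ∨ (j : ℕ) + 1 = i) :
    f (.F j) * f (.K i) = (qhalf q)⁻¹ • (f (.K i) * f (.F j)) := by
  rw [G.F_K, cartanHalf_adj h, qpow_neg_half]

lemma F_K_far (G : UqRelations q ℓ ℓ f) {i j : Fin ℓ} (h : (i : ℕ) + 1 < j ∨ (j : ℕ) + 1 < i) :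
    Commute (f (.F j)) (f (.K i)) := by
  rw [Commute, SemiconjBy, G.F_K, cartanHalf_far h, qpow_zero, one_smul]

lemma E_K_self (G : UqRelations q ℓ ℓ f) (i : Fin ℓ) :
    f (.E i) * f (.K i) = (qhalf q ^ 2)⁻¹ • (f (.K i) * f (.E i)) := by
  rw [G.E_K, cartanHalf_self, qpow_neg_one]

lemma E_K_adj (G : UqRelations q ℓ ℓ f) {i j : Fin ℓ} (h : (i : ℕ) + 1 = j ∨ (j : ℕ) + 1 = i) :
    f (.E j) * f (.K i) = qhalf q • (f (.K i) * f (.E j)) := by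
  rw [G.E_K, cartanHalf_adj h, neg_neg]; rfl

lemma E_K_far (G : UqRelations q ℓ ℓ f) {i j : Fin ℓ} (h : (i : ℕ) + 1 < j ∨ (j : ℕ) + 1 < i) :
    Commute (f (.E j)) (f (.K i)) := by
  rw [Commute, SemiconjBy, G.E_K, cartanHalf_far h, neg_zero, qpow_zero, one_smul]

lemma K_F_self (G : UqRelations q ℓ ℓ f) (i : Fin ℓ) :
    f (.K i) * f (.F i) = (qhalf q ^ 2)⁻¹ • (f (.F i) * f (.K i)) :=
  swap_smul (pow_ne_zero _ (qhalf_ne_zero q)) (G.F_K_self i)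

lemma K_F_adj (G : UqRelations q ℓ ℓ f) {i j : Fin ℓ} (h : (i : ℕ) + 1 = j ∨ (j : ℕ) + 1 = i) :
    f (.K i) * f (.F j) = qhalf q • (f (.F j) * f (.K i)) := by
  have := swap_smul (inv_ne_zero (qhalf_ne_zero q)) (G.F_K_adj h)
  rwa [inv_inv] at this

lemma commute_Khat (G : UqRelations q ℓ ℓ f) (i : Fin ℓ) : Commute (f .Khat) (f (.K i)) := G.Khat_K i

lemma commute_E_F (G : UqRelations q ℓ ℓ f) {i j : Fin ℓ} (h : i ≠ j) :
    Commute (f (.E i)) (f (.F j)) := by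
  have := G.E_F i j
  rw [if_neg h, sub_eq_zero] at this
  exact this

lemma serre_F_eq (G : UqRelations q ℓ ℓ f) {i j : Fin ℓ} (h : (i : ℕ) + 1 = j ∨ (j : ℕ) + 1 = i) :
    serre (qhalf q) (f (.F i)) (f (.F j)) = 0 := by
  have := G.serre_F i j h
  rwa [qpow_one, qpow_neg_one] at this

end UqRelations

/-- The recursion for the lowering root vectors `K̂ X_i`. -/
structure IsLowering (q : QParam) {ℓ : ℕ} (f : Gen ℓ → B) (y : Fin ℓ → B) : Prop where
  last (i : Fin ℓ) (h : (i : ℕ) + 1 = ℓ) : y i = f (.K i) * f (.F i)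
  step (i j : Fin ℓ) (h : (i : ℕ) + 1 = j) :
    y i = f (.K i) * (y j * f (.F i) - (qhalf q)⁻¹ • (f (.F i) * y j))

namespace IsLowering
variable {y : Fin ℓ → B}

/-- By the recursion y_i is a polynomial in y_j and in the K_k, F_k with i ≤ k < j. -/
lemma commute_of_le (Y : IsLowering q f y) {z : B} {i j : Fin ℓ} (hij : i ≤ j)
    (hz : Commute z (y j)) (hK : ∀ k, i ≤ k → k < j → Commute z (f (.K k)))
    (hF : ∀ k, i ≤ k → k < j → Commute z (f (.F k))) : Commute z (y i) := by
  induction i using Fin.down_induction with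
  | last i h =>
    have : i = j := Fin.ext (by have := Fin.le_def.1 hij; omega)
    rwa [this]
  | step i i' h ih =>
    rcases hij.eq_or_lt with rfl | hlt
    · exact hz
    · have hle : i' ≤ j := by rw [Fin.le_def]; rw [Fin.lt_def] at hlt; omega
      have hii : i ≤ i' := by rw [Fin.le_def]; omega
      rw [Y.step i i' h]
      exact commute_twisted (ih hle (fun k hk => hK k (hii.trans hk)) fun k hk => hF k (hii.trans hk))
        (hK i le_rfl hlt) (hF i le_rfl hlt)

lemma commute_of_forall (Y : IsLowering q f y) {z : B} {i : Fin ℓ}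
    (hK : ∀ k, i ≤ k → Commute z (f (.K k))) (hF : ∀ k, i ≤ k → Commute z (f (.F k))) :
    Commute z (y i) := by
  induction i using Fin.down_induction with
  | last i h => rw [Y.last i h]; exact (hK i le_rfl).mul_right (hF i le_rfl)
  | step i i' h ih =>
    have hii : i ≤ i' := by rw [Fin.le_def]; omega
    rw [Y.step i i' h]
    exact commute_twisted (ih (fun k hk => hK k (hii.trans hk)) fun k hk => hF k (hii.trans hk))
        (hK i le_rfl) (hF i le_rfl)

lemma commute_F_far (Y : IsLowering q f y) (G : UqRelations q ℓ ℓ f) {i j : Fin ℓ}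
    (h : (j : ℕ) + 1 < i) : Commute (f (.F j)) (y i) := by
  apply Y.commute_of_forall <;> intro k hk <;> rw [Fin.le_def] at hk
  · exact G.F_K_far (by omega)
  · exact G.comm_F _ _ (by omega)

lemma commute_E_far (Y : IsLowering q f y) (G : UqRelations q ℓ ℓ f) {i j : Fin ℓ}
    (h : (j : ℕ) + 1 < i) : Commute (f (.E j)) (y i) := by
  apply Y.commute_of_forall <;> intro k hk <;> rw [Fin.le_def] at hk
  · exact G.E_K_far (by omega)
  · exact G.commute_E_F (by rintro rfl; omega)

lemma commute_K_far (Y : IsLowering q f y) (G : UqRelations q ℓ ℓ f) {i j : Fin ℓ}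
    (h : (j : ℕ) + 1 < i) : Commute (f (.K j)) (y i) := by
  apply Y.commute_of_forall <;> intro k hk <;> rw [Fin.le_def] at hk
  · exact G.K_K _ _
  · exact (G.F_K_far (by omega)).symm

/-- Splitting off the Cartan part. -/
lemma exists_eq_K_mul (Y : IsLowering q f y) (G : UqRelations q ℓ ℓ f) {j j' : Fin ℓ}
    (h : (j : ℕ) + 1 = j') : ∃ w, y j' = f (.K j') * w ∧ Commute (f (.E j)) w ∧
      f (.K j) * w = qhalf q • (w * f (.K j)) ∧ serre (qhalf q) (f (.F j)) w = 0 := by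
  have hne : j ≠ j' := by rintro rfl; omega
  by_cases hl : (j' : ℕ) + 1 = ℓ
  · exact ⟨_, Y.last j' hl, G.commute_E_F hne, G.K_F_adj (Or.inl h), G.serre_F_eq (Or.inl h)⟩
  · obtain ⟨k, hk⟩ : ∃ k : Fin ℓ, (j' : ℕ) + 1 = k := ⟨⟨j' + 1, by omega⟩, rfl⟩
    have hjk : (j : ℕ) + 1 < k := by omega
    refine ⟨_, Y.step j' k hk, ?_, ?_, ?_⟩
    · have h1 := Y.commute_E_far G hjk
      have h2 := G.commute_E_F hne
      exact (h1.mul_right h2).sub_right ((h2.mul_right h1).smul_right _)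
    · have h1 := (Y.commute_K_far G hjk).eq
      have h2 := G.K_F_adj (Or.inl h)
      have h1' : ∀ x, f (.K j) * (y k * x) = y k * (f (.K j) * x) := fun x => by
        rw [← mul_assoc, h1, mul_assoc]
      have h2' := qcomm_assoc h2
      simp only [mul_sub, sub_mul, mul_smul_comm, smul_mul_assoc, mul_assoc, h1, h1', h2, h2',
        smul_sub, smul_smul, mul_comm]
    · exact serre_twisted (G.serre_F_eq (Or.inl h)) (Y.commute_F_far G hjk)

lemma K_succ (Y : IsLowering q f y) (G : UqRelations q ℓ ℓ f) {j j' : Fin ℓ}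
    (h : (j : ℕ) + 1 = j') : f (.K j) * y j' = qhalf q • (y j' * f (.K j)) := by
  obtain ⟨w, hw, -, h2, -⟩ := Y.exists_eq_K_mul G h
  rw [hw, ← mul_assoc, G.K_K, mul_assoc, h2, mul_smul_comm, mul_assoc]

lemma E_succ (Y : IsLowering q f y) (G : UqRelations q ℓ ℓ f) {j j' : Fin ℓ}
    (h : (j : ℕ) + 1 = j') : f (.E j) * y j' = qhalf q • (y j' * f (.E j)) := by
  obtain ⟨w, hw, h1, -, -⟩ := Y.exists_eq_K_mul G h
  rw [hw, ← mul_assoc, G.E_K_adj (Or.inr h), smul_mul_assoc, mul_assoc, h1.eq, mul_assoc]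

/-- With y_{j+1} = K_{j+1} w, the factor w satisfies the usual Serre relation with F_j. Moving
K_{j+1} to the left past one or two F_j changes the coefficients to those shown. -/
lemma serre_succ (Y : IsLowering q f y) (G : UqRelations q ℓ ℓ f) {j j' : Fin ℓ}
    (h : (j : ℕ) + 1 = j') :
    qhalf q ^ 2 • (f (.F j) * (f (.F j) * y j'))
      - (qhalf q ^ 3 + (qhalf q)⁻¹) • (f (.F j) * (y j' * f (.F j)))
      + y j' * (f (.F j) * f (.F j)) = 0 := by
  obtain ⟨w, hw, -, -, h3⟩ := Y.exists_eq_K_mul G h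
  rw [hw]
  exact serre_mul_left (qhalf_ne_zero q) h3 (G.F_K_adj (Or.inr h))

lemma K_self (Y : IsLowering q f y) (G : UqRelations q ℓ ℓ f) {j j' : Fin ℓ}
    (h : (j : ℕ) + 1 = j') : f (.K j) * y j = (qhalf q)⁻¹ • (y j * f (.K j)) := by
  have h1 := Y.K_succ G h
  have h2 := G.K_F_self j
  have h1' := qcomm_assoc h1
  have h2' := qcomm_assoc h2
  have h0 := qhalf_ne_zero q
  rw [Y.step j j' h]
  simp only [mul_sub, sub_mul, mul_smul_comm, smul_mul_assoc, mul_assoc, h1, h1', h2, h2',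
        smul_sub, smul_smul]
  match_scalars <;> field_simp

/-- The inhomogeneous term comes from [E_j, F_j]: in the twisted commutator the K_j² part cancels,
since K_j has weight t on y_{j+1}, and the K_j^{-2} part leaves K_j^{-1} y_{j+1}. -/
lemma E_self (Y : IsLowering q f y) (G : UqRelations q ℓ ℓ f) {j j' : Fin ℓ}
    (h : (j : ℕ) + 1 = j') :
    y j * f (.E j) = qhalf q • (f (.E j) * y j) + f (.Kinv j) * y j' := by
  rw [Y.step j j' h]
  refine raise_twisted (qhalf_ne_zero q) (qhalf_pow_sub_one_ne_zero q) (G.K_Kinv j) (G.Kinv_K j)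
    (G.E_K_self j) (Y.E_succ G h) (Y.K_succ G h) ?_
  have := G.E_F j j
  rwa [if_pos rfl, qpow_one, qpow_neg_one] at this

/-- After inserting the recursion, this is K_j times the modified Serre relation `serre_succ`. -/
lemma F_self (Y : IsLowering q f y) (G : UqRelations q ℓ ℓ f) {j j' : Fin ℓ}
    (h : (j : ℕ) + 1 = j') : y j * f (.F j) = qhalf q • (f (.F j) * y j) := by
  have h0 := qhalf_ne_zero q
  have hs := congrArg (f (.K j) * ·) (Y.serre_succ G h)
  have h2 := G.F_K_self j
  have h2' := qcomm_assoc h2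
  rw [Y.step j j' h]
  rw [← sub_eq_zero]
  refine Eq.trans ?_ (hs.trans (mul_zero _))
  simp only [mul_sub, sub_mul, mul_add, mul_smul_comm, smul_mul_assoc, mul_assoc, h2, h2',
        smul_sub, smul_smul]
  match_scalars <;> field_simp
  ring

lemma F_succ (Y : IsLowering q f y) (G : UqRelations q ℓ ℓ f) {j j' : Fin ℓ}
    (h : (j : ℕ) + 1 = j') :
    y j' * f (.F j) = (qhalf q)⁻¹ • (f (.F j) * y j') + f (.Kinv j) * y j := by
  rw [Y.step j j' h, ← mul_assoc, G.Kinv_K, one_mul]; abel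

/-- In the recursion for y_{j-1} the weight t^{-1} of y_j under K_j and the weight t of F_{j-1}
compensate each other. -/
lemma commute_K_pred (Y : IsLowering q f y) (G : UqRelations q ℓ ℓ f) {i j j' : Fin ℓ}
    (hi : (i : ℕ) + 1 = j) (h : (j : ℕ) + 1 = j') : Commute (f (.K j)) (y i) := by
  have h1 := Y.K_self G h
  have h2 := G.K_F_adj (Or.inr hi)
  have h1' := qcomm_assoc h1
  have h2' := qcomm_assoc h2
  have h3 : ∀ x, f (.K j) * (f (.K i) * x) = f (.K i) * (f (.K j) * x) := fun x => by
    rw [← mul_assoc, G.K_K, mul_assoc]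
  have h0 := qhalf_ne_zero q
  rw [Commute, SemiconjBy, Y.step i j hi]
  simp only [mul_sub, sub_mul, mul_smul_comm, smul_mul_assoc, mul_assoc, h1, h1', h2, h2', h3,
        smul_sub, smul_smul]
  match_scalars <;> field_simp

lemma commute_F_pred (Y : IsLowering q f y) (G : UqRelations q ℓ ℓ f) {i j j' : Fin ℓ}
    (hi : (i : ℕ) + 1 = j) (h : (j : ℕ) + 1 = j') : Commute (f (.F j)) (y i) := by
  rw [Y.step i j hi, Y.step j j' h]
  exact lower_twisted (qhalf_ne_zero q) (qhalf_pow_add_one_ne_zero q)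
    (Y.commute_F_far G (by omega)).eq (G.F_K_adj (Or.inl hi)) (G.F_K_adj (Or.inr hi))
    (G.F_K_self j) (G.serre_F_eq (Or.inr hi)) (Y.serre_succ G h)

/-- E_j commutes with F_{j-1}, so only the term K_j^{-1} y_{j+1} of `E_self` could obstruct. It
appears once on each side of F_{j-1}. As F_{j-1} commutes with y_{j+1} and picks up t when passing
K_j^{-1}, the two contributions to the twisted commutator cancel. -/
lemma commute_E_pred (Y : IsLowering q f y) (G : UqRelations q ℓ ℓ f) {i j j' : Fin ℓ}
    (hi : (i : ℕ) + 1 = j) (h : (j : ℕ) + 1 = j') : Commute (f (.E j)) (y i) := by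
  have h0 := qhalf_ne_zero q
  have h1 : f (.E j) * y j = (qhalf q)⁻¹ • (y j * f (.E j) - f (.Kinv j) * y j') := by
    rw [Y.E_self G h, add_sub_cancel_right, smul_smul, inv_mul_cancel₀ h0, one_smul]
  have h1' : ∀ x, f (.E j) * (y j * x)
      = (qhalf q)⁻¹ • (y j * (f (.E j) * x) - f (.Kinv j) * (y j' * x)) := fun x => by
    rw [← mul_assoc, h1, smul_mul_assoc, sub_mul, mul_assoc, mul_assoc]
  have h2 := G.E_K_adj (Or.inl hi)
  have h2' := qcomm_assoc h2
  have h3 := (G.commute_E_F (i := j) (j := i) (by rintro rfl; omega)).eq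
  have h3' : ∀ x, f (.E j) * (f (.F i) * x) = f (.F i) * (f (.E j) * x) := fun x => by
    rw [← mul_assoc, h3, mul_assoc]
  have h4 : f (.F i) * f (.Kinv j) = qhalf q • (f (.Kinv j) * f (.F i)) := by
    rw [G.F_Kinv, cartanHalf_adj (Or.inr hi), neg_neg]; rfl
  have h4' := qcomm_assoc h4
  have h5 := (Y.commute_F_far G (i := j') (j := i) (by omega)).eq
  rw [Commute, SemiconjBy, Y.step i j hi]
  simp only [mul_sub, sub_mul, mul_smul_comm, smul_mul_assoc, mul_assoc, h1, h1', h2, h2', h3, h3',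
    h4, h4', h5, smul_sub, smul_smul]
  match_scalars <;> field_simp
  ring

/-- Beyond y_{j-1} the recursion for y_i uses only K_k and F_k with k < j - 1, which are not
adjacent to j. The hypothesis that j is not the last index is essential; it lets the case i = j - 1
be reduced to the relations with y_{j+1}. -/
lemma commute_K_lt (Y : IsLowering q f y) (G : UqRelations q ℓ ℓ f) {i j j' : Fin ℓ}
    (hi : i < j) (h : (j : ℕ) + 1 = j') : Commute (f (.K j)) (y i) := by
  rw [Fin.lt_def] at hi
  refine Y.commute_of_le (j := ⟨j - 1, by omega⟩) (Fin.le_def.2 (by simp only; omega))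
    (Y.commute_K_pred G (by simp only; omega) h) ?_ ?_ <;> intro k _ hk <;> rw [Fin.lt_def] at hk <;>
    simp only at hk
  · exact G.K_K _ _
  · exact (G.F_K_far (by omega)).symm

lemma commute_F_lt (Y : IsLowering q f y) (G : UqRelations q ℓ ℓ f) {i j j' : Fin ℓ}
    (hi : i < j) (h : (j : ℕ) + 1 = j') : Commute (f (.F j)) (y i) := by
  rw [Fin.lt_def] at hi
  refine Y.commute_of_le (j := ⟨j - 1, by omega⟩) (Fin.le_def.2 (by simp only; omega))
    (Y.commute_F_pred G (by simp only; omega) h) ?_ ?_ <;> intro k _ hk <;> rw [Fin.lt_def] at hk <;>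
    simp only at hk
  · exact G.F_K_far (by omega)
  · exact G.comm_F _ _ (by omega)

lemma commute_E_lt (Y : IsLowering q f y) (G : UqRelations q ℓ ℓ f) {i j j' : Fin ℓ}
    (hi : i < j) (h : (j : ℕ) + 1 = j') : Commute (f (.E j)) (y i) := by
  rw [Fin.lt_def] at hi
  refine Y.commute_of_le (j := ⟨j - 1, by omega⟩) (Fin.le_def.2 (by simp only; omega))
    (Y.commute_E_pred G (by simp only; omega) h) ?_ ?_ <;> intro k _ hk <;> rw [Fin.lt_def] at hk <;>
    simp only at hk
  · exact G.E_K_far (by omega)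
  · exact G.commute_E_F (by rintro rfl; omega)

/-- The weight of `y_i` under `K_j`. -/
def wt (i j : Fin ℓ) : ℝ :=
  if i = j then 1 / 2 else if (j : ℕ) + 1 = i then -(1 / 2) else 0

lemma wt_self (j : Fin ℓ) : wt j j = 1 / 2 := by simp [wt]

lemma wt_succ {j j' : Fin ℓ} (h : (j : ℕ) + 1 = j') : wt j' j = -(1 / 2) := by
  rw [wt, if_neg (by rintro rfl; omega), if_pos h]

lemma wt_of_ne {i j : Fin ℓ} (h : i ≠ j) (h' : (j : ℕ) + 1 ≠ i) : wt i j = 0 := by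
  rw [wt, if_neg h, if_neg h']

lemma K_mul (Y : IsLowering q f y) (G : UqRelations q ℓ ℓ f) {j j' : Fin ℓ}
    (h : (j : ℕ) + 1 = j') (i : Fin ℓ) :
    f (.K j) * y i = qpow q (-wt i j) • (y i * f (.K j)) := by
  by_cases h1 : i = j
  · subst h1; rw [wt_self, qpow_neg_half]; exact Y.K_self G h
  by_cases h2 : (j : ℕ) + 1 = i
  · rw [wt_succ h2, neg_neg]; exact Y.K_succ G h2
  rw [wt_of_ne h1 h2, neg_zero, qpow_zero, one_smul]
  rcases lt_or_gt_of_ne h1 with h3 | h3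
  · exact Y.commute_K_lt G h3 h
  · exact Y.commute_K_far G (by rw [Fin.lt_def] at h3; omega)

/-- Together with `K_mul` and `mul_F` this says that the y_i span a copy of the vector
representation of U_q(su(ℓ)) under a twisted adjoint action: E_j maps y_j to y_{j+1}, and F_j maps
y_{j+1} to y_j. -/
lemma mul_E (Y : IsLowering q f y) (G : UqRelations q ℓ ℓ f) {j j' : Fin ℓ}
    (h : (j : ℕ) + 1 = j') (i : Fin ℓ) :
    y i * f (.E j) = qpow q (wt i j) • (f (.E j) * y i)
      + if i = j then f (.Kinv j) * y j' else 0 := by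
  by_cases h1 : i = j
  · subst h1; rw [wt_self, if_pos rfl]; exact Y.E_self G h
  by_cases h2 : (j : ℕ) + 1 = i
  · rw [wt_succ h2, if_neg h1, qpow_neg_half, Y.E_succ G h2, smul_smul,
      inv_mul_cancel₀ (qhalf_ne_zero q), one_smul, add_zero]
  rw [wt_of_ne h1 h2, qpow_zero, one_smul, if_neg h1, add_zero]
  rcases lt_or_gt_of_ne h1 with h3 | h3
  · exact (Y.commute_E_lt G h3 h).symm
  · exact (Y.commute_E_far G (by rw [Fin.lt_def] at h3; omega)).symm

lemma mul_F (Y : IsLowering q f y) (G : UqRelations q ℓ ℓ f) {j j' : Fin ℓ}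
    (h : (j : ℕ) + 1 = j') (i : Fin ℓ) :
    y i * f (.F j) = qpow q (wt i j) • (f (.F j) * y i)
      + if i = j' then f (.Kinv j) * y j else 0 := by
  by_cases h1 : i = j
  · subst h1
    rw [wt_self, if_neg (by rintro rfl; omega), add_zero]; exact Y.F_self G h
  by_cases h2 : i = j'
  · subst h2
    rw [wt_succ h, if_pos rfl, qpow_neg_half]; exact Y.F_succ G h
  have h4 : (j : ℕ) + 1 ≠ i := fun h5 => h2 (Fin.ext (by omega))
  rw [wt_of_ne h1 h4, qpow_zero, one_smul, if_neg h2, add_zero]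
  rcases lt_or_gt_of_ne h1 with h3 | h3
  · exact (Y.commute_F_lt G h3 h).symm
  · exact (Y.commute_F_far G (by rw [Fin.lt_def] at h3; omega)).symm

/-- Every y_i contains F_ℓ exactly once, and K̂ commutes with all other F_k and with the K_k. -/
lemma Khat_mul (Y : IsLowering q f y) (G : UqRelations q ℓ ℓ f) (i : Fin ℓ) :
    f .Khat * y i = qpow q (-1) • (y i * f .Khat) := by
  have hF : ∀ j : Fin ℓ, f .Khat * f (.F j)
      = qpow q (-hatWeight ℓ j) • (f (.F j) * f .Khat) := by
    intro j
    rw [qpow_neg]; exact swap_smul (qpow_ne_zero _ _) (G.F_Khat j)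
  induction i using Fin.down_induction with
  | last i h =>
    rw [Y.last i h, ← mul_assoc, G.Khat_K, mul_assoc, hF, hatWeight, if_pos h, mul_smul_comm,
      mul_assoc]
  | step i j h ih =>
    rw [Y.step i j h]
    refine qcomm_twisted ih (G.commute_Khat i) ?_
    have := hF i
    rwa [hatWeight, if_neg (by omega), neg_zero, qpow_zero, one_smul] at this

/-- For the neighbour y_{ℓ-1} the claim is a consequence of the Serre relation between F_ℓ and
F_{ℓ-1}. Further down, K_i and F_i commute with y_ℓ, and the relation is inherited through the
recursion. -/
lemma mul_mul_last (Y : IsLowering q f y) (G : UqRelations q ℓ ℓ f) {i n : Fin ℓ}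
    (hn : (n : ℕ) + 1 = ℓ) (hi : i < n) : y n * y i = qhalf q ^ 2 • (y i * y n) := by
  induction i using Fin.down_induction with
  | last i h => rw [Fin.lt_def] at hi; omega
  | step i j h ih =>
    rw [Fin.lt_def] at hi
    by_cases hj : j = n
    · subst hj
      have ht := qhalf_ne_zero q
      have h4 := qhalf_pow_add_one_ne_zero q
      have s1 := serre_eq ht h4 (G.serre_F_eq (Or.inr h))
      have r1 := G.F_K_self i
      have r2 := G.F_K_self j
      have r3 := G.F_K_adj (Or.inl h)
      have r4 := G.F_K_adj (Or.inr h)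
      have r1' := qcomm_assoc r1
      have r2' := qcomm_assoc r2
      have r3' := qcomm_assoc r3
      have r4' := qcomm_assoc r4
      have r5 := G.K_K j i
      have r5' : ∀ x, f (.K j) * (f (.K i) * x) = f (.K i) * (f (.K j) * x) := fun x => by
        rw [← mul_assoc, G.K_K, mul_assoc]
      rw [Y.step i j h, Y.last j hn]
      simp only [mul_sub, sub_mul, mul_smul_comm, smul_mul_assoc, mul_assoc, r1, r2, r3, r4, r5, r1',
        r2', r3', r4', r5', s1, smul_sub, smul_smul, smul_add, mul_add]
      match_scalars <;> field_simp <;> ring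
    · have hlt : j < n := by
        rw [Fin.lt_def]
        have : (j : ℕ) ≠ n := fun h => hj (Fin.ext h)
        omega
      rw [Fin.lt_def] at hlt
      rw [Y.step i j h]
      exact qcomm_twisted (ih hlt) (Y.commute_K_far G (by omega)).symm
        (Y.commute_F_far G (by omega)).symm

/-- The root vectors `q`-commute. -/
lemma mul_mul (Y : IsLowering q f y) (G : UqRelations q ℓ ℓ f) {i j : Fin ℓ} (hi : i < j) :
    y i * y j = qpow q (-1) • (y j * y i) := by
  rw [qpow_neg_one]
  induction j using Fin.down_induction with
  | last j h => exact swap_smul (pow_ne_zero _ (qhalf_ne_zero q)) (Y.mul_mul_last G h hi)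
  | step j j' h ih =>
    -- K_j and F_j commute with y_i for i < j < ℓ, so the twisted commutator defining y_j q-commutes
    -- with y_i as y_{j+1} does.
    rw [Y.step j j' h]
    refine qcomm_twisted (ih (by rw [Fin.lt_def] at hi ⊢; omega)) ?_ ?_
    · exact (Y.commute_K_lt G hi h).symm
    · exact (Y.commute_F_lt G hi h).symm

end IsLowering

end lowering

/-! ### The elements K̂ X_i of U and their coproducts. -/

section rootVectors
variable (q : QParam) (ℓ : ℕ)

/-- `K_i K_{i+1} ⋯ K_ℓ`. -/
def Nel (i : Fin ℓ) : Uq q ℓ ℓ :=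
  (((List.finRange ℓ).filter (i ≤ ·)).map fun j => gen q ℓ (.K j)).prod

/-- `K̂ X_i`. -/
def Yel (i : Fin ℓ) : Uq q ℓ ℓ := gen q ℓ .Khat * Xel q ℓ i

variable {q ℓ}

lemma Nel_last {i : Fin ℓ} (h : (i : ℕ) + 1 = ℓ) : Nel q ℓ i = gen q ℓ (.K i) := by
  have hp : ((List.finRange ℓ).filter (i ≤ ·)).Perm [i] := by
    rw [List.perm_ext_iff_of_nodup ((List.nodup_finRange ℓ).filter _) (List.nodup_singleton i)]
    intro k
    simp only [List.mem_filter, List.mem_finRange, true_and, decide_eq_true_eq, List.mem_singleton,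
      Fin.le_def, Fin.ext_iff]
    omega
  rw [Nel, List.perm_singleton.1 hp]; simp

lemma Nel_step {i j : Fin ℓ} (h : (i : ℕ) + 1 = j) :
    Nel q ℓ i = gen q ℓ (.K i) * Nel q ℓ j := by
  have G := gen_relations (q := q) (ℓ := ℓ) (m := ℓ)
  have hp : ((List.finRange ℓ).filter (i ≤ ·)).Perm (i :: (List.finRange ℓ).filter (j ≤ ·)) := by
    rw [List.perm_ext_iff_of_nodup ((List.nodup_finRange ℓ).filter _)
      (List.nodup_cons.2 ⟨by simp [Fin.le_def, ← h], (List.nodup_finRange ℓ).filter _⟩)]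
    intro k
    simp only [List.mem_filter, List.mem_finRange, true_and, decide_eq_true_eq, List.mem_cons,
      Fin.le_def, Fin.ext_iff]
    omega
  rw [Nel, Nel, ← List.prod_cons, ← List.map_cons (f := fun j => gen q ℓ (.K j))]
  apply List.Perm.prod_eq' (hp.map _)
  rw [List.pairwise_map]
  exact List.pairwise_of_forall fun i j => G.K_K i j

lemma commute_Nel {z : Uq q ℓ ℓ} {i : Fin ℓ} (hz : ∀ k, i ≤ k → Commute z (gen q ℓ (.K k))) :
    Commute z (Nel q ℓ i) := by
  apply Commute.list_prod_right
  intro x hx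
  simp only [List.mem_map, List.mem_filter, decide_eq_true_eq] at hx
  obtain ⟨k, ⟨-, hk⟩, rfl⟩ := hx
  exact hz k hk

lemma commute_K_Nel (i j : Fin ℓ) : Commute (gen q ℓ (.K i)) (Nel q ℓ j) :=
  commute_Nel fun k _ => gen_relations.K_K i k

lemma commute_Khat_Nel (j : Fin ℓ) : Commute (gen q ℓ .Khat) (Nel q ℓ j) :=
  commute_Nel fun k _ => gen_relations.Khat_K k

lemma commute_F_Nel {i j : Fin ℓ} (h : (i : ℕ) + 1 < j) :
    Commute (gen q ℓ (.F i)) (Nel q ℓ j) :=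
  commute_Nel fun k hk => gen_relations.F_K_far (by rw [Fin.le_def] at hk; omega)

lemma F_Nel_succ {i j : Fin ℓ} (h : (i : ℕ) + 1 = j) :
    gen q ℓ (.F i) * Nel q ℓ j = (qhalf q)⁻¹ • (Nel q ℓ j * gen q ℓ (.F i)) := by
  have G := gen_relations (q := q) (ℓ := ℓ) (m := ℓ)
  by_cases hl : (j : ℕ) + 1 = ℓ
  · rw [Nel_last hl, G.F_K_adj (Or.inr h)]
  · obtain ⟨k, hk⟩ : ∃ k : Fin ℓ, (j : ℕ) + 1 = k := ⟨⟨j + 1, by omega⟩, rfl⟩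
    rw [Nel_step hk, ← mul_assoc, G.F_K_adj (Or.inr h), smul_mul_assoc, mul_assoc,
      (commute_F_Nel (by omega)).eq, mul_assoc]

lemma F_Nel_self {i j : Fin ℓ} (h : (i : ℕ) + 1 = j) :
    gen q ℓ (.F i) * Nel q ℓ i = qhalf q • (Nel q ℓ i * gen q ℓ (.F i)) := by
  have G := gen_relations (q := q) (ℓ := ℓ) (m := ℓ)
  have h0 := qhalf_ne_zero q
  rw [Nel_step h, ← mul_assoc, G.F_K_self, smul_mul_assoc, mul_assoc, F_Nel_succ h, mul_smul_comm,
    smul_smul, mul_assoc]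
  congr 1
  field_simp

lemma rootM_congr {d d' j j' : ℕ} (hd : d = d') (hj : j = j') (h : j + d < ℓ) (h' : j' + d' < ℓ) :
    rootM q ℓ d j h = rootM q ℓ d' j' h' := by
  subst hd hj; rfl

/-- K̂ commutes with the K_j, hence cancels against the factor K̂^{-1} of X_i. -/
lemma Yel_eq (i : Fin ℓ) :
    Yel q ℓ i = Nel q ℓ i * starU q ℓ (rootM q ℓ (ℓ - 1 - i) i (by omega)) := by
  have G := gen_relations (q := q) (ℓ := ℓ) (m := ℓ)
  rw [Yel, Xel]
  change gen q ℓ .Khat * (Nel q ℓ i * gen q ℓ .KhatInv * _) = _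
  rw [← mul_assoc, ← mul_assoc, (commute_Khat_Nel i).eq, mul_assoc (Nel q ℓ i), G.Khat_KhatInv,
    mul_one]

/-- The adjoint of the q-commutator recursion for M_{iℓ}. The coefficient q^{-1} becomes q^{-1/2}
because F_i is carried to the left past K_{i+1} ⋯ K_ℓ, where it meets only the neighbour K_{i+1}. -/
lemma Yel_isLowering : IsLowering q (gen q ℓ) (Yel q ℓ) where
  last i h := by
    rw [Yel_eq, Nel_last h, rootM_congr (show ℓ - 1 - (i : ℕ) = 0 by omega) rfl _ (by omega)]
    exact congrArg _ (starU_E i)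
  step i j h := by
    have h0 := qhalf_ne_zero q
    have e : rootM q ℓ (ℓ - 1 - i) i (by omega) =
        qcomm q (gen q ℓ (.E i)) (rootM q ℓ (ℓ - 1 - j) j (by omega)) := by
      rw [rootM_congr (show ℓ - 1 - (i : ℕ) = (ℓ - 1 - j) + 1 by omega) rfl _ (by omega), rootM]
      rw [rootM_congr rfl h _ (by omega)]
    have e2 : ∀ x : Uq q ℓ ℓ, gen q ℓ (.F i) * (Nel q ℓ j * x)
        = (qhalf q)⁻¹ • (Nel q ℓ j * (gen q ℓ (.F i) * x)) := qcomm_assoc (F_Nel_succ h)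
    rw [Yel_eq, Yel_eq, e, Nel_step h]
    have e3 : ∀ M : Uq q ℓ ℓ, starU q ℓ (qcomm q (gen q ℓ (.E i)) M)
        = starU q ℓ M * gen q ℓ (.F i) - qpow q (-1) • (gen q ℓ (.F i) * starU q ℓ M) := by
      intro M
      rw [qcomm, sub_eq_add_neg, starU_add, ← neg_smul, starU_smul, starU_mul, starU_mul, starU_E,
        map_neg, conj_qpow, neg_smul, ← sub_eq_add_neg]
    rw [e3, qpow_neg_one]
    simp only [mul_sub, mul_smul_comm, smul_mul_assoc, mul_assoc, e2, smul_smul]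
    match_scalars <;> field_simp

/-- A row of the matrix of the elements `t_{ij}` with `Δ(y_i) = 1 ⊗ y_i + ∑_j y_j ⊗ t_{ij}`. -/
structure IsRow (q : QParam) (ℓ : ℕ) (i : Fin ℓ) (r : Fin ℓ → Uq q ℓ ℓ) : Prop where
  of_lt (j : Fin ℓ) (h : j < i) : r j = 0
  self : r i = Nel q ℓ i * Nel q ℓ i
  succ (j : Fin ℓ) (h : (i : ℕ) + 1 = j) : r j = (qhalf q * (qhalf q ^ 2 - (qhalf q ^ 2)⁻¹)) •
    (gen q ℓ (.K i) * gen q ℓ (.F i) * (Nel q ℓ j * Nel q ℓ j))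
  commute_F (j k : Fin ℓ) (h : (k : ℕ) + 1 < i) : Commute (gen q ℓ (.F k)) (r j)
  K_pred (j k : Fin ℓ) (h : (k : ℕ) + 1 = i) (hj : i < j) :
    gen q ℓ (.K k) * r j = qhalf q • (r j * gen q ℓ (.K k))
  commute_K (j k : Fin ℓ) (h : (k : ℕ) + 1 < i) : Commute (gen q ℓ (.K k)) (r j)
  F_mul (j j' : Fin ℓ) (hj : i < j) (h : (j : ℕ) + 1 = j') : gen q ℓ (.F j) * r j =
    (qhalf q)⁻¹ • (r j * gen q ℓ (.F j)) + r j' * gen q ℓ (.K j)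
  K_mul (j j' : Fin ℓ) (hj : i < j) (h : (j : ℕ) + 1 = j') :
    gen q ℓ (.K j) * r j = qhalf q • (r j * gen q ℓ (.K j))
  comul : comulU q ℓ ℓ (Yel q ℓ i) = 1 ⊗ₜ Yel q ℓ i + ∑ j, Yel q ℓ j ⊗ₜ r j

/-- Δ(K_ℓ F_ℓ) = K_ℓ F_ℓ ⊗ K_ℓ² + 1 ⊗ K_ℓ F_ℓ. The last row has only its diagonal entry. -/
lemma isRow_last {i : Fin ℓ} (h : (i : ℕ) + 1 = ℓ) :
    IsRow q ℓ i (fun j => if j = i then Nel q ℓ i * Nel q ℓ i else 0) where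
  of_lt j hj := if_neg hj.ne
  self := if_pos rfl
  succ j hj := by omega
  commute_F j k hk := by
    have := commute_F_Nel (q := q) hk
    split_ifs
    · exact this.mul_right this
    · exact Commute.zero_right _
  K_pred j k hk hj := by rw [Fin.lt_def] at hj; omega
  commute_K j k hk := by
    have := commute_K_Nel (q := q) k i
    split_ifs
    · exact this.mul_right this
    · exact Commute.zero_right _
  F_mul j j' hj _ := by rw [Fin.lt_def] at hj; omega
  K_mul j j' hj _ := by rw [Fin.lt_def] at hj; omega
  comul := by
    have G := gen_relations (q := q) (ℓ := ℓ) (m := ℓ)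
    rw [Finset.sum_eq_single i (fun j _ hj => by rw [if_neg hj, TensorProduct.tmul_zero])
      (by simp), if_pos rfl, Yel_isLowering.last i h, Nel_last h, map_mul, comulU_gen, comulU_gen]
    simp only [comulGen, mul_add, Algebra.TensorProduct.tmul_mul_tmul, G.K_Kinv]
    rw [add_comm]

/-- The operation that produces `Δ(y_i)` from `Δ(y_{i+1})`. -/
lemma comul_step (i : Fin ℓ) (a b b' : Uq q ℓ ℓ) (c : ℂ)
    (hb : gen q ℓ (.K i) * b = c • b') (hb' : b * gen q ℓ (.K i) = b') :
    comulU q ℓ ℓ (gen q ℓ (.K i)) * (a ⊗ₜ b * comulU q ℓ ℓ (gen q ℓ (.F i))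
      - (qhalf q)⁻¹ • (comulU q ℓ ℓ (gen q ℓ (.F i)) * a ⊗ₜ b))
    = (gen q ℓ (.K i) * (a * gen q ℓ (.F i) - ((qhalf q)⁻¹ * c) • (gen q ℓ (.F i) * a))) ⊗ₜ
        (gen q ℓ (.K i) * b')
      + (gen q ℓ (.K i) * a * gen q ℓ (.Kinv i)) ⊗ₜ (gen q ℓ (.K i) * (b * gen q ℓ (.F i)))
      - (qhalf q)⁻¹ • (a ⊗ₜ (gen q ℓ (.K i) * (gen q ℓ (.F i) * b))) := by
  have G := gen_relations (q := q) (ℓ := ℓ) (m := ℓ)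
  rw [comulU_gen, comulU_gen]
  simp only [comulGen, mul_add, add_mul, mul_sub, Algebra.TensorProduct.tmul_mul_tmul, hb, hb',
    mul_smul_comm, smul_add, ← mul_assoc, G.K_Kinv, one_mul, TensorProduct.sub_tmul,
    TensorProduct.tmul_smul, ← TensorProduct.smul_tmul', smul_smul]
  abel

/-- The row of y_i is obtained by applying the recursion y_{i+1} ↦ y_i to Δ(y_{i+1}). Beyond column
i+1 the entries undergo the same twisted commutator as y_{i+1} does; the entries in columns i and
i+1 come from the single term y_{i+1} ⊗ N_{i+1}², where N_i = K_i ⋯ K_ℓ. The weight `K_pred` is what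
makes the first legs combine in this computation, while `F_mul` and `K_mul` are carried along for
the Leibniz rule, where they relate the neighbouring columns j and j+1. -/
lemma isRow_step {i i' : Fin ℓ} (h : (i : ℕ) + 1 = i') {r : Fin ℓ → Uq q ℓ ℓ}
    (hr : IsRow q ℓ i' r) : IsRow q ℓ i (fun j => if j = i then Nel q ℓ i * Nel q ℓ i else
      if j = i' then (qhalf q * (qhalf q ^ 2 - (qhalf q ^ 2)⁻¹)) •
        (gen q ℓ (.K i) * gen q ℓ (.F i) * (Nel q ℓ i' * Nel q ℓ i')) else
      gen q ℓ (.K i) * (r j * gen q ℓ (.F i) - (qhalf q)⁻¹ • (gen q ℓ (.F i) * r j))) where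
  of_lt j hj := by
    have : j < i' := by rw [Fin.lt_def] at hj ⊢; omega
    rw [if_neg hj.ne, if_neg this.ne, hr.of_lt j this]; simp
  self := if_pos rfl
  succ j hj := by
    obtain rfl : j = i' := Fin.ext (by omega)
    rw [if_neg (by rintro rfl; omega), if_pos rfl]
  commute_F j k hk := by
    have G := gen_relations (q := q) (ℓ := ℓ) (m := ℓ)
    have h1 := commute_F_Nel (q := q) hk
    have h2 := commute_F_Nel (q := q) (i := k) (j := i') (by omega)
    have h3 : Commute (gen q ℓ (.F k)) (gen q ℓ (.F i)) := G.comm_F _ _ (by omega)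
    have h4 : Commute (gen q ℓ (.F k)) (gen q ℓ (.K i)) := G.F_K_far (by omega)
    split_ifs
    · exact h1.mul_right h1
    · exact ((h4.mul_right h3).mul_right (h2.mul_right h2)).smul_right _
    · exact commute_twisted (hr.commute_F j k (by omega)) h4 h3
  K_pred j k hk hj := by
    have G := gen_relations (q := q) (ℓ := ℓ) (m := ℓ)
    have h1 := G.K_F_adj (Or.inl hk)
    have h1' := qcomm_assoc h1
    have h2 := commute_K_Nel (q := q) k i'
    have h3 := (h2.mul_right h2).eq
    have h4 : ∀ x, gen q ℓ (.K k) * (gen q ℓ (.K i) * x) = gen q ℓ (.K i) * (gen q ℓ (.K k) * x) :=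
      fun x => by rw [← mul_assoc, G.K_K, mul_assoc]
    rw [if_neg hj.ne']
    split_ifs
    · rw [mul_smul_comm, mul_assoc (gen q ℓ (.K i)), h4, h1', h3]
      simp only [mul_smul_comm, smul_mul_assoc, mul_assoc, smul_smul, mul_comm]
    · have h5 := (hr.commute_K j k (by omega)).eq
      have h5' : ∀ x, gen q ℓ (.K k) * (r j * x) = r j * (gen q ℓ (.K k) * x) :=
        fun x => by rw [← mul_assoc, h5, mul_assoc]
      simp only [mul_sub, sub_mul, mul_smul_comm, smul_mul_assoc, mul_assoc, h4, h5, h5', h1, h1',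
        smul_sub, smul_smul, mul_comm]
  commute_K j k hk := by
    have G := gen_relations (q := q) (ℓ := ℓ) (m := ℓ)
    have h1 := commute_K_Nel (q := q) k i
    have h2 := commute_K_Nel (q := q) k i'
    have h3 : Commute (gen q ℓ (.K k)) (gen q ℓ (.F i)) := (G.F_K_far (by omega)).symm
    have h4 : Commute (gen q ℓ (.K k)) (gen q ℓ (.K i)) := G.K_K _ _
    split_ifs
    · exact h1.mul_right h1
    · exact ((h4.mul_right h3).mul_right (h2.mul_right h2)).smul_right _
    · exact commute_twisted (hr.commute_K j k (by omega)) h4 h3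
  F_mul j j' hj hj' := by
    have G := gen_relations (q := q) (ℓ := ℓ) (m := ℓ)
    have h0 := qhalf_ne_zero q
    have hj2 := Fin.lt_def.1 hj
    rw [if_neg hj.ne', if_neg (by rintro rfl; omega : ¬ j' = i),
      if_neg (by rintro rfl; omega : ¬ j' = i')]
    split_ifs with hji
    · subst hji
      rw [hr.succ j' hj', Nel_step hj']
      have h1 := G.F_K_self i
      have h2 := G.F_K_self j
      have h3 := G.F_K_adj (Or.inl h)
      have h4 := G.F_K_adj (Or.inr h)
      have h5 := (commute_F_Nel (q := q) (i := i) (j := j') (by omega)).eq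
      have h6 := F_Nel_succ (q := q) hj'
      have h7 := (commute_K_Nel (q := q) j j').eq
      have h8 := G.K_K j i
      have h1' := qcomm_assoc h1
      have h2' := qcomm_assoc h2
      have h3' := qcomm_assoc h3
      have h4' := qcomm_assoc h4
      have h5' : ∀ x, gen q ℓ (.F i) * (Nel q ℓ j' * x) = Nel q ℓ j' * (gen q ℓ (.F i) * x) :=
        fun x => by rw [← mul_assoc, h5, mul_assoc]
      have h6' := qcomm_assoc h6
      have h7' : ∀ x, gen q ℓ (.K j) * (Nel q ℓ j' * x) = Nel q ℓ j' * (gen q ℓ (.K j) * x) :=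
        fun x => by rw [← mul_assoc, h7, mul_assoc]
      have h8' : ∀ x, gen q ℓ (.K j) * (gen q ℓ (.K i) * x) = gen q ℓ (.K i) * (gen q ℓ (.K j) * x) :=
        fun x => by rw [← mul_assoc, h8, mul_assoc]
      have h9 := (commute_K_Nel (q := q) i j').eq
      have h9' : ∀ x, gen q ℓ (.K i) * (Nel q ℓ j' * x) = Nel q ℓ j' * (gen q ℓ (.K i) * x) :=
        fun x => by rw [← mul_assoc, h9, mul_assoc]
      simp only [mul_sub, sub_mul, mul_smul_comm, smul_mul_assoc, mul_assoc, h1, h2, h3, h4, h5, h6,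
        h7, h8, h9, h1', h2', h3', h4', h5', h6', h7', h8', h9', smul_sub, smul_smul]
      match_scalars <;> field_simp
      -- The column j = i+1 is where the two exceptional entries of the new row meet: F_j passing
      -- K_i, F_i, N_j and the entry in column j+1, itself a twisted commutator of the old first
      -- off-diagonal entry, must account for each other.
      ring
    · have hj3 : i' < j := by
        rw [Fin.lt_def]
        have : (j : ℕ) ≠ i' := fun h => hji (Fin.ext h)
        omega
      have hj4 := Fin.lt_def.1 hj3
      have h1 := hr.F_mul j j' hj3 hj'
      have h1' : ∀ x, gen q ℓ (.F j) * (r j * x) =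
          (qhalf q)⁻¹ • (r j * (gen q ℓ (.F j) * x)) + r j' * (gen q ℓ (.K j) * x) := fun x => by
        rw [← mul_assoc, h1, add_mul, smul_mul_assoc, mul_assoc, mul_assoc]
      have h2 := G.comm_F j i (by omega)
      have h2' : ∀ x, gen q ℓ (.F j) * (gen q ℓ (.F i) * x) = gen q ℓ (.F i) * (gen q ℓ (.F j) * x) :=
        fun x => by rw [← mul_assoc, h2, mul_assoc]
      have h3 := (G.F_K_far (i := i) (j := j) (by omega)).eq
      have h3' : ∀ x, gen q ℓ (.F j) * (gen q ℓ (.K i) * x) = gen q ℓ (.K i) * (gen q ℓ (.F j) * x) :=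
        fun x => by rw [← mul_assoc, h3, mul_assoc]
      have h4 := (G.F_K_far (i := j) (j := i) (by omega)).eq
      simp only [mul_sub, sub_mul, mul_add, mul_smul_comm, smul_mul_assoc, mul_assoc, h1, h1', h2,
        h2', h3, h3', h4, smul_sub, smul_add, smul_smul]
      module
  K_mul j j' hj hj' := by
    have G := gen_relations (q := q) (ℓ := ℓ) (m := ℓ)
    have hj2 := Fin.lt_def.1 hj
    have h4 : ∀ x, gen q ℓ (.K j) * (gen q ℓ (.K i) * x) = gen q ℓ (.K i) * (gen q ℓ (.K j) * x) :=
      fun x => by rw [← mul_assoc, G.K_K, mul_assoc]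
    rw [if_neg hj.ne']
    split_ifs with hji
    · subst hji
      have h1 := G.K_F_adj (Or.inr h)
      have h1' := qcomm_assoc h1
      have h2 := commute_K_Nel (q := q) j j
      have h3 := (h2.mul_right h2).eq
      rw [mul_smul_comm, mul_assoc (gen q ℓ (.K i)), h4, h1', h3]
      simp only [mul_smul_comm, smul_mul_assoc, mul_assoc, smul_smul, mul_comm]
    · have hj3 : i' < j := by
        rw [Fin.lt_def]
        have : (j : ℕ) ≠ i' := fun h => hji (Fin.ext h)
        omega
      have hj4 := Fin.lt_def.1 hj3
      have h1 := (G.F_K_far (i := j) (j := i) (by omega)).symm.eq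
      have h1' : ∀ x, gen q ℓ (.K j) * (gen q ℓ (.F i) * x) = gen q ℓ (.F i) * (gen q ℓ (.K j) * x) :=
        fun x => by rw [← mul_assoc, h1, mul_assoc]
      have h5 := hr.K_mul j j' hj3 hj'
      have h5' := qcomm_assoc h5
      simp only [mul_sub, sub_mul, mul_smul_comm, smul_mul_assoc, mul_assoc, h4, h5, h5', h1, h1',
        smul_sub, smul_smul, mul_comm]
  comul := by
    have G := gen_relations (q := q) (ℓ := ℓ) (m := ℓ)
    have Y := Yel_isLowering (q := q) (ℓ := ℓ)
    have h0 := qhalf_ne_zero q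
    have hii : i ≠ i' := by rintro rfl; omega
    -- Ψ is the operation of the recursion, transported to U ⊗ U by the coproduct.
    set Ψ : Uq q ℓ ℓ ⊗[ℂ] Uq q ℓ ℓ → Uq q ℓ ℓ ⊗[ℂ] Uq q ℓ ℓ := fun x =>
      comulU q ℓ ℓ (gen q ℓ (.K i)) * (x * comulU q ℓ ℓ (gen q ℓ (.F i))
        - (qhalf q)⁻¹ • (comulU q ℓ ℓ (gen q ℓ (.F i)) * x)) with hΨ
    have hadd : ∀ x z, Ψ (x + z) = Ψ x + Ψ z := by
      intro x z; simp only [hΨ, add_mul, mul_add, mul_sub, smul_add]; abel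
    have hsum : ∀ (s : Finset (Fin ℓ)) (g : Fin ℓ → Uq q ℓ ℓ ⊗[ℂ] Uq q ℓ ℓ),
        Ψ (∑ j ∈ s, g j) = ∑ j ∈ s, Ψ (g j) := by
      intro s g
      simp only [hΨ, Finset.sum_mul, Finset.mul_sum, Finset.smul_sum, ← Finset.sum_sub_distrib]
    have hΔ : comulU q ℓ ℓ (Yel q ℓ i) = Ψ (comulU q ℓ ℓ (Yel q ℓ i')) := by
      rw [Y.step i i' h]
      simp only [map_mul, map_sub, map_smul, hΨ]
    -- Here K_i y_{i+1} = t y_{i+1} K_i makes the coefficient t^{-1} t = 1 in the first leg, whose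
    -- commutator 1 · F_i - F_i · 1 then vanishes.
    have hone : Ψ (1 ⊗ₜ Yel q ℓ i') = 1 ⊗ₜ Yel q ℓ i := by
      simp only [hΨ]
      rw [comul_step i _ _ _ _ (Y.K_succ G h) rfl, inv_mul_cancel₀ h0, Y.step i i' h]
      simp only [one_mul, mul_one, one_smul, sub_self, mul_zero, TensorProduct.zero_tmul, zero_add,
        G.K_Kinv, mul_sub, TensorProduct.tmul_sub, TensorProduct.tmul_smul, mul_smul_comm]
    -- The diagonal contribution y_i ⊗ N_i² of the new row is produced by the old term of index i+1,
    -- not by that of index i, which is zero. The two conditional terms record this shift of index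
    -- and cancel in the sum over j.
    have hterm : ∀ j, Ψ (Yel q ℓ j ⊗ₜ r j) = Yel q ℓ j ⊗ₜ (if j = i then Nel q ℓ i * Nel q ℓ i else
        if j = i' then (qhalf q * (qhalf q ^ 2 - (qhalf q ^ 2)⁻¹)) •
          (gen q ℓ (.K i) * gen q ℓ (.F i) * (Nel q ℓ i' * Nel q ℓ i')) else
        gen q ℓ (.K i) * (r j * gen q ℓ (.F i) - (qhalf q)⁻¹ • (gen q ℓ (.F i) * r j)))
        + ((if j = i' then Yel q ℓ i ⊗ₜ (Nel q ℓ i * Nel q ℓ i) else 0)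
          - (if j = i then Yel q ℓ i ⊗ₜ (Nel q ℓ i * Nel q ℓ i) else 0)) := by
      intro j
      by_cases hji : j = i
      · subst hji
        rw [if_pos rfl, if_pos rfl, if_neg hii, hr.of_lt j (by rw [Fin.lt_def]; omega)]
        simp [hΨ]
      by_cases hji' : j = i'
      · subst hji'
        have k1 := commute_K_Nel (q := q) i j
        have k2 := (k1.mul_right k1).eq
        have k3 : Nel q ℓ j * Nel q ℓ j * gen q ℓ (.F i)
            = qhalf q ^ 2 • (gen q ℓ (.F i) * (Nel q ℓ j * Nel q ℓ j)) := by
          have k4 := F_Nel_succ (q := q) h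
          have k4' := qcomm_assoc k4
          simp only [k4', k4, mul_smul_comm, mul_assoc]
          match_scalars
          field_simp
        have k5 : gen q ℓ (.K i) * Yel q ℓ j * gen q ℓ (.Kinv i) = qhalf q • Yel q ℓ j := by
          rw [Y.K_succ G h, smul_mul_assoc, mul_assoc, G.K_Kinv, mul_one]
        have k6 : gen q ℓ (.K i) * (Nel q ℓ j * Nel q ℓ j * gen q ℓ (.K i))
            = Nel q ℓ i * Nel q ℓ i := by
          rw [Nel_step h, ← k2, mul_assoc _ (Nel q ℓ j), ← mul_assoc (Nel q ℓ j), ← k1.eq]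
          simp only [mul_assoc]
        rw [if_neg hji, if_pos rfl, if_pos rfl, if_neg hji, sub_zero, hr.self]
        simp only [hΨ]
        rw [comul_step i _ _ (Nel q ℓ j * Nel q ℓ j * gen q ℓ (.K i)) 1 (by rw [k2, one_smul]) rfl,
          mul_one, ← Y.step i j h, k6, k3, k5]
        simp only [mul_smul_comm, TensorProduct.tmul_smul, ← TensorProduct.smul_tmul', mul_assoc]
        match_scalars <;> field_simp
      · rw [if_neg hji, if_neg hji', if_neg hji', if_neg hji, sub_zero, add_zero]
        rcases lt_or_gt_of_ne hji' with hlt | hgt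
        · rw [hr.of_lt j hlt]; simp [hΨ]
        · have hgt' := Fin.lt_def.1 hgt
          have k1 := Y.commute_F_far G (i := j) (j := i) (by omega)
          have k2 := Y.commute_K_far G (i := j) (j := i) (by omega)
          -- For j > i+1 the first leg is an ordinary commutator of y_j and F_i, which is zero, so
          -- only the second leg is changed.
          simp only [hΨ]
          rw [comul_step i _ _ _ _ (hr.K_pred j i h hgt) rfl, inv_mul_cancel₀ h0, one_smul, k1.eq,
            sub_self, mul_zero, TensorProduct.zero_tmul, zero_add, k2.eq, mul_assoc, G.K_Kinv,
            mul_one, mul_sub, TensorProduct.tmul_sub, mul_smul_comm, TensorProduct.tmul_smul]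
    rw [hΔ, hr.comul, hadd, hsum, hone]
    congr 1
    simp only [hterm]
    rw [Finset.sum_add_distrib, Finset.sum_sub_distrib]
    simp

lemma exists_isRow (i : Fin ℓ) : ∃ r, IsRow q ℓ i r := by
  induction i using Fin.down_induction with
  | last i h => exact ⟨_, isRow_last h⟩
  | step i j h ih =>
    obtain ⟨r, hr⟩ := ih
    exact ⟨_, isRow_step h hr⟩

end rootVectors

/-! ### Structure of the quantum Grassmann algebra -/

section grassmannStructure
variable {q : QParam} {ℓ : ℕ}

lemma wedge_apply (v w : Gr ℓ) (s : Finset (Fin ℓ)) : wedge q ℓ v w s =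
    ∑ A ∈ s.powerset, (-qpow q (-1)) ^ crossings A (s \ A) * (v A * w (s \ A)) := rfl

lemma basisGr_apply (s t : Finset (Fin ℓ)) : basisGr s t = if t = s then 1 else 0 := by
  rw [basisGr, Pi.single_apply]

lemma Gr.induction {P : Gr ℓ → Prop} (hb : ∀ s, P (basisGr s)) (hadd : ∀ v w, P v → P w → P (v + w))
    (hsmul : ∀ (c : ℂ) v, P v → P (c • v)) (v : Gr ℓ) : P v := by
  have hv : v = ∑ s, v s • basisGr s := by
    ext t; simp [basisGr_apply]
  have h0 : P 0 := by simpa using hsmul 0 _ (hb ∅)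
  rw [hv]
  exact Finset.sum_induction _ P hadd h0 fun s _ => hsmul _ _ (hb s)

lemma crossings_union_left {A B C : Finset (Fin ℓ)} (h : Disjoint A B) :
    crossings (A ∪ B) C = crossings A C + crossings B C := by
  rw [crossings, Finset.union_product, Finset.filter_union, Finset.card_union_of_disjoint]
  · rfl
  · exact Finset.disjoint_filter_filter (Finset.disjoint_product.2 (Or.inl h))

lemma crossings_union_right {A B C : Finset (Fin ℓ)} (h : Disjoint B C) :
    crossings A (B ∪ C) = crossings A B + crossings A C := by
  rw [crossings, Finset.product_union, Finset.filter_union, Finset.card_union_of_disjoint]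
  · rfl
  · exact Finset.disjoint_filter_filter (Finset.disjoint_product.2 (Or.inr h))

lemma wedge_basisGr (A B : Finset (Fin ℓ)) : wedge q ℓ (basisGr A) (basisGr B) =
    if Disjoint A B then (-qpow q (-1)) ^ crossings A B • basisGr (A ∪ B) else 0 := by
  ext s
  rw [wedge_apply]
  by_cases hA : A ⊆ s
  · rw [Finset.sum_eq_single A]
    · simp only [basisGr_apply, if_true, one_mul]
      by_cases hs : s \ A = B
      · have hd : Disjoint A B := hs ▸ Finset.disjoint_sdiff
        have hu : s = A ∪ B := by rw [← hs, Finset.union_sdiff_of_subset hA]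
        rw [if_pos hs, if_pos hd, hs]
        simp [basisGr_apply, hu]
      · rw [if_neg hs, mul_zero]
        split_ifs with hd
        · have : s ≠ A ∪ B := by
            rintro rfl
            exact hs (by rw [Finset.union_sdiff_left, hd.symm.sdiff_eq_left])
          simp [basisGr_apply, this]
        · rfl
    · intro C _ hC; simp [basisGr_apply, hC]
    · intro h; exact absurd (Finset.mem_powerset.2 hA) h
  · rw [Finset.sum_eq_zero]
    · split_ifs
      · have : s ≠ A ∪ B := by rintro rfl; exact hA Finset.subset_union_left
        simp [basisGr_apply, this]
      · rfl
    · intro C hC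
      have : C ≠ A := by rintro rfl; exact hA (Finset.mem_powerset.1 hC)
      simp [basisGr_apply, this]

/-- On basis vectors with pairwise disjoint index sets, additivity of the number of crossings gives
both sides the exponent c(A,B) + c(A,C) + c(B,C), where c counts crossings; otherwise both sides
vanish. -/
lemma wedge_assoc (u v w : Gr ℓ) :
    wedge q ℓ (wedge q ℓ u v) w = wedge q ℓ u (wedge q ℓ v w) := by
  induction u using Gr.induction with
  | hadd u u' h h' => simp only [map_add, LinearMap.add_apply, h, h']
  | hsmul c u h => simp only [map_smul, LinearMap.smul_apply, h]
  | hb A =>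
  induction v using Gr.induction with
  | hadd u u' h h' => simp only [map_add, LinearMap.add_apply, h, h']
  | hsmul c u h => simp only [map_smul, LinearMap.smul_apply, h]
  | hb B =>
  induction w using Gr.induction with
  | hadd u u' h h' => simp only [map_add, LinearMap.add_apply, h, h']
  | hsmul c u h => simp only [map_smul, LinearMap.smul_apply, h]
  | hb C =>
  rw [wedge_basisGr, wedge_basisGr]
  by_cases hAB : Disjoint A B
  · rw [if_pos hAB, map_smul, LinearMap.smul_apply, wedge_basisGr]
    by_cases hBC : Disjoint B C
    · rw [if_pos hBC, map_smul, wedge_basisGr]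
      by_cases hAC : Disjoint A C
      · rw [if_pos (Finset.disjoint_union_left.2 ⟨hAC, hBC⟩),
          if_pos (Finset.disjoint_union_right.2 ⟨hAB, hAC⟩), smul_smul, smul_smul, ← pow_add,
          ← pow_add, crossings_union_left hAB, crossings_union_right hBC, Finset.union_assoc]
        congr 2; ring
      · rw [if_neg (fun h => hAC (Finset.disjoint_union_left.1 h).1),
          if_neg (fun h => hAC (Finset.disjoint_union_right.1 h).2), smul_zero, smul_zero]
    · rw [if_neg (fun h => hBC (Finset.disjoint_union_left.1 h).2), if_neg hBC, smul_zero, map_zero]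
  · rw [if_neg hAB, map_zero, LinearMap.zero_apply]
    by_cases hBC : Disjoint B C
    · rw [if_pos hBC, map_smul, wedge_basisGr,
        if_neg (fun h => hAB (Finset.disjoint_union_right.1 h).1), smul_zero]
    · rw [if_neg hBC, map_zero]

lemma wedge_one_left (w : Gr ℓ) : wedge q ℓ (basisGr ∅) w = w := by
  induction w using Gr.induction with
  | hadd u u' h h' => simp only [map_add, LinearMap.add_apply, h, h']
  | hsmul c u h => simp only [map_smul, LinearMap.smul_apply, h]
  | hb A => rw [wedge_basisGr]; simp [crossings]

lemma wedge_one_right (w : Gr ℓ) : wedge q ℓ w (basisGr ∅) = w := by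
  induction w using Gr.induction with
  | hadd u u' h h' => simp only [map_add, LinearMap.add_apply, h, h']
  | hsmul c u h => simp only [map_smul, LinearMap.smul_apply, h]
  | hb A => rw [wedge_basisGr]; simp [crossings]

lemma wedge_mem_Wk {k k' : ℕ} {v w : Gr ℓ} (hv : v ∈ Wk ℓ k) (hw : w ∈ Wk ℓ k') :
    wedge q ℓ v w ∈ Wk ℓ (k + k') := by
  intro s hs
  rw [wedge_apply]
  apply Finset.sum_eq_zero
  intro A hA
  have h1 := Finset.card_sdiff_add_card_eq_card (Finset.mem_powerset.1 hA)
  by_cases h : A.card = k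
  · rw [hw (s \ A) (by omega), mul_zero, mul_zero]
  · rw [hv A h, zero_mul, mul_zero]

lemma basisGr_mem_Wk (s : Finset (Fin ℓ)) : basisGr s ∈ Wk ℓ s.card := by
  intro t ht
  rw [basisGr_apply, if_neg]
  rintro rfl; exact ht rfl

/-- The number of elements of `s` below `i`. -/
def below (i : Fin ℓ) (s : Finset (Fin ℓ)) : ℕ := (s.filter (· < i)).card

lemma crossings_singleton_left (i : Fin ℓ) (s : Finset (Fin ℓ)) : crossings {i} s = below i s := by
  rw [crossings, below, Finset.singleton_product, Finset.filter_map, Finset.card_map]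
  rfl

lemma below_sdiff_self (i : Fin ℓ) (s : Finset (Fin ℓ)) : below i (s \ {i}) = below i s := by
  rw [below, below]
  congr 1
  ext x
  simp only [Finset.mem_filter, Finset.mem_sdiff, Finset.mem_singleton]
  constructor
  · rintro ⟨⟨h, _⟩, h'⟩; exact ⟨h, h'⟩
  · rintro ⟨h, h'⟩; exact ⟨⟨h, h'.ne⟩, h'⟩

lemma eL_apply (i : Fin ℓ) (w : Gr ℓ) (s : Finset (Fin ℓ)) : eL q ℓ i w s =
    if i ∈ s then (-qpow q (-1)) ^ below i s * w (s \ {i}) else 0 := by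
  rw [eL, wedge_apply]
  split_ifs with h
  · rw [Finset.sum_eq_single {i}]
    · rw [crossings_singleton_left, below_sdiff_self, basisGr_apply, if_pos rfl, one_mul]
    · intro A _ hA; rw [basisGr_apply, if_neg hA, zero_mul, mul_zero]
    · intro h'; exact absurd (Finset.mem_powerset.2 (Finset.singleton_subset_iff.2 h)) h'
  · apply Finset.sum_eq_zero
    intro A hA
    rw [basisGr_apply, if_neg, zero_mul, mul_zero]
    rintro rfl
    exact h (Finset.singleton_subset_iff.1 (Finset.mem_powerset.1 hA))

lemma eL_eL_self (i : Fin ℓ) (w : Gr ℓ) : eL q ℓ i (eL q ℓ i w) = 0 := by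
  rw [eL, ← wedge_assoc, wedge_basisGr, if_neg (by simp), map_zero, LinearMap.zero_apply]

lemma eL_eL_swap {i j : Fin ℓ} (h : i < j) (w : Gr ℓ) :
    eL q ℓ j (eL q ℓ i w) = -qpow q (-1) • eL q ℓ i (eL q ℓ j w) := by
  have h1 : below i {j} = 0 := by simp [below, h.le]
  have h2 : below j {i} = 1 := by
    rw [below, Finset.filter_singleton, if_pos h, Finset.card_singleton]
  rw [eL, eL, ← wedge_assoc, ← wedge_assoc, wedge_basisGr, wedge_basisGr,
    if_pos (Finset.disjoint_singleton.2 h.ne'), if_pos (Finset.disjoint_singleton.2 h.ne),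
    crossings_singleton_left, crossings_singleton_left, h1, h2, pow_one, pow_zero, one_smul,
    map_smul, LinearMap.smul_apply, Finset.union_comm]

/-- Gr is generated in degree one; with the new element smallest, no power of q appears. This drives
the inductions that extend formulas for e_i ∧ w to all products. -/
lemma basisGr_insert_min {a : Fin ℓ} {s : Finset (Fin ℓ)} (h : ∀ x ∈ s, a < x) :
    basisGr (insert a s) = eL q ℓ a (basisGr s) := by
  have h1 : a ∉ s := fun h' => lt_irrefl _ (h a h')
  have h2 : below a s = 0 := by
    rw [below, Finset.card_eq_zero, Finset.filter_eq_empty_iff]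
    intro x hx; exact (h x hx).not_gt
  rw [eL, wedge_basisGr, if_pos (Finset.disjoint_singleton_left.2 h1), crossings_singleton_left, h2,
    pow_zero, one_smul, Finset.insert_eq]

/-! The representation `σ^N` and the product. -/

variable (q ℓ) in
/-- The operators of the representation `σ^N`. -/
def sg (N : ℤ) : Kq q ℓ →ₐ[ℂ] Module.End ℂ (Gr ℓ) :=
  (Matrix.toLinAlgEquiv' (R := ℂ) (n := Finset (Fin ℓ))).toAlgHom.comp (sigma q ℓ N)

lemma toLin'_qdiag (κ : Finset (Fin ℓ) → ℝ) (w : Gr ℓ) (s : Finset (Fin ℓ)) :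
    Matrix.toLin' (qdiag q κ) w s = qpow q (κ s) * w s := by
  rw [Matrix.toLin'_apply, qdiag, Matrix.mulVec_diagonal]

lemma toLin'_pmat (P : Finset (Fin ℓ) → Prop) [DecidablePred P]
    (τ : Finset (Fin ℓ) → Finset (Fin ℓ)) (w : Gr ℓ) (s : Finset (Fin ℓ)) :
    Matrix.toLin' (pmat P τ) w s = if P s then w (τ s) else 0 := by
  rw [Matrix.toLin'_apply, Matrix.mulVec, dotProduct]
  split_ifs with h <;> simp [pmat_apply, h]

lemma sg_apply (N : ℤ) (h : Kq q ℓ) : sg q ℓ N h = Matrix.toLin' (sigma q ℓ N h) := rfl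

lemma sg_gen (N : ℤ) (x : Gen (ℓ - 1)) : sg q ℓ N (gen q ℓ x) = Matrix.toLin' (repGen q
    (sharp (ℓ := ℓ)) (fun s => (s.card : ℝ) - ℓ * N / (ℓ + 1)) exch x) := by
  rw [sg_apply, sigma, Uq.lift_gen]

variable (N : ℤ) (j : Fin (ℓ - 1))

lemma sg_K (w : Gr ℓ) (s : Finset (Fin ℓ)) :
    sg q ℓ N (gen q ℓ (.K j)) w s = qpow q ((sharp j s : ℝ) / 2) * w s := by
  rw [sg_gen]; exact toLin'_qdiag _ _ _

lemma sg_Kinv (w : Gr ℓ) (s : Finset (Fin ℓ)) :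
    sg q ℓ N (gen q ℓ (.Kinv j)) w s = qpow q (-((sharp j s : ℝ) / 2)) * w s := by
  rw [sg_gen]; exact toLin'_qdiag _ _ _

lemma sg_Khat (w : Gr ℓ) (s : Finset (Fin ℓ)) :
    sg q ℓ N (gen q ℓ .Khat) w s = qpow q ((s.card : ℝ) - ℓ * N / (ℓ + 1)) * w s := by
  rw [sg_gen]; exact toLin'_qdiag _ _ _

lemma sg_KhatInv (w : Gr ℓ) (s : Finset (Fin ℓ)) :
    sg q ℓ N (gen q ℓ .KhatInv) w s = qpow q (-((s.card : ℝ) - ℓ * N / (ℓ + 1))) * w s := by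
  rw [sg_gen]; exact toLin'_qdiag _ _ _

lemma sg_E (w : Gr ℓ) (s : Finset (Fin ℓ)) :
    sg q ℓ N (gen q ℓ (.E j)) w s = if sharp j s = 1 then w (exch j s) else 0 := by
  rw [sg_gen]; exact toLin'_pmat _ _ _ _

lemma sg_F (w : Gr ℓ) (s : Finset (Fin ℓ)) :
    sg q ℓ N (gen q ℓ (.F j)) w s = if sharp j s = -1 then w (exch j s) else 0 := by
  rw [sg_gen]; exact toLin'_pmat _ _ _ _

/-- Multiplicativity of diagonal operators with additive weights. -/
lemma wedge_diag {T : Module.End ℂ (Gr ℓ)} {κ : Finset (Fin ℓ) → ℝ}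
    (hT : ∀ w s, T w s = qpow q (κ s) * w s)
    (hκ : ∀ s A, A ⊆ s → κ s = κ A + κ (s \ A)) (v w : Gr ℓ) :
    T (wedge q ℓ v w) = wedge q ℓ (T v) (T w) := by
  ext s
  rw [hT, wedge_apply, wedge_apply, Finset.mul_sum]
  refine Finset.sum_congr rfl fun A hA => ?_
  rw [hT, hT, hκ s A (Finset.mem_powerset.1 hA), qpow_add]
  ring

lemma sharp_sdiff {A s : Finset (Fin ℓ)} (h : A ⊆ s) : sharp j s = sharp j A + sharp j (s \ A) := by
  have h1 := @h (lo j)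
  have h2 := @h (hi j)
  simp only [sharp, Finset.mem_sdiff]
  by_cases a1 : lo j ∈ A <;> by_cases a2 : hi j ∈ A <;> by_cases a3 : lo j ∈ s <;>
    by_cases a4 : hi j ∈ s <;> simp_all

lemma sg_K_wedge (v w : Gr ℓ) : sg q ℓ N (gen q ℓ (.K j)) (wedge q ℓ v w) =
    wedge q ℓ (sg q ℓ N (gen q ℓ (.K j)) v) (sg q ℓ N (gen q ℓ (.K j)) w) :=
  wedge_diag (sg_K N j) (fun s A h => by rw [sharp_sdiff j h]; push_cast; ring) v w

lemma sg_Kinv_wedge (v w : Gr ℓ) : sg q ℓ N (gen q ℓ (.Kinv j)) (wedge q ℓ v w) =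
    wedge q ℓ (sg q ℓ N (gen q ℓ (.Kinv j)) v) (sg q ℓ N (gen q ℓ (.Kinv j)) w) :=
  wedge_diag (sg_Kinv N j) (fun s A h => by rw [sharp_sdiff j h]; push_cast; ring) v w

/-- Multiplicativity of K̂ requires N = 0: for other N the weight k - ℓN/(ℓ+1) is not additive in
the degree. This is why only the untwisted forms are claimed to be an algebra. -/
lemma sg_Khat_wedge (v w : Gr ℓ) : sg q ℓ 0 (gen q ℓ .Khat) (wedge q ℓ v w) =
    wedge q ℓ (sg q ℓ 0 (gen q ℓ .Khat) v) (sg q ℓ 0 (gen q ℓ .Khat) w) :=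
  wedge_diag (sg_Khat 0) (fun s A h => by
    rw [← Finset.card_sdiff_add_card_eq_card h]; push_cast; ring) v w

lemma sg_KhatInv_wedge (v w : Gr ℓ) : sg q ℓ 0 (gen q ℓ .KhatInv) (wedge q ℓ v w) =
    wedge q ℓ (sg q ℓ 0 (gen q ℓ .KhatInv) v) (sg q ℓ 0 (gen q ℓ .KhatInv) w) :=
  wedge_diag (sg_KhatInv 0) (fun s A h => by
    rw [← Finset.card_sdiff_add_card_eq_card h]; push_cast; ring) v w

/-! ### Exchange of j and j+1 in index sets, and the action of E_j and F_j on exterior products. -/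

lemma lo_ne_hi : lo j ≠ hi j := by simp [lo, hi]

/-- The weight of the basis vector of index i under K_j is the number `wt` that governs the
commutation of y_i with K_j; in the symbol of ∂̄ the two powers of q are inverse to each other. -/
lemma sharp_singleton (i : Fin ℓ) : (sharp j {i} : ℝ) / 2 = IsLowering.wt i (lo j) := by
  have := lo_ne_hi j
  by_cases h1 : i = lo j
  · subst h1; rw [IsLowering.wt_self]; simp [sharp, this.symm]
  by_cases h2 : i = hi j
  · subst h2; rw [IsLowering.wt_succ (by simp [lo, hi])]; simp [sharp, this]; norm_num
  rw [IsLowering.wt_of_ne h1 (fun h => h2 (Fin.ext (by simpa [lo, hi] using h.symm)))]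
  simp [sharp, Ne.symm h1, Ne.symm h2]

lemma sharp_eq_one {s : Finset (Fin ℓ)} : sharp j s = 1 ↔ lo j ∈ s ∧ hi j ∉ s := by
  unfold sharp; split_ifs <;> simp_all

lemma sharp_eq_neg_one {s : Finset (Fin ℓ)} : sharp j s = -1 ↔ lo j ∉ s ∧ hi j ∈ s := by
  unfold sharp; split_ifs <;> simp_all

lemma below_exch {i : Fin ℓ} (h1 : i ≠ lo j) (h2 : i ≠ hi j) (s : Finset (Fin ℓ)) :
    below i (exch j s) = below i s := by
  rw [below, below, exch, Finset.filter_map, Finset.card_map]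
  congr 1
  apply Finset.filter_congr
  intro x _
  have e1 : (lo j : Fin ℓ) < i ↔ hi j < i := by
    have a1 : (i : ℕ) ≠ j := fun h => h1 (Fin.ext h)
    have a2 : (i : ℕ) ≠ j + 1 := fun h => h2 (Fin.ext h)
    simp only [Fin.lt_def, lo, hi]; omega
  simp only [Function.comp, Equiv.toEmbedding_apply]
  rw [Equiv.swap_apply_def]
  split_ifs with a b
  · subst a; exact e1.symm
  · subst b; exact e1
  · rfl

lemma below_hi (s : Finset (Fin ℓ)) :
    below (hi j) s = below (lo j) s + if lo j ∈ s then 1 else 0 := by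
  have e : s.filter (· < hi j) = s.filter (· < lo j) ∪ s.filter (· = lo j) := by
    ext x
    simp only [Finset.mem_filter, Finset.mem_union, Fin.lt_def, Fin.ext_iff, lo, hi]
    constructor
    · rintro ⟨h, h'⟩
      rcases Nat.lt_succ_iff_lt_or_eq.1 h' with h' | h' <;> simp [h, h']
    · rintro (⟨h, h'⟩ | ⟨h, h'⟩) <;> exact ⟨h, by omega⟩
  rw [below, e, Finset.card_union_of_disjoint]
  · rw [below]
    congr 1
    rw [Finset.filter_eq']
    split_ifs <;> simp
  · rw [Finset.disjoint_filter]
    intro x _ h h'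
    exact h.ne h'

lemma below_lo_exch (s : Finset (Fin ℓ)) : below (lo j) (exch j s) = below (lo j) s := by
  rw [below, below, exch, Finset.filter_map, Finset.card_map]
  congr 1
  apply Finset.filter_congr
  intro x _
  simp only [Function.comp, Equiv.toEmbedding_apply, Fin.lt_def]
  rw [Equiv.swap_apply_def]
  split_ifs with a b
  · subst a; simp [lo, hi]
  · subst b; simp [lo, hi]
  · rfl

lemma exch_sdiff (s A : Finset (Fin ℓ)) : exch j (s \ A) = exch j s \ exch j A := by
  rw [exch, exch, exch, Finset.map_sdiff]

lemma exch_singleton (i : Fin ℓ) : exch j {i} = {Equiv.swap (lo j) (hi j) i} := by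
  rw [exch, Finset.map_singleton]; rfl

lemma exch_exch (s : Finset (Fin ℓ)) : exch j (exch j s) = s := by
  ext x; simp [mem_exch]

lemma exch_eq_self_of_mem {s : Finset (Fin ℓ)} (h1 : lo j ∈ s) (h2 : hi j ∈ s) : exch j s = s := by
  ext x
  rw [mem_exch, Equiv.swap_apply_def]
  split_ifs with a b
  · subst a; simp [h1, h2]
  · subst b; simp [h1, h2]
  · rfl

lemma exch_eq_self_of_notMem {s : Finset (Fin ℓ)} (h1 : lo j ∉ s) (h2 : hi j ∉ s) :
    exch j s = s := by
  ext x
  rw [mem_exch, Equiv.swap_apply_def]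
  split_ifs with a b
  · subst a; simp [h1, h2]
  · subst b; simp [h1, h2]
  · rfl

lemma mem_lo_exch (s : Finset (Fin ℓ)) : lo j ∈ exch j s ↔ hi j ∈ s := by
  rw [mem_exch, Equiv.swap_apply_left]

lemma mem_hi_exch (s : Finset (Fin ℓ)) : hi j ∈ exch j s ↔ lo j ∈ s := by
  rw [mem_exch, Equiv.swap_apply_right]

lemma sharp_exch (s : Finset (Fin ℓ)) : sharp j (exch j s) = - sharp j s := by
  simp only [sharp, mem_exch, Equiv.swap_apply_left, Equiv.swap_apply_right]; ring

lemma exch_sdiff_lo {s : Finset (Fin ℓ)} (h1 : lo j ∈ s) (h2 : hi j ∈ s) :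
    exch j (s \ {lo j}) = s \ {hi j} := by
  rw [exch_sdiff, exch_singleton, exch_eq_self_of_mem j h1 h2, Equiv.swap_apply_left]

lemma exch_sdiff_hi {s : Finset (Fin ℓ)} (h1 : lo j ∈ s) (h2 : hi j ∈ s) :
    exch j (s \ {hi j}) = s \ {lo j} := by
  rw [exch_sdiff, exch_singleton, exch_eq_self_of_mem j h1 h2, Equiv.swap_apply_right]

/-- This is Δ(E_j) = E_j ⊗ K_j + K_j^{-1} ⊗ E_j applied to a product whose left factor has degree
one. It is verified componentwise and is the base of `sg_E_wedge`. -/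
lemma sg_E_eL (i : Fin ℓ) (w : Gr ℓ) : sg q ℓ N (gen q ℓ (.E j)) (eL q ℓ i w) =
    (if i = hi j then eL q ℓ (lo j) (sg q ℓ N (gen q ℓ (.K j)) w) else 0)
      + qpow q (-IsLowering.wt i (lo j)) • eL q ℓ i (sg q ℓ N (gen q ℓ (.E j)) w) := by
  have hne := lo_ne_hi j
  ext s
  rw [Pi.add_apply, Pi.smul_apply, sg_E, smul_eq_mul]
  by_cases h1 : i = lo j
  · subst h1
    rw [if_neg hne]
    simp only [eL_apply, sg_E, mem_lo_exch, sharp_eq_one, Finset.mem_sdiff, Finset.mem_singleton]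
    by_cases a : lo j ∈ s <;> by_cases b : hi j ∈ s <;> simp [a, b]
  by_cases h2 : i = hi j
  · subst h2
    rw [if_pos rfl, IsLowering.wt_succ (show (lo j : ℕ) + 1 = (hi j : Fin ℓ) from rfl), neg_neg]
    simp only [eL_apply, sg_E, sg_K, mem_hi_exch, sharp_eq_one, Finset.mem_sdiff,
      Finset.mem_singleton]
    by_cases a : lo j ∈ s
    · by_cases b : hi j ∈ s
      -- When s contains both j and j+1 the left side is zero, and the two terms on the right
      -- cancel: j+1 has one more element of s below it than j, which gives the factor -q^{-1}
      -- between them.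
      · have e1 : sharp j (s \ {lo j}) = -1 := by
          rw [sharp_eq_neg_one]; simp [b, hne.symm]
        simp only [a, b, hne, exch_sdiff_hi j a b, e1, below_hi, if_true, not_true, and_false,
          if_false, not_false_iff, and_self]
        have e2 : qpow q (1 / 2) * qpow q (-1) = qpow q (((-1 : ℤ) : ℝ) / 2) := by
          rw [← qpow_add]; norm_num
        rw [← e2, pow_succ]; ring
      · have e1 : sharp j (s \ {lo j}) = 0 := by simp [sharp, b]
        have e2 : exch j s \ {hi j} = s \ {lo j} := by
          rw [← exch_eq_self_of_notMem j (s := s \ {lo j}) (by simp) (by simp [b]), exch_sdiff,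
            exch_singleton, Equiv.swap_apply_left]
        simp [a, b, e1, e2, below_hi, mem_lo_exch, below_lo_exch]
    · by_cases b : hi j ∈ s <;> simp [a, b]
  · rw [if_neg h2, IsLowering.wt_of_ne h1
      (fun h => h2 (Fin.ext (by simpa [lo, hi] using h.symm))), neg_zero, qpow_zero, one_mul]
    have e : Equiv.swap (lo j) (hi j) i = i := Equiv.swap_apply_of_ne_of_ne h1 h2
    have e2 : exch j (s \ {i}) = exch j s \ {i} := by rw [exch_sdiff, exch_singleton, e]
    simp only [eL_apply, sg_E, sharp_eq_one, mem_exch, e, below_exch j h1 h2, Finset.mem_sdiff,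
      Finset.mem_singleton, Ne.symm h1, Ne.symm h2, not_false_iff, and_true, e2, Pi.zero_apply,
      zero_add]
    split_ifs <;> simp

lemma sg_F_eL (i : Fin ℓ) (w : Gr ℓ) : sg q ℓ N (gen q ℓ (.F j)) (eL q ℓ i w) =
    (if i = lo j then eL q ℓ (hi j) (sg q ℓ N (gen q ℓ (.K j)) w) else 0)
      + qpow q (-IsLowering.wt i (lo j)) • eL q ℓ i (sg q ℓ N (gen q ℓ (.F j)) w) := by
  have hne := lo_ne_hi j
  ext s
  rw [Pi.add_apply, Pi.smul_apply, sg_F, smul_eq_mul]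
  by_cases h2 : i = hi j
  · subst h2
    rw [if_neg hne.symm]
    simp only [eL_apply, sg_F, mem_hi_exch, sharp_eq_neg_one, Finset.mem_sdiff,
      Finset.mem_singleton]
    by_cases a : lo j ∈ s <;> by_cases b : hi j ∈ s <;> simp [a, b]
  by_cases h1 : i = lo j
  · subst h1
    rw [if_pos rfl, IsLowering.wt_self]
    simp only [eL_apply, sg_F, sg_K, mem_lo_exch, sharp_eq_neg_one, Finset.mem_sdiff,
      Finset.mem_singleton]
    by_cases b : hi j ∈ s
    · by_cases a : lo j ∈ s
      -- The same cancellation as for E_j, with the roles of j and j+1 exchanged.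
      · have e1 : sharp j (s \ {hi j}) = 1 := by
          rw [sharp_eq_one]; simp [a, hne]
        simp only [a, b, hne.symm, exch_sdiff_lo j a b, e1, below_hi, if_true, not_true, false_and,
          if_false, not_false_iff, and_self, and_true, true_and, and_false]
        have e2 : qpow q (((1 : ℤ) : ℝ) / 2) * qpow q (-1) = qpow q (-(1 / 2)) := by
          rw [← qpow_add]; norm_num
        rw [← e2, pow_succ]; ring
      · have e1 : sharp j (s \ {hi j}) = 0 := by simp [sharp, a]
        have e2 : exch j s \ {lo j} = s \ {hi j} := by
          rw [← exch_eq_self_of_notMem j (s := s \ {hi j}) (by simp [a]) (by simp), exch_sdiff,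
            exch_singleton, Equiv.swap_apply_right]
        simp [a, b, e1, e2, below_hi, mem_lo_exch, below_lo_exch]
    · by_cases a : lo j ∈ s <;> simp [a, b]
  · rw [if_neg h1, IsLowering.wt_of_ne h1
      (fun h => h2 (Fin.ext (by simpa [lo, hi] using h.symm))), neg_zero, qpow_zero, one_mul]
    have e : Equiv.swap (lo j) (hi j) i = i := Equiv.swap_apply_of_ne_of_ne h1 h2
    have e2 : exch j (s \ {i}) = exch j s \ {i} := by rw [exch_sdiff, exch_singleton, e]
    simp only [eL_apply, sg_F, sharp_eq_neg_one, mem_exch, e, below_exch j h1 h2, Finset.mem_sdiff,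
      Finset.mem_singleton, Ne.symm h1, Ne.symm h2, not_false_iff, and_true, e2, Pi.zero_apply,
      zero_add]
    split_ifs <;> simp

lemma sg_K_basisGr (s : Finset (Fin ℓ)) : sg q ℓ N (gen q ℓ (.K j)) (basisGr s)
    = qpow q ((sharp j s : ℝ) / 2) • basisGr s := by
  ext t
  rw [sg_K, Pi.smul_apply, basisGr_apply]
  split_ifs with h <;> simp [h]

lemma sg_Kinv_basisGr (s : Finset (Fin ℓ)) : sg q ℓ N (gen q ℓ (.Kinv j)) (basisGr s)
    = qpow q (-((sharp j s : ℝ) / 2)) • basisGr s := by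
  ext t
  rw [sg_Kinv, Pi.smul_apply, basisGr_apply]
  split_ifs with h <;> simp [h]

lemma sg_E_basisGr (s : Finset (Fin ℓ)) : sg q ℓ N (gen q ℓ (.E j)) (basisGr s)
    = if sharp j s = -1 then basisGr (exch j s) else 0 := by
  ext t
  have h1 : exch j t = s ↔ t = exch j s :=
    ⟨fun h => by rw [← h, exch_exch], fun h => by rw [h, exch_exch]⟩
  rw [sg_E, basisGr_apply]
  simp only [h1]
  by_cases h : t = exch j s
  · subst h
    rw [sharp_exch]
    simp only [if_true, neg_eq_iff_eq_neg]
    split_ifs <;> simp [basisGr_apply]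
  · simp only [h, if_false, ite_self]
    split_ifs <;> simp [basisGr_apply, h]

lemma sg_F_basisGr (s : Finset (Fin ℓ)) : sg q ℓ N (gen q ℓ (.F j)) (basisGr s)
    = if sharp j s = 1 then basisGr (exch j s) else 0 := by
  ext t
  have h1 : exch j t = s ↔ t = exch j s :=
    ⟨fun h => by rw [← h, exch_exch], fun h => by rw [h, exch_exch]⟩
  rw [sg_F, basisGr_apply]
  simp only [h1]
  by_cases h : t = exch j s
  · subst h
    rw [sharp_exch]
    simp only [if_true, neg_inj]
    split_ifs <;> simp [basisGr_apply]
  · simp only [h, if_false, ite_self]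
    split_ifs <;> simp [basisGr_apply, h]

/-- Gr is a module algebra for U_q(su(ℓ)). Once the rule holds for left factors of degree one it
extends by associativity, since the twisting operators K_j and K_j^{-1} are multiplicative. -/
lemma sg_E_wedge (v w : Gr ℓ) : sg q ℓ N (gen q ℓ (.E j)) (wedge q ℓ v w) =
    wedge q ℓ (sg q ℓ N (gen q ℓ (.E j)) v) (sg q ℓ N (gen q ℓ (.K j)) w)
    + wedge q ℓ (sg q ℓ N (gen q ℓ (.Kinv j)) v) (sg q ℓ N (gen q ℓ (.E j)) w) := by
  induction v using Gr.induction with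
  | hadd u u' h h' => simp only [map_add, LinearMap.add_apply, h, h']; abel
  | hsmul c u h => simp only [map_smul, LinearMap.smul_apply, h, smul_add]
  | hb s =>
    have hsing : ∀ (i : Fin ℓ) (w : Gr ℓ), sg q ℓ N (gen q ℓ (.E j)) (wedge q ℓ (basisGr {i}) w) =
        wedge q ℓ (sg q ℓ N (gen q ℓ (.E j)) (basisGr {i})) (sg q ℓ N (gen q ℓ (.K j)) w)
        + wedge q ℓ (sg q ℓ N (gen q ℓ (.Kinv j)) (basisGr {i})) (sg q ℓ N (gen q ℓ (.E j)) w) := by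
      intro i w
      have h1 : sharp j {i} = -1 ↔ i = hi j := by
        rw [sharp_eq_neg_one, Finset.mem_singleton, Finset.mem_singleton]
        have := lo_ne_hi j
        constructor
        · rintro ⟨_, h⟩; exact h.symm
        · rintro rfl; exact ⟨this, rfl⟩
      have h2 := sg_E_eL (q := q) N j i w
      rw [eL] at h2
      rw [h2, sg_E_basisGr, sg_Kinv_basisGr, sharp_singleton, map_smul, LinearMap.smul_apply]
      congr 1
      simp only [h1]
      split_ifs with h
      · subst h; rw [exch_singleton, Equiv.swap_apply_right]; rfl
      · rw [map_zero, LinearMap.zero_apply]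
    induction s using Finset.induction_on_min generalizing w with
    | empty =>
      rw [sg_E_basisGr, sg_Kinv_basisGr, if_neg (by simp [sharp])]
      simp [sharp, wedge_one_left]
    | insert a s ha ih =>
      -- The degree one rule is used twice, for the product of three factors and for the vector e_a
      -- ∧ e_s itself.
      rw [basisGr_insert_min (q := q) ha, eL, wedge_assoc, hsing, ih, hsing, map_add,
        sg_K_wedge, sg_Kinv_wedge]
      simp only [map_add, LinearMap.add_apply, wedge_assoc]
      abel

lemma sg_F_wedge (v w : Gr ℓ) : sg q ℓ N (gen q ℓ (.F j)) (wedge q ℓ v w) =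
    wedge q ℓ (sg q ℓ N (gen q ℓ (.F j)) v) (sg q ℓ N (gen q ℓ (.K j)) w)
    + wedge q ℓ (sg q ℓ N (gen q ℓ (.Kinv j)) v) (sg q ℓ N (gen q ℓ (.F j)) w) := by
  induction v using Gr.induction with
  | hadd u u' h h' => simp only [map_add, LinearMap.add_apply, h, h']; abel
  | hsmul c u h => simp only [map_smul, LinearMap.smul_apply, h, smul_add]
  | hb s =>
    have hsing : ∀ (i : Fin ℓ) (w : Gr ℓ), sg q ℓ N (gen q ℓ (.F j)) (wedge q ℓ (basisGr {i}) w) =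
        wedge q ℓ (sg q ℓ N (gen q ℓ (.F j)) (basisGr {i})) (sg q ℓ N (gen q ℓ (.K j)) w)
        + wedge q ℓ (sg q ℓ N (gen q ℓ (.Kinv j)) (basisGr {i})) (sg q ℓ N (gen q ℓ (.F j)) w) := by
      intro i w
      have h1 : sharp j {i} = 1 ↔ i = lo j := by
        rw [sharp_eq_one, Finset.mem_singleton, Finset.mem_singleton]
        have := lo_ne_hi j
        constructor
        · rintro ⟨h, _⟩; exact h.symm
        · rintro rfl; exact ⟨rfl, this.symm⟩
      have h2 := sg_F_eL (q := q) N j i w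
      rw [eL] at h2
      rw [h2, sg_F_basisGr, sg_Kinv_basisGr, sharp_singleton, map_smul, LinearMap.smul_apply]
      congr 1
      simp only [h1]
      split_ifs with h
      · subst h; rw [exch_singleton, Equiv.swap_apply_left]; rfl
      · rw [map_zero, LinearMap.zero_apply]
    induction s using Finset.induction_on_min generalizing w with
    | empty =>
      rw [sg_F_basisGr, sg_Kinv_basisGr, if_neg (by simp [sharp])]
      simp [sharp, wedge_one_left]
    | insert a s ha ih =>
      rw [basisGr_insert_min (q := q) ha, eL, wedge_assoc, hsing, ih, hsing, map_add,
        sg_K_wedge, sg_Kinv_wedge]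
      simp only [map_add, LinearMap.add_apply, wedge_assoc]
      abel

end grassmannStructure

/-! ### The Dolbeault operator as an element of a tensor product algebra -/

section symbols
variable {q : QParam} {ℓ : ℕ}

instance : StarRing (Uq q ℓ ℓ) where
  star := starU q ℓ
  star_involutive := starU_starU
  star_mul := starU_mul
  star_add := starU_add

lemma star_eq_starU (h : Uq q ℓ ℓ) : star h = starU q ℓ h := rfl

instance : StarModule ℂ (Uq q ℓ ℓ) where
  star_smul := starU_smul

/-- Matrices indexed by the subsets of `{1, …, ℓ}`. -/
abbrev GrMat (ℓ : ℕ) := Matrix (Finset (Fin ℓ)) (Finset (Fin ℓ)) ℂ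

variable (q ℓ) in
/-- The algebra acting on `A(SU_q(ℓ+1)) ⊗ Gr` through `𝓛` and matrices. -/
abbrev Symb := Uq q ℓ ℓ ⊗[ℂ] GrMat ℓ

lemma star_symb_mul (x y : Symb q ℓ) : star (x * y) = star y * star x := by
  induction x using TensorProduct.induction_on with
  | zero => simp
  | add x x' hx hx' => rw [add_mul, star_add, hx, hx', star_add, mul_add]
  | tmul a b =>
    induction y using TensorProduct.induction_on with
    | zero => simp
    | add y y' hy hy' => rw [mul_add, star_add, hy, hy', star_add, add_mul]
    | tmul c d => simp [Algebra.TensorProduct.tmul_mul_tmul]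

lemma Commute.star_symb {x y : Symb q ℓ} (h : Commute x y) : Commute (star x) (star y) := by
  rw [Commute, SemiconjBy, ← star_symb_mul, ← star_symb_mul, h.eq]

variable (q ℓ) in
/-- The operator with a given symbol. -/
def opOf : Symb q ℓ →ₐ[ℂ] Module.End ℂ (Forms q ℓ) :=
  (Module.endTensorEndAlgHom (R := ℂ) (S := ℂ) (A := ℂ) (M := ASU q ℓ) (N := Gr ℓ)).comp
    (Algebra.TensorProduct.map (LopHom q ℓ)
      (Matrix.toLinAlgEquiv' (R := ℂ) (n := Finset (Fin ℓ))).toAlgHom)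

lemma opOf_tmul (h : Uq q ℓ ℓ) (M : GrMat ℓ) :
    opOf q ℓ (h ⊗ₜ M) = TensorProduct.map (Lop q ℓ h) (Matrix.toLin' M) := rfl

variable (q ℓ) in
/-- The homomorphism `h ↦ h_(1) ⊗ σ^N(h_(2))`. -/
def theta (N : ℤ) : Kq q ℓ →ₐ[ℂ] Symb q ℓ :=
  (Algebra.TensorProduct.map (incl q ℓ) (sigma q ℓ N)).comp (comulU q ℓ (ℓ - 1))

/-- Invariance becomes a condition on symbols: an operator whose symbol commutes with all θ(h)
preserves invariant forms. -/
lemma formAct_eq (N : ℤ) (h : Kq q ℓ) : formAct q ℓ N h = opOf q ℓ (theta q ℓ N h) := by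
  rw [formAct, theta]
  simp only [LinearMap.comp_apply, AlgHom.comp_apply, AlgHom.toLinearMap_apply]
  induction comulU q ℓ (ℓ - 1) h using TensorProduct.induction_on with
  | zero => simp
  | add x y hx hy => simp only [map_add, hx, hy]
  | tmul x y => rfl

lemma incl_gen (x : Gen (ℓ - 1)) :
    incl q ℓ (gen q ℓ x) = gen q ℓ (x.castLE (Nat.sub_le ℓ 1)) := Uq.lift_gen _ _ _

lemma incl_E (j : Fin (ℓ - 1)) : incl q ℓ (gen q ℓ (.E j)) = gen q ℓ (.E (lo j)) := incl_gen _
lemma incl_F (j : Fin (ℓ - 1)) : incl q ℓ (gen q ℓ (.F j)) = gen q ℓ (.F (lo j)) := incl_gen _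
lemma incl_K (j : Fin (ℓ - 1)) : incl q ℓ (gen q ℓ (.K j)) = gen q ℓ (.K (lo j)) := incl_gen _
lemma incl_Kinv (j : Fin (ℓ - 1)) : incl q ℓ (gen q ℓ (.Kinv j)) = gen q ℓ (.Kinv (lo j)) :=
  incl_gen _
lemma incl_Khat : incl q ℓ (gen q ℓ .Khat) = gen q ℓ .Khat := incl_gen _
lemma incl_KhatInv : incl q ℓ (gen q ℓ .KhatInv) = gen q ℓ .KhatInv := incl_gen _

variable (N : ℤ)

lemma theta_gen (x : Gen (ℓ - 1)) : theta q ℓ N (gen q ℓ x) =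
    Algebra.TensorProduct.map (incl q ℓ) (sigma q ℓ N) (comulGen q ℓ (ℓ - 1) x) := by
  rw [theta, AlgHom.comp_apply, comulU_gen]

lemma theta_E (j : Fin (ℓ - 1)) : theta q ℓ N (gen q ℓ (.E j)) =
    gen q ℓ (.E (lo j)) ⊗ₜ sigma q ℓ N (gen q ℓ (.K j))
      + gen q ℓ (.Kinv (lo j)) ⊗ₜ sigma q ℓ N (gen q ℓ (.E j)) := by
  rw [theta_gen, comulGen, map_add, Algebra.TensorProduct.map_tmul, Algebra.TensorProduct.map_tmul,
    incl_E, incl_Kinv]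

lemma theta_F (j : Fin (ℓ - 1)) : theta q ℓ N (gen q ℓ (.F j)) =
    gen q ℓ (.F (lo j)) ⊗ₜ sigma q ℓ N (gen q ℓ (.K j))
      + gen q ℓ (.Kinv (lo j)) ⊗ₜ sigma q ℓ N (gen q ℓ (.F j)) := by
  rw [theta_gen, comulGen, map_add, Algebra.TensorProduct.map_tmul, Algebra.TensorProduct.map_tmul,
    incl_F, incl_Kinv]

lemma theta_K (j : Fin (ℓ - 1)) : theta q ℓ N (gen q ℓ (.K j)) =
    gen q ℓ (.K (lo j)) ⊗ₜ sigma q ℓ N (gen q ℓ (.K j)) := by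
  rw [theta_gen, comulGen, Algebra.TensorProduct.map_tmul, incl_K]

lemma theta_Kinv (j : Fin (ℓ - 1)) : theta q ℓ N (gen q ℓ (.Kinv j)) =
    gen q ℓ (.Kinv (lo j)) ⊗ₜ sigma q ℓ N (gen q ℓ (.Kinv j)) := by
  rw [theta_gen, comulGen, Algebra.TensorProduct.map_tmul, incl_Kinv]

lemma theta_Khat : theta q ℓ N (gen q ℓ .Khat) =
    gen q ℓ .Khat ⊗ₜ sigma q ℓ N (gen q ℓ .Khat) := by
  rw [theta_gen, comulGen, Algebra.TensorProduct.map_tmul, incl_Khat]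

lemma theta_KhatInv : theta q ℓ N (gen q ℓ .KhatInv) =
    gen q ℓ .KhatInv ⊗ₜ sigma q ℓ N (gen q ℓ .KhatInv) := by
  rw [theta_gen, comulGen, Algebra.TensorProduct.map_tmul, incl_KhatInv]

lemma sigma_gen (x : Gen (ℓ - 1)) : sigma q ℓ N (gen q ℓ x) = repGen q
    (sharp (ℓ := ℓ)) (fun s => (s.card : ℝ) - ℓ * N / (ℓ + 1)) exch x := Uq.lift_gen _ _ _

lemma star_qdiag (κ : Finset (Fin ℓ) → ℝ) : star (qdiag q κ) = qdiag q κ := by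
  rw [Matrix.star_eq_conjTranspose, qdiag, Matrix.diagonal_conjTranspose]
  congr 1; ext s; exact conj_qpow q _

lemma star_sigma_E (j : Fin (ℓ - 1)) :
    star (sigma q ℓ N (gen q ℓ (.E j))) = sigma q ℓ N (gen q ℓ (.F j)) := by
  rw [sigma_gen, sigma_gen]
  ext s t
  rw [Matrix.star_apply]
  simp only [repGen, pmat_apply]
  have : (sharp j t = 1 ∧ s = exch j t) ↔ (sharp j s = -1 ∧ t = exch j s) := by
    constructor
    · rintro ⟨h, rfl⟩; exact ⟨by rw [sharp_exch, h], (exch_exch j t).symm⟩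
    · rintro ⟨h, rfl⟩; exact ⟨by rw [sharp_exch, h, neg_neg], (exch_exch j s).symm⟩
  simp only [this]
  split_ifs <;> simp

/-- The involution on the generators. -/
def Gen.adj {m : ℕ} : Gen m → Gen m
  | .E i => .F i
  | .F i => .E i
  | x => x

lemma Gen.adj_adj {m : ℕ} (x : Gen m) : x.adj.adj = x := by cases x <;> rfl

/-- The coproduct and σ^N both respect the involutions. Hence commutation of a symbol with all θ(x)
passes to its adjoint. -/
lemma star_theta_gen (x : Gen (ℓ - 1)) :
    star (theta q ℓ N (gen q ℓ x)) = theta q ℓ N (gen q ℓ x.adj) := by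
  have hF : ∀ j : Fin (ℓ - 1), star (sigma q ℓ N (gen q ℓ (.F j))) = sigma q ℓ N (gen q ℓ (.E j)) :=
    fun j => by rw [← star_sigma_E, star_star]
  rcases x with j | j | j | j | _ | _
  · rw [Gen.adj, theta_E, theta_F, star_add, TensorProduct.star_tmul, TensorProduct.star_tmul,
      star_sigma_E, star_eq_starU, star_eq_starU, starU_E, starU_Kinv, sigma_gen N (.K j),
      repGen, star_qdiag]
  · rw [Gen.adj, theta_E, theta_F, star_add, TensorProduct.star_tmul, TensorProduct.star_tmul,
      hF, star_eq_starU, star_eq_starU, starU_F, starU_Kinv, sigma_gen N (.K j), repGen, star_qdiag]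
  · simp only [Gen.adj]
    rw [theta_K, TensorProduct.star_tmul, star_eq_starU, starU_K, sigma_gen, repGen, star_qdiag]
  · simp only [Gen.adj]
    rw [theta_Kinv, TensorProduct.star_tmul, star_eq_starU, starU_Kinv, sigma_gen, repGen,
      star_qdiag]
  · simp only [Gen.adj]
    rw [theta_Khat, TensorProduct.star_tmul, star_eq_starU, starU_Khat, sigma_gen, repGen,
      star_qdiag]
  · simp only [Gen.adj]
    rw [theta_KhatInv, TensorProduct.star_tmul, star_eq_starU, starU_KhatInv, sigma_gen, repGen,
      star_qdiag]

/-! ### The symbols of ∂̄ and ∂̄†. -/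

variable (q) in
/-- The matrix of `eL`. -/
def eMat (i : Fin ℓ) : GrMat ℓ := LinearMap.toMatrix' (eL q ℓ i)

lemma toLin'_eMat (i : Fin ℓ) : Matrix.toLin' (eMat q i) = eL q ℓ i := Matrix.toLin'_toMatrix' _

lemma grMat_ext {A B : GrMat ℓ} (h : ∀ w, Matrix.toLin' A w = Matrix.toLin' B w) : A = B :=
  Matrix.toLin'.injective (LinearMap.ext h)

lemma sigma_E_mul_eMat (j : Fin (ℓ - 1)) (i : Fin ℓ) : sigma q ℓ N (gen q ℓ (.E j)) * eMat q i =
    (if i = hi j then eMat q (lo j) * sigma q ℓ N (gen q ℓ (.K j)) else 0)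
      + qpow q (-IsLowering.wt i (lo j)) • (eMat q i * sigma q ℓ N (gen q ℓ (.E j))) := by
  apply grMat_ext
  intro w
  rw [Matrix.toLin'_mul, LinearMap.comp_apply, toLin'_eMat, ← sg_apply, sg_E_eL]
  split_ifs <;> simp [Matrix.toLin'_mul, toLin'_eMat, sg_apply]

lemma sigma_F_mul_eMat (j : Fin (ℓ - 1)) (i : Fin ℓ) : sigma q ℓ N (gen q ℓ (.F j)) * eMat q i =
    (if i = lo j then eMat q (hi j) * sigma q ℓ N (gen q ℓ (.K j)) else 0)
      + qpow q (-IsLowering.wt i (lo j)) • (eMat q i * sigma q ℓ N (gen q ℓ (.F j))) := by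
  apply grMat_ext
  intro w
  rw [Matrix.toLin'_mul, LinearMap.comp_apply, toLin'_eMat, ← sg_apply, sg_F_eL]
  split_ifs <;> simp [Matrix.toLin'_mul, toLin'_eMat, sg_apply]

lemma sigma_K_mul_eMat (j : Fin (ℓ - 1)) (i : Fin ℓ) : sigma q ℓ N (gen q ℓ (.K j)) * eMat q i =
    qpow q (IsLowering.wt i (lo j)) • (eMat q i * sigma q ℓ N (gen q ℓ (.K j))) := by
  apply grMat_ext
  intro w
  rw [Matrix.toLin'_mul, LinearMap.comp_apply, toLin'_eMat, ← sg_apply, eL, sg_K_wedge,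
    sg_K_basisGr, sharp_singleton]
  simp [Matrix.toLin'_mul, toLin'_eMat, sg_apply, eL]

lemma sigma_Khat_mul_eMat (i : Fin ℓ) : sigma q ℓ N (gen q ℓ .Khat) * eMat q i =
    qpow q 1 • (eMat q i * sigma q ℓ N (gen q ℓ .Khat)) := by
  apply grMat_ext
  intro w
  rw [Matrix.toLin'_mul, LinearMap.comp_apply, toLin'_eMat, ← sg_apply, map_smul,
    Matrix.toLin'_mul, LinearMap.smul_apply, LinearMap.comp_apply, toLin'_eMat, ← sg_apply]
  ext s
  rw [Pi.smul_apply, sg_Khat, eL_apply, eL_apply]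
  split_ifs with h
  · have h1 := Finset.card_sdiff_add_card_eq_card (Finset.singleton_subset_iff.2 h)
    rw [Finset.card_singleton] at h1
    have e : (s.card : ℝ) - ℓ * N / (ℓ + 1) = 1 + (((s \ {i}).card : ℝ) - ℓ * N / (ℓ + 1)) := by
      rw [← h1]; push_cast; ring
    rw [sg_Khat, e, qpow_add, smul_eq_mul]; ring
  · simp

variable (q ℓ) in
/-- The symbol of the Dolbeault operator. -/
def dbarSymb : Symb q ℓ := ∑ i : Fin ℓ, Yel q ℓ i ⊗ₜ eMat q i

lemma dbar_eq : dbar q ℓ = opOf q ℓ (dbarSymb q ℓ) := by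
  rw [dbar, dbarSymb, map_sum]
  refine Finset.sum_congr rfl fun i _ => ?_
  rw [opOf_tmul, toLin'_eMat]; rfl

/-- The adjoint of K̂ X_i is X_i^* K̂, and the adjoint matrix of an exterior multiplication is the
contraction. -/
lemma dbarDag_eq : dbarDag q ℓ = opOf q ℓ (star (dbarSymb q ℓ)) := by
  rw [dbarDag, dbarSymb, star_sum, map_sum]
  refine Finset.sum_congr rfl fun i _ => ?_
  rw [TensorProduct.star_tmul, opOf_tmul, star_eq_starU, Yel, starU_mul, starU_Khat]; rfl

/-- For i < j one has y_i y_j = q^{-1} y_j y_i and e_j e_i = -q^{-1} e_i e_j, so the terms (i, j)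
and (j, i) are opposite; the diagonal terms vanish since e_i² = 0. -/
lemma dbarSymb_mul_self : dbarSymb q ℓ * dbarSymb q ℓ = 0 := by
  have hs : ∀ i : Fin ℓ, eMat q i * eMat q i = 0 := fun i => by
    apply grMat_ext; intro w
    rw [Matrix.toLin'_mul, LinearMap.comp_apply, toLin'_eMat, eL_eL_self]; simp
  have hlt : ∀ i j : Fin ℓ, i < j → (Yel q ℓ i * Yel q ℓ j) ⊗ₜ[ℂ] (eMat q i * eMat q j)
      + (Yel q ℓ j * Yel q ℓ i) ⊗ₜ[ℂ] (eMat q j * eMat q i) = 0 := fun i j h => by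
    have h1 : eMat q j * eMat q i = -qpow q (-1) • (eMat q i * eMat q j) := by
      apply grMat_ext; intro w
      rw [Matrix.toLin'_mul, LinearMap.comp_apply, toLin'_eMat, toLin'_eMat, eL_eL_swap h]
      simp [Matrix.toLin'_mul, toLin'_eMat]
    rw [h1, Yel_isLowering.mul_mul gen_relations h, ← TensorProduct.smul_tmul', neg_smul,
      TensorProduct.tmul_neg, TensorProduct.tmul_smul, add_neg_cancel]
  rw [dbarSymb, Finset.sum_mul_sum]
  simp only [Algebra.TensorProduct.tmul_mul_tmul]
  set f : Fin ℓ → Fin ℓ → Symb q ℓ :=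
    fun i j => (Yel q ℓ i * Yel q ℓ j) ⊗ₜ (eMat q i * eMat q j) with hf
  have hz : ∀ i j, f i j + f j i = 0 := fun i j => by
    rcases lt_trichotomy i j with h | h | h
    · exact hlt i j h
    · subst h; simp [hf, hs]
    · rw [add_comm]; exact hlt j i h
  have h2 : (2 : ℂ) • ∑ i, ∑ j, f i j = 0 := by
    rw [two_smul]
    nth_rewrite 2 [Finset.sum_comm]
    simp only [← Finset.sum_add_distrib, hz, Finset.sum_const_zero]
  exact (smul_eq_zero.1 h2).resolve_left two_ne_zero

lemma commute_of_inv {B : Type*} [Ring B] {d k ki : B} (h : Commute k d) (h1 : k * ki = 1)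
    (h2 : ki * k = 1) : Commute ki d := by
  rw [Commute, SemiconjBy]
  calc ki * d = ki * (d * k) * ki := by rw [mul_assoc, mul_assoc, h1, mul_one]
    _ = d * ki := by rw [← h.eq, ← mul_assoc, h2, one_mul]

/-- D is the invariant element of a pairing between two dual vector representations. For K_j and K̂
the weights of y_i and e_i cancel. For E_j and F_j each order of multiplication produces one
inhomogeneous term, from σ(E_j) e_{j+1} or from y_j E_j, respectively from σ(F_j) e_j or from
y_{j+1} F_j. -/
lemma commute_theta_dbarSymb_gen (x : Gen (ℓ - 1)) :
    Commute (theta q ℓ N (gen q ℓ x)) (dbarSymb q ℓ) := by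
  have Y := Yel_isLowering (q := q) (ℓ := ℓ)
  have G := gen_relations (q := q) (ℓ := ℓ) (m := ℓ)
  have G' := gen_relations (q := q) (ℓ := ℓ) (m := ℓ - 1)
  have hlohi : ∀ j : Fin (ℓ - 1), ((lo j : Fin ℓ) : ℕ) + 1 = (hi j : Fin ℓ) := fun _ => rfl
  have hK : ∀ j : Fin (ℓ - 1), Commute (theta q ℓ N (gen q ℓ (.K j))) (dbarSymb q ℓ) := by
    intro j
    rw [Commute, SemiconjBy, theta_K, dbarSymb, Finset.mul_sum, Finset.sum_mul]
    refine Finset.sum_congr rfl fun i _ => ?_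
    rw [Algebra.TensorProduct.tmul_mul_tmul, Algebra.TensorProduct.tmul_mul_tmul,
      Y.K_mul G (hlohi j), sigma_K_mul_eMat, ← TensorProduct.smul_tmul', TensorProduct.tmul_smul,
      smul_smul, ← qpow_add, neg_add_cancel, qpow_zero, one_smul]
  have hKhat : Commute (theta q ℓ N (gen q ℓ .Khat)) (dbarSymb q ℓ) := by
    rw [Commute, SemiconjBy, theta_Khat, dbarSymb, Finset.mul_sum, Finset.sum_mul]
    refine Finset.sum_congr rfl fun i _ => ?_
    rw [Algebra.TensorProduct.tmul_mul_tmul, Algebra.TensorProduct.tmul_mul_tmul,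
      Y.Khat_mul G, sigma_Khat_mul_eMat, ← TensorProduct.smul_tmul', TensorProduct.tmul_smul,
      smul_smul, ← qpow_add, neg_add_cancel, qpow_zero, one_smul]
  have hYK : ∀ (j : Fin (ℓ - 1)) (i : Fin ℓ), Yel q ℓ i * gen q ℓ (.Kinv (lo j)) =
      qpow q (-IsLowering.wt i (lo j)) • (gen q ℓ (.Kinv (lo j)) * Yel q ℓ i) := fun j i =>
    inv_qcomm (G.K_Kinv _) (G.Kinv_K _) (Y.K_mul G (hlohi j) i)
  rcases x with j | j | j | j | _ | _
  · rw [Commute, SemiconjBy, theta_E, dbarSymb, Finset.mul_sum, Finset.sum_mul]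
    -- `e1` and `e2` have the same diagonal terms. Their extra terms are equal as well, but are
    -- attached to i = j+1 and to i = j respectively, so only the sums over i agree.
    have e1 : ∀ i : Fin ℓ, (gen q ℓ (.E (lo j)) ⊗ₜ[ℂ] sigma q ℓ N (gen q ℓ (.K j))
        + gen q ℓ (.Kinv (lo j)) ⊗ₜ sigma q ℓ N (gen q ℓ (.E j))) * Yel q ℓ i ⊗ₜ eMat q i =
        qpow q (IsLowering.wt i (lo j)) • ((gen q ℓ (.E (lo j)) * Yel q ℓ i) ⊗ₜ[ℂ]
          (eMat q i * sigma q ℓ N (gen q ℓ (.K j))))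
        + qpow q (-IsLowering.wt i (lo j)) • ((gen q ℓ (.Kinv (lo j)) * Yel q ℓ i) ⊗ₜ[ℂ]
          (eMat q i * sigma q ℓ N (gen q ℓ (.E j))))
        + if i = hi j then (gen q ℓ (.Kinv (lo j)) * Yel q ℓ (hi j)) ⊗ₜ[ℂ]
          (eMat q (lo j) * sigma q ℓ N (gen q ℓ (.K j))) else 0 := fun i => by
      rw [add_mul, Algebra.TensorProduct.tmul_mul_tmul, Algebra.TensorProduct.tmul_mul_tmul,
        sigma_K_mul_eMat, sigma_E_mul_eMat, TensorProduct.tmul_add, TensorProduct.tmul_smul,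
        TensorProduct.tmul_smul]
      split_ifs with h
      · subst h; abel
      · rw [TensorProduct.tmul_zero]; abel
    have e2 : ∀ i : Fin ℓ, Yel q ℓ i ⊗ₜ[ℂ] eMat q i *
        (gen q ℓ (.E (lo j)) ⊗ₜ[ℂ] sigma q ℓ N (gen q ℓ (.K j))
        + gen q ℓ (.Kinv (lo j)) ⊗ₜ sigma q ℓ N (gen q ℓ (.E j))) =
        qpow q (IsLowering.wt i (lo j)) • ((gen q ℓ (.E (lo j)) * Yel q ℓ i) ⊗ₜ[ℂ]
          (eMat q i * sigma q ℓ N (gen q ℓ (.K j))))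
        + qpow q (-IsLowering.wt i (lo j)) • ((gen q ℓ (.Kinv (lo j)) * Yel q ℓ i) ⊗ₜ[ℂ]
          (eMat q i * sigma q ℓ N (gen q ℓ (.E j))))
        + if i = lo j then (gen q ℓ (.Kinv (lo j)) * Yel q ℓ (hi j)) ⊗ₜ[ℂ]
          (eMat q (lo j) * sigma q ℓ N (gen q ℓ (.K j))) else 0 := fun i => by
      rw [mul_add, Algebra.TensorProduct.tmul_mul_tmul, Algebra.TensorProduct.tmul_mul_tmul,
        Y.mul_E G (hlohi j), hYK, TensorProduct.add_tmul, TensorProduct.smul_tmul',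
        TensorProduct.smul_tmul']
      split_ifs with h
      · subst h; abel
      · rw [TensorProduct.zero_tmul]; abel
    simp only [e1, e2, Finset.sum_add_distrib, Finset.sum_ite_eq', Finset.mem_univ, if_true]
  · rw [Commute, SemiconjBy, theta_F, dbarSymb, Finset.mul_sum, Finset.sum_mul]
    have e1 : ∀ i : Fin ℓ, (gen q ℓ (.F (lo j)) ⊗ₜ[ℂ] sigma q ℓ N (gen q ℓ (.K j))
        + gen q ℓ (.Kinv (lo j)) ⊗ₜ sigma q ℓ N (gen q ℓ (.F j))) * Yel q ℓ i ⊗ₜ eMat q i =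
        qpow q (IsLowering.wt i (lo j)) • ((gen q ℓ (.F (lo j)) * Yel q ℓ i) ⊗ₜ[ℂ]
          (eMat q i * sigma q ℓ N (gen q ℓ (.K j))))
        + qpow q (-IsLowering.wt i (lo j)) • ((gen q ℓ (.Kinv (lo j)) * Yel q ℓ i) ⊗ₜ[ℂ]
          (eMat q i * sigma q ℓ N (gen q ℓ (.F j))))
        + if i = lo j then (gen q ℓ (.Kinv (lo j)) * Yel q ℓ (lo j)) ⊗ₜ[ℂ]
          (eMat q (hi j) * sigma q ℓ N (gen q ℓ (.K j))) else 0 := fun i => by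
      rw [add_mul, Algebra.TensorProduct.tmul_mul_tmul, Algebra.TensorProduct.tmul_mul_tmul,
        sigma_K_mul_eMat, sigma_F_mul_eMat, TensorProduct.tmul_add, TensorProduct.tmul_smul,
        TensorProduct.tmul_smul]
      split_ifs with h
      · subst h; abel
      · rw [TensorProduct.tmul_zero]; abel
    have e2 : ∀ i : Fin ℓ, Yel q ℓ i ⊗ₜ[ℂ] eMat q i *
        (gen q ℓ (.F (lo j)) ⊗ₜ[ℂ] sigma q ℓ N (gen q ℓ (.K j))
        + gen q ℓ (.Kinv (lo j)) ⊗ₜ sigma q ℓ N (gen q ℓ (.F j))) =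
        qpow q (IsLowering.wt i (lo j)) • ((gen q ℓ (.F (lo j)) * Yel q ℓ i) ⊗ₜ[ℂ]
          (eMat q i * sigma q ℓ N (gen q ℓ (.K j))))
        + qpow q (-IsLowering.wt i (lo j)) • ((gen q ℓ (.Kinv (lo j)) * Yel q ℓ i) ⊗ₜ[ℂ]
          (eMat q i * sigma q ℓ N (gen q ℓ (.F j))))
        + if i = hi j then (gen q ℓ (.Kinv (lo j)) * Yel q ℓ (lo j)) ⊗ₜ[ℂ]
          (eMat q (hi j) * sigma q ℓ N (gen q ℓ (.K j))) else 0 := fun i => by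
      rw [mul_add, Algebra.TensorProduct.tmul_mul_tmul, Algebra.TensorProduct.tmul_mul_tmul,
        Y.mul_F G (hlohi j), hYK, TensorProduct.add_tmul, TensorProduct.smul_tmul',
        TensorProduct.smul_tmul']
      split_ifs with h
      · subst h; abel
      · rw [TensorProduct.zero_tmul]; abel
    simp only [e1, e2, Finset.sum_add_distrib, Finset.sum_ite_eq', Finset.mem_univ, if_true]
  · exact hK j
  · exact commute_of_inv (hK j) (by rw [← map_mul, G'.K_Kinv, map_one])
      (by rw [← map_mul, G'.Kinv_K, map_one])
  · exact hKhat
  · exact commute_of_inv hKhat (by rw [← map_mul, G'.Khat_KhatInv, map_one])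
      (by rw [← map_mul, G'.KhatInv_Khat, map_one])

lemma commute_theta_star_dbarSymb_gen (x : Gen (ℓ - 1)) :
    Commute (theta q ℓ N (gen q ℓ x)) (star (dbarSymb q ℓ)) := by
  have := Commute.star_symb (commute_theta_dbarSymb_gen (q := q) N x.adj)
  rwa [star_theta_gen, Gen.adj_adj] at this

lemma dbar_dbar (ω : Forms q ℓ) : dbar q ℓ (dbar q ℓ ω) = 0 := by
  have := congrArg (opOf q ℓ) (dbarSymb_mul_self (q := q) (ℓ := ℓ))
  rw [map_mul, map_zero] at this
  rw [dbar_eq]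
  exact LinearMap.congr_fun this ω

lemma dbarDag_dbarDag (ω : Forms q ℓ) : dbarDag q ℓ (dbarDag q ℓ ω) = 0 := by
  have := congrArg (fun x => opOf q ℓ (star x)) (dbarSymb_mul_self (q := q) (ℓ := ℓ))
  simp only [star_symb_mul, map_mul, star_zero, map_zero] at this
  rw [dbarDag_eq]
  exact LinearMap.congr_fun this ω

end symbols

/-! ### Forms -/

section formsStructure
variable {q : QParam} {ℓ : ℕ}

lemma coord_tmul (s : Finset (Fin ℓ)) (a : ASU q ℓ) (v : Gr ℓ) :
    coord q ℓ s (a ⊗ₜ v) = v s • a := by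
  simp [coord]

lemma sum_coord_tmul (ω : Forms q ℓ) : ∑ s, coord q ℓ s ω ⊗ₜ[ℂ] basisGr s = ω := by
  induction ω using TensorProduct.induction_on with
  | zero => simp
  | add x y hx hy => simp only [map_add, TensorProduct.add_tmul, Finset.sum_add_distrib, hx, hy]
  | tmul a v =>
    have hv : v = ∑ s, v s • basisGr s := by ext t; simp [basisGr_apply]
    conv_rhs => rw [hv, TensorProduct.tmul_sum]
    simp only [coord_tmul, TensorProduct.smul_tmul, TensorProduct.tmul_smul]

lemma forms_ext {ω ω' : Forms q ℓ} (h : ∀ s, coord q ℓ s ω = coord q ℓ s ω') : ω = ω' := by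
  rw [← sum_coord_tmul ω, ← sum_coord_tmul ω']
  simp only [h]

variable (q ℓ) in
/-- The forms of degree `k`. -/
def formsDeg (k : ℕ) : Submodule ℂ (Forms q ℓ) :=
  LinearMap.range ((Wk ℓ k).subtype.lTensor (ASU q ℓ))

lemma tmul_mem_formsDeg {k : ℕ} (a : ASU q ℓ) {v : Gr ℓ} (hv : v ∈ Wk ℓ k) :
    a ⊗ₜ v ∈ formsDeg q ℓ k := ⟨a ⊗ₜ ⟨v, hv⟩, rfl⟩

lemma formsDeg_induction {k : ℕ} {P : Forms q ℓ → Prop} (h0 : P 0)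
    (htmul : ∀ (a : ASU q ℓ) (v : Gr ℓ), v ∈ Wk ℓ k → P (a ⊗ₜ v))
    (hadd : ∀ x y, P x → P y → P (x + y)) {ω : Forms q ℓ} (hω : ω ∈ formsDeg q ℓ k) : P ω := by
  obtain ⟨x, rfl⟩ := hω
  induction x using TensorProduct.induction_on with
  | zero => simpa using h0
  | add x y hx hy => rw [map_add]; exact hadd _ _ hx hy
  | tmul a v => exact htmul a v v.2

lemma coord_eq_zero {k : ℕ} {ω : Forms q ℓ} (hω : ω ∈ formsDeg q ℓ k) {s : Finset (Fin ℓ)}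
    (hs : s.card ≠ k) : coord q ℓ s ω = 0 := by
  refine formsDeg_induction (P := fun ω => coord q ℓ s ω = 0) (map_zero _) (fun a v hv => ?_)
    (fun x y hx hy => ?_) hω
  · rw [coord_tmul, hv s hs, zero_smul]
  · rw [map_add, hx, hy, add_zero]

lemma map_mem_formsDeg {k k' : ℕ} (f : ASU q ℓ →ₗ[ℂ] ASU q ℓ) {g : Gr ℓ →ₗ[ℂ] Gr ℓ}
    (hg : ∀ v ∈ Wk ℓ k, g v ∈ Wk ℓ k') {ω : Forms q ℓ} (hω : ω ∈ formsDeg q ℓ k) :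
    TensorProduct.map f g ω ∈ formsDeg q ℓ k' := by
  refine formsDeg_induction (P := fun ω => TensorProduct.map f g ω ∈ formsDeg q ℓ k') (by simp)
    (fun a v hv => tmul_mem_formsDeg _ (hg v hv)) (fun x y hx hy => ?_) hω
  rw [map_add]; exact add_mem hx hy

lemma wedgeForm_tmul (a b : ASU q ℓ) (v w : Gr ℓ) :
    wedgeForm q ℓ (a ⊗ₜ v) (b ⊗ₜ w) = (a * b) ⊗ₜ wedge q ℓ v w := by
  simp [wedgeForm]

lemma wedgeForm_mem_formsDeg {k k' : ℕ} {ω ω' : Forms q ℓ} (hω : ω ∈ formsDeg q ℓ k)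
    (hω' : ω' ∈ formsDeg q ℓ k') : wedgeForm q ℓ ω ω' ∈ formsDeg q ℓ (k + k') := by
  refine formsDeg_induction (P := fun ω => wedgeForm q ℓ ω ω' ∈ formsDeg q ℓ (k + k')) (by simp)
    (fun a v hv => ?_) (fun x y hx hy => ?_) hω
  · refine formsDeg_induction (P := fun ω' => wedgeForm q ℓ (a ⊗ₜ v) ω' ∈ formsDeg q ℓ (k + k'))
      (by simp) (fun b w hw => ?_) (fun x y hx hy => ?_) hω'
    · rw [wedgeForm_tmul]; exact tmul_mem_formsDeg _ (wedge_mem_Wk hv hw)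
    · rw [map_add]; exact add_mem hx hy
  · rw [map_add, LinearMap.add_apply]; exact add_mem hx hy

lemma dbar_mem_formsDeg {k : ℕ} {ω : Forms q ℓ} (hω : ω ∈ formsDeg q ℓ k) :
    dbar q ℓ ω ∈ formsDeg q ℓ (k + 1) := by
  rw [dbar, LinearMap.sum_apply]
  refine sum_mem fun i _ => map_mem_formsDeg _ (fun v hv => ?_) hω
  rw [add_comm]
  exact wedge_mem_Wk (by simpa using basisGr_mem_Wk {i}) hv

lemma iL_mem_Wk {k : ℕ} (i : Fin ℓ) {v : Gr ℓ} (hv : v ∈ Wk ℓ (k + 1)) : iL q ℓ i v ∈ Wk ℓ k := by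
  intro s hs
  rw [iL, Matrix.toLin'_apply, Matrix.mulVec, dotProduct]
  refine Finset.sum_eq_zero fun t _ => ?_
  by_cases ht : t.card = k + 1
  · have h1 : eL q ℓ i (basisGr s) ∈ Wk ℓ (1 + s.card) :=
      wedge_mem_Wk (by simpa using basisGr_mem_Wk {i}) (basisGr_mem_Wk s)
    have h2 : LinearMap.toMatrix' (eL q ℓ i) t s = eL q ℓ i (basisGr s) t := by
      rw [LinearMap.toMatrix'_apply, basisGr]
    rw [Matrix.conjTranspose_apply, h2, h1 t (by omega), star_zero, zero_mul]
  · rw [hv t ht, mul_zero]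

lemma dbarDag_mem_formsDeg {k : ℕ} {ω : Forms q ℓ} (hω : ω ∈ formsDeg q ℓ (k + 1)) :
    dbarDag q ℓ ω ∈ formsDeg q ℓ k := by
  rw [dbarDag, LinearMap.sum_apply]
  exact sum_mem fun i _ => map_mem_formsDeg _ (fun v hv => iL_mem_Wk i hv) hω

/-- Invariance has to be checked on generators only. -/
lemma mem_Omega {k : ℕ} {N : ℤ} {ω : Forms q ℓ} : ω ∈ Omega q ℓ k N ↔ ω ∈ formsDeg q ℓ k ∧
    ∀ x : Gen (ℓ - 1), formAct q ℓ N (gen q ℓ x) ω = counitGen (ℓ - 1) x • ω := by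
  refine ⟨fun h => ⟨h.1, fun x => by rw [h.2, counitU_gen]⟩, fun h => ⟨h.1, fun g => ?_⟩⟩
  induction g using Uq.induction with
  | halg c =>
    rw [formAct_eq, AlgHom.commutes, AlgHom.commutes, AlgHom.commutes]
    rfl
  | hgen x => rw [h.2, counitU_gen]
  | hmul g g' hg hg' =>
    rw [formAct_eq] at *
    rw [map_mul, map_mul, Module.End.mul_apply, hg', map_smul, hg, smul_smul, map_mul, mul_comm]
  | hadd g g' hg hg' => rw [map_add, LinearMap.add_apply, hg, hg', map_add, add_smul]

lemma opOf_invariant {N : ℤ} {ω : Forms q ℓ} {x : Symb q ℓ}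
    (hx : ∀ y : Gen (ℓ - 1), Commute (theta q ℓ N (gen q ℓ y)) x) (y : Gen (ℓ - 1))
    (h : formAct q ℓ N (gen q ℓ y) ω = counitGen (ℓ - 1) y • ω) :
    formAct q ℓ N (gen q ℓ y) (opOf q ℓ x ω) = counitGen (ℓ - 1) y • opOf q ℓ x ω := by
  rw [← map_smul, ← h, formAct_eq, ← Module.End.mul_apply, ← Module.End.mul_apply, ← map_mul,
    ← map_mul, (hx y).eq]

lemma dbar_mem_Omega {k : ℕ} {N : ℤ} {ω : Forms q ℓ} (hω : ω ∈ Omega q ℓ k N) :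
    dbar q ℓ ω ∈ Omega q ℓ (k + 1) N := by
  rw [mem_Omega] at hω ⊢
  refine ⟨dbar_mem_formsDeg hω.1, fun y => ?_⟩
  rw [dbar_eq]
  exact opOf_invariant (commute_theta_dbarSymb_gen N) y (hω.2 y)

lemma dbarDag_mem_Omega {k : ℕ} {N : ℤ} {ω : Forms q ℓ} (hω : ω ∈ Omega q ℓ (k + 1) N) :
    dbarDag q ℓ ω ∈ Omega q ℓ k N := by
  rw [mem_Omega] at hω ⊢
  refine ⟨dbarDag_mem_formsDeg hω.1, fun y => ?_⟩
  rw [dbarDag_eq]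
  exact opOf_invariant (commute_theta_star_dbarSymb_gen N) y (hω.2 y)

lemma coord_opOf_tmul (h : Uq q ℓ ℓ) (M : GrMat ℓ) (s : Finset (Fin ℓ)) (ω : Forms q ℓ) :
    coord q ℓ s (opOf q ℓ (h ⊗ₜ M) ω) = ∑ t, M s t • Lop q ℓ h (coord q ℓ t ω) := by
  induction ω using TensorProduct.induction_on with
  | zero => simp
  | add x y hx hy => simp only [map_add, hx, hy, smul_add, Finset.sum_add_distrib]
  | tmul a v =>
    rw [opOf_tmul, TensorProduct.map_tmul, coord_tmul, Matrix.toLin'_apply, Matrix.mulVec,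
      dotProduct, Finset.sum_smul]
    simp only [coord_tmul, map_smul, smul_smul]

lemma starA_sum {ι : Type*} (s : Finset ι) (f : ι → ASU q ℓ) :
    starA q ℓ (∑ i ∈ s, f i) = ∑ i ∈ s, starA q ℓ (f i) := by
  classical
  induction s using Finset.induction_on with
  | empty => simp [starA_zero]
  | insert a s ha ih => rw [Finset.sum_insert ha, Finset.sum_insert ha, starA_add, ih]

/-- On a symbol h ⊗ M this combines the adjoint property of 𝓛 with the conjugate transpose of M.
With x = D it says that ∂̄† is conjugate to ∂̄. -/
lemma IsHaar.formInner_opOf {φ : ASU q ℓ →ₗ[ℂ] ℂ} (hφ : IsHaar q ℓ φ) (x : Symb q ℓ)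
    (ω ω' : Forms q ℓ) :
    formInner q ℓ φ (opOf q ℓ (star x) ω) ω' = formInner q ℓ φ ω (opOf q ℓ x ω') := by
  induction x using TensorProduct.induction_on with
  | zero => simp [formInner, starA_zero]
  | add x y hx hy =>
    simp only [formInner, star_add, map_add, LinearMap.add_apply, starA_add, add_mul, mul_add,
      Finset.sum_add_distrib] at *
    rw [hx, hy]
  | tmul h M =>
    simp only [formInner, TensorProduct.star_tmul, coord_opOf_tmul, starA_sum, starA_smul,
      Finset.sum_mul, Finset.mul_sum, map_sum, smul_mul_assoc, mul_smul_comm, map_smul,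
      star_eq_starU, hφ.adjoint]
    rw [Finset.sum_comm]
    simp [Matrix.star_apply]

lemma IsHaar.formInner_dbar {φ : ASU q ℓ →ₗ[ℂ] ℂ} (hφ : IsHaar q ℓ φ) (ω ω' : Forms q ℓ) :
    formInner q ℓ φ (dbarDag q ℓ ω) ω' = formInner q ℓ φ ω (dbar q ℓ ω') := by
  rw [dbarDag_eq, dbar_eq, hφ.formInner_opOf]

/-! The product of forms. -/

lemma wedgeForm_assoc (ω ω' ω'' : Forms q ℓ) : wedgeForm q ℓ (wedgeForm q ℓ ω ω') ω''
    = wedgeForm q ℓ ω (wedgeForm q ℓ ω' ω'') := by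
  induction ω using TensorProduct.induction_on with
  | zero => simp
  | add x y hx hy => simp only [map_add, LinearMap.add_apply, hx, hy]
  | tmul a u =>
  induction ω' using TensorProduct.induction_on with
  | zero => simp
  | add x y hx hy => simp only [map_add, LinearMap.add_apply, hx, hy]
  | tmul b v =>
  induction ω'' using TensorProduct.induction_on with
  | zero => simp
  | add x y hx hy => simp only [map_add, LinearMap.add_apply, hx, hy]
  | tmul c w => simp only [wedgeForm_tmul, wedge_assoc, mul_assoc]

lemma ofFun_apply (a : ASU q ℓ) : ofFun q ℓ a = a ⊗ₜ basisGr ∅ := rfl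

lemma wedgeForm_ofFun (a b : ASU q ℓ) :
    wedgeForm q ℓ (ofFun q ℓ a) (ofFun q ℓ b) = ofFun q ℓ (a * b) := by
  rw [ofFun_apply, ofFun_apply, wedgeForm_tmul, wedge_one_left]; rfl

lemma wedgeForm_one_left (ω : Forms q ℓ) : wedgeForm q ℓ (ofFun q ℓ 1) ω = ω := by
  induction ω using TensorProduct.induction_on with
  | zero => simp
  | add x y hx hy => rw [map_add, hx, hy]
  | tmul a v => rw [ofFun_apply, wedgeForm_tmul, wedge_one_left, one_mul]

lemma wedgeForm_one_right (ω : Forms q ℓ) : wedgeForm q ℓ ω (ofFun q ℓ 1) = ω := by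
  induction ω using TensorProduct.induction_on with
  | zero => simp
  | add x y hx hy => rw [map_add, LinearMap.add_apply, hx, hy]
  | tmul a v => rw [ofFun_apply, wedgeForm_tmul, wedge_one_right, mul_one]

lemma formAct_K_tmul (N : ℤ) (j : Fin (ℓ - 1)) (a : ASU q ℓ) (v : Gr ℓ) :
    formAct q ℓ N (gen q ℓ (.K j)) (a ⊗ₜ v) =
      Lop q ℓ (gen q ℓ (.K (lo j))) a ⊗ₜ sg q ℓ N (gen q ℓ (.K j)) v := by
  rw [formAct_eq, theta_K, opOf_tmul]; rfl

lemma formAct_Kinv_tmul (N : ℤ) (j : Fin (ℓ - 1)) (a : ASU q ℓ) (v : Gr ℓ) :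
    formAct q ℓ N (gen q ℓ (.Kinv j)) (a ⊗ₜ v) =
      Lop q ℓ (gen q ℓ (.Kinv (lo j))) a ⊗ₜ sg q ℓ N (gen q ℓ (.Kinv j)) v := by
  rw [formAct_eq, theta_Kinv, opOf_tmul]; rfl

lemma formAct_Khat_tmul (N : ℤ) (a : ASU q ℓ) (v : Gr ℓ) :
    formAct q ℓ N (gen q ℓ .Khat) (a ⊗ₜ v) =
      Lop q ℓ (gen q ℓ .Khat) a ⊗ₜ sg q ℓ N (gen q ℓ .Khat) v := by
  rw [formAct_eq, theta_Khat, opOf_tmul]; rfl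

lemma formAct_KhatInv_tmul (N : ℤ) (a : ASU q ℓ) (v : Gr ℓ) :
    formAct q ℓ N (gen q ℓ .KhatInv) (a ⊗ₜ v) =
      Lop q ℓ (gen q ℓ .KhatInv) a ⊗ₜ sg q ℓ N (gen q ℓ .KhatInv) v := by
  rw [formAct_eq, theta_KhatInv, opOf_tmul]; rfl

lemma formAct_E_tmul (N : ℤ) (j : Fin (ℓ - 1)) (a : ASU q ℓ) (v : Gr ℓ) :
    formAct q ℓ N (gen q ℓ (.E j)) (a ⊗ₜ v) =
      Lop q ℓ (gen q ℓ (.E (lo j))) a ⊗ₜ sg q ℓ N (gen q ℓ (.K j)) v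
      + Lop q ℓ (gen q ℓ (.Kinv (lo j))) a ⊗ₜ sg q ℓ N (gen q ℓ (.E j)) v := by
  rw [formAct_eq, theta_E, map_add, opOf_tmul, opOf_tmul]; rfl

lemma formAct_F_tmul (N : ℤ) (j : Fin (ℓ - 1)) (a : ASU q ℓ) (v : Gr ℓ) :
    formAct q ℓ N (gen q ℓ (.F j)) (a ⊗ₜ v) =
      Lop q ℓ (gen q ℓ (.F (lo j))) a ⊗ₜ sg q ℓ N (gen q ℓ (.K j)) v
      + Lop q ℓ (gen q ℓ (.Kinv (lo j))) a ⊗ₜ sg q ℓ N (gen q ℓ (.F j)) v := by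
  rw [formAct_eq, theta_F, map_add, opOf_tmul, opOf_tmul]; rfl

lemma Lop_mul_group {g : Uq q ℓ ℓ} (hg : comulU q ℓ ℓ g = g ⊗ₜ g) (a b : ASU q ℓ) :
    Lop q ℓ g (a * b) = Lop q ℓ g a * Lop q ℓ g b := by
  rw [Lop_mul, hg, Algebra.TensorProduct.comm_tmul, mulAct_tmul]

lemma Lop_mul_skew {x k k' : Uq q ℓ ℓ} (hx : comulU q ℓ ℓ x = x ⊗ₜ k + k' ⊗ₜ x) (a b : ASU q ℓ) :
    Lop q ℓ x (a * b) = Lop q ℓ k a * Lop q ℓ x b + Lop q ℓ x a * Lop q ℓ k' b := by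
  rw [Lop_mul, hx, map_add, map_add, Algebra.TensorProduct.comm_tmul,
    Algebra.TensorProduct.comm_tmul, mulAct_tmul, mulAct_tmul]

/-- Bilinear maps that agree on pure tensors. -/
lemma forms_bilin_ext {B B' : Forms q ℓ →ₗ[ℂ] Forms q ℓ →ₗ[ℂ] Forms q ℓ}
    (h : ∀ a v b w, B (a ⊗ₜ v) (b ⊗ₜ w) = B' (a ⊗ₜ v) (b ⊗ₜ w)) : B = B' := by
  apply TensorProduct.ext'
  intro a v
  apply TensorProduct.ext'
  intro b w
  exact h a v b w

lemma formAct_K_wedge (N : ℤ) (j : Fin (ℓ - 1)) (ω ω' : Forms q ℓ) :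
    formAct q ℓ N (gen q ℓ (.K j)) (wedgeForm q ℓ ω ω') = wedgeForm q ℓ
      (formAct q ℓ N (gen q ℓ (.K j)) ω) (formAct q ℓ N (gen q ℓ (.K j)) ω') := by
  have : (wedgeForm q ℓ).compr₂ (formAct q ℓ N (gen q ℓ (.K j))) = (wedgeForm q ℓ).compl₁₂
      (formAct q ℓ N (gen q ℓ (.K j))) (formAct q ℓ N (gen q ℓ (.K j))) := by
    apply forms_bilin_ext
    intro a v b w
    simp only [LinearMap.compr₂_apply, LinearMap.compl₁₂_apply, wedgeForm_tmul, formAct_K_tmul,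
      Lop_mul_group (comulU_gen (.K (lo j))), sg_K_wedge]
  exact LinearMap.congr_fun₂ this ω ω'

lemma formAct_Kinv_wedge (N : ℤ) (j : Fin (ℓ - 1)) (ω ω' : Forms q ℓ) :
    formAct q ℓ N (gen q ℓ (.Kinv j)) (wedgeForm q ℓ ω ω') = wedgeForm q ℓ
      (formAct q ℓ N (gen q ℓ (.Kinv j)) ω) (formAct q ℓ N (gen q ℓ (.Kinv j)) ω') := by
  have : (wedgeForm q ℓ).compr₂ (formAct q ℓ N (gen q ℓ (.Kinv j))) = (wedgeForm q ℓ).compl₁₂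
      (formAct q ℓ N (gen q ℓ (.Kinv j))) (formAct q ℓ N (gen q ℓ (.Kinv j))) := by
    apply forms_bilin_ext
    intro a v b w
    simp only [LinearMap.compr₂_apply, LinearMap.compl₁₂_apply, wedgeForm_tmul, formAct_Kinv_tmul,
      Lop_mul_group (comulU_gen (.Kinv (lo j))), sg_Kinv_wedge]
  exact LinearMap.congr_fun₂ this ω ω'

lemma formAct_Khat_wedge (ω ω' : Forms q ℓ) :
    formAct q ℓ 0 (gen q ℓ .Khat) (wedgeForm q ℓ ω ω') = wedgeForm q ℓ
      (formAct q ℓ 0 (gen q ℓ .Khat) ω) (formAct q ℓ 0 (gen q ℓ .Khat) ω') := by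
  have : (wedgeForm q ℓ).compr₂ (formAct q ℓ 0 (gen q ℓ .Khat)) = (wedgeForm q ℓ).compl₁₂
      (formAct q ℓ 0 (gen q ℓ .Khat)) (formAct q ℓ 0 (gen q ℓ .Khat)) := by
    apply forms_bilin_ext
    intro a v b w
    simp only [LinearMap.compr₂_apply, LinearMap.compl₁₂_apply, wedgeForm_tmul, formAct_Khat_tmul,
      Lop_mul_group (comulU_gen .Khat), sg_Khat_wedge]
  exact LinearMap.congr_fun₂ this ω ω'

lemma formAct_KhatInv_wedge (ω ω' : Forms q ℓ) :
    formAct q ℓ 0 (gen q ℓ .KhatInv) (wedgeForm q ℓ ω ω') = wedgeForm q ℓ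
      (formAct q ℓ 0 (gen q ℓ .KhatInv) ω) (formAct q ℓ 0 (gen q ℓ .KhatInv) ω') := by
  have : (wedgeForm q ℓ).compr₂ (formAct q ℓ 0 (gen q ℓ .KhatInv)) = (wedgeForm q ℓ).compl₁₂
      (formAct q ℓ 0 (gen q ℓ .KhatInv)) (formAct q ℓ 0 (gen q ℓ .KhatInv)) := by
    apply forms_bilin_ext
    intro a v b w
    simp only [LinearMap.compr₂_apply, LinearMap.compl₁₂_apply, wedgeForm_tmul,
      formAct_KhatInv_tmul, Lop_mul_group (comulU_gen .KhatInv), sg_KhatInv_wedge]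
  exact LinearMap.congr_fun₂ this ω ω'

/-- The product rule is that of Δ(E_j) on Gr and that of the flipped coproduct on A, so there is no
module algebra structure on A ⊗ Gr. The four resulting terms are grouped so that the left factor ω
only meets full actions of generators; this is what invariance of ω can simplify. -/
lemma formAct_E_wedge (N : ℤ) (j : Fin (ℓ - 1)) (ω ω' : Forms q ℓ) :
    formAct q ℓ N (gen q ℓ (.E j)) (wedgeForm q ℓ ω ω') =
      wedgeForm q ℓ (formAct q ℓ N (gen q ℓ (.K j)) ω) (TensorProduct.map
        (Lop q ℓ (gen q ℓ (.E (lo j)))) (sg q ℓ N (gen q ℓ (.K j))) ω')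
      + wedgeForm q ℓ (formAct q ℓ N (gen q ℓ (.E j)) ω) (TensorProduct.map
        (Lop q ℓ (gen q ℓ (.Kinv (lo j)))) (sg q ℓ N (gen q ℓ (.K j))) ω')
      + wedgeForm q ℓ (formAct q ℓ N (gen q ℓ (.Kinv j)) ω) (TensorProduct.map
        (Lop q ℓ (gen q ℓ (.Kinv (lo j)))) (sg q ℓ N (gen q ℓ (.E j))) ω') := by
  have : (wedgeForm q ℓ).compr₂ (formAct q ℓ N (gen q ℓ (.E j))) =
      (wedgeForm q ℓ).compl₁₂ (formAct q ℓ N (gen q ℓ (.K j))) (TensorProduct.map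
        (Lop q ℓ (gen q ℓ (.E (lo j)))) (sg q ℓ N (gen q ℓ (.K j))))
      + (wedgeForm q ℓ).compl₁₂ (formAct q ℓ N (gen q ℓ (.E j))) (TensorProduct.map
        (Lop q ℓ (gen q ℓ (.Kinv (lo j)))) (sg q ℓ N (gen q ℓ (.K j))))
      + (wedgeForm q ℓ).compl₁₂ (formAct q ℓ N (gen q ℓ (.Kinv j))) (TensorProduct.map
        (Lop q ℓ (gen q ℓ (.Kinv (lo j)))) (sg q ℓ N (gen q ℓ (.E j)))) := by
    apply forms_bilin_ext
    intro a v b w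
    simp only [LinearMap.compr₂_apply, LinearMap.compl₁₂_apply, LinearMap.add_apply, wedgeForm_tmul,
      formAct_K_tmul, formAct_Kinv_tmul, formAct_E_tmul, map_add, TensorProduct.map_tmul,
      Lop_mul_group (comulU_gen (.Kinv (lo j))), Lop_mul_skew (comulU_gen (.E (lo j))), sg_K_wedge,
      sg_E_wedge, TensorProduct.add_tmul, TensorProduct.tmul_add]
    abel
  exact LinearMap.congr_fun₂ this ω ω'

lemma formAct_F_wedge (N : ℤ) (j : Fin (ℓ - 1)) (ω ω' : Forms q ℓ) :
    formAct q ℓ N (gen q ℓ (.F j)) (wedgeForm q ℓ ω ω') =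
      wedgeForm q ℓ (formAct q ℓ N (gen q ℓ (.K j)) ω) (TensorProduct.map
        (Lop q ℓ (gen q ℓ (.F (lo j)))) (sg q ℓ N (gen q ℓ (.K j))) ω')
      + wedgeForm q ℓ (formAct q ℓ N (gen q ℓ (.F j)) ω) (TensorProduct.map
        (Lop q ℓ (gen q ℓ (.Kinv (lo j)))) (sg q ℓ N (gen q ℓ (.K j))) ω')
      + wedgeForm q ℓ (formAct q ℓ N (gen q ℓ (.Kinv j)) ω) (TensorProduct.map
        (Lop q ℓ (gen q ℓ (.Kinv (lo j)))) (sg q ℓ N (gen q ℓ (.F j))) ω') := by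
  have : (wedgeForm q ℓ).compr₂ (formAct q ℓ N (gen q ℓ (.F j))) =
      (wedgeForm q ℓ).compl₁₂ (formAct q ℓ N (gen q ℓ (.K j))) (TensorProduct.map
        (Lop q ℓ (gen q ℓ (.F (lo j)))) (sg q ℓ N (gen q ℓ (.K j))))
      + (wedgeForm q ℓ).compl₁₂ (formAct q ℓ N (gen q ℓ (.F j))) (TensorProduct.map
        (Lop q ℓ (gen q ℓ (.Kinv (lo j)))) (sg q ℓ N (gen q ℓ (.K j))))
      + (wedgeForm q ℓ).compl₁₂ (formAct q ℓ N (gen q ℓ (.Kinv j))) (TensorProduct.map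
        (Lop q ℓ (gen q ℓ (.Kinv (lo j)))) (sg q ℓ N (gen q ℓ (.F j)))) := by
    apply forms_bilin_ext
    intro a v b w
    simp only [LinearMap.compr₂_apply, LinearMap.compl₁₂_apply, LinearMap.add_apply, wedgeForm_tmul,
      formAct_K_tmul, formAct_Kinv_tmul, formAct_F_tmul, map_add, TensorProduct.map_tmul,
      Lop_mul_group (comulU_gen (.Kinv (lo j))), Lop_mul_skew (comulU_gen (.F (lo j))), sg_K_wedge,
      sg_F_wedge, TensorProduct.add_tmul, TensorProduct.tmul_add]
    abel
  exact LinearMap.congr_fun₂ this ω ω'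

lemma formAct_E_eq (N : ℤ) (j : Fin (ℓ - 1)) : formAct q ℓ N (gen q ℓ (.E j)) =
    TensorProduct.map (Lop q ℓ (gen q ℓ (.E (lo j)))) (sg q ℓ N (gen q ℓ (.K j)))
    + TensorProduct.map (Lop q ℓ (gen q ℓ (.Kinv (lo j)))) (sg q ℓ N (gen q ℓ (.E j))) :=
  TensorProduct.ext' fun a v => formAct_E_tmul N j a v

lemma formAct_F_eq (N : ℤ) (j : Fin (ℓ - 1)) : formAct q ℓ N (gen q ℓ (.F j)) =
    TensorProduct.map (Lop q ℓ (gen q ℓ (.F (lo j)))) (sg q ℓ N (gen q ℓ (.K j)))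
    + TensorProduct.map (Lop q ℓ (gen q ℓ (.Kinv (lo j)))) (sg q ℓ N (gen q ℓ (.F j))) :=
  TensorProduct.ext' fun a v => formAct_F_tmul N j a v

lemma wedgeForm_mem_Omega {k k' : ℕ} {ω ω' : Forms q ℓ} (hω : ω ∈ Omega q ℓ k 0)
    (hω' : ω' ∈ Omega q ℓ k' 0) : wedgeForm q ℓ ω ω' ∈ Omega q ℓ (k + k') 0 := by
  rw [mem_Omega] at *
  obtain ⟨hd, hi⟩ := hω
  obtain ⟨hd', hi'⟩ := hω'
  refine ⟨wedgeForm_mem_formsDeg hd hd', ?_⟩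
  rintro (j | j | j | j | _ | _)
  -- Invariance of ω removes the middle term and turns the other two into ω ∧ (E_j · ω'), which
  -- vanishes by invariance of ω'.
  · rw [formAct_E_wedge, hi, hi, hi]
    have := hi' (.E j)
    rw [formAct_E_eq, LinearMap.add_apply] at this
    simp only [counitGen, one_smul, zero_smul, map_zero, LinearMap.zero_apply, add_zero] at this ⊢
    rw [← map_add, this, map_zero]
  · rw [formAct_F_wedge, hi, hi, hi]
    have := hi' (.F j)
    rw [formAct_F_eq, LinearMap.add_apply] at this
    simp only [counitGen, one_smul, zero_smul, map_zero, LinearMap.zero_apply, add_zero] at this ⊢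
    rw [← map_add, this, map_zero]
  · rw [formAct_K_wedge, hi, hi']; simp only [counitGen, one_smul]
  · rw [formAct_Kinv_wedge, hi, hi']; simp only [counitGen, one_smul]
  · rw [formAct_Khat_wedge, hi, hi']; simp only [counitGen, one_smul]
  · rw [formAct_KhatInv_wedge, hi, hi']; simp only [counitGen, one_smul]

/-! The forms of degree `0`. -/

lemma basisGr_empty_mem_Wk : (basisGr ∅ : Gr ℓ) ∈ Wk ℓ 0 := by simpa using basisGr_mem_Wk ∅

lemma coord_ofFun (a : ASU q ℓ) : coord q ℓ ∅ (ofFun q ℓ a) = a := by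
  rw [ofFun_apply, coord_tmul, basisGr_apply, if_pos rfl, one_smul]

lemma ofFun_injective : Function.Injective (ofFun q ℓ) := fun a b h => by
  rw [← coord_ofFun a, h, coord_ofFun]

lemma sharp_empty (j : Fin (ℓ - 1)) : sharp j ∅ = 0 := by simp [sharp]

lemma formAct_gen_ofFun (x : Gen (ℓ - 1)) (a : ASU q ℓ) : formAct q ℓ 0 (gen q ℓ x) (ofFun q ℓ a) =
    ofFun q ℓ (Lop q ℓ (gen q ℓ (x.castLE (Nat.sub_le ℓ 1))) a) := by
  have hK : ∀ j : Fin (ℓ - 1), sg q ℓ 0 (gen q ℓ (.K j)) (basisGr ∅) = basisGr ∅ := fun j => by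
    rw [sg_K_basisGr, sharp_empty]; simp
  rcases x with j | j | j | j | _ | _
  · rw [ofFun_apply, formAct_E_tmul, hK, sg_E_basisGr, sharp_empty, if_neg (by norm_num),
      TensorProduct.tmul_zero, add_zero]; rfl
  · rw [ofFun_apply, formAct_F_tmul, hK, sg_F_basisGr, sharp_empty, if_neg (by norm_num),
      TensorProduct.tmul_zero, add_zero]; rfl
  · rw [ofFun_apply, formAct_K_tmul, hK]; rfl
  · rw [ofFun_apply, formAct_Kinv_tmul, sg_Kinv_basisGr, sharp_empty]; simp [ofFun_apply]; rfl
  · rw [ofFun_apply, formAct_Khat_tmul]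
    have : sg q ℓ 0 (gen q ℓ .Khat) (basisGr ∅) = basisGr ∅ := by
      ext t; rw [sg_Khat, basisGr_apply]; split_ifs with h <;> simp [h]
    rw [this]; rfl
  · rw [ofFun_apply, formAct_KhatInv_tmul]
    have : sg q ℓ 0 (gen q ℓ .KhatInv) (basisGr ∅) = basisGr ∅ := by
      ext t; rw [sg_KhatInv, basisGr_apply]; split_ifs with h <;> simp [h]
    rw [this]; rfl

lemma eq_ofFun {ω : Forms q ℓ} (h : ω ∈ formsDeg q ℓ 0) : ω = ofFun q ℓ (coord q ℓ ∅ ω) := by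
  conv_lhs => rw [← sum_coord_tmul ω]
  rw [Finset.sum_eq_single ∅]
  · rfl
  · intro s _ hs
    rw [coord_eq_zero h (by rwa [Ne, Finset.card_eq_zero]), TensorProduct.zero_tmul]
  · simp

/-- For N = 0 the representation on W_0 is the counit, so invariance of a ⊗ 1 says that 𝓛 acts on a
by the counit. This can be tested on the generators of U_q(su(ℓ)) and on K̂. -/
lemma Omega_zero_zero : Omega q ℓ 0 0 = (ACP q ℓ).map (ofFun q ℓ) := by
  have G := gen_relations (q := q) (ℓ := ℓ) (m := ℓ)
  ext ω
  rw [mem_Omega, Submodule.mem_map]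
  constructor
  · rintro ⟨hd, hi⟩
    refine ⟨coord q ℓ ∅ ω, ?_, (eq_ofFun hd).symm⟩
    rw [eq_ofFun hd] at hi
    set a := coord q ℓ ∅ ω
    have hi' : ∀ x : Gen (ℓ - 1), Lop q ℓ (gen q ℓ (x.castLE (Nat.sub_le ℓ 1))) a
        = counitGen (ℓ - 1) x • a := fun x => by
      apply ofFun_injective
      rw [map_smul, ← hi, formAct_gen_ofFun]
    refine ⟨fun h hh => ?_, by simpa [counitGen, Gen.castLE] using hi' .Khat⟩
    induction hh using Algebra.adjoin_induction with
    | mem x hx =>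
      obtain ⟨i, hi, hx⟩ := hx
      have hil : (i : ℕ) < ℓ - 1 := by omega
      rcases hx with rfl | rfl | rfl | rfl <;> rw [counitU_gen]
      · exact hi' (.E ⟨i, hil⟩)
      · exact hi' (.F ⟨i, hil⟩)
      · exact hi' (.K ⟨i, hil⟩)
      · exact hi' (.Kinv ⟨i, hil⟩)
    | algebraMap c =>
      rw [AlgHom.commutes, Algebra.algebraMap_eq_smul_one, map_smul, LinearMap.smul_apply,
        Lop_one_left]; rfl
    | add x y _ _ hx hy => rw [map_add, LinearMap.add_apply, hx, hy, map_add, add_smul]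
    | mul x y _ _ hx hy => rw [Lop_mul_left, hy, map_smul, hx, smul_smul, map_mul, mul_comm]
  · rintro ⟨a, ⟨ha, ha'⟩, rfl⟩
    refine ⟨tmul_mem_formsDeg a basisGr_empty_mem_Wk, fun x => ?_⟩
    rw [formAct_gen_ofFun, ← map_smul]
    congr 1
    have hs : ∀ (x : Uq q ℓ ℓ) (i : Fin ℓ), (i : ℕ) + 1 < ℓ → (x = gen q ℓ (.E i) ∨
        x = gen q ℓ (.F i) ∨ x = gen q ℓ (.K i) ∨ x = gen q ℓ (.Kinv i)) → x ∈ UqSub q ℓ :=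
      fun x i hi hx => Algebra.subset_adjoin ⟨i, hi, hx⟩
    rcases x with j | j | j | j | _ | _
    · exact (ha _ (hs _ (lo j) (hi j).2 (by simp [Gen.castLE, lo, Fin.castLE]))).trans
        (by rw [counitU_gen]; rfl)
    · exact (ha _ (hs _ (lo j) (hi j).2 (by simp [Gen.castLE, lo, Fin.castLE]))).trans
        (by rw [counitU_gen]; rfl)
    · exact (ha _ (hs _ (lo j) (hi j).2 (by simp [Gen.castLE, lo, Fin.castLE]))).trans
        (by rw [counitU_gen]; rfl)
    · exact (ha _ (hs _ (lo j) (hi j).2 (by simp [Gen.castLE, lo, Fin.castLE]))).trans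
        (by rw [counitU_gen]; rfl)
    · rw [Gen.castLE, ha', counitGen, one_smul]
      all_goals exact fun _ => by simp
    -- The definition of A(CP^ℓ_q) mentions K̂ only; invariance under K̂^{-1} follows by inverting.
    · have : Lop q ℓ (gen q ℓ .KhatInv) (Lop q ℓ (gen q ℓ .Khat) a) = a := by
        rw [← Lop_mul_left, G.KhatInv_Khat, Lop_one_left]
      rw [ha'] at this
      rw [Gen.castLE, this, counitGen, one_smul]
      all_goals exact fun _ => by simp

lemma ofFun_one_mem_Omega : ofFun q ℓ 1 ∈ Omega q ℓ 0 0 := by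
  rw [Omega_zero_zero]
  refine ⟨1, ⟨fun h _ => Lop_one_right h, ?_⟩, rfl⟩
  rw [Lop_one_right, counitU_gen, counitGen, one_smul]
  all_goals exact fun _ => by simp

/-! Covariance. -/

lemma lactForm_tmul (h : Uq q ℓ ℓ) (a : ASU q ℓ) (v : Gr ℓ) :
    lactForm q ℓ h (a ⊗ₜ v) = lact q ℓ h a ⊗ₜ v := rfl

/-- Symbols act through ◁ on the A-factor, which commutes with ▷. Stability of Ω^k_N under U and
covariance of ∂̄ are both instances. -/
lemma lactForm_opOf (h : Uq q ℓ ℓ) (x : Symb q ℓ) (ω : Forms q ℓ) :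
    opOf q ℓ x (lactForm q ℓ h ω) = lactForm q ℓ h (opOf q ℓ x ω) := by
  induction x using TensorProduct.induction_on with
  | zero => simp
  | add x y hx hy => simp only [map_add, LinearMap.add_apply, hx, hy]
  | tmul g M =>
    induction ω using TensorProduct.induction_on with
    | zero => simp
    | add x y hx hy => simp only [map_add, hx, hy]
    | tmul a v => rw [lactForm_tmul, opOf_tmul, TensorProduct.map_tmul, TensorProduct.map_tmul,
        lactForm_tmul, Lop_lact]

lemma lactForm_mem_Omega {k : ℕ} {N : ℤ} (h : Uq q ℓ ℓ) {ω : Forms q ℓ} (hω : ω ∈ Omega q ℓ k N) :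
    lactForm q ℓ h ω ∈ Omega q ℓ k N := by
  rw [mem_Omega] at *
  refine ⟨?_, fun x => ?_⟩
  · exact map_mem_formsDeg (lact q ℓ h) (g := LinearMap.id) (fun v hv => hv) hω.1
  · rw [formAct_eq, lactForm_opOf, ← formAct_eq, hω.2, map_smul]

lemma lactForm_mul (g h : Uq q ℓ ℓ) (ω : Forms q ℓ) :
    lactForm q ℓ (g * h) ω = lactForm q ℓ g (lactForm q ℓ h ω) := by
  induction ω using TensorProduct.induction_on with
  | zero => simp
  | add x y hx hy => simp only [map_add, hx, hy]
  | tmul a v => rw [lactForm_tmul, lactForm_tmul, lactForm_tmul, lact_mul_left]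

lemma lactForm_one (ω : Forms q ℓ) : lactForm q ℓ 1 ω = ω := by
  induction ω using TensorProduct.induction_on with
  | zero => simp
  | add x y hx hy => simp only [map_add, hx, hy]
  | tmul a v => rw [lactForm_tmul, lact_one_left]

lemma lactWedge_tmul (ω ω' : Forms q ℓ) (g h : Uq q ℓ ℓ) :
    lactWedge q ℓ ω ω' (g ⊗ₜ h) = wedgeForm q ℓ (lactForm q ℓ g ω) (lactForm q ℓ h ω') := rfl

lemma lactForm_wedgeForm (h : Uq q ℓ ℓ) (ω ω' : Forms q ℓ) :
    lactForm q ℓ h (wedgeForm q ℓ ω ω') = lactWedge q ℓ ω ω' (comulU q ℓ ℓ h) := by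
  have hadd : ∀ (x y ω' : Forms q ℓ) (V : Uq q ℓ ℓ ⊗[ℂ] Uq q ℓ ℓ),
      lactWedge q ℓ (x + y) ω' V = lactWedge q ℓ x ω' V + lactWedge q ℓ y ω' V := by
    intro x y ω' V
    induction V using TensorProduct.induction_on with
    | zero => simp
    | add V W hV hW => simp only [map_add, hV, hW]; abel
    | tmul g h => simp only [lactWedge_tmul, map_add, LinearMap.add_apply]
  have hadd' : ∀ (ω x y : Forms q ℓ) (V : Uq q ℓ ℓ ⊗[ℂ] Uq q ℓ ℓ),
      lactWedge q ℓ ω (x + y) V = lactWedge q ℓ ω x V + lactWedge q ℓ ω y V := by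
    intro ω x y V
    induction V using TensorProduct.induction_on with
    | zero => simp
    | add V W hV hW => simp only [map_add, hV, hW]; abel
    | tmul g h => simp only [lactWedge_tmul, map_add, LinearMap.add_apply]
  have hz : ∀ ω' : Forms q ℓ, lactWedge q ℓ 0 ω' = 0 := fun ω' => by
    apply TensorProduct.ext'; intro g h; simp [lactWedge_tmul]
  have hz' : ∀ ω : Forms q ℓ, lactWedge q ℓ ω 0 = 0 := fun ω => by
    apply TensorProduct.ext'; intro g h; simp [lactWedge_tmul]
  induction ω using TensorProduct.induction_on with
  | zero => simp [hz]
  | add x y hx hy => simp only [map_add, LinearMap.add_apply, hadd, hx, hy]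
  | tmul a v =>
  induction ω' using TensorProduct.induction_on with
  | zero => simp [hz']
  | add x y hx hy => simp only [map_add, LinearMap.add_apply, hadd', hx, hy]
  | tmul b w =>
    rw [wedgeForm_tmul, lactForm_tmul, lact_mul]
    induction comulU q ℓ ℓ h using TensorProduct.induction_on with
    | zero => simp
    | add V W hV hW => simp only [map_add, TensorProduct.add_tmul, hV, hW]
    | tmul g h => rw [mulAct_tmul, lactWedge_tmul, lactForm_tmul, lactForm_tmul, wedgeForm_tmul]

lemma lactForm_ofFun_one (h : Uq q ℓ ℓ) :
    lactForm q ℓ h (ofFun q ℓ 1) = counitU q ℓ ℓ h • ofFun q ℓ 1 := by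
  rw [ofFun_apply, lactForm_tmul, lact_one_right, TensorProduct.smul_tmul']

lemma dbar_lactForm (h : Uq q ℓ ℓ) (ω : Forms q ℓ) :
    dbar q ℓ (lactForm q ℓ h ω) = lactForm q ℓ h (dbar q ℓ ω) := by
  rw [dbar_eq, lactForm_opOf]

end formsStructure

/-! ### The action of `(K_1 ⋯ K_ℓ)^2` on the components of a form -/

section rootExtraction

open Polynomial in
/-- For a diagonalizable operator with positive eigenvalues, an eigenvector of the `n`-th power is
an eigenvector. -/
lemma apply_eq_of_pow_apply_eq {V : Type*} [AddCommGroup V] [Module ℂ V] (T : Module.End ℂ V)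
    (hT : Submodule.span ℂ {v | ∃ μ : ℝ, 0 < μ ∧ T v = (μ : ℂ) • v} = ⊤) {c : ℝ} (hc : 0 < c)
    {n : ℕ} (hn : n ≠ 0) {a : V} (ha : (T ^ n) a = (c : ℂ) ^ n • a) : T a = (c : ℂ) • a := by
  -- s = (X^n - c^n)/(X - c). It is positive at positive reals, so it cannot vanish at an eigenvalue
  -- of T; hence s(T) should be injective, and s(T)(T - c) a = 0 forces T a = c a.
  set s : ℂ[X] := ∑ i ∈ Finset.range n, X ^ i * C (c : ℂ) ^ (n - 1 - i) with hs
  have hmul : s * (X - C (c : ℂ)) = X ^ n - C (c : ℂ) ^ n := geom_sum₂_mul _ _ _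
  have hpos : ∀ μ : ℝ, 0 < μ → s.eval (μ : ℂ) ≠ 0 := by
    intro μ hμ
    have e : s.eval (μ : ℂ) = ((∑ i ∈ Finset.range n, μ ^ i * c ^ (n - 1 - i) : ℝ) : ℂ) := by
      simp [hs, eval_finsetSum]
    rw [e, Ne, Complex.ofReal_eq_zero]
    exact (Finset.sum_pos (fun i _ => by positivity) (Finset.nonempty_range_iff.2 hn)).ne'
  -- V may be infinite dimensional; injectivity of s(T) is obtained vector by vector. A finite sum
  -- of eigenvectors is killed by a product of factors X - μ with μ > 0, and this product is coprime
  -- to s.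
  have hann : ∀ v : V, ∃ p : ℂ[X], aeval T p v = 0 ∧ IsCoprime p s := by
    intro v
    have hv : v ∈ Submodule.span ℂ {v | ∃ μ : ℝ, 0 < μ ∧ T v = (μ : ℂ) • v} := hT ▸ trivial
    induction hv using Submodule.span_induction with
    | mem x hx =>
      obtain ⟨μ, hμ, hx⟩ := hx
      refine ⟨X - C (μ : ℂ), by simp [hx, Module.algebraMap_end_apply], ?_⟩
      rw [(irreducible_X_sub_C (μ : ℂ)).coprime_iff_not_dvd, dvd_iff_isRoot]
      exact hpos μ hμ
    | zero => exact ⟨1, by simp, isCoprime_one_left⟩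
    | add x y _ _ hx hy =>
      obtain ⟨p, hp, hps⟩ := hx
      obtain ⟨p', hp', hps'⟩ := hy
      refine ⟨p * p', ?_, hps.mul_left hps'⟩
      rw [map_add, map_mul, Module.End.mul_apply, Module.End.mul_apply, hp', map_zero, add_zero,
        ← Module.End.mul_apply, ← map_mul, mul_comm, map_mul, Module.End.mul_apply, hp, map_zero]
    | smul r x _ hx =>
      obtain ⟨p, hp, hps⟩ := hx
      exact ⟨p, by rw [map_smul, hp, smul_zero], hps⟩
  set b := T a - (c : ℂ) • a with hb
  have hsb : aeval T s b = 0 := by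
    have e : b = aeval T (X - C (c : ℂ)) a := by simp [hb, Module.algebraMap_end_apply]
    rw [e, ← Module.End.mul_apply, ← map_mul, hmul, ← C_pow, map_sub, map_pow, aeval_X, aeval_C,
      LinearMap.sub_apply, ha, Module.algebraMap_end_apply, sub_self]
  obtain ⟨p, hp, u, w, huw⟩ := hann b
  have : aeval T (u * p + w * s) b = 0 := by
    rw [map_add, map_mul, map_mul, LinearMap.add_apply, Module.End.mul_apply, Module.End.mul_apply,
      hp, hsb, map_zero, map_zero, add_zero]
  rw [huw, map_one, Module.End.one_apply] at this
  exact sub_eq_zero.1 this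

end rootExtraction

/-! ### The torus part of U acting on coefficients. -/

section cartanWeights
variable {q : QParam} {ℓ : ℕ}

lemma comulU_Nel (i : Fin ℓ) : comulU q ℓ ℓ (Nel q ℓ i) = Nel q ℓ i ⊗ₜ Nel q ℓ i := by
  induction i using Fin.down_induction with
  | last i h => rw [Nel_last h, comulU_gen]; rfl
  | step i j h ih =>
    rw [Nel_step h, map_mul, ih, comulU_gen, comulGen, Algebra.TensorProduct.tmul_mul_tmul]

lemma counitU_Nel (i : Fin ℓ) : counitU q ℓ ℓ (Nel q ℓ i) = 1 := by
  induction i using Fin.down_induction with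
  | last i h => rw [Nel_last h, counitU_gen]; rfl
  | step i j h ih => rw [Nel_step h, map_mul, ih, counitU_gen, mul_one]; rfl

lemma Lop_K_u (i : Fin ℓ) (r c : Fin (ℓ + 1)) : Lop q ℓ (gen q ℓ (.K i)) (uA q ℓ r c) =
    (qpow q ((piC ℓ i r : ℝ) / 2))⁻¹ • uA q ℓ r c := by
  rw [Lop_eq, antipodeInv_K, ract_u, piRep_Kinv]
  simp [Matrix.diagonal_apply, ite_smul]

lemma Lop_Nel_u (i : Fin ℓ) (r c : Fin (ℓ + 1)) :
    ∃ μ : ℝ, 0 < μ ∧ Lop q ℓ (Nel q ℓ i) (uA q ℓ r c) = (μ : ℂ) • uA q ℓ r c := by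
  have hK : ∀ i : Fin ℓ, ∃ μ : ℝ, 0 < μ ∧
      Lop q ℓ (gen q ℓ (.K i)) (uA q ℓ r c) = (μ : ℂ) • uA q ℓ r c := fun i =>
    ⟨((q : ℝ) ^ ((piC ℓ i r : ℝ) / 2))⁻¹, inv_pos.2 (Real.rpow_pos_of_pos q.2.1 _), by
      rw [Lop_K_u, Complex.ofReal_inv]; rfl⟩
  induction i using Fin.down_induction with
  | last i h => rw [Nel_last h]; exact hK i
  | step i j h ih =>
    obtain ⟨μ, hμ, e⟩ := ih
    obtain ⟨ν, hν, e'⟩ := hK i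
    refine ⟨μ * ν, mul_pos hμ hν, ?_⟩
    rw [Nel_step h, Lop_mul_left, e, map_smul, e', smul_smul, Complex.ofReal_mul]

/-- The element is group-like, so a product of eigenvectors is an eigenvector for the product of the
eigenvalues. The generators u^i_j are eigenvectors with powers of q as eigenvalues, which are
positive. -/
lemma span_eigenvectors_Nel (i : Fin ℓ) : Submodule.span ℂ {a | ∃ μ : ℝ, 0 < μ ∧
    LopHom q ℓ (Nel q ℓ i * Nel q ℓ i) a = (μ : ℂ) • a} = ⊤ := by
  set E : Set (ASU q ℓ) := {a | ∃ μ : ℝ, 0 < μ ∧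
    LopHom q ℓ (Nel q ℓ i * Nel q ℓ i) a = (μ : ℂ) • a} with hE
  have hg : comulU q ℓ ℓ (Nel q ℓ i * Nel q ℓ i) =
      (Nel q ℓ i * Nel q ℓ i) ⊗ₜ (Nel q ℓ i * Nel q ℓ i) := by
    rw [map_mul, comulU_Nel, Algebra.TensorProduct.tmul_mul_tmul]
  have h1 : (1 : ASU q ℓ) ∈ E := by
    refine ⟨1, one_pos, ?_⟩
    rw [LopHom_apply, Lop_one_right, map_mul, counitU_Nel]; simp
  rw [eq_top_iff]
  rintro a -
  induction a using ASU.induction with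
  | halg c =>
    rw [Algebra.algebraMap_eq_smul_one]
    exact Submodule.smul_mem _ _ (Submodule.subset_span h1)
  | hu r c =>
    apply Submodule.subset_span
    obtain ⟨μ, hμ, e⟩ := Lop_Nel_u (q := q) i r c
    refine ⟨μ * μ, mul_pos hμ hμ, ?_⟩
    rw [LopHom_apply, Lop_mul_left, e, map_smul, e, smul_smul, Complex.ofReal_mul]
  | hmul a b ha hb =>
    have h := Submodule.mul_mem_mul ha hb
    rw [Submodule.span_mul_span] at h
    refine Submodule.span_mono ?_ h
    rintro _ ⟨x, ⟨μ, hμ, hx⟩, y, ⟨ν, hν, hy⟩, rfl⟩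
    refine ⟨μ * ν, mul_pos hμ hν, ?_⟩
    rw [LopHom_apply] at *
    change Lop q ℓ _ (x * y) = _
    rw [Lop_mul_group hg, hx, hy, smul_mul_smul_comm, Complex.ofReal_mul]
  | hadd a b ha hb => exact Submodule.add_mem _ ha hb

variable (q) in
/-- The monomial `∏ K_i ^ {n_i}`. -/
def Kpow (n : Fin ℓ → ℕ) : Uq q ℓ ℓ :=
  ((List.finRange ℓ).map fun i => gen q ℓ (.K i) ^ n i).prod

lemma Kpow_add (n m : Fin ℓ → ℕ) : Kpow q (n + m) = Kpow q n * Kpow q m := by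
  rw [Kpow, Kpow, Kpow]
  induction List.finRange ℓ with
  | nil => simp
  | cons i l ih =>
    have hc : Commute (l.map fun i => gen q ℓ (.K i) ^ n i).prod (gen q ℓ (.K i) ^ m i) := by
      apply Commute.list_prod_left
      intro x hx
      obtain ⟨j, -, rfl⟩ := List.mem_map.1 hx
      exact Commute.pow_pow (gen_relations.K_K j i) _ _
    rw [List.map_cons, List.map_cons, List.map_cons, List.prod_cons, List.prod_cons,
      List.prod_cons, ih, Pi.add_apply, pow_add, mul_assoc, mul_assoc, ← mul_assoc (gen q ℓ (.K i) ^ m i), ← hc.eq, mul_assoc]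

lemma Kpow_nsmul (n : Fin ℓ → ℕ) (c : ℕ) : Kpow q (c • n) = Kpow q n ^ c := by
  induction c with
  | zero => simp [Kpow]
  | succ c ih => rw [succ_nsmul, Kpow_add, ih, pow_succ]

lemma Lop_Kpow {n : Fin ℓ → ℕ} {a : ASU q ℓ} {c : Fin ℓ → ℂ}
    (h : ∀ i, Lop q ℓ (gen q ℓ (.K i) ^ n i) a = c i • a) :
    Lop q ℓ (Kpow q n) a = (∏ i, c i) • a := by
  rw [Kpow, ← List.prod_ofFn, List.ofFn_eq_map]
  induction List.finRange ℓ with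
  | nil => simp [Lop_one_left]
  | cons i l ih =>
    rw [List.map_cons, List.map_cons, List.prod_cons, List.prod_cons, Lop_mul_left, ih, map_smul, h,
      smul_smul, mul_comm]

/-- The defining root relation raised to the power gcd(2, ℓ+1). -/
lemma Khat_pow : gen q ℓ (m := ℓ) .Khat ^ (ℓ + 1) = Kpow q (fun i : Fin ℓ => (i : ℕ) + 1) ^ 2 := by
  have h := congrArg (· ^ Nat.gcd 2 (ℓ + 1)) ((gen_relations (q := q) (ℓ := ℓ) (m := ℓ)).root rfl)
  simp only [← pow_mul] at h
  rwa [Nat.div_mul_cancel (Nat.gcd_dvd_right 2 (ℓ + 1)),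
    Nat.div_mul_cancel (Nat.gcd_dvd_left 2 (ℓ + 1))] at h

lemma sum_telescope (χ : ℕ → ℝ) (n : ℕ) :
    ∑ i ∈ Finset.range n, ((n : ℝ) - i) * (χ i - χ (i + 1)) =
      n * χ 0 - ∑ i ∈ Finset.range n, χ (i + 1) := by
  induction n with
  | zero => simp
  | succ n ih =>
    have h1 : ∑ i ∈ Finset.range (n + 1), (((n + 1 : ℕ) : ℝ) - i) * (χ i - χ (i + 1)) =
        ∑ i ∈ Finset.range (n + 1), ((n : ℝ) - i) * (χ i - χ (i + 1))
        + ∑ i ∈ Finset.range (n + 1), (χ i - χ (i + 1)) := by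
      rw [← Finset.sum_add_distrib]
      refine Finset.sum_congr rfl fun i _ => ?_
      push_cast; ring
    rw [h1, Finset.sum_range_succ, ih, Finset.sum_range_sub', Finset.sum_range_succ _ n]
    push_cast; ring

/-- Summation by parts: j # t is the difference χ(j) - χ(j+1) of the indicator function of t, and
the boundary term vanishes because the first index is not in t. -/
lemma sum_sharp {n : ℕ} {t : Finset (Fin (n + 1))} (ht : 0 ∉ t) :
    ∑ j : Fin n, ((n : ℝ) - j) * (sharp (ℓ := n + 1) j t : ℝ) = -t.card := by
  set χ : ℕ → ℝ := fun x => if ∃ h : x < n + 1, (⟨x, h⟩ : Fin (n + 1)) ∈ t then 1 else 0 with hχ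
  have h1 : ∀ x : Fin (n + 1), χ x = if x ∈ t then 1 else 0 := fun x => by
    simp only [hχ, Fin.eta, exists_prop, x.2, true_and]
  have h2 : ∀ j : Fin n, ((sharp (ℓ := n + 1) j t : ℤ) : ℝ) = χ j - χ (j + 1) := fun j => by
    have a := h1 j.castSucc
    have b := h1 j.succ
    rw [Fin.val_castSucc] at a
    rw [Fin.val_succ] at b
    rw [a, b, sharp]
    push_cast
    rfl
  have h0 : χ 0 = 0 := by simpa [ht] using h1 0
  have hcard : (t.card : ℝ) = ∑ i ∈ Finset.range n, χ (i + 1) := by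
    have : (t.card : ℝ) = ∑ x : Fin (n + 1), χ x := by simp [h1]
    rw [this, Fin.sum_univ_succ, Fin.val_zero, h0, zero_add, Finset.sum_range]
    simp
  simp only [h2]
  rw [← Finset.sum_range fun i => ((n : ℝ) - i) * (χ i - χ (i + 1)), sum_telescope, h0, hcard]
  ring

lemma coord_formAct_K (j : Fin (ℓ - 1)) (t : Finset (Fin ℓ)) (ω : Forms q ℓ) :
    coord q ℓ t (formAct q ℓ 0 (gen q ℓ (.K j)) ω) =
      qpow q ((sharp j t : ℝ) / 2) • Lop q ℓ (gen q ℓ (.K (lo j))) (coord q ℓ t ω) := by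
  rw [formAct_eq, theta_K, coord_opOf_tmul, sigma_gen]
  simp [repGen, qdiag, Matrix.diagonal_apply]

lemma coord_formAct_Khat (t : Finset (Fin ℓ)) (ω : Forms q ℓ) :
    coord q ℓ t (formAct q ℓ 0 (gen q ℓ .Khat) ω) =
      qpow q t.card • Lop q ℓ (gen q ℓ .Khat) (coord q ℓ t ω) := by
  rw [formAct_eq, theta_Khat, coord_opOf_tmul, sigma_gen]
  simp [repGen, qdiag, Matrix.diagonal_apply]

lemma Nel_zero {n : ℕ} : Nel q (n + 1) 0 = Kpow q 1 := by
  rw [Nel, Kpow, List.filter_eq_self.2 (by simp)]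
  simp

lemma LopHom_pow_apply {h : Uq q ℓ ℓ} {a : ASU q ℓ} {c : ℂ} (e : Lop q ℓ h a = c • a) (n : ℕ) :
    Lop q ℓ (h ^ n) a = c ^ n • a := by
  induction n with
  | zero => simp [Lop_one_left]
  | succ n ih => rw [pow_succ, Lop_mul_left, e, map_smul, ih, smul_smul, pow_succ, mul_comm]

/-- Invariance gives the action on the coefficient of K_1, …, K_{ℓ-1} and of K̂, but not of K_ℓ. A
monomial in these elements equals the ℓ-th power of (K_1 ⋯ K_ℓ)², whose eigenvalue is q^{-kℓ};
positivity of the spectrum selects the root q^{-k}. -/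
lemma Lop_Nel_sq {n k : ℕ} {ω : Forms q (n + 1)} (hω : ω ∈ Omega q (n + 1) k 0)
    {t : Finset (Fin (n + 1))} (ht : 0 ∉ t) (hk : t.card = k) :
    Lop q (n + 1) (Nel q (n + 1) 0 * Nel q (n + 1) 0) (coord q (n + 1) t ω) =
      qpow q (-k) • coord q (n + 1) t ω := by
  rw [mem_Omega] at hω
  set a := coord q (n + 1) t ω with ha
  have hK : ∀ j : Fin n, Lop q (n + 1) (gen q (n + 1) (.K j.castSucc)) a =
      qpow q (-((sharp (ℓ := n + 1) j t : ℝ) / 2)) • a := fun j => by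
    have h := congrArg (coord q (n + 1) t) (hω.2 (.K j))
    rw [coord_formAct_K, counitGen, one_smul] at h
    · rw [qpow_neg]; exact swap_smul (qpow_ne_zero q _) h.symm
    all_goals exact fun _ => by simp
  have hKhat : Lop q (n + 1) (gen q (n + 1) .Khat) a = qpow q (-k) • a := by
    have h := congrArg (coord q (n + 1) t) (hω.2 .Khat)
    rw [coord_formAct_Khat, counitGen, one_smul, hk] at h
    · rw [qpow_neg]; exact swap_smul (qpow_ne_zero q _) h.symm
    all_goals exact fun _ => by simp
  -- With indices from 0, the exponent n - i completes the exponent i + 1 of K_i in the root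
  -- relation to the constant n + 1. It is zero for the last index, whose K_i is not available; the
  -- last weight is therefore set to 0.
  set m : Fin (n + 1) → ℕ := fun i => n - i with hm
  set x : Fin (n + 1) → ℝ := Fin.snoc (α := fun _ => ℝ)
    (fun j : Fin n => -(((n : ℝ) - j) * (sharp (ℓ := n + 1) j t : ℝ)) / 2) 0 with hx
  have hm' : Lop q (n + 1) (Kpow q m) a = qpow q (k / 2) • a := by
    have e : ∀ i, Lop q (n + 1) (gen q (n + 1) (.K i) ^ m i) a = qpow q (x i) • a := by
      intro i
      induction i using Fin.lastCases with
      | last => simp [hm, hx, Lop_one_left]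
      | cast j =>
        rw [LopHom_pow_apply (hK j), ← qpow_nat_mul]
        have hj : (j : ℕ) ≤ n := j.2.le
        simp only [hm, hx, Fin.snoc_castSucc, Fin.val_castSucc]
        rw [Nat.cast_sub hj]
        congr 2; ring
    rw [Lop_Kpow e, qpow_sum]
    congr 2
    rw [Fin.sum_univ_castSucc, hx]
    simp only [Fin.snoc_castSucc, Fin.snoc_last, add_zero]
    rw [← Finset.sum_div, Finset.sum_neg_distrib, sum_sharp ht, hk, neg_neg]
  have hpow : (Nel q (n + 1) 0 * Nel q (n + 1) 0) ^ (n + 1) =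
      Kpow q m ^ 2 * gen q (n + 1) .Khat ^ (n + 1 + 1) := by
    have hsum : (n + 1) • (1 : Fin (n + 1) → ℕ) = m + fun i : Fin (n + 1) => (i : ℕ) + 1 := by
      ext i; have := i.2; simp [hm]; omega
    have hc : Commute (Kpow q m) (Kpow q fun i : Fin (n + 1) => (i : ℕ) + 1) := by
      rw [Commute, SemiconjBy, ← Kpow_add, ← Kpow_add, add_comm m]
    rw [Khat_pow, ← hc.mul_pow, ← Kpow_add, ← hsum, Kpow_nsmul, Nel_zero, ← sq, ← pow_mul, ← pow_mul,
      mul_comm]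
  -- K̂^{n+2} contributes q^{-k(n+2)}, and the square of the monomial with exponents m contributes
  -- q^{k}; in total q^{-k(n+1)}.
  have hfin : ((LopHom q (n + 1) (Nel q (n + 1) 0 * Nel q (n + 1) 0)) ^ (n + 1)) a =
      (((q : ℝ) ^ (-(k : ℝ)) : ℝ) : ℂ) ^ (n + 1) • a := by
    rw [← map_pow, LopHom_apply, hpow, Lop_mul_left, LopHom_pow_apply hKhat, map_smul,
      LopHom_pow_apply hm', smul_smul]
    congr 1
    change qpow q (-k) ^ (n + 1 + 1) * qpow q (k / 2) ^ 2 = qpow q (-k) ^ (n + 1)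
    rw [← qpow_nat_mul q 2, pow_succ, mul_assoc, ← qpow_add]
    have : -(k : ℝ) + ((2 : ℕ) : ℝ) * (k / 2) = 0 := by push_cast; ring
    rw [this, qpow_zero, mul_one]
  exact apply_eq_of_pow_apply_eq _ (span_eigenvectors_Nel 0) (Real.rpow_pos_of_pos q.2.1 _)
    (Nat.succ_ne_zero n) hfin

end cartanWeights

/-! ### The Leibniz rule -/

section leibniz
variable {q : QParam} {ℓ : ℕ}

/-- Rows of the coproducts of the `K̂ X_i`: `Δ(K̂ X_i) = 1 ⊗ K̂ X_i + ∑_j K̂ X_j ⊗ t_{ij}`. -/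
def row (q : QParam) (ℓ : ℕ) (i : Fin ℓ) : Fin ℓ → Uq q ℓ ℓ := (exists_isRow i).choose

lemma isRow_row (i : Fin ℓ) : IsRow q ℓ i (row q ℓ i) := (exists_isRow i).choose_spec

lemma Lop_Yel_mul (i : Fin ℓ) (a b : ASU q ℓ) : Lop q ℓ (Yel q ℓ i) (a * b) =
    Lop q ℓ (Yel q ℓ i) a * b + ∑ j, Lop q ℓ (row q ℓ i j) a * Lop q ℓ (Yel q ℓ j) b := by
  rw [Lop_mul, (isRow_row i).comul, map_add, map_add, map_sum, map_sum,
    Algebra.TensorProduct.comm_tmul, mulAct_tmul, Lop_one_left]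
  simp only [Algebra.TensorProduct.comm_tmul, mulAct_tmul]

variable (q ℓ) in
/-- The symbol `∑_i t_{ij} ⊗ e^L_i`. -/
def twistSymb (j : Fin ℓ) : Symb q ℓ := ∑ i, row q ℓ i j ⊗ₜ eMat q i

/-- A twisted Leibniz rule, valid without any invariance. The matrix t_{ij}, the second leg in
Δ(y_i), acts on the left factor because 𝓛 reverses the coproduct. -/
lemma dbar_wedgeForm (ω ω' : Forms q ℓ) : dbar q ℓ (wedgeForm q ℓ ω ω') =
    wedgeForm q ℓ (dbar q ℓ ω) ω' + ∑ j, wedgeForm q ℓ (opOf q ℓ (twistSymb q ℓ j) ω)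
      (TensorProduct.map (Lop q ℓ (Yel q ℓ j)) LinearMap.id ω') := by
  have : (wedgeForm q ℓ).compr₂ (dbar q ℓ) = (wedgeForm q ℓ).compl₁₂ (dbar q ℓ) LinearMap.id
      + ∑ j, (wedgeForm q ℓ).compl₁₂ (opOf q ℓ (twistSymb q ℓ j))
        (TensorProduct.map (Lop q ℓ (Yel q ℓ j)) LinearMap.id) := by
    apply forms_bilin_ext
    intro a v b w
    simp only [LinearMap.compr₂_apply, LinearMap.add_apply, LinearMap.sum_apply,
      LinearMap.compl₁₂_apply, wedgeForm_tmul, dbar_eq, dbarSymb, twistSymb, map_sum, opOf_tmul,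
      TensorProduct.map_tmul, toLin'_eMat, LinearMap.id_apply, Lop_Yel_mul, TensorProduct.add_tmul,
      Finset.sum_add_distrib, TensorProduct.sum_tmul]
    rw [Finset.sum_comm]
    simp only [eL, wedge_assoc]
  have h := LinearMap.congr_fun₂ this ω ω'
  simpa only [LinearMap.compr₂_apply, LinearMap.add_apply, LinearMap.sum_apply,
      LinearMap.compl₁₂_apply, LinearMap.id_apply] using h

/-- With N_j = K_j N_{j+1} for N_j = K_j ⋯ K_ℓ, both sides are N_{j+1}² K_j. It identifies the
diagonal entry of the next column in `theta_F_mul_twistSymb`. -/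
lemma row_self_mul_Kinv {j j' : Fin ℓ} (h : (j : ℕ) + 1 = j') :
    row q ℓ j j * gen q ℓ (.Kinv j) = row q ℓ j' j' * gen q ℓ (.K j) := by
  have G := gen_relations (q := q) (ℓ := ℓ) (m := ℓ)
  have hc := commute_K_Nel (q := q) j j'
  rw [(isRow_row j).self, (isRow_row j').self, Nel_step h]
  have e : gen q ℓ (.K j) * Nel q ℓ j' * (gen q ℓ (.K j) * Nel q ℓ j') =
      Nel q ℓ j' * Nel q ℓ j' * gen q ℓ (.K j) * gen q ℓ (.K j) := by
    rw [hc.eq, mul_assoc, ← mul_assoc (gen q ℓ (.K j)), hc.eq]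
    simp only [mul_assoc]
  rw [e, mul_assoc, G.K_Kinv, mul_one]

lemma row_succ_mul_K {j j' : Fin ℓ} (h : (j : ℕ) + 1 = j') :
    row q ℓ j j' * gen q ℓ (.K j) =
      (qhalf q ^ 3 - (qhalf q)⁻¹) • (row q ℓ j j * gen q ℓ (.F j)) := by
  have G := gen_relations (q := q) (ℓ := ℓ) (m := ℓ)
  have h0 := qhalf_ne_zero q
  have hc := commute_K_Nel (q := q) j j'
  have h1 := F_Nel_succ (q := q) h
  have h1' := qcomm_assoc h1
  have h2 := G.F_K_self j
  have hc' : ∀ x, gen q ℓ (.K j) * (Nel q ℓ j' * x) = Nel q ℓ j' * (gen q ℓ (.K j) * x) := fun x => by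
    rw [← mul_assoc, hc.eq, mul_assoc]
  rw [(isRow_row j).self, (isRow_row j).succ j' h, Nel_step h]
  simp only [mul_assoc, smul_mul_assoc, mul_smul_comm, smul_smul, h1, h1', h2, hc', hc.eq]
  congr 1
  field_simp

/-- F_j carries the column j of (t_{ij}) to the column j+1. On an invariant form θ(F_j) acts by 0
and θ(K_j) by 1, so the identity reduces to F_j · (T_j ω) = T_{j+1} ω. -/
lemma theta_F_mul_twistSymb (j : Fin (ℓ - 1)) :
    theta q ℓ 0 (gen q ℓ (.F j)) * twistSymb q ℓ (lo j) =
      (qhalf q)⁻¹ • (twistSymb q ℓ (lo j) * theta q ℓ 0 (gen q ℓ (.F j)))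
      + twistSymb q ℓ (hi j) * theta q ℓ 0 (gen q ℓ (.K j)) := by
  have G := gen_relations (q := q) (ℓ := ℓ) (m := ℓ)
  have h0 := qhalf_ne_zero q
  have hlt : lo j < hi j := Fin.lt_def.2 (Nat.lt_succ_self _)
  have hs : ((lo j : Fin ℓ) : ℕ) + 1 = (hi j : Fin ℓ) := rfl
  -- Row by row, up to one shift: the term of T_{j+1} with i = j+1 is produced by the row i = j,
  -- through σ(F_j) e_j, and is therefore recorded there. Rows i < j use the relation `F_mul`, rows
  -- i > j contribute nothing.
  have key : ∀ i : Fin ℓ, theta q ℓ 0 (gen q ℓ (.F j)) * row q ℓ i (lo j) ⊗ₜ eMat q i =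
      (qhalf q)⁻¹ • (row q ℓ i (lo j) ⊗ₜ eMat q i * theta q ℓ 0 (gen q ℓ (.F j)))
      + (if i = hi j then 0 else
          row q ℓ i (hi j) ⊗ₜ eMat q i * theta q ℓ 0 (gen q ℓ (.K j)))
      + (if i = lo j then
          row q ℓ (hi j) (hi j) ⊗ₜ eMat q (hi j) * theta q ℓ 0 (gen q ℓ (.K j)) else 0) := by
    intro i
    rcases lt_trichotomy i (lo j) with h | h | h
    · rw [if_neg (h.trans hlt).ne, if_neg h.ne, add_zero, theta_F, theta_K, add_mul, mul_add,
        Algebra.TensorProduct.tmul_mul_tmul, Algebra.TensorProduct.tmul_mul_tmul,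
        Algebra.TensorProduct.tmul_mul_tmul, Algebra.TensorProduct.tmul_mul_tmul,
        Algebra.TensorProduct.tmul_mul_tmul, sigma_K_mul_eMat, sigma_F_mul_eMat, if_neg h.ne,
        IsLowering.wt_of_ne h.ne
          (fun e => (h.trans hlt).ne (Fin.ext (by rw [← hs, e]))), neg_zero,
        qpow_zero, one_smul, one_smul, zero_add, (isRow_row i).F_mul _ _ h hs]
      have e := (isRow_row (q := q) i).K_mul _ _ h hs
      have e' := swap_smul h0 (inv_qcomm (G.K_Kinv (lo j)) (G.Kinv_K (lo j)) e)
      rw [e', TensorProduct.add_tmul, ← TensorProduct.smul_tmul', ← TensorProduct.smul_tmul',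
        smul_add]
      abel
    · subst h
      have e1 : gen q ℓ (.F (lo j)) * row q ℓ (lo j) (lo j) =
          qhalf q ^ 2 • (row q ℓ (lo j) (lo j) * gen q ℓ (.F (lo j))) := by
        have e := F_Nel_self (q := q) hs
        rw [(isRow_row (lo j)).self, ← mul_assoc, e, smul_mul_assoc, mul_assoc, e, mul_smul_comm,
          smul_smul, mul_assoc, sq]
      have e2 : gen q ℓ (.Kinv (lo j)) * row q ℓ (lo j) (lo j) =
          row q ℓ (lo j) (lo j) * gen q ℓ (.Kinv (lo j)) := by
        have hc := commute_K_Nel (q := q) (lo j) (lo j)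
        rw [(isRow_row (lo j)).self]
        exact commute_of_inv (hc.mul_right hc) (G.K_Kinv _) (G.Kinv_K _)
      rw [if_neg hlt.ne, if_pos rfl, theta_F, theta_K, add_mul, mul_add,
        Algebra.TensorProduct.tmul_mul_tmul, Algebra.TensorProduct.tmul_mul_tmul,
        Algebra.TensorProduct.tmul_mul_tmul, Algebra.TensorProduct.tmul_mul_tmul,
        Algebra.TensorProduct.tmul_mul_tmul, Algebra.TensorProduct.tmul_mul_tmul,
        sigma_K_mul_eMat, sigma_F_mul_eMat, if_pos rfl, IsLowering.wt_self, e1, e2,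
        row_succ_mul_K hs, ← row_self_mul_Kinv hs, qpow_half, qpow_neg_half]
      simp only [TensorProduct.tmul_add, TensorProduct.tmul_smul, ← TensorProduct.smul_tmul',
        smul_add, smul_smul]
      -- F_j passes t_{jj} with t² and K_j passes e_j with t. Of the resulting t³, the part t^{-1}
      -- belongs to the term T_j θ(F_j) and the rest is the off-diagonal entry t_{j,j+1} of
      -- `row_succ_mul_K`.
      have e3 : qhalf q * qhalf q ^ 2 = (qhalf q)⁻¹ + (qhalf q ^ 3 - (qhalf q)⁻¹) := by ring
      rw [e3, add_smul]
      abel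
    · rw [(isRow_row i).of_lt _ h, if_neg h.ne', TensorProduct.zero_tmul, mul_zero, zero_mul,
        smul_zero, zero_add, add_zero]
      split_ifs with h'
      · rfl
      · have : hi j < i := by
          rw [Fin.lt_def] at h ⊢
          have h3 : (i : ℕ) ≠ (hi j : Fin ℓ) := fun e => h' (Fin.ext e)
          omega
        rw [(isRow_row i).of_lt _ this, TensorProduct.zero_tmul, zero_mul]
  rw [twistSymb, Finset.mul_sum]
  simp only [key, Finset.sum_add_distrib]
  rw [← Finset.smul_sum, ← Finset.sum_mul, Finset.sum_ite_eq' Finset.univ, if_pos (Finset.mem_univ _),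
    add_assoc]
  congr 1
  rw [twistSymb, Finset.sum_mul, ← Finset.add_sum_erase _ _ (Finset.mem_univ (hi j)),
    ← Finset.add_sum_erase _ _ (Finset.mem_univ (hi j)), if_pos rfl, zero_add, add_comm]
  congr 1
  exact Finset.sum_congr rfl fun i hi' => if_neg (Finset.ne_of_mem_erase hi')

variable (q ℓ) in
/-- The right exterior product by `e_{j}`. -/
def rightWedge (j : Fin ℓ) (ω : Forms q ℓ) : Forms q ℓ := wedgeForm q ℓ ω (1 ⊗ₜ basisGr {j})

/-- By triangularity the first column of (t_{ij}) has only its diagonal entry (K_1 ⋯ K_ℓ)². -/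
lemma coord_opOf_twistSymb_zero {n : ℕ} (ω : Forms q (n + 1)) (s : Finset (Fin (n + 1))) :
    coord q (n + 1) s (opOf q (n + 1) (twistSymb q (n + 1) 0) ω) = if 0 ∈ s then
      Lop q (n + 1) (Nel q (n + 1) 0 * Nel q (n + 1) 0) (coord q (n + 1) (s \ {0}) ω) else 0 := by
  have e : twistSymb q (n + 1) 0 = (Nel q (n + 1) 0 * Nel q (n + 1) 0) ⊗ₜ eMat q 0 := by
    rw [twistSymb, Finset.sum_eq_single 0, (isRow_row 0).self]
    · intro i _ hi
      rw [(isRow_row i).of_lt 0 (Fin.pos_of_ne_zero hi), TensorProduct.zero_tmul]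
    · simp
  rw [e, opOf_tmul, toLin'_eMat]
  have hb : below 0 s = 0 := by simp [below]
  induction ω using TensorProduct.induction_on with
  | zero => simp
  | add x y hx hy => rw [map_add, map_add, hx, hy]; split_ifs <;> simp
  | tmul a v =>
    rw [TensorProduct.map_tmul, coord_tmul, eL_apply, hb, coord_tmul]
    split_ifs <;> simp

/-- The first index, placed on the right, crosses every other element of s. -/
lemma coord_rightWedge_zero {n : ℕ} (ω : Forms q (n + 1)) (s : Finset (Fin (n + 1))) :
    coord q (n + 1) s (rightWedge q (n + 1) 0 ω) = if 0 ∈ s then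
      (-qpow q (-1)) ^ (s \ {0}).card • coord q (n + 1) (s \ {0}) ω else 0 := by
  rw [rightWedge]
  induction ω using TensorProduct.induction_on with
  | zero => simp
  | add x y hx hy => rw [map_add, LinearMap.add_apply, map_add, hx, hy]; split_ifs <;> simp
  | tmul a v =>
    rw [wedgeForm_tmul, mul_one, coord_tmul, wedge_apply, coord_tmul]
    split_ifs with h
    · have hs : {0} ⊆ s := Finset.singleton_subset_iff.2 h
      rw [Finset.sum_eq_single (s \ {0})]
      · have hc : crossings (s \ {0}) {0} = (s \ {0}).card := by
          rw [crossings, Finset.filter_true_of_mem, Finset.card_product, Finset.card_singleton,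
            mul_one]
          rintro ⟨x, y⟩ hxy
          simp only [Finset.mem_product, Finset.mem_sdiff, Finset.mem_singleton] at hxy
          rw [hxy.2]
          exact Fin.pos_of_ne_zero hxy.1.2
        rw [Finset.sdiff_sdiff_eq_self hs, hc, basisGr_apply, if_pos rfl, mul_one, smul_smul]
      · intro A hA hne
        rw [basisGr_apply, if_neg, mul_zero, mul_zero]
        intro e
        apply hne
        rw [← e, Finset.sdiff_sdiff_eq_self (Finset.mem_powerset.1 hA)]
      · intro h'; exact absurd (Finset.mem_powerset.2 Finset.sdiff_subset) h'
    · rw [Finset.sum_eq_zero, zero_smul]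
      intro A hA
      rw [basisGr_apply, if_neg, mul_zero, mul_zero]
      intro e
      have : (0 : Fin (n + 1)) ∈ s \ A := by rw [e]; exact Finset.mem_singleton_self _
      exact h (Finset.mem_sdiff.1 this).1

/-- The right factor is 1 ⊗ e_j, with trivial 𝓛-part, and σ(F_j) maps e_j to e_{j+1}. Invariance of
ω removes all other terms of the product rule. -/
lemma formAct_F_rightWedge {k : ℕ} {ω : Forms q ℓ} (hω : ω ∈ Omega q ℓ k 0) (j : Fin (ℓ - 1)) :
    formAct q ℓ 0 (gen q ℓ (.F j)) (rightWedge q ℓ (lo j) ω) = rightWedge q ℓ (hi j) ω := by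
  have hi' := (mem_Omega.1 hω).2
  have hne := lo_ne_hi j
  have hsh : sharp j {lo j} = 1 := by
    rw [sharp_eq_one]; simp [hne.symm]
  rw [rightWedge, formAct_F_wedge, hi', hi', hi', TensorProduct.map_tmul, TensorProduct.map_tmul,
    TensorProduct.map_tmul, Lop_one_right, Lop_one_right, counitU_gen, counitU_gen, sg_F_basisGr,
    if_pos hsh, exch_singleton, Equiv.swap_apply_left, rightWedge]
  simp [counitGen]

/-- The twist in the Leibniz rule, evaluated on an invariant form, is the sign (-1)^k together with
moving e_j to the right of the form. For the first index the powers of q match; acting with F_j on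
both sides then raises the index. -/
lemma opOf_twistSymb {k : ℕ} {ω : Forms q ℓ} (hω : ω ∈ Omega q ℓ k 0) (j : Fin ℓ) :
    opOf q ℓ (twistSymb q ℓ j) ω = (-1 : ℂ) ^ k • rightWedge q ℓ j ω := by
  obtain ⟨n, rfl⟩ : ∃ n, ℓ = n + 1 := ⟨ℓ - 1, by have := j.2; omega⟩
  have hd := (mem_Omega.1 hω).1
  have hi' := (mem_Omega.1 hω).2
  induction j using Fin.induction with
  | zero =>
    apply forms_ext
    intro s
    rw [map_smul, coord_opOf_twistSymb_zero, coord_rightWedge_zero]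
    split_ifs with h
    · by_cases hk : (s \ {0}).card = k
      -- The eigenvalue q^{-k} equals (-1)^k (-q^{-1})^k, the second factor being the cost of the k
      -- crossings.
      · rw [Lop_Nel_sq hω (by simp) hk, hk, smul_smul, ← mul_pow, neg_mul_neg, one_mul,
          ← qpow_nat_mul, mul_neg_one]
      · rw [coord_eq_zero hd hk]; simp
    · simp
  | succ j ih =>
    have h := congrArg (fun x => opOf q (n + 1) x ω) (theta_F_mul_twistSymb (q := q) (ℓ := n + 1) j)
    simp only [map_mul, map_add, map_smul, Module.End.mul_apply, LinearMap.add_apply,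
      LinearMap.smul_apply, ← formAct_eq] at h
    -- By invariance θ(F_j) ω = 0 and θ(K_j) ω = ω.
    rw [hi', hi'] at h
    simp only [counitGen, one_smul, zero_smul, map_zero, smul_zero, zero_add] at h
    change opOf q (n + 1) (twistSymb q (n + 1) (hi (ℓ := n + 1) j)) ω = _
    rw [← h]
    have ih' : opOf q (n + 1) (twistSymb q (n + 1) (lo (ℓ := n + 1) j)) ω =
      (-1 : ℂ) ^ k • rightWedge q (n + 1) (lo (ℓ := n + 1) j) ω := ih
    rw [ih', map_smul, formAct_F_rightWedge hω]
    rfl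

lemma wedgeForm_rightWedge (j : Fin ℓ) (ω ω' : Forms q ℓ) :
    wedgeForm q ℓ (rightWedge q ℓ j ω) (TensorProduct.map (Lop q ℓ (Yel q ℓ j)) LinearMap.id ω') =
      wedgeForm q ℓ ω (TensorProduct.map (Lop q ℓ (Yel q ℓ j)) (eL q ℓ j) ω') := by
  rw [rightWedge, wedgeForm_assoc]
  congr 1
  induction ω' using TensorProduct.induction_on with
  | zero => simp
  | add x y hx hy => simp only [map_add, hx, hy]
  | tmul a v => rw [TensorProduct.map_tmul, TensorProduct.map_tmul, wedgeForm_tmul, one_mul]; rfl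

/-- Only the left factor has to be invariant: e_j, moved to the right end of ω, acts on ω' by left
exterior multiplication and recombines with 𝓛_{y_j} to ∂̄ω'. -/
lemma dbar_leibniz {k : ℕ} {ω : Forms q ℓ} (hω : ω ∈ Omega q ℓ k 0) (ω' : Forms q ℓ) :
    dbar q ℓ (wedgeForm q ℓ ω ω')
      = wedgeForm q ℓ (dbar q ℓ ω) ω' + (-1 : ℂ) ^ k • wedgeForm q ℓ ω (dbar q ℓ ω') := by
  rw [dbar_wedgeForm]
  congr 1
  have e : dbar q ℓ ω' = ∑ j, TensorProduct.map (Lop q ℓ (Yel q ℓ j)) (eL q ℓ j) ω' := by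
    rw [dbar, LinearMap.sum_apply]; rfl
  rw [e, map_sum, Finset.smul_sum]
  refine Finset.sum_congr rfl fun j _ => ?_
  rw [opOf_twistSymb hω, map_smul, LinearMap.smul_apply, wedgeForm_rightWedge]

end leibniz

end QProj

end

theorem mainTheorem5 (q : QParam) (ℓ : ℕ) (hℓ : 1 ≤ ℓ) :
    -- the Dolbeault operator on the twisted forms
    (∀ (N : ℤ) (k : ℕ), ∀ ω ∈ Omega q ℓ k N, dbar q ℓ ω ∈ Omega q ℓ (k + 1) N) ∧
    (∀ ω : Forms q ℓ, dbar q ℓ (dbar q ℓ ω) = 0) ∧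
    -- its Hermitian conjugate
    (∀ φ : ASU q ℓ →ₗ[ℂ] ℂ, IsHaar q ℓ φ → ∀ ω ω' : Forms q ℓ,
      formInner q ℓ φ (dbarDag q ℓ ω) ω' = formInner q ℓ φ ω (dbar q ℓ ω')) ∧
    (∀ (N : ℤ) (k : ℕ), ∀ ω ∈ Omega q ℓ (k + 1) N, dbarDag q ℓ ω ∈ Omega q ℓ k N) ∧
    (∀ ω : Forms q ℓ, dbarDag q ℓ (dbarDag q ℓ ω) = 0) ∧
    -- the untwisted forms are a graded algebra that starts with the functions
    Omega q ℓ 0 0 = (ACP q ℓ).map (ofFun q ℓ) ∧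
    (∀ k k' : ℕ, ∀ ω ∈ Omega q ℓ k 0, ∀ ω' ∈ Omega q ℓ k' 0,
      wedgeForm q ℓ ω ω' ∈ Omega q ℓ (k + k') 0) ∧
    (∀ ω ω' ω'' : Forms q ℓ, wedgeForm q ℓ (wedgeForm q ℓ ω ω') ω''
      = wedgeForm q ℓ ω (wedgeForm q ℓ ω' ω'')) ∧
    (∀ a b : ASU q ℓ, wedgeForm q ℓ (ofFun q ℓ a) (ofFun q ℓ b) = ofFun q ℓ (a * b)) ∧
    (∀ ω : Forms q ℓ, wedgeForm q ℓ (ofFun q ℓ 1) ω = ω ∧ wedgeForm q ℓ ω (ofFun q ℓ 1) = ω) ∧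
    ofFun q ℓ 1 ∈ Omega q ℓ 0 0 ∧
    -- the graded Leibniz rule
    (∀ k k' : ℕ, ∀ ω ∈ Omega q ℓ k 0, ∀ ω' ∈ Omega q ℓ k' 0,
      dbar q ℓ (wedgeForm q ℓ ω ω')
        = wedgeForm q ℓ (dbar q ℓ ω) ω' + (-1 : ℂ) ^ k • wedgeForm q ℓ ω (dbar q ℓ ω')) ∧
    -- covariance under the left action of the quantized enveloping algebra
    (∀ (N : ℤ) (k : ℕ) (h : Uq q ℓ ℓ), ∀ ω ∈ Omega q ℓ k N, lactForm q ℓ h ω ∈ Omega q ℓ k N) ∧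
    (∀ (g h : Uq q ℓ ℓ) (ω : Forms q ℓ),
      lactForm q ℓ (g * h) ω = lactForm q ℓ g (lactForm q ℓ h ω)) ∧
    (∀ ω : Forms q ℓ, lactForm q ℓ 1 ω = ω) ∧
    (∀ (h : Uq q ℓ ℓ) (ω ω' : Forms q ℓ),
      lactForm q ℓ h (wedgeForm q ℓ ω ω') = lactWedge q ℓ ω ω' (comulU q ℓ ℓ h)) ∧
    (∀ h : Uq q ℓ ℓ, lactForm q ℓ h (ofFun q ℓ 1) = counitU q ℓ ℓ h • ofFun q ℓ 1) ∧
    (∀ (h : Uq q ℓ ℓ) (ω : Forms q ℓ),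
      dbar q ℓ (lactForm q ℓ h ω) = lactForm q ℓ h (dbar q ℓ ω)) := by
  exact ⟨fun _ _ _ hω => dbar_mem_Omega hω, dbar_dbar, fun _ hφ => hφ.formInner_dbar,
    fun _ _ _ hω => dbarDag_mem_Omega hω, dbarDag_dbarDag, Omega_zero_zero,
    fun _ _ _ hω _ hω' => wedgeForm_mem_Omega hω hω', wedgeForm_assoc, wedgeForm_ofFun,
    fun ω => ⟨wedgeForm_one_left ω, wedgeForm_one_right ω⟩, ofFun_one_mem_Omega,
    fun _ _ _ hω ω' _ => dbar_leibniz hω ω', fun _ _ h _ hω => lactForm_mem_Omega h hω,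
    lactForm_mul, lactForm_one, lactForm_wedgeForm, lactForm_ofFun_one, dbar_lactForm⟩
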